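/- Let $(V,Y,\mathbf 1,\omega)$ be a vertex operator algebra over $\mathbb C$: $V=\bigoplus_{n\in\mathbb Z}V_{(n)}$, graded by the eigenvalues of $L(0)$ where $Y(\omega,x)=\sum_n L(n)x^{-n-2}$, with $\dim V_{(n)}<\infty$ and $V_{(n)}=0$ for $n$ sufficiently small. Write $Y(v,x)=\sum_{n\in\mathbb Z}v_nx^{-n-1}$, and $\mathrm{wt}\,v$ for the weight of a homogeneous $v$. *Modules.* A weak $V$-module satisfies all the axioms of a module except those on a grading (truncation, vacuum, Jacobi identity, $L(-1)$-derivative property). A generalized $V$-module is a weak module $W$ that is the direct sum of the eigenspaces $W_{(h)}$, $h\in\mathbb C$, of $L(0)$. A $V$-module is a generalized $V$-module such that, for all $h$, $\dim W_{(h)}<\infty$ and $W_{(h-n)}=0$ for all sufficiently large integers $n$. A lowest weight generalized $V$-module is a generalized module with $W=\bigoplus_{n\in\mathbb N}W_{(h+n)}$ for some $h$ that is generated by $W_{(h)}$. If $W=\bigoplus_{n\in\mathbb N}W_{(h+n)}$ with $W_{(h)}\ne0$ (as is the case for every irreducible $V$-module), put $W(0)=W_{(h)}$. The contragredient module of a $V$-module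 $W$ is $W'=\bigoplus_h W_{(h)}^*$ with $\langle Y(v,x)f,w\rangle=\langle f,Y(e^{xL(1)}(-x^{-2})^{L(0)}v,x^{-1})w\rangle$. *Zhu's algebra.* For a $V$-module $W$ let $O(W)$ be the span of the elements $\mathrm{Res}_x\,x^{-2}(1+x)^{\mathrm{wt}\,v}Y(v,x)w$ ($v\in V$ homogeneous, $w\in W$), and $A(W)=W/O(W)$. Then $A(V)$ is an associative algebra with product induced by $u*v=\mathrm{Res}_x\,x^{-1}(1+x)^{\mathrm{wt}\,u}Y(u,x)v$, and $A(W)$ is an $A(V)$-bimodule with actions induced by $v*w=\mathrm{Res}_x\,x^{-1}(1+x)^{\mathrm{wt}\,v}Y(v,x)w$ and $w*v=\mathrm{Res}_x\,x^{-1}(1+x)^{\mathrm{wt}\,v-1}Y(v,x)w$. If $W$ is an irreducible $V$-module, $W(0)$ is an $A(V)$-module on which the class of $v$ acts as $v_{\mathrm{wt}\,v-1}$, and $W(0)^*$ is an $A(V)$-module by $(af)(u)=f(\theta(a)u)$, where $\theta$ is induced by $v\mapsto e^{L(1)}(-1)^{L(0)}v$. *The functor $F$.* Let $g(V)$ be the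 Lie algebra $(V\otimes\mathbb C[t,t^{-1}])/(L(-1)\otimes1+1\otimes\tfrac{d}{dt})(V\otimes\mathbb C[t,t^{-1}])$ with $[u(m),v(n)]=\sum_{i\ge0}\binom mi(u_iv)(m+n-i)$, where $v(n)$ is the class of $v\otimes t^n$. Let $g(V)_0$ and $g(V)_-$ be the spans of the $v(\mathrm{wt}\,v-1)$ and of the $v(m)$ with $m\ge\mathrm{wt}\,v$, respectively, for $v$ homogeneous. For an $A(V)$-module $U$, let $v(\mathrm{wt}\,v-1)$ act on $U$ as the class of $v$ in $A(V)$ and $g(V)_-$ as zero. Then $F(U)$ is the quotient of the $g(V)$-module $U(g(V))\otimes_{U(g(V)_-+g(V)_0)}U$ by the submodule generated by all the coefficients of the Jacobi identity for the operators $Y(v,x)=\sum_nv(n)x^{-n-1}$. *Intertwining operators.* $\mathcal V^{W_2}_{W\,W_1}$ is the space of linear maps $w\mapsto\mathcal Y(w,x)=\sum_{n\in\mathbb C}w_nx^{-n-1}$, $w_n\in\mathrm{Hom}(W_1,W_2)$, such that for all $w\in W$, $w_1\in W_1$ one has $w_nw_1=0$ when the real part of $n$ is sufficiently large, and that satisfy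 the Jacobi identity and $\mathcal Y(L(-1)w,x)=\frac{d}{dx}\mathcal Y(w,x)$. **Statement.** Let $W$ be a $V$-module and let $W_1$ and $W_2$ be irreducible $V$-modules. Then: 1. $F(W_1(0))$ is irreducible if and only if $W_1=F(W_1(0))$ (that is, the identity of $W_1(0)$ extends to an isomorphism $F(W_1(0))\cong W_1$), and $F(W_2(0)^*)$ is irreducible if and only if $W_2'=F(W_2(0)^*)$ (in the same sense). 2. If $F(W_1(0))$ and $F(W_2(0)^*)$ are irreducible, then $$\dim\mathrm{Hom}_{A(V)}\bigl(A(W)\otimes_{A(V)}W_1(0),\,W_2(0)\bigr)=\dim\mathcal V^{W_2}_{W\,W_1}.$$ 3. In particular, this equality holds if every lowest weight generalized $V$-module is completely reducible. -/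

import Mathlib

universe u

noncomputable section

open scoped TensorProduct LaurentPolynomial

/-- The component form of the Jacobi identity
`x₀⁻¹ δ((x₁ - x₂)/x₀) Y(v,x₁) 𝒴(a,x₂) b - x₀⁻¹ δ((x₂ - x₁)/(-x₀)) 𝒴(a,x₂) Y(v,x₁) b
  = x₂⁻¹ δ((x₁ - x₀)/x₂) 𝒴(Y(v,x₀)a,x₂) b`:
left side minus right side of the coefficients of `x₀^(-l-1) x₁^(-m-1) x₂^(-n-1)`.
Here `v_k` acts on the three spaces by `yA`, `yB`, `yC`, and `𝒴 a n` is the coefficient of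
`x^(-n-1)` in `𝒴(a,x)`; the exponents `n` lie in `Γ` (the integers, or the complex numbers for
intertwining operators).  All sums are finite where the definition is applied. -/
def jacobiDefect {V A B C Γ : Type*} [AddCommGroup C] [AddGroupWithOne Γ]
    (yA : V → ℤ → A → A) (yB : V → ℤ → B → B) (yC : V → ℤ → C → C) (𝒴 : A → Γ → B → C)
    (v : V) (a : A) (b : B) (l m : ℤ) (n : Γ) : C :=
  (∑ᶠ i : ℕ, ((-1) ^ i * Ring.choose l i : ℤ) •
      (yC v (m + l - i) (𝒴 a (n + (i : ℤ)) b)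
        - (l.negOnePow : ℤ) • 𝒴 a (n + ((l - i : ℤ) : Γ)) (yB v (m + i) b)))
    - ∑ᶠ i : ℕ, Ring.choose m i • 𝒴 (yA v (l + i) a) (n + ((m - i : ℤ) : Γ)) b

/-- A vertex operator algebra `(V, Y, 𝟙, ω)` over `ℂ`.  The coefficient `v_n` of `x^(-n-1)` in
`Y(v,x)` is `VertexOperator.ncoeff (Y v) n`; that `Y(v,x)w` has only finitely many negative powers
of `x` is part of Mathlib's `VertexOperator`.  The grading `V = ⨁ V_(n)`, `n ∈ ℤ`, is the one by
the eigenspaces of `L(0) = ω₁`. -/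
structure VertexOperatorAlgebra (V : Type u) [AddCommGroup V] [Module ℂ V] where
  Y : V →ₗ[ℂ] VertexOperator ℂ V
  /-- the vacuum vector -/
  one : V
  /-- the Virasoro element -/
  ω : V
  /-- the central charge (rank) -/
  c : ℂ
  vacuum : ∀ n : ℤ, VertexOperator.ncoeff (Y one) n = if n = -1 then 1 else 0
  creation_regular : ∀ (v : V) (n : ℤ), 0 ≤ n → VertexOperator.ncoeff (Y v) n one = 0
  creation : ∀ v : V, VertexOperator.ncoeff (Y v) (-1) one = v
  jacobi : ∀ (u v w : V) (l m n : ℤ),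
    jacobiDefect (fun v n => VertexOperator.ncoeff (Y v) n)
      (fun v n => VertexOperator.ncoeff (Y v) n) (fun v n => VertexOperator.ncoeff (Y v) n)
      (fun v n => VertexOperator.ncoeff (Y v) n) u v w l m n = 0
  /-- `L(n) = ω_(n+1)` satisfy the Virasoro relations -/
  virasoro : ∀ m n : ℤ,
    VertexOperator.ncoeff (Y ω) (m + 1) * VertexOperator.ncoeff (Y ω) (n + 1)
        - VertexOperator.ncoeff (Y ω) (n + 1) * VertexOperator.ncoeff (Y ω) (m + 1)
      = ((m : ℂ) - n) • VertexOperator.ncoeff (Y ω) (m + n + 1)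
        + (if m + n = 0 then ((m : ℂ) ^ 3 - m) / 12 * c else 0) • (1 : Module.End ℂ V)
  /-- `Y(L(-1)v,x) = d/dx Y(v,x)` -/
  derivative : ∀ (v : V) (n : ℤ), VertexOperator.ncoeff (Y (VertexOperator.ncoeff (Y ω) 0 v)) n
    = -(n : ℂ) • VertexOperator.ncoeff (Y v) (n - 1)
  iSup_grading : ⨆ n : ℤ, (VertexOperator.ncoeff (Y ω) 1).eigenspace (n : ℂ) = ⊤
  finite_grading : ∀ n : ℤ,
    FiniteDimensional ℂ ((VertexOperator.ncoeff (Y ω) 1).eigenspace (n : ℂ))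
  lower_grading : ∃ N : ℤ, ∀ n < N, (VertexOperator.ncoeff (Y ω) 1).eigenspace (n : ℂ) = ⊥

/-- A weak module for a vertex operator algebra: all the axioms for a module, except that no
grading is required. -/
structure WeakModule {V : Type u} [AddCommGroup V] [Module ℂ V] (𝒱 : VertexOperatorAlgebra V)
    (W : Type u) [AddCommGroup W] [Module ℂ W] where
  Y : V →ₗ[ℂ] VertexOperator ℂ W
  vacuum : ∀ n : ℤ, VertexOperator.ncoeff (Y 𝒱.one) n = if n = -1 then 1 else 0
  jacobi : ∀ (u v : V) (w : W) (l m n : ℤ),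
    jacobiDefect (fun v n => VertexOperator.ncoeff (𝒱.Y v) n)
      (fun v n => VertexOperator.ncoeff (Y v) n) (fun v n => VertexOperator.ncoeff (Y v) n)
      (fun v n => VertexOperator.ncoeff (Y v) n) u v w l m n = 0
  derivative : ∀ (v : V) (n : ℤ),
    VertexOperator.ncoeff (Y (VertexOperator.ncoeff (𝒱.Y 𝒱.ω) 0 v)) n
      = -(n : ℂ) • VertexOperator.ncoeff (Y v) (n - 1)

variable {V : Type u} [AddCommGroup V] [Module ℂ V] {𝒱 : VertexOperatorAlgebra V}
  {W : Type u} [AddCommGroup W] [Module ℂ W]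

/-- The adjoint module: `V` as a module for itself. -/
def VertexOperatorAlgebra.adjoint (𝒱 : VertexOperatorAlgebra V) : WeakModule 𝒱 V where
  Y := 𝒱.Y
  vacuum := 𝒱.vacuum
  jacobi := 𝒱.jacobi
  derivative := 𝒱.derivative

namespace WeakModule

/-- The operator `v_n` on a weak module. -/
def mode (M : WeakModule 𝒱 W) (v : V) (n : ℤ) : Module.End ℂ W :=
  VertexOperator.ncoeff (M.Y v) n

/-- The Virasoro operator `L(n) = ω_(n+1)` on a weak module. -/
def L (M : WeakModule 𝒱 W) (n : ℤ) : Module.End ℂ W := M.mode 𝒱.ω (n + 1)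

/-- The homogeneous subspace `W_(h)`: the eigenspace of `L(0)` for the eigenvalue `h`. -/
def weightSpace (M : WeakModule 𝒱 W) (h : ℂ) : Submodule ℂ W := (M.L 0).eigenspace h

end WeakModule

/-- The homogeneous subspace `V_(k)` of the vertex operator algebra: the vectors of weight `k`. -/
def VertexOperatorAlgebra.homog (𝒱 : VertexOperatorAlgebra V) (k : ℤ) : Submodule ℂ V :=
  𝒱.adjoint.weightSpace k

/-! ### Calculus of modes -/

namespace WeakModule

variable (M : WeakModule 𝒱 W)

@[simp] theorem mode_add (u v : V) (n : ℤ) : M.mode (u + v) n = M.mode u n + M.mode v n := by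
  simp [mode]

@[simp] theorem mode_smul (c : ℂ) (v : V) (n : ℤ) : M.mode (c • v) n = c • M.mode v n := by
  simp [mode]

@[simp] theorem mode_zero (n : ℤ) : M.mode 0 n = 0 := by
  simp [mode]

theorem trunc (v : V) (w : W) : ∃ K : ℤ, ∀ n ≥ K, M.mode v n w = 0 := by
  refine ⟨- HahnSeries.order ((HahnModule.of ℂ).symm (M.Y v w)), fun n hn => ?_⟩
  exact VertexOperator.ncoeff_eq_zero_of_lt_order _ _ _ (by omega)

end WeakModule

/-- A function on `ℕ` that vanishes from some point on. -/
def EvZero {X : Type*} [Zero X] (f : ℕ → X) : Prop := ∃ N : ℕ, ∀ i ≥ N, f i = 0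

namespace EvZero

variable {X : Type*} [AddCommGroup X] {f g : ℕ → X}

theorem support_finite (hf : EvZero f) : (Function.support f).Finite := by
  obtain ⟨N, hN⟩ := hf
  refine (Set.finite_lt_nat N).subset fun i hi => ?_
  by_contra h
  exact hi (hN i (not_lt.mp h))

theorem finsum_eq {N : ℕ} (hN : ∀ i ≥ N, f i = 0) : ∑ᶠ i, f i = ∑ i ∈ Finset.range N, f i := by
  refine finsum_eq_sum_of_support_subset f fun i hi => ?_
  by_contra h
  exact hi (hN i (by simpa using h))

theorem finsum_add (hf : EvZero f) (hg : EvZero g) :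
    ∑ᶠ i, (f i + g i) = ∑ᶠ i, f i + ∑ᶠ i, g i :=
  finsum_add_distrib hf.support_finite hg.support_finite

theorem finsum_sub (hf : EvZero f) (hg : EvZero g) :
    ∑ᶠ i, (f i - g i) = ∑ᶠ i, f i - ∑ᶠ i, g i :=
  finsum_sub_distrib hf.support_finite hg.support_finite

theorem map_finsum {Z : Type*} [AddCommGroup Z] (φ : X →+ Z) (hf : EvZero f) :
    φ (∑ᶠ i, f i) = ∑ᶠ i, φ (f i) := AddMonoidHom.map_finsum φ hf.support_finite

theorem finsum_succ (hf : EvZero f) : ∑ᶠ i, f i = f 0 + ∑ᶠ i, f (i + 1) := by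
  obtain ⟨N, hN⟩ := hf
  rw [finsum_eq (N := N + 1) fun i hi => hN i (by omega),
    finsum_eq (f := fun i => f (i + 1)) (N := N) fun i hi => hN _ (by omega),
    Finset.sum_range_succ', add_comm]

theorem add (hf : EvZero f) (hg : EvZero g) : EvZero fun i => f i + g i := by
  obtain ⟨N, hN⟩ := hf
  obtain ⟨N', hN'⟩ := hg
  exact ⟨max N N', fun i hi => by
    simp [hN i (le_trans (le_max_left _ _) hi), hN' i (le_trans (le_max_right _ _) hi)]⟩

theorem zsmul (hf : EvZero f) (c : ℕ → ℤ) : EvZero fun i => c i • f i := by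
  obtain ⟨N, hN⟩ := hf
  exact ⟨N, fun i hi => by simp [hN i hi]⟩

theorem sub (hf : EvZero f) (hg : EvZero g) : EvZero fun i => f i - g i := by
  simpa [sub_eq_add_neg] using hf.add (hg.zsmul fun _ => -1)

theorem shift (hf : EvZero f) (k : ℕ) : EvZero fun i => f (i + k) := by
  obtain ⟨N, hN⟩ := hf
  exact ⟨N, fun i hi => hN _ (by omega)⟩

theorem finsum_mem {S : Type*} [SetLike S X] [AddSubmonoidClass S X] (s : S)
    (h : ∀ i, f i ∈ s) : ∑ᶠ i, f i ∈ s := by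
  by_cases hf : (Function.support f).Finite
  · rw [finsum_eq_sum f hf]
    exact sum_mem fun i _ => h i
  · rw [finsum_of_infinite_support hf]
    exact zero_mem s

end EvZero

namespace WeakModule

variable (M : WeakModule 𝒱 W)

theorem evZero_mode (v : V) (w : W) (n : ℤ) : EvZero fun i : ℕ => M.mode v (n + i) w := by
  obtain ⟨K, hK⟩ := M.trunc v w
  exact ⟨(K - n).toNat, fun i hi => hK _ (by omega)⟩

/-- `res n a v = Res_x x^n (1+x)^a Y(v,x) = ∑_{i ≥ 0} (a choose i) v_(n+i)`. -/
def res (n a : ℤ) : V →ₗ[ℂ] Module.End ℂ W :=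
  LinearMap.mk₂ ℂ (fun v w => ∑ᶠ i : ℕ, Ring.choose a i • M.mode v (n + i) w)
    (fun v v' w => by
      rw [← EvZero.finsum_add ((M.evZero_mode _ _ _).zsmul _) ((M.evZero_mode _ _ _).zsmul _)]
      simp)
    (fun c v w => by
      rw [smul_finsum]
      exact finsum_congr fun i => by
        simp only [mode_smul, LinearMap.smul_apply]
        rw [smul_comm])
    (fun v w w' => by
      rw [← EvZero.finsum_add ((M.evZero_mode _ _ _).zsmul _) ((M.evZero_mode _ _ _).zsmul _)]
      simp)
    (fun c v w => by
      rw [smul_finsum]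
      exact finsum_congr fun i => by
        simp only [map_smul]
        rw [smul_comm])

theorem res_apply (n a : ℤ) (v : V) (w : W) :
    M.res n a v w = ∑ᶠ i : ℕ, Ring.choose a i • M.mode v (n + i) w := rfl

theorem res_eq_zero {v : V} {w : W} {K : ℤ} (hK : ∀ n ≥ K, M.mode v n w = 0) {n : ℤ} (hn : K ≤ n)
    (a : ℤ) : M.res n a v w = 0 := by
  rw [res_apply]
  refine (finsum_congr fun i => ?_).trans finsum_zero
  rw [hK _ (by omega), smul_zero]

theorem evZero_res (n a : ℤ) (v : V) (w : W) : EvZero fun i : ℕ => M.res (n + i) a v w := by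
  obtain ⟨K, hK⟩ := M.trunc v w
  exact ⟨(K - n).toNat, fun i hi => M.res_eq_zero hK (by omega) a⟩

theorem res_zero (n : ℤ) (v : V) (w : W) : M.res n 0 v w = M.mode v n w := by
  rw [res_apply, finsum_eq_single _ 0]
  · simp
  · intro i hi
    simp [Ring.choose_zero_pos ℤ (by omega : 0 < i)]

theorem res_succ (n a : ℤ) (v : V) (w : W) :
    M.res n (a + 1) v w = M.res n a v w + M.res (n + 1) a v w := by
  have h := M.evZero_mode v w
  rw [res_apply, EvZero.finsum_succ ((h n).zsmul _), res_apply,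
    EvZero.finsum_succ ((h n).zsmul _), res_apply]
  have e : ∀ i : ℕ, n + ((i + 1 : ℕ) : ℤ) = n + 1 + i := fun i => by push_cast; ring
  simp only [e, Ring.choose_succ_succ, add_smul, Ring.choose_zero_right]
  rw [EvZero.finsum_add ((h _).zsmul _) ((h _).zsmul _)]
  abel

/-- The Jacobi identity, with the factors `(1+x₁)^a (1+x₂)^b` inserted: left side. -/
def jl (u v : V) (w : W) (l m n a b : ℤ) : W :=
  ∑ᶠ i : ℕ, ((-1) ^ i * Ring.choose l i : ℤ) •
      (M.res (m + l - i) a u (M.res (n + i) b v w)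
        - (l.negOnePow : ℤ) • M.res (n + (l - i)) b v (M.res (m + i) a u w))

/-- Auxiliary inner sum. -/
def js (u v : V) (w : W) (l n a b : ℤ) : W :=
  ∑ᶠ j : ℕ, Ring.choose a j • M.res n (a + b - j) (𝒱.adjoint.mode u (l + j) v) w

/-- The Jacobi identity, with the factors `(1+x₁)^a (1+x₂)^b` inserted: right side. -/
def jr (u v : V) (w : W) (l m n a b : ℤ) : W :=
  ∑ᶠ i : ℕ, Ring.choose m i • M.js u v w (l + i) (n + (m - i)) a b

theorem jl_evZero (u v : V) (w : W) (l m n a b : ℤ) : EvZero fun i : ℕ =>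
    (M.res (m + l - i) a u (M.res (n + i) b v w)
        - (l.negOnePow : ℤ) • M.res (n + (l - i)) b v (M.res (m + i) a u w)) := by
  have h1 : EvZero fun i : ℕ => M.res (m + l - i) a u (M.res (n + i) b v w) := by
    obtain ⟨N, hN⟩ := M.evZero_res n b v w
    exact ⟨N, fun i hi => by simp [hN i hi]⟩
  have h2 : EvZero fun i : ℕ => M.res (n + (l - i)) b v (M.res (m + i) a u w) := by
    obtain ⟨N, hN⟩ := M.evZero_res m a u w
    exact ⟨N, fun i hi => by simp [hN i hi]⟩
  exact h1.sub (h2.zsmul _)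

theorem js_evZero (u v : V) (w : W) (l n : ℤ) (c : ℕ → ℤ) : EvZero fun j : ℕ =>
    M.res n (c j) (𝒱.adjoint.mode u (l + j) v) w := by
  obtain ⟨N, hN⟩ := 𝒱.adjoint.evZero_mode u v l
  exact ⟨N, fun i hi => by simp [hN i hi]⟩

theorem jr_evZero (u v : V) (w : W) (l a b : ℤ) (k : ℕ → ℤ) : EvZero fun i : ℕ =>
    M.js u v w (l + i) (k i) a b := by
  obtain ⟨K, hK⟩ := 𝒱.adjoint.trunc u v
  refine ⟨(K - l).toNat, fun i hi => ?_⟩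
  refine (finsum_congr fun j => ?_).trans finsum_zero
  rw [hK _ (by omega)]
  simp

theorem jl_succ_left (u v : V) (w : W) (l m n a b : ℤ) :
    M.jl u v w l m n (a + 1) b = M.jl u v w l m n a b + M.jl u v w l (m + 1) n a b := by
  unfold jl
  rw [← EvZero.finsum_add ((M.jl_evZero ..).zsmul _) ((M.jl_evZero ..).zsmul _)]
  refine finsum_congr fun i => ?_
  rw [← smul_add, M.res_succ, M.res_succ, show m + l - (i : ℤ) + 1 = m + 1 + l - i by ring,
    show m + (i : ℤ) + 1 = m + 1 + i by ring, map_add, smul_add]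
  congr 1
  abel

theorem jl_succ_right (u v : V) (w : W) (l m n a b : ℤ) :
    M.jl u v w l m n a (b + 1) = M.jl u v w l m n a b + M.jl u v w l m (n + 1) a b := by
  unfold jl
  rw [← EvZero.finsum_add ((M.jl_evZero ..).zsmul _) ((M.jl_evZero ..).zsmul _)]
  refine finsum_congr fun i => ?_
  rw [← smul_add, M.res_succ, M.res_succ, show n + (l - (i : ℤ)) + 1 = n + 1 + (l - i) by ring,
    show n + (i : ℤ) + 1 = n + 1 + i by ring, map_add, smul_add]
  congr 1
  abel

theorem js_succ_right (u v : V) (w : W) (l n a b : ℤ) :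
    M.js u v w l n a (b + 1) = M.js u v w l n a b + M.js u v w l (n + 1) a b := by
  unfold js
  rw [← EvZero.finsum_add ((M.js_evZero ..).zsmul _) ((M.js_evZero ..).zsmul _)]
  refine finsum_congr fun i => ?_
  rw [show a + (b + 1) - (i : ℤ) = a + b - i + 1 by ring, M.res_succ, smul_add]

theorem js_succ_left (u v : V) (w : W) (l n a b : ℤ) :
    M.js u v w l n (a + 1) b
      = M.js u v w l n a b + M.js u v w l (n + 1) a b + M.js u v w (l + 1) n a b := by
  rw [← js_succ_right]
  unfold js
  rw [EvZero.finsum_succ ((M.js_evZero ..).zsmul _),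
    EvZero.finsum_succ (f := fun j : ℕ => Ring.choose a j •
      M.res n (a + (b + 1) - j) (𝒱.adjoint.mode u (l + j) v) w) ((M.js_evZero ..).zsmul _)]
  have e : ∀ i : ℕ, l + ((i + 1 : ℕ) : ℤ) = l + 1 + i := fun i => by push_cast; ring
  have e1 : ∀ i : ℕ, a + 1 + b - ((i + 1 : ℕ) : ℤ) = a + b - i := fun i => by push_cast; ring
  have e2 : ∀ i : ℕ, a + (b + 1) - ((i + 1 : ℕ) : ℤ) = a + b - i := fun i => by push_cast; ring
  simp only [e, e1, e2, Ring.choose_succ_succ, add_smul, Ring.choose_zero_right]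
  rw [EvZero.finsum_add ((M.js_evZero ..).zsmul _) ((M.js_evZero ..).zsmul _),
    show a + 1 + b = a + (b + 1) by ring]
  abel

theorem jr_succ_right (u v : V) (w : W) (l m n a b : ℤ) :
    M.jr u v w l m n a (b + 1) = M.jr u v w l m n a b + M.jr u v w l m (n + 1) a b := by
  unfold jr
  rw [← EvZero.finsum_add ((M.jr_evZero u v w l a b _).zsmul _)
    ((M.jr_evZero u v w l a b _).zsmul _)]
  refine finsum_congr fun i => ?_
  rw [js_succ_right, smul_add, show n + (m - (i : ℤ)) + 1 = n + 1 + (m - i) by ring]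

theorem jr_succ_left (u v : V) (w : W) (l m n a b : ℤ) :
    M.jr u v w l m n (a + 1) b = M.jr u v w l m n a b + M.jr u v w l (m + 1) n a b := by
  have h : ∀ l (k : ℕ → ℤ), EvZero fun i : ℕ => M.js u v w (l + i) (k i) a b :=
    fun l k => M.jr_evZero u v w l a b k
  have h' : EvZero fun i : ℕ => M.js u v w (l + i + 1) (n + (m - i)) a b := by
    simpa only [add_right_comm] using h (l + 1) fun i => n + (m - i)
  unfold jr
  simp only [js_succ_left, smul_add]
  rw [EvZero.finsum_add (((h ..).zsmul _).add ((h ..).zsmul _)) (h'.zsmul _),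
    EvZero.finsum_add ((h ..).zsmul _) ((h ..).zsmul _), add_assoc]
  congr 1
  rw [EvZero.finsum_succ (f := fun i : ℕ => Ring.choose m i •
      M.js u v w (l + i) (n + (m - i) + 1) a b) ((h ..).zsmul _),
    EvZero.finsum_succ (f := fun i : ℕ => Ring.choose (m + 1) i •
      M.js u v w (l + i) (n + (m + 1 - i)) a b) ((h ..).zsmul _)]
  have e : ∀ i : ℕ, l + ((i + 1 : ℕ) : ℤ) = l + i + 1 := fun i => by push_cast; ring
  have e1 : ∀ i : ℕ, n + (m + 1 - ((i + 1 : ℕ) : ℤ)) = n + (m - i) := fun i => by push_cast; ring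
  have e2 : ∀ i : ℕ, n + (m - ((i + 1 : ℕ) : ℤ)) + 1 = n + (m - i) := fun i => by push_cast; ring
  simp only [e, e1, e2, Ring.choose_succ_succ, add_smul, Ring.choose_zero_right]
  have h'' : EvZero fun i : ℕ => M.js u v w (l + i + 1) (n + (m - i)) a b := h'
  rw [EvZero.finsum_add (h'.zsmul _) (h'.zsmul _),
    show n + (m - ((0 : ℕ) : ℤ)) + 1 = n + (m + 1 - ((0 : ℕ) : ℤ)) by ring]
  abel

/-- Both sides vanish for large `m`. -/
theorem jl_jr_zero_left (u v : V) (w : W) (l n a b : ℤ) : ∃ K : ℤ, ∀ m ≥ K,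
    M.jl u v w l m n a b = 0 ∧ M.jr u v w l m n a b = 0 := by
  obtain ⟨I, hI⟩ := M.evZero_res n b v w
  choose K₁ hK₁ using fun i : ℕ => M.trunc u (M.res (n + i) b v w)
  obtain ⟨K₂, hK₂⟩ := M.trunc u w
  obtain ⟨J, hJ⟩ := 𝒱.adjoint.trunc u v
  choose K₃ hK₃ using fun i : ℕ => M.trunc (𝒱.adjoint.mode u (l + i) v) w
  let S := ∑ i ∈ Finset.range I, (|K₁ i| + i) + |l| + |K₂|
  let T := ∑ i ∈ Finset.range (J - l).toNat, (|K₃ i| + i) + |n|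
  refine ⟨max S T, fun m hm => ⟨?_, ?_⟩⟩
  · have hm : S ≤ m := (le_max_left _ _).trans hm
    have hS : ∑ i ∈ Finset.range I, (|K₁ i| + (i : ℤ)) + |l| + |K₂| ≤ m := hm
    have hS0 : 0 ≤ ∑ i ∈ Finset.range I, (|K₁ i| + (i : ℤ)) :=
      Finset.sum_nonneg fun i _ => by positivity
    refine (finsum_congr fun i => ?_).trans finsum_zero
    rw [M.res_eq_zero hK₂ (n := m + i) (by
      have := le_abs_self K₂; have := abs_nonneg l; omega), map_zero, smul_zero, sub_zero]
    by_cases hi : I ≤ i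
    · have := hI i hi
      simp only at this
      rw [this, map_zero, smul_zero]
    · have : |K₁ i| + (i : ℤ) ≤ ∑ i ∈ Finset.range I, (|K₁ i| + (i : ℤ)) :=
        Finset.single_le_sum (f := fun i : ℕ => |K₁ i| + (i : ℤ)) (fun i _ => by positivity)
          (Finset.mem_range.mpr (not_le.mp hi))
      rw [M.res_eq_zero (hK₁ i), smul_zero]
      have := le_abs_self (K₁ i)
      have := neg_abs_le l
      have := abs_nonneg K₂
      omega
  · have hm : T ≤ m := (le_max_right _ _).trans hm
    have hT : ∑ i ∈ Finset.range (J - l).toNat, (|K₃ i| + (i : ℤ)) + |n| ≤ m := hm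
    refine (finsum_congr fun i => ?_).trans finsum_zero
    rw [show M.js u v w (l + i) (n + (m - i)) a b = 0 from ?_, smul_zero]
    refine (finsum_congr fun j => ?_).trans finsum_zero
    by_cases hi : J ≤ l + i + j
    · rw [hJ _ hi]; simp
    · have : |K₃ (i + j)| + ((i + j : ℕ) : ℤ)
          ≤ ∑ i ∈ Finset.range (J - l).toNat, (|K₃ i| + (i : ℤ)) :=
        Finset.single_le_sum (f := fun i : ℕ => |K₃ i| + (i : ℤ)) (fun i _ => by positivity)
          (Finset.mem_range.mpr (by omega))
      have h3 := hK₃ (i + j)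
      rw [show l + ((i + j : ℕ) : ℤ) = l + i + j by push_cast; ring] at h3
      rw [M.res_eq_zero h3, smul_zero]
      have := le_abs_self (K₃ (i + j))
      have := neg_abs_le n
      push_cast at *
      omega

/-- Both sides vanish for large `n`. -/
theorem jl_jr_zero_right (u v : V) (w : W) (l m a b : ℤ) : ∃ K : ℤ, ∀ n ≥ K,
    M.jl u v w l m n a b = 0 ∧ M.jr u v w l m n a b = 0 := by
  obtain ⟨I, hI⟩ := M.evZero_res m a u w
  choose K₁ hK₁ using fun i : ℕ => M.trunc v (M.res (m + i) a u w)
  obtain ⟨K₂, hK₂⟩ := M.trunc v w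
  obtain ⟨J, hJ⟩ := 𝒱.adjoint.trunc u v
  choose K₃ hK₃ using fun i : ℕ => M.trunc (𝒱.adjoint.mode u (l + i) v) w
  let S := ∑ i ∈ Finset.range I, (|K₁ i| + i) + |l| + |K₂|
  let T := ∑ i ∈ Finset.range (J - l).toNat, (|K₃ i| + i) + |m|
  refine ⟨max S T, fun n hm => ⟨?_, ?_⟩⟩
  · have hm : S ≤ n := (le_max_left _ _).trans hm
    have hS : ∑ i ∈ Finset.range I, (|K₁ i| + (i : ℤ)) + |l| + |K₂| ≤ n := hm
    have hS0 : 0 ≤ ∑ i ∈ Finset.range I, (|K₁ i| + (i : ℤ)) :=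
      Finset.sum_nonneg fun i _ => by positivity
    refine (finsum_congr fun i => ?_).trans finsum_zero
    rw [M.res_eq_zero hK₂ (n := n + i) (by
      have := le_abs_self K₂; have := abs_nonneg l; omega), map_zero, zero_sub]
    by_cases hi : I ≤ i
    · have := hI i hi
      simp only at this
      rw [this, map_zero, smul_zero, neg_zero, smul_zero]
    · have : |K₁ i| + (i : ℤ) ≤ ∑ i ∈ Finset.range I, (|K₁ i| + (i : ℤ)) :=
        Finset.single_le_sum (f := fun i : ℕ => |K₁ i| + (i : ℤ)) (fun i _ => by positivity)
          (Finset.mem_range.mpr (not_le.mp hi))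
      rw [M.res_eq_zero (hK₁ i), smul_zero, neg_zero, smul_zero]
      have := le_abs_self (K₁ i)
      have := neg_abs_le l
      have := abs_nonneg K₂
      omega
  · have hm : T ≤ n := (le_max_right _ _).trans hm
    have hT : ∑ i ∈ Finset.range (J - l).toNat, (|K₃ i| + (i : ℤ)) + |m| ≤ n := hm
    refine (finsum_congr fun i => ?_).trans finsum_zero
    rw [show M.js u v w (l + i) (n + (m - i)) a b = 0 from ?_, smul_zero]
    refine (finsum_congr fun j => ?_).trans finsum_zero
    by_cases hi : J ≤ l + i + j
    · rw [hJ _ hi]; simp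
    · have : |K₃ (i + j)| + ((i + j : ℕ) : ℤ)
          ≤ ∑ i ∈ Finset.range (J - l).toNat, (|K₃ i| + (i : ℤ)) :=
        Finset.single_le_sum (f := fun i : ℕ => |K₃ i| + (i : ℤ)) (fun i _ => by positivity)
          (Finset.mem_range.mpr (by omega))
      have h3 := hK₃ (i + j)
      rw [show l + ((i + j : ℕ) : ℤ) = l + i + j by push_cast; ring] at h3
      rw [M.res_eq_zero h3, smul_zero]
      have := le_abs_self (K₃ (i + j))
      have := neg_abs_le m
      push_cast at *
      omega

/-- A function with `E m + E (m+1) = 0` that vanishes for large `m` is zero. -/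
theorem eq_zero_of_succ {X : Type*} [AddCommGroup X] {E : ℤ → X} (h : ∀ m, E m + E (m + 1) = 0)
    (h0 : ∃ K, ∀ m ≥ K, E m = 0) (m : ℤ) : E m = 0 := by
  obtain ⟨K, hK⟩ := h0
  have : ∀ d : ℕ, ∀ m, K - m ≤ d → E m = 0 := by
    intro d
    induction d with
    | zero => intro m hm; exact hK m (by push_cast at hm; omega)
    | succ d ih =>
      intro m hm
      have := h m
      rwa [ih (m + 1) (by push_cast at hm; omega), add_zero] at this
  exact this (K - m).toNat m (by omega)

theorem jl_eq_jr (u v : V) (w : W) (l m n a b : ℤ) :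
    M.jl u v w l m n a b = M.jr u v w l m n a b := by
  have base : ∀ m n, M.jl u v w l m n 0 0 = M.jr u v w l m n 0 0 := by
    intro m n
    have h := M.jacobi u v w l m n
    unfold jacobiDefect at h
    rw [sub_eq_zero] at h
    unfold jl jr js
    have e : ∀ i : ℕ, (∑ᶠ j : ℕ, Ring.choose (0 : ℤ) j • M.res (n + (m - i)) (0 + 0 - j)
        (𝒱.adjoint.mode u (l + i + j) v) w) = M.mode (𝒱.adjoint.mode u (l + i) v)
          (n + (m - i)) w := by
      intro i
      rw [finsum_eq_single _ 0]
      · simp [res_zero]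
      · intro j hj
        simp [Ring.choose_zero_pos ℤ (by omega : 0 < j)]
    simp only [e, res_zero]
    simpa [mode, VertexOperatorAlgebra.adjoint] using h
  have left : ∀ a m n, M.jl u v w l m n a 0 = M.jr u v w l m n a 0 := by
    intro a
    induction a using Int.induction_on with
    | zero => exact base
    | succ a ih =>
      intro m n
      rw [jl_succ_left, jr_succ_left, ih, ih]
    | pred a ih =>
      intro m n
      rw [← sub_eq_zero]
      refine eq_zero_of_succ (E := fun m => M.jl u v w l m n (-a - 1) 0
        - M.jr u v w l m n (-a - 1) 0) (fun m => ?_) ?_ m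
      · have := ih m n
        rw [show -(a : ℤ) = -a - 1 + 1 by ring, jl_succ_left, jr_succ_left] at this
        rw [sub_add_sub_comm, this, sub_self]
      · obtain ⟨K, hK⟩ := M.jl_jr_zero_left u v w l n (-a - 1) 0
        exact ⟨K, fun m hm => by rw [(hK m hm).1, (hK m hm).2, sub_self]⟩
  induction b using Int.induction_on generalizing n with
  | zero => exact left a m n
  | succ b ih => rw [jl_succ_right, jr_succ_right, ih, ih]
  | pred b ih =>
    rw [← sub_eq_zero]
    refine eq_zero_of_succ (E := fun n => M.jl u v w l m n a (-b - 1)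
      - M.jr u v w l m n a (-b - 1)) (fun n => ?_) ?_ n
    · have := ih n
      rw [show -(b : ℤ) = -b - 1 + 1 by ring, jl_succ_right, jr_succ_right] at this
      rw [sub_add_sub_comm, this, sub_self]
    · obtain ⟨K, hK⟩ := M.jl_jr_zero_right u v w l m a (-b - 1)
      exact ⟨K, fun n hn => by rw [(hK n hn).1, (hK n hn).2, sub_self]⟩

/-- Commutator formula. -/
theorem res_comm (u v : V) (w : W) (m n a b : ℤ) :
    M.res m a u (M.res n b v w) - M.res n b v (M.res m a u w)
      = ∑ᶠ i : ℕ, Ring.choose m i • M.js u v w i (n + (m - i)) a b := by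
  have h := M.jl_eq_jr u v w 0 m n a b
  unfold jl jr at h
  rw [finsum_eq_single _ 0] at h
  · simpa using h
  · intro i hi
    simp [Ring.choose_zero_pos ℤ (by omega : 0 < i)]

/-- Associativity formula. -/
theorem res_assoc (u v : V) (w : W) (l n a b : ℤ) :
    M.jl u v w l 0 n a b
      = ∑ᶠ j : ℕ, Ring.choose a j • M.res n (a + b - j) (𝒱.adjoint.mode u (l + j) v) w := by
  have h := M.jl_eq_jr u v w l 0 n a b
  rw [h]
  unfold jr
  rw [finsum_eq_single _ 0]
  · simp [js]
  · intro i hi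
    simp [Ring.choose_zero_pos ℤ (by omega : 0 < i)]

end WeakModule

namespace WeakModule

variable (M : WeakModule 𝒱 W)

theorem mode_comm (u v : V) (w : W) (m n : ℤ) :
    M.mode u m (M.mode v n w) - M.mode v n (M.mode u m w)
      = ∑ᶠ i : ℕ, Ring.choose m i • M.mode (𝒱.adjoint.mode u i v) (n + (m - i)) w := by
  have h := M.res_comm u v w m n 0 0
  simp only [res_zero] at h
  rw [h]
  refine finsum_congr fun i => ?_
  unfold js
  rw [finsum_eq_single _ 0]
  · simp [res_zero]
  · intro j hj
    simp [Ring.choose_zero_pos ℤ (by omega : 0 < j)]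

theorem mode_L_neg_one (v : V) (n : ℤ) :
    M.mode (𝒱.adjoint.L (-1) v) n = -(n : ℂ) • M.mode v (n - 1) :=
  M.derivative v n

theorem mem_homog {k : ℤ} {v : V} : v ∈ 𝒱.homog k ↔ 𝒱.adjoint.L 0 v = (k : ℂ) • v :=
  Module.End.mem_eigenspace_iff

theorem mem_weightSpace {h : ℂ} {w : W} : w ∈ M.weightSpace h ↔ M.L 0 w = h • w :=
  Module.End.mem_eigenspace_iff

theorem mode_mem {k : ℤ} {v : V} (hv : v ∈ 𝒱.homog k) {h : ℂ} {w : W} (hw : w ∈ M.weightSpace h)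
    (n : ℤ) : M.mode v n w ∈ M.weightSpace (h + (k - n - 1)) := by
  rw [mem_weightSpace] at hw ⊢
  rw [mem_homog] at hv
  have h1 := M.mode_comm 𝒱.ω v w 1 n
  rw [finsum_eq_sum_of_support_subset (s := Finset.range 2)] at h1
  · simp only [Finset.sum_range_succ, Finset.sum_range_zero, zero_add, Ring.choose_zero_right,
      Ring.choose_one_right, one_smul, Nat.cast_zero, Nat.cast_one, sub_zero, sub_self,
      add_zero] at h1
    have e0 : 𝒱.adjoint.mode 𝒱.ω 0 v = 𝒱.adjoint.L (-1) v := rfl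
    have e1 : 𝒱.adjoint.mode 𝒱.ω 1 v = 𝒱.adjoint.L 0 v := rfl
    have e2 : M.mode 𝒱.ω 1 = M.L 0 := rfl
    rw [e0, e1, hv, e2, hw, mode_L_neg_one, map_smul, sub_eq_iff_eq_add] at h1
    rw [h1]
    simp only [mode_smul, LinearMap.smul_apply, add_sub_cancel_right, ← add_smul]
    congr 1
    push_cast
    ring
  · intro i hi
    by_contra h
    apply hi
    have : Ring.choose (1 : ℤ) i = 0 := by
      have := Ring.choose_natCast (R := ℤ) 1 i
      rw [Nat.choose_eq_zero_of_lt (by simpa using h)] at this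
      simpa using this
    simp [this]

theorem mode_mem_homog {p q : ℤ} {u v : V} (hu : u ∈ 𝒱.homog p) (hv : v ∈ 𝒱.homog q) {r : ℤ}
    (n : ℤ) (hr : r = p + q - n - 1) : 𝒱.adjoint.mode u n v ∈ 𝒱.homog r := by
  have := 𝒱.adjoint.mode_mem hu hv n
  unfold VertexOperatorAlgebra.homog
  convert this using 2
  rw [hr]; push_cast; ring

theorem omega_mem : 𝒱.ω ∈ 𝒱.homog 2 := by
  rw [mem_homog]
  have h := 𝒱.virasoro 0 (-2)
  have h' := LinearMap.congr_fun h 𝒱.one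
  simp only [LinearMap.sub_apply, Module.End.mul_apply, LinearMap.add_apply,
    LinearMap.smul_apply] at h'
  norm_num at h'
  rw [𝒱.creation, 𝒱.creation_regular _ 1 (by norm_num), map_zero, sub_zero] at h'
  exact_mod_cast h'

theorem L_neg_one_mem {k : ℤ} {v : V} (hv : v ∈ 𝒱.homog k) :
    𝒱.adjoint.L (-1) v ∈ 𝒱.homog (k + 1) :=
  mode_mem_homog omega_mem hv _ (by ring)

/-- `O(W)`: the span of `Res_x x^(-2) (1+x)^(wt v) Y(v,x)w` for homogeneous `v`. -/
def O : Submodule ℂ W :=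
  Submodule.span ℂ {x | ∃ (k : ℤ) (v : V) (w : W), v ∈ 𝒱.homog k ∧ x = M.res (-2) k v w}

theorem res_deriv (v : V) (w : W) (n a : ℤ) : M.res n a (𝒱.adjoint.L (-1) v) w
    = -((n : ℂ) • M.res (n - 1) a v w + (a : ℂ) • M.res n (a - 1) v w) := by
  have h0 := M.evZero_mode v w (n - 1)
  have key : ∀ i : ℕ, ((i + 1 : ℕ) : ℤ) * Ring.choose a (i + 1) = a * Ring.choose (a - 1) i := by
    intro i
    have := Ring.choose_smul_choose a (n := i + 1) (k := 1) (by omega)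
    simpa [Ring.choose_one_right] using this
  have e1 : M.res n a (𝒱.adjoint.L (-1) v) w
      = ∑ᶠ i : ℕ, (-(n : ℤ) * Ring.choose a i + -(i * Ring.choose a i)) •
        M.mode v (n - 1 + i) w := by
    rw [res_apply]
    refine finsum_congr fun i => ?_
    rw [mode_L_neg_one, show n + (i : ℤ) - 1 = n - 1 + i by ring, LinearMap.smul_apply,
      ← Int.cast_smul_eq_zsmul ℂ, ← Int.cast_smul_eq_zsmul ℂ, smul_smul]
    congr 1
    push_cast; ring
  rw [e1]
  simp only [add_smul]
  rw [EvZero.finsum_add (h0.zsmul _) (h0.zsmul _),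
    EvZero.finsum_succ (f := fun i : ℕ => (-(i * Ring.choose a i)) • M.mode v (n - 1 + i) w)
      (h0.zsmul _)]
  simp only [key]
  rw [neg_add, res_apply, res_apply, smul_finsum, smul_finsum, ← finsum_neg_distrib,
    ← finsum_neg_distrib]
  congr 1
  · refine finsum_congr fun i => ?_
    rw [← Int.cast_smul_eq_zsmul ℂ, ← Int.cast_smul_eq_zsmul ℂ, smul_smul, ← neg_smul]
    congr 1; push_cast; ring
  · simp only [Nat.cast_zero, zero_mul, neg_zero, zero_smul, zero_add]
    refine finsum_congr fun i => ?_
    rw [← Int.cast_smul_eq_zsmul ℂ, ← Int.cast_smul_eq_zsmul ℂ, smul_smul, ← neg_smul,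
      show n - 1 + ((i + 1 : ℕ) : ℤ) = n + i by push_cast; ring]
    congr 1; push_cast; ring

theorem res_mem_O {k : ℤ} {v : V} (hv : v ∈ 𝒱.homog k) (w : W) (n m : ℕ) (hmn : m ≤ n) {s r : ℤ}
    (hs : s = -2 - n) (hr : r = k + m) : M.res s r v w ∈ M.O := by
  subst hs hr
  have base : ∀ (n : ℕ) (k : ℤ) (v : V), v ∈ 𝒱.homog k → M.res (-2 - n) k v w ∈ M.O := by
    intro n
    induction n with
    | zero =>
      intro k v hv
      exact Submodule.subset_span ⟨k, v, w, hv, by simp⟩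
    | succ n ih =>
      intro k v hv
      have h1 := ih (k + 1) _ (L_neg_one_mem hv)
      rw [res_deriv, res_succ, add_sub_cancel_right, show (-2 - (n : ℤ) - 1) + 1 = -2 - n by ring,
        Submodule.neg_mem_iff, smul_add] at h1
      have h2 := ih k v hv
      have h3 := (Submodule.add_mem_iff_left _ (M.O.smul_mem _ h2)).mp h1
      have h4 := (Submodule.add_mem_iff_left _ (M.O.smul_mem _ h2)).mp h3
      have hne : ((-2 - (n : ℤ) : ℤ) : ℂ) ≠ 0 := by
        exact_mod_cast (by omega : (-2 - (n : ℤ) : ℤ) ≠ 0)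
      rw [Submodule.smul_mem_iff _ hne] at h4
      rwa [show (-2 - ((n + 1 : ℕ) : ℤ)) = -2 - n - 1 by push_cast; ring]
  induction m generalizing n with
  | zero => simpa using base n k v hv
  | succ m ih =>
    obtain ⟨n, rfl⟩ : ∃ n', n = n' + 1 := ⟨n - 1, by omega⟩
    rw [show k + ((m + 1 : ℕ) : ℤ) = k + m + 1 by push_cast; ring, res_succ]
    refine M.O.add_mem (ih _ (by omega)) ?_
    rw [show -2 - ((n + 1 : ℕ) : ℤ) + 1 = -2 - n by push_cast; ring]
    exact ih n (by omega)

/-- An operator that maps the generators of `O(W)` into `O(W)` preserves `O(W)`. -/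
theorem O_le_comap (φ : Module.End ℂ W)
    (h : ∀ (k : ℤ) (v : V) (w : W), v ∈ 𝒱.homog k → φ (M.res (-2) k v w) ∈ M.O) :
    M.O ≤ M.O.comap φ := by
  refine Submodule.span_le.mpr ?_
  rintro x ⟨k, v, w, hv, rfl⟩
  exact h k v w hv

theorem left_O {p : ℤ} {u : V} (hu : u ∈ 𝒱.homog p) : M.O ≤ M.O.comap (M.res (-1) p u) := by
  refine M.O_le_comap _ fun q v w hv => ?_
  have h := M.res_comm u v w (-1) (-2) p q
  rw [sub_eq_iff_eq_add] at h
  rw [h]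
  refine M.O.add_mem (EvZero.finsum_mem _ fun i => zsmul_mem (EvZero.finsum_mem _ fun j =>
    zsmul_mem ?_ _) _) (M.res_mem_O hv _ 0 0 le_rfl (by simp) (by simp))
  exact M.res_mem_O (mode_mem_homog hu hv _ rfl) w (i + 1) (i + 1) le_rfl (by push_cast; ring)
    (by push_cast; ring)

theorem right_O {p : ℤ} {u : V} (hu : u ∈ 𝒱.homog p) :
    M.O ≤ M.O.comap (M.res (-1) (p - 1) u) := by
  refine M.O_le_comap _ fun q v w hv => ?_
  have h := M.res_comm u v w (-1) (-2) (p - 1) q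
  rw [sub_eq_iff_eq_add] at h
  rw [h]
  refine M.O.add_mem (EvZero.finsum_mem _ fun i => zsmul_mem (EvZero.finsum_mem _ fun j =>
    zsmul_mem ?_ _) _) (M.res_mem_O hv _ 0 0 le_rfl (by simp) (by simp))
  exact M.res_mem_O (mode_mem_homog hu hv _ rfl) w (i + 1) i (by omega) (by push_cast; ring)
    (by push_cast; ring)

theorem left_right_comm {p q : ℤ} {u v : V} (hu : u ∈ 𝒱.homog p) (hv : v ∈ 𝒱.homog q) (w : W) :
    M.res (-1) (p - 1) u (M.res (-1) q v w) - M.res (-1) q v (M.res (-1) (p - 1) u w) ∈ M.O := by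
  rw [M.res_comm]
  refine EvZero.finsum_mem _ fun i => zsmul_mem (EvZero.finsum_mem _ fun j => zsmul_mem ?_ _) _
  exact M.res_mem_O (mode_mem_homog hu hv _ rfl) w i i le_rfl (by push_cast; ring)
    (by push_cast; ring)

theorem neg_one_choose (i : ℕ) : ((-1) ^ i * Ring.choose (-1) i : ℤ) = 1 := by
  induction i with
  | zero => simp
  | succ i ih =>
    have h := Ring.choose_succ_succ (-1 : ℤ) i
    rw [show (-1 : ℤ) + 1 = 0 by ring, Ring.choose_zero_succ] at h
    rw [pow_succ]
    linear_combination ih + (-1) ^ i * h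

theorem jl_neg_one (u v : V) (w : W) (a b : ℤ) : M.jl u v w (-1) 0 (-1) a b
    = ∑ᶠ i : ℕ, (M.res (-1 - i) a u (M.res (-1 + i) b v w)
      + M.res (-2 - i) b v (M.res i a u w)) := by
  unfold jl
  refine finsum_congr fun i => ?_
  rw [neg_one_choose, one_smul]
  simp only [Int.negOnePow_neg, Int.negOnePow_one, Units.val_neg, Units.val_one, neg_smul, one_smul,
    sub_neg_eq_add, zero_add]
  rw [show -1 + (-1 - (i : ℤ)) = -2 - i by ring]

theorem evZero_jl_fst (u v : V) (w : W) (n a b : ℤ) (k : ℕ → ℤ) :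
    EvZero fun i : ℕ => M.res (k i) a u (M.res (n + i) b v w) := by
  obtain ⟨N, hN⟩ := M.evZero_res n b v w
  exact ⟨N, fun i hi => by
    have := hN i hi
    simp only at this ⊢
    rw [this, map_zero]⟩

theorem left_assoc {p q : ℤ} {u v : V} (hu : u ∈ 𝒱.homog p) (hv : v ∈ 𝒱.homog q) (w : W) :
    (∑ᶠ j : ℕ, Ring.choose p j • M.res (-1) (p + q - j) (𝒱.adjoint.mode u (-1 + j) v) w)
      - M.res (-1) p u (M.res (-1) q v w) ∈ M.O := by
  have h2 : EvZero fun i : ℕ => M.res (-2 - i) q v (M.res i p u w) := by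
    simpa using M.evZero_jl_fst v u w 0 q p fun i => -2 - i
  rw [← M.res_assoc u v w (-1) (-1) p q, jl_neg_one,
    EvZero.finsum_add (M.evZero_jl_fst ..) h2, EvZero.finsum_succ (M.evZero_jl_fst ..)]
  simp only [Nat.cast_zero, sub_zero, add_zero]
  rw [add_assoc, add_sub_cancel_left]
  refine M.O.add_mem (EvZero.finsum_mem _ fun i => ?_) (EvZero.finsum_mem _ fun i => ?_)
  · exact M.res_mem_O hu _ i 0 (by omega) (by push_cast; ring) (by simp)
  · exact M.res_mem_O hv _ i 0 (by omega) (by push_cast; ring) (by simp)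

theorem right_assoc {p q : ℤ} {u v : V} (hu : u ∈ 𝒱.homog p) (hv : v ∈ 𝒱.homog q) (w : W) :
    (∑ᶠ j : ℕ, Ring.choose p j • M.res (-1) (p + q - j - 1) (𝒱.adjoint.mode u (-1 + j) v) w)
      - M.res (-1) (q - 1) v (M.res (-1) (p - 1) u w) ∈ M.O := by
  have h2 : ∀ (k : ℕ → ℤ) b a, EvZero fun i : ℕ => M.res (k i) b v (M.res i a u w) := by
    intro k b a
    simpa using M.evZero_jl_fst v u w 0 b a k
  have h3 := M.res_assoc u v w (-1) (-1) p (q - 1)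
  simp only [show ∀ j : ℕ, p + (q - 1) - (j : ℤ) = p + q - j - 1 from fun j => by ring] at h3
  rw [← h3, jl_neg_one, EvZero.finsum_add (M.evZero_jl_fst ..) (h2 ..),
    EvZero.finsum_succ (M.evZero_jl_fst ..)]
  simp only [Nat.cast_zero, sub_zero, add_zero]
  -- rewrite the second sum
  have hp : ∀ i : ℤ, M.res i p u w = M.res i (p - 1) u w + M.res (i + 1) (p - 1) u w := by
    intro i
    have := M.res_succ i (p - 1) u w
    rwa [sub_add_cancel] at this
  have hq : ∀ (i : ℤ) (x : W), M.res i q v x = M.res i (q - 1) v x + M.res (i + 1) (q - 1) v x := by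
    intro i x
    have := M.res_succ i (q - 1) v x
    rwa [sub_add_cancel] at this
  have h4 : EvZero fun i : ℕ => M.res (-2 - i) (q - 1) v (M.res (i + 1) (p - 1) u w) := by
    have := M.evZero_jl_fst v u w 1 (q - 1) (p - 1) fun i => -2 - i
    simpa only [add_comm (1 : ℤ)] using this
  have e : (∑ᶠ i : ℕ, M.res (-2 - i) (q - 1) v (M.res i p u w))
      = (∑ᶠ i : ℕ, M.res (-2 - i) q v (M.res i (p - 1) u w))
        - M.res (-1) (q - 1) v (M.res 0 (p - 1) u w) := by
    have e1 : (∑ᶠ i : ℕ, M.res (-2 - i) (q - 1) v (M.res i p u w))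
      = (∑ᶠ i : ℕ, M.res (-2 - i) (q - 1) v (M.res i (p - 1) u w))
        + ∑ᶠ i : ℕ, M.res (-2 - i) (q - 1) v (M.res (i + 1) (p - 1) u w) := by
      rw [← EvZero.finsum_add (h2 ..) h4]
      exact finsum_congr fun i => by rw [hp, map_add]
    have e2 : (∑ᶠ i : ℕ, M.res (-2 - i) q v (M.res i (p - 1) u w))
      = (∑ᶠ i : ℕ, M.res (-2 - i) (q - 1) v (M.res i (p - 1) u w))
        + ∑ᶠ i : ℕ, M.res (-1 - i) (q - 1) v (M.res i (p - 1) u w) := by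
      rw [← EvZero.finsum_add (h2 ..) (h2 ..)]
      exact finsum_congr fun i => by rw [hq, show -2 - (i : ℤ) + 1 = -1 - i by ring]
    rw [e1, e2, EvZero.finsum_succ
      (f := fun i : ℕ => M.res (-1 - i) (q - 1) v (M.res i (p - 1) u w)) (h2 ..)]
    simp only [Nat.cast_zero, sub_zero,
      show ∀ i : ℕ, -1 - ((i + 1 : ℕ) : ℤ) = -2 - i from fun i => by push_cast; ring]
    push_cast
    abel
  rw [e]
  have h5 := M.left_right_comm hv hu w
  have h6 := hp (-1)
  rw [show (-1 : ℤ) + 1 = 0 by ring] at h6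
  have h7 : M.res (-1) (q - 1) v (M.res (-1) p u w)
      = M.res (-1) (q - 1) v (M.res (-1) (p - 1) u w)
        + M.res (-1) (q - 1) v (M.res 0 (p - 1) u w) := by
    rw [h6, map_add]
  rw [h7] at h5
  have h8 : (∑ᶠ i : ℕ, M.res (-1 - ((i + 1 : ℕ) : ℤ)) p u
      (M.res (-1 + ((i + 1 : ℕ) : ℤ)) (q - 1) v w)) ∈ M.O :=
    EvZero.finsum_mem _ fun i =>
      M.res_mem_O hu _ i 0 (by omega) (by push_cast; ring) (by simp)
  have h9 : (∑ᶠ i : ℕ, M.res (-2 - i) q v (M.res i (p - 1) u w)) ∈ M.O :=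
    EvZero.finsum_mem _ fun i =>
      M.res_mem_O hv _ i 0 (by omega) (by push_cast; ring) (by simp)
  have := M.O.sub_mem (M.O.add_mem h8 h9) h5
  convert this using 1
  abel

theorem O_left {p q : ℤ} {u v : V} (hu : u ∈ 𝒱.homog p) (hv : v ∈ 𝒱.homog q) (w : W) :
    (∑ᶠ j : ℕ, Ring.choose p j • M.res (-1) (p + q + 1 - j) (𝒱.adjoint.mode u (-2 + j) v) w)
      ∈ M.O := by
  have h := M.res_assoc u v w (-2) (-1) p (q + 1)
  rw [show p + (q + 1) = p + q + 1 by ring] at h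
  rw [← h]
  refine EvZero.finsum_mem _ fun i => zsmul_mem (M.O.sub_mem ?_ (zsmul_mem ?_ _)) _
  · exact M.res_mem_O hu _ i 0 (by omega) (by ring) (by simp)
  · exact M.res_mem_O hv _ (i + 1) 1 (by omega) (by push_cast; ring) (by simp)

theorem O_right {p q : ℤ} {u v : V} (hu : u ∈ 𝒱.homog p) (hv : v ∈ 𝒱.homog q) (w : W) :
    (∑ᶠ j : ℕ, Ring.choose p j • M.res (-1) (p + q + 1 - j - 1) (𝒱.adjoint.mode u (-2 + j) v) w)
      ∈ M.O := by
  have h := M.res_assoc u v w (-2) (-1) p q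
  simp only [show ∀ j : ℕ, p + q + 1 - (j : ℤ) - 1 = p + q - j from fun j => by ring]
  rw [← h]
  refine EvZero.finsum_mem _ fun i => zsmul_mem (M.O.sub_mem ?_ (zsmul_mem ?_ _)) _
  · exact M.res_mem_O hu _ i 0 (by omega) (by ring) (by simp)
  · exact M.res_mem_O hv _ (i + 1) 0 (by omega) (by push_cast; ring) (by simp)

end WeakModule

/-! ### The algebra `A(V)` and the bimodule `A(W)` -/

namespace VertexOperatorAlgebra

variable (𝒱 : VertexOperatorAlgebra V)

theorem isInternal_homog : Function.Bijective (DirectSum.coeLinearMap 𝒱.homog) := by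
  change DirectSum.IsInternal 𝒱.homog
  refine DirectSum.isInternal_submodule_of_iSupIndep_of_iSup_eq_top ?_ 𝒱.iSup_grading
  exact ((𝒱.adjoint.L 0).eigenspaces_iSupIndep).comp (f := fun n : ℤ => (n : ℂ)) Int.cast_injective

/-- Extension by linearity: the linear map on `V` that is `φ k` on the homogeneous subspace
`V_(k)`, for every `k`. -/
def extend {X : Type*} [AddCommGroup X] [Module ℂ X] (φ : ℤ → V →ₗ[ℂ] X) : V →ₗ[ℂ] X :=
  DirectSum.toModule ℂ ℤ X (fun k => (φ k).domRestrict (𝒱.homog k)) ∘ₗ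
    (LinearEquiv.ofBijective (DirectSum.coeLinearMap 𝒱.homog) 𝒱.isInternal_homog).symm.toLinearMap

variable {𝒱} in
theorem extend_apply {X : Type*} [AddCommGroup X] [Module ℂ X] (φ : ℤ → V →ₗ[ℂ] X) {k : ℤ} {v : V}
    (hv : v ∈ 𝒱.homog k) : 𝒱.extend φ v = φ k v := by
  have : (LinearEquiv.ofBijective (DirectSum.coeLinearMap 𝒱.homog) 𝒱.isInternal_homog).symm v
      = DirectSum.lof ℂ ℤ (fun k => 𝒱.homog k) k ⟨v, hv⟩ := by
    rw [LinearEquiv.symm_apply_eq]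
    simp
  simp only [extend, LinearMap.comp_apply, LinearEquiv.coe_coe, this, DirectSum.toModule_lof]
  rfl

variable {𝒱} in
@[elab_as_elim]
theorem homog_induction {P : V → Prop} (h : ∀ k, ∀ v ∈ 𝒱.homog k, P v) (h0 : P 0)
    (hadd : ∀ u v, P u → P v → P (u + v)) (v : V) : P v := by
  have hv : v ∈ ⨆ k, 𝒱.homog k := by
    rw [show ⨆ k, 𝒱.homog k = ⊤ from 𝒱.iSup_grading]; trivial
  exact Submodule.iSup_induction _ (motive := P) hv h h0 hadd

theorem one_mem : 𝒱.one ∈ 𝒱.homog 0 := by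
  rw [WeakModule.mem_homog]
  have := 𝒱.creation_regular 𝒱.ω 1 (by norm_num)
  simpa [WeakModule.L, WeakModule.mode, adjoint] using this

end VertexOperatorAlgebra

namespace WeakModule

variable (M : WeakModule 𝒱 W)

/-- The left action `v * w = Res_x x^(-1) (1+x)^(wt v) Y(v,x)w` for homogeneous `v`. -/
def left : V →ₗ[ℂ] Module.End ℂ W := 𝒱.extend fun k => M.res (-1) k

/-- The right action `w * v = Res_x x^(-1) (1+x)^(wt v - 1) Y(v,x)w` for homogeneous `v`. -/
def right : V →ₗ[ℂ] Module.End ℂ W := 𝒱.extend fun k => M.res (-1) (k - 1)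

variable {M} in
theorem left_apply {k : ℤ} {v : V} (hv : v ∈ 𝒱.homog k) : M.left v = M.res (-1) k v :=
  VertexOperatorAlgebra.extend_apply _ hv

variable {M} in
theorem right_apply {k : ℤ} {v : V} (hv : v ∈ 𝒱.homog k) : M.right v = M.res (-1) (k - 1) v :=
  VertexOperatorAlgebra.extend_apply _ hv

/-- The bimodule `A(W) = W / O(W)`. -/
def A : Type u := W ⧸ M.O

instance : AddCommGroup M.A := inferInstanceAs (AddCommGroup (W ⧸ M.O))

instance : Module ℂ M.A := inferInstanceAs (Module ℂ (W ⧸ M.O))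

/-- The class of a vector in `A(W)`. -/
def toA : W →ₗ[ℂ] M.A := M.O.mkQ

theorem toA_surjective : Function.Surjective M.toA := M.O.mkQ_surjective

theorem toA_eq_zero {w : W} : M.toA w = 0 ↔ w ∈ M.O := Submodule.Quotient.mk_eq_zero _

theorem left_mem_O (v : V) : M.O ≤ M.O.comap (M.left v) := by
  induction v using VertexOperatorAlgebra.homog_induction (𝒱 := 𝒱) with
  | h q v hv =>
    rw [left_apply hv]; exact M.left_O hv
  | h0 =>
    intro x _; simp
  | hadd v v' h h' =>
    intro x hx
    rw [Submodule.mem_comap, map_add]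
    exact M.O.add_mem (h hx) (h' hx)

theorem right_mem_O (v : V) : M.O ≤ M.O.comap (M.right v) := by
  induction v using VertexOperatorAlgebra.homog_induction (𝒱 := 𝒱) with
  | h q v hv =>
    rw [right_apply hv]; exact M.right_O hv
  | h0 =>
    intro x _; simp
  | hadd v v' h h' =>
    intro x hx
    rw [Submodule.mem_comap, map_add]
    exact M.O.add_mem (h hx) (h' hx)

/-- The map induced on `A(W)` by an operator that depends linearly on `v ∈ V`. -/
def descend (φ : V →ₗ[ℂ] Module.End ℂ W) (h : ∀ v, M.O ≤ M.O.comap (φ v)) :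
    V →ₗ[ℂ] Module.End ℂ M.A where
  toFun v := M.O.mapQ M.O (φ v) (h v)
  map_add' u v := LinearMap.ext fun x => by
    obtain ⟨w, rfl⟩ := M.O.mkQ_surjective x
    simp [Submodule.mapQ_apply]; rfl
  map_smul' c v := LinearMap.ext fun x => by
    obtain ⟨w, rfl⟩ := M.O.mkQ_surjective x
    simp [Submodule.mapQ_apply]; rfl

theorem descend_apply (φ : V →ₗ[ℂ] Module.End ℂ W) (h : ∀ v, M.O ≤ M.O.comap (φ v)) (v : V) (w : W) :
    M.descend φ h v (M.toA w) = M.toA (φ v w) := rfl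

/-- `u * v` in `V`, written out. -/
theorem adjoint_left {p : ℤ} {u : V} (hu : u ∈ 𝒱.homog p) (v : V) :
    𝒱.adjoint.left u v = ∑ᶠ j : ℕ, Ring.choose p j • 𝒱.adjoint.mode u (-1 + j) v := by
  rw [left_apply hu, res_apply]

theorem evZero_adjoint (u v : V) (n : ℤ) (c : ℕ → ℤ) :
    EvZero fun j : ℕ => c j • 𝒱.adjoint.mode u (n + j) v :=
  (𝒱.adjoint.evZero_mode u v n).zsmul c

theorem left_finsum {p q n : ℤ} {u v : V} (hu : u ∈ 𝒱.homog p) (hv : v ∈ 𝒱.homog q) (c : ℕ → ℤ)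
    (w : W) : M.left (∑ᶠ j : ℕ, c j • 𝒱.adjoint.mode u (n + j) v) w
      = ∑ᶠ j : ℕ, c j • M.res (-1) (p + q - n - 1 - j) (𝒱.adjoint.mode u (n + j) v) w := by
  have := EvZero.map_finsum ((LinearMap.applyₗ w).comp M.left : V →ₗ[ℂ] W).toAddMonoidHom
    (evZero_adjoint (𝒱 := 𝒱) u v n c)
  simp only [LinearMap.toAddMonoidHom_coe, LinearMap.comp_apply, LinearMap.applyₗ_apply_apply]
    at this
  rw [this]
  refine finsum_congr fun j => ?_
  rw [map_zsmul, LinearMap.smul_apply, left_apply (mode_mem_homog hu hv _ rfl)]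
  congr 4
  ring

theorem right_finsum {p q n : ℤ} {u v : V} (hu : u ∈ 𝒱.homog p) (hv : v ∈ 𝒱.homog q) (c : ℕ → ℤ)
    (w : W) : M.right (∑ᶠ j : ℕ, c j • 𝒱.adjoint.mode u (n + j) v) w
      = ∑ᶠ j : ℕ, c j • M.res (-1) (p + q - n - 1 - j - 1) (𝒱.adjoint.mode u (n + j) v) w := by
  have := EvZero.map_finsum ((LinearMap.applyₗ w).comp M.right : V →ₗ[ℂ] W).toAddMonoidHom
    (evZero_adjoint (𝒱 := 𝒱) u v n c)
  simp only [LinearMap.toAddMonoidHom_coe, LinearMap.comp_apply, LinearMap.applyₗ_apply_apply]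
    at this
  rw [this]
  refine finsum_congr fun j => ?_
  rw [map_zsmul, LinearMap.smul_apply, right_apply (mode_mem_homog hu hv _ rfl)]
  congr 4
  ring

theorem left_of_mem_O {u : V} (hu : u ∈ 𝒱.adjoint.O) (w : W) : M.left u w ∈ M.O := by
  suffices 𝒱.adjoint.O ≤ M.O.comap ((LinearMap.applyₗ w).comp M.left : V →ₗ[ℂ] W) from this hu
  refine Submodule.span_le.mpr ?_
  rintro x ⟨p, u, v, hu, rfl⟩
  induction v using VertexOperatorAlgebra.homog_induction (𝒱 := 𝒱) with
  | h q v hv =>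
    rw [res_apply]
    change M.left _ w ∈ M.O
    rw [M.left_finsum hu hv]
    simp only [show ∀ j : ℕ, p + q - -2 - 1 - (j : ℤ) = p + q + 1 - j from fun j => by ring]
    exact M.O_left hu hv w
  | h0 =>
    simp
  | hadd v v' h h' =>
    rw [map_add]; exact Submodule.add_mem _ h h'

theorem right_of_mem_O {u : V} (hu : u ∈ 𝒱.adjoint.O) (w : W) : M.right u w ∈ M.O := by
  suffices 𝒱.adjoint.O ≤ M.O.comap ((LinearMap.applyₗ w).comp M.right : V →ₗ[ℂ] W) from this hu
  refine Submodule.span_le.mpr ?_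
  rintro x ⟨p, u, v, hu, rfl⟩
  induction v using VertexOperatorAlgebra.homog_induction (𝒱 := 𝒱) with
  | h q v hv =>
    rw [res_apply]
    change M.right _ w ∈ M.O
    rw [M.right_finsum hu hv]
    simp only [show ∀ j : ℕ, p + q - -2 - 1 - (j : ℤ) = p + q + 1 - j from fun j => by ring]
    exact M.O_right hu hv w
  | h0 =>
    simp
  | hadd v v' h h' =>
    rw [map_add]; exact Submodule.add_mem _ h h'

theorem left_left (u v : V) (w : W) :
    M.left (𝒱.adjoint.left u v) w - M.left u (M.left v w) ∈ M.O := by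
  induction u using VertexOperatorAlgebra.homog_induction (𝒱 := 𝒱) with
  | h p u hu =>
    induction v using VertexOperatorAlgebra.homog_induction (𝒱 := 𝒱) with
    | h q v hv =>
      rw [adjoint_left hu, M.left_finsum hu hv, left_apply hu, left_apply hv]
      convert M.left_assoc hu hv w using 8
      ring
    | h0 =>
      simp
    | hadd v v' h h' =>
      have := M.O.add_mem h h'
      rw [sub_add_sub_comm] at this
      simpa using this
  | h0 =>
    simp
  | hadd u u' h h' =>
    have := M.O.add_mem h h'
    rw [sub_add_sub_comm] at this
    simpa using this

theorem right_left (u v : V) (w : W) :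
    M.right (𝒱.adjoint.left u v) w - M.right v (M.right u w) ∈ M.O := by
  induction u using VertexOperatorAlgebra.homog_induction (𝒱 := 𝒱) with
  | h p u hu =>
    induction v using VertexOperatorAlgebra.homog_induction (𝒱 := 𝒱) with
    | h q v hv =>
      rw [adjoint_left hu, M.right_finsum hu hv, right_apply hu, right_apply hv]
      convert M.right_assoc hu hv w using 8
      ring
    | h0 =>
      simp
    | hadd v v' h h' =>
      have := M.O.add_mem h h'
      rw [sub_add_sub_comm] at this
      simpa using this
  | h0 =>
    simp
  | hadd u u' h h' =>
    have := M.O.add_mem h h'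
    rw [sub_add_sub_comm] at this
    simpa using this

theorem right_left_comm (u v : V) (w : W) :
    M.right u (M.left v w) - M.left v (M.right u w) ∈ M.O := by
  induction u using VertexOperatorAlgebra.homog_induction (𝒱 := 𝒱) with
  | h p u hu =>
    induction v using VertexOperatorAlgebra.homog_induction (𝒱 := 𝒱) with
    | h q v hv =>
      rw [right_apply hu, left_apply hv]
      exact M.left_right_comm hu hv w
    | h0 =>
      simp
    | hadd v v' h h' =>
      have := M.O.add_mem h h'
      rw [sub_add_sub_comm] at this
      simpa using this
  | h0 =>
    simp
  | hadd u u' h h' =>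
    have := M.O.add_mem h h'
    rw [sub_add_sub_comm] at this
    simpa using this

theorem left_one (w : W) : M.left 𝒱.one w = w := by
  rw [left_apply 𝒱.one_mem, res_zero]
  simp [mode, M.vacuum]

theorem right_one (w : W) : M.right 𝒱.one w = w := by
  rw [right_apply 𝒱.one_mem, res_apply, finsum_eq_single _ 0]
  · simp [mode, M.vacuum]
  · intro i hi
    simp [mode, M.vacuum, hi]

theorem adjoint_left_one (v : V) : 𝒱.adjoint.left v 𝒱.one = v := by
  induction v using VertexOperatorAlgebra.homog_induction (𝒱 := 𝒱) with
  | h q v hv =>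
    rw [adjoint_left hv, finsum_eq_single _ 0]
    · simpa [WeakModule.mode, VertexOperatorAlgebra.adjoint] using 𝒱.creation v
    · intro i hi
      have : 𝒱.adjoint.mode v (-1 + i) 𝒱.one = 0 := 𝒱.creation_regular v _ (by omega)
      rw [this, smul_zero]
  | h0 =>
    simp
  | hadd v v' h h' =>
    simp [h, h']

end WeakModule

/-- The associative algebra `A(V) = V / O(V)`, with the product induced by
`u * v = Res_x x^(-1) (1+x)^(wt u) Y(u,x)v`. -/
def VertexOperatorAlgebra.A (𝒱 : VertexOperatorAlgebra V) : Type u := 𝒱.adjoint.A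

instance : AddCommGroup 𝒱.A := inferInstanceAs (AddCommGroup 𝒱.adjoint.A)

instance : Module ℂ 𝒱.A := inferInstanceAs (Module ℂ 𝒱.adjoint.A)

/-- The class of a vector in `A(V)`. -/
def VertexOperatorAlgebra.toA (𝒱 : VertexOperatorAlgebra V) : V →ₗ[ℂ] 𝒱.A := 𝒱.adjoint.toA

theorem VertexOperatorAlgebra.toA_surjective (𝒱 : VertexOperatorAlgebra V) :
    Function.Surjective 𝒱.toA := 𝒱.adjoint.toA_surjective

namespace WeakModule

variable (M : WeakModule 𝒱 W)

/-- The left action of `A(V)` on `A(W)`. -/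
def actLeft : 𝒱.A →ₗ[ℂ] Module.End ℂ M.A :=
  Submodule.liftQ 𝒱.adjoint.O (M.descend M.left M.left_mem_O) fun u hu =>
    LinearMap.ext fun x => by
      obtain ⟨w, rfl⟩ := M.toA_surjective x
      exact M.toA_eq_zero.mpr (M.left_of_mem_O hu w)

/-- The right action of `A(V)` on `A(W)`. -/
def actRight : 𝒱.A →ₗ[ℂ] Module.End ℂ M.A :=
  Submodule.liftQ 𝒱.adjoint.O (M.descend M.right M.right_mem_O) fun u hu =>
    LinearMap.ext fun x => by
      obtain ⟨w, rfl⟩ := M.toA_surjective x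
      exact M.toA_eq_zero.mpr (M.right_of_mem_O hu w)

theorem actLeft_toA (v : V) (w : W) : M.actLeft (𝒱.toA v) (M.toA w) = M.toA (M.left v w) := rfl

theorem actRight_toA (v : V) (w : W) : M.actRight (𝒱.toA v) (M.toA w) = M.toA (M.right v w) := rfl

end WeakModule

namespace VertexOperatorAlgebra

instance : Mul 𝒱.A := ⟨fun a b => 𝒱.adjoint.actLeft a b⟩

instance : One 𝒱.A := ⟨𝒱.toA 𝒱.one⟩

theorem toA_mul_toA (u v : V) : 𝒱.toA u * 𝒱.toA v = 𝒱.toA (𝒱.adjoint.left u v) := rfl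

theorem mul_def (a b : 𝒱.A) : a * b = 𝒱.adjoint.actLeft a b := rfl

end VertexOperatorAlgebra

namespace WeakModule

variable (M : WeakModule 𝒱 W)

theorem actLeft_mul (a b : 𝒱.A) (x : M.A) : M.actLeft (a * b) x = M.actLeft a (M.actLeft b x) := by
  obtain ⟨u, rfl⟩ := 𝒱.toA_surjective a
  obtain ⟨v, rfl⟩ := 𝒱.toA_surjective b
  obtain ⟨w, rfl⟩ := M.toA_surjective x
  rw [VertexOperatorAlgebra.toA_mul_toA, actLeft_toA, actLeft_toA, actLeft_toA, ← sub_eq_zero,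
    ← map_sub, toA_eq_zero]
  exact M.left_left u v w

theorem actRight_mul (a b : 𝒱.A) (x : M.A) :
    M.actRight (a * b) x = M.actRight b (M.actRight a x) := by
  obtain ⟨u, rfl⟩ := 𝒱.toA_surjective a
  obtain ⟨v, rfl⟩ := 𝒱.toA_surjective b
  obtain ⟨w, rfl⟩ := M.toA_surjective x
  rw [VertexOperatorAlgebra.toA_mul_toA, actRight_toA, actRight_toA, actRight_toA, ← sub_eq_zero,
    ← map_sub, toA_eq_zero]
  exact M.right_left u v w

theorem actRight_actLeft (a b : 𝒱.A) (x : M.A) :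
    M.actRight a (M.actLeft b x) = M.actLeft b (M.actRight a x) := by
  obtain ⟨u, rfl⟩ := 𝒱.toA_surjective a
  obtain ⟨v, rfl⟩ := 𝒱.toA_surjective b
  obtain ⟨w, rfl⟩ := M.toA_surjective x
  rw [actRight_toA, actLeft_toA, actLeft_toA, actRight_toA, ← sub_eq_zero,
    ← map_sub, toA_eq_zero]
  exact M.right_left_comm u v w

theorem actLeft_one (x : M.A) : M.actLeft 1 x = x := by
  obtain ⟨w, rfl⟩ := M.toA_surjective x
  change M.toA (M.left 𝒱.one w) = _
  rw [left_one]

theorem actRight_one (x : M.A) : M.actRight 1 x = x := by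
  obtain ⟨w, rfl⟩ := M.toA_surjective x
  change M.toA (M.right 𝒱.one w) = _
  rw [right_one]

end WeakModule

instance : Ring 𝒱.A where
  __ := (inferInstance : AddCommGroup 𝒱.A)
  mul_assoc a b c := 𝒱.adjoint.actLeft_mul a b c
  one_mul a := 𝒱.adjoint.actLeft_one a
  mul_one a := by
    obtain ⟨v, rfl⟩ := 𝒱.toA_surjective a
    change 𝒱.toA (𝒱.adjoint.left v 𝒱.one) = _
    rw [WeakModule.adjoint_left_one]
  left_distrib a b c := map_add (𝒱.adjoint.actLeft a) b c
  right_distrib a b c := by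
    change 𝒱.adjoint.actLeft (a + b) c = 𝒱.adjoint.actLeft a c + 𝒱.adjoint.actLeft b c
    rw [map_add]; rfl
  zero_mul a := by
    change 𝒱.adjoint.actLeft 0 a = 0
    rw [map_zero]; rfl
  mul_zero a := map_zero (𝒱.adjoint.actLeft a)

instance : Algebra ℂ 𝒱.A :=
  Algebra.ofModule
    (fun c a b => by
      change 𝒱.adjoint.actLeft (c • a) b = c • 𝒱.adjoint.actLeft a b
      rw [map_smul]; rfl)
    (fun c a b => map_smul (𝒱.adjoint.actLeft a) c b)

namespace WeakModule

variable (M : WeakModule 𝒱 W)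

instance : Module 𝒱.A M.A where
  smul a x := M.actLeft a x
  one_smul := M.actLeft_one
  mul_smul := M.actLeft_mul
  smul_zero a := map_zero (M.actLeft a)
  smul_add a := map_add (M.actLeft a)
  add_smul a b x := by change M.actLeft (a + b) x = _; rw [map_add]; rfl
  zero_smul x := by change M.actLeft 0 x = _; rw [map_zero]; rfl

instance : Module (𝒱.A)ᵐᵒᵖ M.A where
  smul a x := M.actRight a.unop x
  one_smul := M.actRight_one
  mul_smul a b x := M.actRight_mul b.unop a.unop x
  smul_zero a := map_zero (M.actRight a.unop)
  smul_add a := map_add (M.actRight a.unop)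
  add_smul a b x := by change M.actRight (a.unop + b.unop) x = _; rw [map_add]; rfl
  zero_smul x := by change M.actRight 0 x = _; rw [map_zero]; rfl

instance : SMulCommClass 𝒱.A (𝒱.A)ᵐᵒᵖ M.A :=
  ⟨fun a b x => (M.actRight_actLeft b.unop a x).symm⟩

instance : IsScalarTower ℂ 𝒱.A M.A :=
  ⟨fun c a x => by change M.actLeft (c • a) x = c • M.actLeft a x; rw [map_smul]; rfl⟩

instance : SMulCommClass ℂ 𝒱.A M.A :=
  ⟨fun c a x => (map_smul (M.actLeft a) c x).symm⟩

instance : SMulCommClass 𝒱.A ℂ M.A :=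
  ⟨fun a c x => map_smul (M.actLeft a) c x⟩

end WeakModule

/-! ### The lowest weight subspace as an `A(V)`-module -/

namespace WeakModule

variable (M : WeakModule 𝒱 W)

/-- `mode` as a linear map. -/
def modeLin (n : ℤ) : V →ₗ[ℂ] Module.End ℂ W where
  toFun v := M.mode v n
  map_add' u v := M.mode_add u v n
  map_smul' c v := M.mode_smul c v n

/-- `o(v) = v_(wt v - 1)` for homogeneous `v`, extended linearly. -/
def o : V →ₗ[ℂ] Module.End ℂ W := 𝒱.extend fun k => M.modeLin (k - 1)

variable {M} in
theorem o_apply {k : ℤ} {v : V} (hv : v ∈ 𝒱.homog k) : M.o v = M.mode v (k - 1) :=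
  VertexOperatorAlgebra.extend_apply _ hv

/-- `h` is the lowest weight: `W = ⨁_{n ≥ 0} W_(h+n)` with `W_(h) ≠ 0`. -/
def IsLowestWeight (h : ℂ) : Prop :=
  M.weightSpace h ≠ ⊥ ∧ ⨆ n : ℕ, M.weightSpace (h + n) = ⊤

/-- The lowest weight subspace `W(0)`: it is `W_(h)` if `W` has a lowest weight `h` (which is then
unique), and zero otherwise. -/
def lowest : Submodule ℂ W := ⨆ (h : ℂ) (_ : M.IsLowestWeight h), M.weightSpace h

variable {M}

theorem IsLowestWeight.eq_bot {h : ℂ} (hh : M.IsLowestWeight h) {h' : ℂ}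
    (hne : ∀ n : ℕ, h' ≠ h + n) : M.weightSpace h' = ⊥ := by
  have hd := (M.L 0).eigenspaces_iSupIndep h'
  have : (⨆ (j : ℂ) (_ : j ≠ h'), (M.L 0).eigenspace j) = ⊤ := by
    refine top_le_iff.mp (hh.2 ▸ iSup_le fun n => ?_)
    exact le_iSup₂_of_le (h + n) (hne n).symm le_rfl
  rw [this] at hd
  exact disjoint_top.mp hd

theorem IsLowestWeight.mode_eq_zero {h : ℂ} (hh : M.IsLowestWeight h) {k : ℤ} {v : V}
    (hv : v ∈ 𝒱.homog k) {w : W} (hw : w ∈ M.weightSpace h) {n : ℤ} (hn : k ≤ n) :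
    M.mode v n w = 0 := by
  have := M.mode_mem hv hw n
  rw [hh.eq_bot] at this
  · simpa using this
  · intro j hj
    have e : (k : ℂ) - n - 1 = j := by linear_combination hj
    have : k - n - 1 = j := by exact_mod_cast e
    omega

theorem IsLowestWeight.o_mem {h : ℂ} (_ : M.IsLowestWeight h) (v : V) {w : W}
    (hw : w ∈ M.weightSpace h) : M.o v w ∈ M.weightSpace h := by
  induction v using VertexOperatorAlgebra.homog_induction (𝒱 := 𝒱) with
  | h k v hv =>
    rw [o_apply hv]
    have := M.mode_mem hv hw (k - 1)
    have e : h + ((k : ℂ) - ((k - 1 : ℤ) : ℂ) - 1) = h := by push_cast; ring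
    rwa [e] at this
  | h0 => simp
  | hadd u v hu hv =>
    rw [map_add]
    exact Submodule.add_mem _ hu hv

variable (M)

theorem o_mem_lowest (v : V) {w : W} (hw : w ∈ M.lowest) : M.o v w ∈ M.lowest := by
  have : M.lowest ≤ M.lowest.comap (M.o v) := iSup₂_le fun h hh x hx =>
    Submodule.mem_iSup_of_mem h (Submodule.mem_iSup_of_mem hh (hh.o_mem v hx))
  exact this hw

theorem mode_assoc (u v : V) (w : W) (l m n : ℤ) :
    ∑ᶠ i : ℕ, Ring.choose m i • M.mode (𝒱.adjoint.mode u (l + i) v) (n + (m - i)) w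
      = ∑ᶠ i : ℕ, ((-1) ^ i * Ring.choose l i : ℤ) • (M.mode u (m + l - i) (M.mode v (n + i) w)
        - (l.negOnePow : ℤ) • M.mode v (n + (l - i)) (M.mode u (m + i) w)) := by
  have h := M.jacobi u v w l m n
  unfold jacobiDefect at h
  rw [sub_eq_zero] at h
  simpa [mode, VertexOperatorAlgebra.adjoint] using h.symm

theorem o_finsum {p q n : ℤ} {u v : V} (hu : u ∈ 𝒱.homog p) (hv : v ∈ 𝒱.homog q) (c : ℕ → ℤ)
    (w : W) : M.o (∑ᶠ j : ℕ, c j • 𝒱.adjoint.mode u (n + j) v) w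
      = ∑ᶠ j : ℕ, c j • M.mode (𝒱.adjoint.mode u (n + j) v) (p + q - n - j - 1 - 1) w := by
  have := EvZero.map_finsum ((LinearMap.applyₗ w).comp M.o : V →ₗ[ℂ] W).toAddMonoidHom
    (evZero_adjoint (𝒱 := 𝒱) u v n c)
  simp only [LinearMap.toAddMonoidHom_coe, LinearMap.comp_apply, LinearMap.applyₗ_apply_apply]
    at this
  rw [this]
  refine finsum_congr fun j => ?_
  rw [map_zsmul, LinearMap.smul_apply, o_apply (mode_mem_homog hu hv _ rfl)]
  congr 3
  ring

theorem o_left (u v : V) {w : W} (hw : w ∈ M.lowest) :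
    M.o (𝒱.adjoint.left u v) w = M.o u (M.o v w) := by
  suffices M.lowest ≤ LinearMap.eqLocus (M.o (𝒱.adjoint.left u v)) (M.o u * M.o v) from this hw
  refine iSup₂_le fun h hh w hw => ?_
  rw [LinearMap.mem_eqLocus, Module.End.mul_apply]
  induction u using VertexOperatorAlgebra.homog_induction (𝒱 := 𝒱) with
  | h p u hu =>
    induction v using VertexOperatorAlgebra.homog_induction (𝒱 := 𝒱) with
    | h q v hv =>
      rw [adjoint_left hu, M.o_finsum hu hv, o_apply hu, o_apply hv]
      have h1 := M.mode_assoc u v w (-1) p (q - 1)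
      simp only [show ∀ j : ℕ, p + q - -1 - (j : ℤ) - 1 - 1 = q - 1 + (p - j) from
        fun j => by ring]
      rw [h1, finsum_eq_single _ 0]
      · rw [hh.mode_eq_zero hu hw (n := p + ((0 : ℕ) : ℤ)) (by simp)]
        simp [← sub_eq_add_neg]
      · intro i hi
        rw [hh.mode_eq_zero hu hw (by omega), hh.mode_eq_zero hv hw (by omega)]
        simp
    | h0 => simp
    | hadd v v' h h' => simp [h, h']
  | h0 => simp
  | hadd v v' h h' => simp [h, h']

theorem o_O {u : V} (hu : u ∈ 𝒱.adjoint.O) {w : W} (hw : w ∈ M.lowest) : M.o u w = 0 := by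
  suffices M.lowest ≤ LinearMap.ker (M.o u) from this hw
  refine iSup₂_le fun h hh w hw => ?_
  rw [LinearMap.mem_ker]
  suffices 𝒱.adjoint.O ≤ LinearMap.ker ((LinearMap.applyₗ w).comp M.o : V →ₗ[ℂ] W) from this hu
  refine Submodule.span_le.mpr ?_
  rintro x ⟨p, u, v, hu, rfl⟩
  change M.o _ w = 0
  induction v using VertexOperatorAlgebra.homog_induction (𝒱 := 𝒱) with
  | h q v hv =>
    rw [res_apply, M.o_finsum hu hv]
    have h1 := M.mode_assoc u v w (-2) p q
    simp only [show ∀ j : ℕ, p + q - -2 - (j : ℤ) - 1 - 1 = q + (p - j) from fun j => by ring]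
    rw [h1]
    refine (finsum_congr fun i => ?_).trans finsum_zero
    rw [hh.mode_eq_zero hu hw (by omega), hh.mode_eq_zero hv hw (by omega)]
    simp
  | h0 => simp
  | hadd v v' h h' => simp [h, h']

theorem o_one (w : W) : M.o 𝒱.one w = w := by
  rw [o_apply 𝒱.one_mem]
  simp [mode, M.vacuum]

/-- The action of `V` on the lowest weight subspace, `v ↦ o(v)`. -/
def oLowest : V →ₗ[ℂ] Module.End ℂ M.lowest where
  toFun v := (M.o v).restrict fun _ hw => M.o_mem_lowest v hw
  map_add' u v := by ext w; simp
  map_smul' c v := by ext w; simp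

/-- The action of `A(V)` on the lowest weight subspace: the class of `v` acts as `o(v)`. -/
def actLowest : 𝒱.A →ₗ[ℂ] Module.End ℂ M.lowest :=
  Submodule.liftQ 𝒱.adjoint.O M.oLowest fun _ hu =>
    LinearMap.ext fun w => Subtype.ext (M.o_O hu w.2)

theorem actLowest_toA (v : V) : M.actLowest (𝒱.toA v) = M.oLowest v := rfl

instance : Module 𝒱.A M.lowest where
  smul a x := M.actLowest a x
  one_smul x := Subtype.ext (M.o_one x)
  mul_smul a b x := by
    obtain ⟨u, rfl⟩ := 𝒱.toA_surjective a
    obtain ⟨v, rfl⟩ := 𝒱.toA_surjective b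
    exact Subtype.ext (M.o_left u v x.2)
  smul_zero a := map_zero (M.actLowest a)
  smul_add a := map_add (M.actLowest a)
  add_smul a b x := by change M.actLowest (a + b) x = _; rw [map_add]; rfl
  zero_smul x := by change M.actLowest 0 x = _; rw [map_zero]; rfl

instance : IsScalarTower ℂ 𝒱.A M.lowest :=
  ⟨fun c a x => by change M.actLowest (c • a) x = c • M.actLowest a x; rw [map_smul]; rfl⟩

instance : SMulCommClass 𝒱.A ℂ M.lowest :=
  ⟨fun a c x => map_smul (M.actLowest a) c x⟩

end WeakModule

/-- The tensor product `B ⊗_A U` of a bimodule `B` and a left module `U` over a `ℂ`-algebra `A`, as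
a left `A`-module: the quotient of `B ⊗_ℂ U` by the elements `(b a) ⊗ u - b ⊗ (a u)`. -/
abbrev BalancedTensor (A B U : Type*) [Ring A] [Algebra ℂ A] [AddCommGroup B] [Module ℂ B]
    [Module A B] [Module Aᵐᵒᵖ B] [SMulCommClass A Aᵐᵒᵖ B] [SMulCommClass ℂ A B]
    [AddCommGroup U] [Module ℂ U] [Module A U] : Type _ :=
  (B ⊗[ℂ] U) ⧸ Submodule.span A
    {x : B ⊗[ℂ] U | ∃ (b : B) (a : A) (u : U),
      x = (MulOpposite.op a • b) ⊗ₜ[ℂ] u - b ⊗ₜ[ℂ] (a • u)}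

/-! ### The functor `F` -/

/-- The defining relations of the universal enveloping algebra of the Lie algebra
`g(V) = (V ⊗ ℂ[t,t⁻¹]) / D(V ⊗ ℂ[t,t⁻¹])`, `D = L(-1) ⊗ 1 + 1 ⊗ d/dt`, with the bracket
`[u(m), v(n)] = ∑_{i ≥ 0} (m choose i) (u_i v)(m+n-i)`, where `v(n) = v ⊗ t^n`. -/
inductive EnvRel (𝒱 : VertexOperatorAlgebra V) :
    TensorAlgebra ℂ (V ⊗[ℂ] ℂ[T;T⁻¹]) → TensorAlgebra ℂ (V ⊗[ℂ] ℂ[T;T⁻¹]) → Prop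
  | deriv (v : V) (m : ℤ) : EnvRel 𝒱
      (TensorAlgebra.ι ℂ ((𝒱.adjoint.L (-1) v) ⊗ₜ[ℂ] LaurentPolynomial.T m
        + (m : ℂ) • (v ⊗ₜ[ℂ] LaurentPolynomial.T (m - 1)))) 0
  | bracket (u v : V) (m n : ℤ) : EnvRel 𝒱
      (TensorAlgebra.ι ℂ (u ⊗ₜ[ℂ] LaurentPolynomial.T m) *
          TensorAlgebra.ι ℂ (v ⊗ₜ[ℂ] LaurentPolynomial.T n)
        - TensorAlgebra.ι ℂ (v ⊗ₜ[ℂ] LaurentPolynomial.T n) *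
          TensorAlgebra.ι ℂ (u ⊗ₜ[ℂ] LaurentPolynomial.T m))
      (TensorAlgebra.ι ℂ (∑ᶠ i : ℕ, Ring.choose m i •
        ((𝒱.adjoint.mode u i v) ⊗ₜ[ℂ] LaurentPolynomial.T (m + n - i))))

/-- The universal enveloping algebra `U(g(V))`. -/
def Env (𝒱 : VertexOperatorAlgebra V) : Type u := RingQuot (EnvRel 𝒱)

instance : Ring (Env 𝒱) := inferInstanceAs (Ring (RingQuot (EnvRel 𝒱)))

instance : Algebra ℂ (Env 𝒱) := inferInstanceAs (Algebra ℂ (RingQuot (EnvRel 𝒱)))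

/-- The element `v(n)` of `U(g(V))`. -/
def Env.gen (𝒱 : VertexOperatorAlgebra V) (v : V) (n : ℤ) : Env 𝒱 :=
  RingQuot.mkAlgHom ℂ (EnvRel 𝒱) (TensorAlgebra.ι ℂ (v ⊗ₜ[ℂ] LaurentPolynomial.T n))

section F

variable {U : Type u} [AddCommGroup U] [Module ℂ U]

/-- The induced module `U(g(V)) ⊗_{U(g(V)₋ + g(V)₀)} U`.  Here `ρ v` is the action on the
`A(V)`-module `U` of the class of `v` in `A(V)`; the element `v(k-1)` of `g(V)₀`, `v` homogeneous
of weight `k`, acts on `U` by `ρ v`, and the elements `v(m)`, `m ≥ k`, of `g(V)₋` act by zero. -/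
abbrev FInduced (ρ : V →ₗ[ℂ] Module.End ℂ U) (𝒱 : VertexOperatorAlgebra V) : Type u :=
  (Env 𝒱 ⊗[ℂ] U) ⧸ Submodule.span (Env 𝒱)
    {x : Env 𝒱 ⊗[ℂ] U | ∃ (k : ℤ) (v : V) (a : U), v ∈ 𝒱.homog k ∧
      ((∃ m ≥ k, x = Env.gen 𝒱 v m ⊗ₜ[ℂ] a) ∨
        x = Env.gen 𝒱 v (k - 1) ⊗ₜ[ℂ] a - (1 : Env 𝒱) ⊗ₜ[ℂ] (ρ v a))}

/-- `F(U)`: the quotient of the induced module by the Jacobi identity. -/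
abbrev FModule (ρ : V →ₗ[ℂ] Module.End ℂ U) (𝒱 : VertexOperatorAlgebra V) : Type u :=
  FInduced ρ 𝒱 ⧸ Submodule.span (Env 𝒱)
    {x : FInduced ρ 𝒱 | ∃ (u v : V) (w : FInduced ρ 𝒱) (l m n : ℤ),
      x = jacobiDefect (fun v n => 𝒱.adjoint.mode v n) (fun v n w => Env.gen 𝒱 v n • w)
        (fun v n w => Env.gen 𝒱 v n • w) (fun v n w => Env.gen 𝒱 v n • w) u v w l m n}

/-- The natural map `e_U : U → F(U)`. -/
def FModule.e (ρ : V →ₗ[ℂ] Module.End ℂ U) (𝒱 : VertexOperatorAlgebra V) (a : U) : FModule ρ 𝒱 :=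
  Submodule.Quotient.mk (Submodule.Quotient.mk ((1 : Env 𝒱) ⊗ₜ[ℂ] a))

/-- The operator `v_n` on `F(U)`. -/
def FModule.mode (ρ : V →ₗ[ℂ] Module.End ℂ U) (𝒱 : VertexOperatorAlgebra V) (v : V) (n : ℤ)
    (x : FModule ρ 𝒱) : FModule ρ 𝒱 := Env.gen 𝒱 v n • x

end F

/-! ### Classes of modules -/

/-- A subspace of a space on which the `v_n` act is a (weak) submodule if it is stable under all
`v_n`. -/
def IsModeStable {X : Type*} [AddCommGroup X] [Module ℂ X] (y : V → ℤ → X → X)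
    (N : Submodule ℂ X) : Prop := ∀ (v : V) (n : ℤ), ∀ x ∈ N, y v n x ∈ N

/-- Irreducibility of a space on which the `v_n` act. -/
def IsModeIrreducible {X : Type*} [AddCommGroup X] [Module ℂ X] (y : V → ℤ → X → X) : Prop :=
  Nontrivial X ∧ ∀ N : Submodule ℂ X, IsModeStable y N → N = ⊥ ∨ N = ⊤

namespace WeakModule

variable (M : WeakModule 𝒱 W)

/-- A subspace is a (weak) submodule. -/
def IsSubmodule (N : Submodule ℂ W) : Prop := IsModeStable (fun v n w => M.mode v n w) N

/-- Irreducible weak modules. -/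
def IsIrreducible : Prop := IsModeIrreducible (fun v n (w : W) => M.mode v n w)

/-- A generalized module: `L(0)` acts semisimply. -/
def IsGeneralized : Prop := ⨆ h : ℂ, M.weightSpace h = ⊤

/-- A `V`-module: a generalized module whose homogeneous subspaces satisfy the two grading
restrictions. -/
structure IsOrdinary : Prop where
  generalized : M.IsGeneralized
  finite : ∀ h : ℂ, FiniteDimensional ℂ (M.weightSpace h)
  lower : ∀ h : ℂ, ∃ N : ℕ, ∀ n ≥ N, M.weightSpace (h - n) = ⊥

/-- A lowest weight generalized module: `W = ⨁_{n ≥ 0} W_(h+n)` for some `h`, and `W_(h)` generates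
`W`. -/
def IsLowestWeightModule : Prop :=
  ∃ h : ℂ, ⨆ n : ℕ, M.weightSpace (h + n) = ⊤ ∧
    ∀ N : Submodule ℂ W, M.IsSubmodule N → M.weightSpace h ≤ N → N = ⊤

/-- Complete reducibility: `W` is a direct sum of irreducible submodules. -/
def IsCompletelyReducible : Prop :=
  ∃ S : Set (Submodule ℂ W),
    (∀ N ∈ S, M.IsSubmodule N ∧ N ≠ ⊥ ∧ ∀ N' ≤ N, M.IsSubmodule N' → N' = ⊥ ∨ N' = N) ∧
      sSupIndep S ∧ sSup S = ⊤

end WeakModule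

/-! ### Contragredient modules -/

namespace VertexOperatorAlgebra

theorem evZero_L_one_pow (v : V) : EvZero fun j : ℕ => ((𝒱.adjoint.L 1) ^ j) v := by
  induction v using homog_induction (𝒱 := 𝒱) with
  | h k v hv =>
    obtain ⟨N, hN⟩ := 𝒱.lower_grading
    have h2 : 𝒱.ω ∈ 𝒱.homog 2 := WeakModule.omega_mem
    have : ∀ j : ℕ, ((𝒱.adjoint.L 1) ^ j) v ∈ 𝒱.homog (k - j) := by
      intro j
      induction j with
      | zero => simpa using hv
      | succ j ih =>
        rw [pow_succ']
        exact WeakModule.mode_mem_homog h2 ih _ (by push_cast; ring)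
    refine ⟨(k - N + 1).toNat, fun j hj => ?_⟩
    have h3 := this j
    have h4 : 𝒱.homog (k - j) = ⊥ := hN _ (by omega)
    rw [h4] at h3
    simpa using h3
  | h0 => exact ⟨0, by simp⟩
  | hadd u v hu hv => simpa using hu.add hv

variable (𝒱)

/-- `θ(v) = e^{L(1)} (-1)^{L(0)} v`. -/
def θ : V →ₗ[ℂ] V := 𝒱.extend fun k =>
  { toFun := fun v => ∑ᶠ j : ℕ, ((-1 : ℂ) ^ k * (j.factorial : ℂ)⁻¹) • ((𝒱.adjoint.L 1) ^ j) v
    map_add' := fun u v => by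
      have h (v : V) : EvZero fun j : ℕ =>
          ((-1 : ℂ) ^ k * (j.factorial : ℂ)⁻¹) • ((𝒱.adjoint.L 1) ^ j) v := by
        obtain ⟨N, hN⟩ := evZero_L_one_pow (𝒱 := 𝒱) v
        exact ⟨N, fun i hi => by
          have := hN i hi
          simp only at this ⊢
          rw [this, smul_zero]⟩
      rw [← EvZero.finsum_add (h u) (h v)]
      simp
    map_smul' := fun c v => by
      rw [RingHom.id_apply, smul_finsum]
      exact finsum_congr fun j => by rw [map_smul, smul_comm] }

end VertexOperatorAlgebra

namespace WeakModule

variable (M : WeakModule 𝒱 W)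

theorem evZero_opp (k m : ℤ) (v : V) (w : W) : EvZero fun j : ℕ =>
    ((-1 : ℂ) ^ k * (j.factorial : ℂ)⁻¹) •
      M.mode (((𝒱.adjoint.L 1) ^ j) v) (2 * k - j - m - 2) w := by
  obtain ⟨N, hN⟩ := VertexOperatorAlgebra.evZero_L_one_pow (𝒱 := 𝒱) v
  exact ⟨N, fun i hi => by
    have := hN i hi
    simp only at this ⊢
    rw [this]
    simp⟩

/-- The coefficient of `x^(-m-1)` in `Y°(v,x) = Y(e^{xL(1)} (-x⁻²)^{L(0)} v, x⁻¹)`: for `v` of weight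
`k` it is `(-1)^k ∑_j (1/j!) (L(1)^j v)_(2k-j-m-2)`. -/
def oppMode (m : ℤ) : V →ₗ[ℂ] Module.End ℂ W := 𝒱.extend fun k =>
  LinearMap.mk₂ ℂ (fun v w => ∑ᶠ j : ℕ, ((-1 : ℂ) ^ k * (j.factorial : ℂ)⁻¹) •
      M.mode (((𝒱.adjoint.L 1) ^ j) v) (2 * k - j - m - 2) w)
    (fun u v w => by
      rw [← EvZero.finsum_add (M.evZero_opp k m u w) (M.evZero_opp k m v w)]
      simp)
    (fun c v w => by
      rw [smul_finsum]
      exact finsum_congr fun j => by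
        rw [map_smul, mode_smul, LinearMap.smul_apply, smul_comm])
    (fun v w w' => by
      rw [← EvZero.finsum_add (M.evZero_opp k m v w) (M.evZero_opp k m v w')]
      simp)
    (fun c v w => by
      rw [smul_finsum]
      exact finsum_congr fun j => by rw [map_smul, smul_comm])

/-- The underlying space `W' = ⨁_h W_(h)^*` of the contragredient module, inside `W^*`. -/
def gradedDual : Submodule ℂ (Module.Dual ℂ W) :=
  ⨆ h : ℂ, (⨆ (h' : ℂ) (_ : h' ≠ h), M.weightSpace h').dualAnnihilator

/-- The action of `V` on the dual of the lowest weight subspace through the `A(V)`-module structure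
`(a f)(w) = f(θ(a) w)`. -/
def oLowestDual : V →ₗ[ℂ] Module.End ℂ (Module.Dual ℂ M.lowest) :=
  Module.Dual.transpose ∘ₗ M.oLowest ∘ₗ 𝒱.θ

/-- `W = F(W(0))`: the identity of `W(0)` extends to an isomorphism `F(W(0)) → W`. -/
def EqF : Prop :=
  ∃ e : FModule M.oLowest 𝒱 ≃ₗ[ℂ] W,
    (∀ v n x, e (FModule.mode M.oLowest 𝒱 v n x) = M.mode v n (e x)) ∧
      ∀ w : M.lowest, e (FModule.e M.oLowest 𝒱 w) = w

/-- `W' = F(W(0)^*)`: the identity of `W(0)^*` extends to an isomorphism from `F(W(0)^*)` to the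
contragredient module `W'`, on which `⟨v_n f, w⟩ = ⟨f, v°_n w⟩` with `v°_n` the coefficients
of `Y°(v,x)`. -/
def DualEqF : Prop :=
  ∃ e : FModule M.oLowestDual 𝒱 →ₗ[ℂ] Module.Dual ℂ W,
    Function.Injective e ∧ LinearMap.range e = M.gradedDual ∧
      (∀ v n x w, e (FModule.mode M.oLowestDual 𝒱 v n x) w = e x (M.oppMode n v w)) ∧
      ∀ (f : Module.Dual ℂ M.lowest) (w : M.lowest), e (FModule.e M.oLowestDual 𝒱 f) w = f w

end WeakModule

/-! ### Intertwining operators -/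

section Intertwining

variable {W₁ W₂ : Type u} [AddCommGroup W₁] [Module ℂ W₁] [AddCommGroup W₂] [Module ℂ W₂]

theorem jacobiDefect_evZero (M : WeakModule 𝒱 W) (M₁ : WeakModule 𝒱 W₁) (M₂ : WeakModule 𝒱 W₂)
    {𝒴 : W →ₗ[ℂ] ℂ → (W₁ →ₗ[ℂ] W₂)}
    (h : ∀ (w : W) (w₁ : W₁), ∃ K : ℝ, ∀ n : ℂ, K ≤ n.re → 𝒴 w n w₁ = 0)
    (v : V) (w : W) (w₁ : W₁) (l m : ℤ) (n : ℂ) :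
    (EvZero fun i : ℕ => M₂.mode v (m + l - i) (𝒴 w (n + ((i : ℤ) : ℂ)) w₁)
        - (l.negOnePow : ℤ) • 𝒴 w (n + ((l - i : ℤ) : ℂ)) (M₁.mode v (m + i) w₁)) ∧
      EvZero fun i : ℕ => 𝒴 (M.mode v (l + i) w) (n + ((m - i : ℤ) : ℂ)) w₁ := by
  constructor
  · refine EvZero.sub ?_ (EvZero.zsmul ?_ _)
    · obtain ⟨K, hK⟩ := h w w₁
      obtain ⟨N, hN⟩ := exists_nat_ge (K - n.re)
      refine ⟨N, fun i hi => ?_⟩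
      have hi' : (N : ℝ) ≤ i := by exact_mod_cast hi
      simp only
      rw [hK _ (by
        simp only [Int.cast_natCast, Complex.add_re, Complex.natCast_re]
        linarith), map_zero]
    · obtain ⟨N, hN⟩ := M₁.evZero_mode v w₁ m
      exact ⟨N, fun i hi => by
        have := hN i hi
        simp only at this ⊢
        rw [this, map_zero]⟩
  · obtain ⟨N, hN⟩ := M.evZero_mode v w l
    exact ⟨N, fun i hi => by
      have := hN i hi
      simp only at this ⊢
      rw [this]
      simp⟩

/-- The space of intertwining operators of type `(W₂ over W W₁)`: linear maps
`w ↦ 𝒴(w,x) = ∑_{n ∈ ℂ} w_n x^(-n-1)` from `W` to `Hom(W₁,W₂){x}`, with the truncation condition,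
the Jacobi identity and the `L(-1)`-derivative property. -/
def intertwiningOperators (M : WeakModule 𝒱 W) (M₁ : WeakModule 𝒱 W₁)
    (M₂ : WeakModule 𝒱 W₂) : Submodule ℂ (W →ₗ[ℂ] ℂ → (W₁ →ₗ[ℂ] W₂)) where
  carrier := {𝒴 |
    (∀ (w : W) (w₁ : W₁), ∃ K : ℝ, ∀ n : ℂ, K ≤ n.re → 𝒴 w n w₁ = 0) ∧
    (∀ (v : V) (w : W) (w₁ : W₁) (l m : ℤ) (n : ℂ),
      jacobiDefect (fun v n w => M.mode v n w) (fun v n w => M₁.mode v n w)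
        (fun v n w => M₂.mode v n w) (fun w n w₁ => 𝒴 w n w₁) v w w₁ l m n = 0) ∧
    (∀ (w : W) (n : ℂ), 𝒴 (M.L (-1) w) n = -n • 𝒴 w (n - 1))}
  zero_mem' := by
    refine ⟨fun w w₁ => ⟨0, fun n _ => by simp⟩, fun v w w₁ l m n => ?_, fun w n => by simp⟩
    simp [jacobiDefect]
  add_mem' := by
    rintro 𝒴 𝒴' ⟨h₁, h₂, h₃⟩ ⟨h₁', h₂', h₃'⟩
    refine ⟨fun w w₁ => ?_, fun v w w₁ l m n => ?_, fun w n => ?_⟩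
    · obtain ⟨K, hK⟩ := h₁ w w₁
      obtain ⟨K', hK'⟩ := h₁' w w₁
      exact ⟨max K K', fun n hn => by
        simp [hK n ((le_max_left _ _).trans hn), hK' n ((le_max_right _ _).trans hn)]⟩
    · have a := jacobiDefect_evZero M M₁ M₂ h₁ v w w₁ l m n
      have b := jacobiDefect_evZero M M₁ M₂ h₁' v w w₁ l m n
      have e := congrArg₂ (· + ·) (h₂ v w w₁ l m n) (h₂' v w w₁ l m n)
      unfold jacobiDefect at e ⊢
      simp only at e
      rw [sub_add_sub_comm, ← EvZero.finsum_add (a.1.zsmul _) (b.1.zsmul _),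
        ← EvZero.finsum_add (a.2.zsmul _) (b.2.zsmul _), add_zero] at e
      rw [← e]
      simp only [LinearMap.add_apply, Pi.add_apply, map_add, smul_add, add_sub_add_comm]
    · simp [h₃, h₃']
  smul_mem' := by
    rintro c 𝒴 ⟨h₁, h₂, h₃⟩
    refine ⟨fun w w₁ => ?_, fun v w w₁ l m n => ?_, fun w n => ?_⟩
    · obtain ⟨K, hK⟩ := h₁ w w₁
      exact ⟨K, fun n hn => by simp [hK n hn]⟩
    · have e := congrArg (c • ·) (h₂ v w w₁ l m n)
      unfold jacobiDefect at e ⊢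
      simp only at e
      rw [smul_sub, smul_finsum, smul_finsum, smul_zero] at e
      rw [← e]
      congr 1
      · refine finsum_congr fun i => ?_
        simp only [LinearMap.smul_apply, Pi.smul_apply, map_smul, smul_sub]
        rw [smul_comm c]
        congr 1
        rw [smul_comm c, smul_comm c]
      · refine finsum_congr fun i => ?_
        rw [smul_comm c]
        simp
    · simp [h₃, smul_comm c]

end Intertwining

end

/-!
# Fusion rules and Zhu's bimodules

An intertwining operator `𝒴` of type `(W₂; W W₁)` has a lowest component, the trilinear map
`w, u ↦` the part in `W₂(0)` of `𝒴(w,1)u` with `u ∈ W₁(0)`. Three instances of the Jacobi identity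
say that it factors through `A(W) ⊗_{A(V)} W₁(0)` and is `A(V)`-linear
(`lowestComponent_mem_bimoduleForms`), and since `W₁` and `W₂` are irreducible, it determines `𝒴`
(`eq_zero_of_lowestComponent`). The fusion rule formula says that every `A(V)`-homomorphism arises
in this way when `W₁ = F(W₁(0))` and `W₂' = F(W₂(0)^*)`. The operator is rebuilt from its values at
`x = 1` in two steps, one for each of these hypotheses. Both use the universal property of `F(U)`
(`FModule.exists_lift`): a map from `U` to a representation of `g(V)` extends to `F(U)` if it is
annihilated by `g(V)_-`, is compatible with `g(V)_0`, and has values in a stable subspace on which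
the Jacobi identity holds.

*Extension in `W₁`.* Let `α : W → W₂(0)` stand for `w ↦ 𝒴(w,1)u`. The correlation function of `v`
would be a rational function of `x` with poles at `0`, `1` and infinity, whose expansion at `x = 1` is
`α(Y(v,x-1)w)`; if it is regular enough at infinity, its residues at `x = 0`, that is, the values of
`𝒴(w,1) v_n u`, are determined by the residues at `x = 1`. This is taken as a definition: the
residues define operators `v_n` on the space `meroHom` of those `α` for which the pole at `x = 0` has
bounded order. The residue theorem is `residueMode_binomial`, and the commutator formula
`residueEnd_bracket` reduces by it to the commutator formula in `W`. A form that vanishes on `O(W)` is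
annihilated by the weight-lowering modes, its weight-preserving modes are given by the right action
of `A(V)`, and it satisfies the Jacobi identity (`jacobiAt_lowest`). So a bimodule form extends to a
map `W ⊗ W₁ → W₂(0)` (`EqF.exists_form`).

*Extension in `W₂`.* On `W ⊗ W₁` there is an action of `g(V)`, `tensorRep`, for which
`w ⊗ w₁ ↦ 𝒴(w,1)w₁` is equivariant. It is not truncated, but the matrix coefficients just obtained
satisfy the Jacobi identity (`mem_tensorForms_of_lowest`), a property that is stable under the action
(`borcherds_comp_y`) and passes to the contragredient action on the dual space (`opp_jacobi`).
Therefore the map from `W₂(0)^*` to `(W ⊗ W₁)^*` extends to `F(W₂(0)^*) = W₂'`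
(`exists_dual_lift`), and dually all homogeneous components of `𝒴(w,1)w₁` are found
(`DualEqF.exists_components`). The grading then gives back the dependence on `x`
(`exists_intertwiningOperator`).

In all of this the Jacobi identity is checked in the same way: the commutator formula is the case
`l = 0`, it makes the case `l = -1` depend on `m + n` only (`borcherds_neg_one_shift`), so that few
instances remain, and the case `l = -1` implies all others (`borcherds_of_neg_one`).

The statements on irreducibility compare `F(W₁(0))` and `F(W₂(0)^*)` with `W₁` and `W₂'` by the
natural maps, whose images are irreducible; for `W₂'` this is `IsIrreducible.gradedDual`. If lowest
weight generalized modules are completely reducible, then these maps are injective, because they are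
injective on the lowest weight spaces (`IsCompletelyReducible.injective`).
-/

noncomputable section

open scoped TensorProduct LaurentPolynomial


/-! ### Finite sums and binomial coefficients -/

/-- `∑_i (-1)^i (m choose i) (B-i choose t-i) = (B-m choose t)`. -/
theorem sum_neg_one_pow_choose_mul_choose (m B : ℤ) (t : ℕ) :
    ∑ ij ∈ Finset.HasAntidiagonal.antidiagonal t, ((-1) ^ ij.1 * Ring.choose m ij.1) * Ring.choose (B - ij.1) ij.2
      = Ring.choose (B - m) t := by
  have h1 : ∀ ij ∈ Finset.HasAntidiagonal.antidiagonal t, ((-1) ^ ij.1 * Ring.choose m ij.1)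
      * Ring.choose (B - ij.1) ij.2
      = (-1) ^ t * (Ring.choose m ij.1 * Ring.choose ((t : ℤ) - B - 1) ij.2) := by
    intro ij hij
    rw [Finset.HasAntidiagonal.mem_antidiagonal] at hij
    have := Ring.choose_neg ((ij.1 : ℤ) - B) ij.2
    rw [neg_sub, Units.smul_def, Int.coe_negOnePow_natCast, smul_eq_mul] at this
    rw [this, ← hij, pow_add]
    have e : (ij.1 : ℤ) - B + ij.2 - 1 = ((ij.1 + ij.2 : ℕ) : ℤ) - B - 1 := by push_cast; ring
    rw [e]
    ring
  rw [Finset.sum_congr rfl h1, ← Finset.mul_sum, ← Ring.add_choose_eq t (Commute.all _ _)]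
  have := Ring.choose_neg (m - B) t
  rw [neg_sub, Units.smul_def, Int.coe_negOnePow_natCast, smul_eq_mul] at this
  rw [this]
  congr 2
  ring

theorem choose_mul_natCast_choose (s : ℤ) (e i : ℕ) :
    Ring.choose s (i + e) * Ring.choose ((i + e : ℕ) : ℤ) i
      = Ring.choose s i * Ring.choose (s - i) e := by
  have h := Ring.choose_smul_choose s (n := i + e) (k := i) (by omega)
  rw [Nat.add_sub_cancel_left] at h
  rw [← h, Ring.choose_natCast, nsmul_eq_mul, mul_comm]

theorem succ_mul_choose_succ (a : ℤ) (i : ℕ) :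
    ((i + 1 : ℕ) : ℤ) * Ring.choose a (i + 1) = a * Ring.choose (a - 1) i := by
  have := Ring.choose_smul_choose a (n := i + 1) (k := 1) (by omega)
  simpa [Ring.choose_one_right] using this

theorem sub_mul_choose (a : ℤ) (i : ℕ) :
    (a - i) * Ring.choose a i = a * Ring.choose (a - 1) i := by
  have h := succ_mul_choose_succ (a := a) i
  have h2 := Ring.choose_smul_choose a (n := i + 1) (k := i) (by omega)
  simp only [Nat.choose_succ_self_right, nsmul_eq_mul, add_tsub_cancel_left,
    Ring.choose_one_right] at h2
  rw [← h, h2]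
  ring

namespace EvZero

variable {X : Type*} [AddCommGroup X]

theorem congr {f g : ℕ → X} (hf : EvZero f) (h : ∀ i, g i = f i) : EvZero g := by
  rwa [show g = f from funext h]

theorem smul_finsum {f : ℕ → X} (hf : EvZero f) (c : ℤ) : c • ∑ᶠ i, f i = ∑ᶠ i, c • f i :=
  map_finsum (zsmulAddGroupHom c) hf

/-- The iterated sum of a doubly indexed family that vanishes for large total index is a finite sum. -/
theorem double_eq_sum {F : ℕ → ℕ → X} {N : ℕ} (hF : ∀ i j, N ≤ i + j → F i j = 0) :
    ∑ᶠ i, ∑ᶠ j, F i j = ∑ i ∈ Finset.range N, ∑ j ∈ Finset.range N, F i j := by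
  have h1 : ∀ i, ∑ᶠ j, F i j = ∑ j ∈ Finset.range N, F i j := fun i =>
    finsum_eq fun j hj => hF i j (by omega)
  simp only [h1]
  exact finsum_eq fun i hi => Finset.sum_eq_zero fun j _ => hF i j (by omega)

theorem finsum_antidiagonal {F : ℕ → ℕ → X} (hF : ∃ N, ∀ i j, N ≤ i + j → F i j = 0) :
    ∑ᶠ i, ∑ᶠ j, F i j = ∑ᶠ t, ∑ ij ∈ Finset.HasAntidiagonal.antidiagonal t, F ij.1 ij.2 := by
  obtain ⟨N, hN⟩ := hF
  rw [double_eq_sum hN, finsum_eq (N := N) fun t ht => Finset.sum_eq_zero fun ij hij =>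
    hN _ _ (by rw [Finset.HasAntidiagonal.mem_antidiagonal] at hij; omega), ← Finset.sum_product',
    ← Finset.sum_filter_of_ne (p := fun ij : ℕ × ℕ => ij.1 + ij.2 < N)]
  · rw [← Finset.sum_fiberwise_of_maps_to (t := Finset.range N) (g := fun ij => ij.1 + ij.2)]
    · refine Finset.sum_congr rfl fun t ht => Finset.sum_congr ?_ fun _ _ => rfl
      ext ij
      simp only [Finset.mem_filter, Finset.mem_product, Finset.mem_range,
        Finset.HasAntidiagonal.mem_antidiagonal] at ht ⊢
      omega
    · intro ij hij
      simp only [Finset.mem_filter] at hij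
      simpa using hij.2
  · intro ij _ h
    by_contra h'
    exact h (hN _ _ (by omega))

/-- Collecting the terms of a double sum whose entries depend only on the total index. -/
theorem finsum_smul_antidiagonal {D : ℕ → X} (hD : EvZero D) (c : ℕ → ℕ → ℤ) :
    ∑ᶠ i, ∑ᶠ j, c i j • D (i + j)
      = ∑ᶠ t, (∑ ij ∈ Finset.HasAntidiagonal.antidiagonal t, c ij.1 ij.2) • D t := by
  obtain ⟨N, hN⟩ := hD
  rw [finsum_antidiagonal (F := fun i j => c i j • D (i + j))
    ⟨N, fun i j h => by simp [hN _ h]⟩]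
  refine finsum_congr fun t => ?_
  rw [Finset.sum_smul]
  exact Finset.sum_congr rfl fun ij hij => by rw [Finset.HasAntidiagonal.mem_antidiagonal.mp hij]

/-- Convolution with binomial coefficients is additive in the exponents. -/
theorem finsum_choose_choose {D : ℕ → X} (hD : EvZero D) (a b : ℤ) :
    ∑ᶠ i, Ring.choose a i • ∑ᶠ j, Ring.choose b j • D (i + j)
      = ∑ᶠ t, Ring.choose (a + b) t • D t := by
  have h : ∀ i, Ring.choose a i • ∑ᶠ j, Ring.choose b j • D (i + j)
      = ∑ᶠ j, (Ring.choose a i * Ring.choose b j) • D (i + j) := fun i => by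
    rw [smul_finsum (((hD.shift i).congr fun j => by rw [add_comm]).zsmul _)]
    exact finsum_congr fun j => by rw [mul_smul]
  simp only [h]
  rw [finsum_smul_antidiagonal hD fun i j => Ring.choose a i * Ring.choose b j]
  exact finsum_congr fun t => by rw [Ring.add_choose_eq t (Commute.all _ _)]

theorem zero' : EvZero (fun _ : ℕ => (0 : X)) := ⟨0, fun _ _ => rfl⟩

theorem comp_zero {Y : Type*} [AddCommGroup Y] {f : ℕ → X} (hf : EvZero f) (φ : X → Y)
    (h0 : φ 0 = 0) : EvZero fun i => φ (f i) := by
  obtain ⟨N, hN⟩ := hf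
  exact ⟨N, fun i hi => by simp only [hN i hi, h0]⟩

end EvZero

/-! ### The Jacobi identity as an identity of double sequences -/

section Borcherds

variable {Γ T : Type*} [AddCommGroupWithOne Γ] [AddCommGroup T]

/-- The contribution of `(x₁ - x₂)^l` expanded in nonnegative powers of `x₂`. -/
def borcherdsFst (P : ℤ → Γ → T) (l m : ℤ) (n : Γ) : T :=
  ∑ᶠ i : ℕ, ((-1) ^ i * Ring.choose l i : ℤ) • P (m + l - i) (n + ((i : ℤ) : Γ))

/-- The contribution of `(x₁ - x₂)^l` expanded in nonnegative powers of `x₁`, without the sign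
`(-1)^l`. -/
def borcherdsSnd (Q : ℤ → Γ → T) (l m : ℤ) (n : Γ) : T :=
  ∑ᶠ i : ℕ, ((-1) ^ i * Ring.choose l i : ℤ) • Q (m + i) (n + ((l - i : ℤ) : Γ))

/-- The contribution of the iterate. -/
def borcherdsIter (g : ℤ → Γ → T) (l m : ℤ) (n : Γ) : T :=
  ∑ᶠ i : ℕ, Ring.choose m i • g (l + i) (n + ((m - i : ℤ) : Γ))

/-- The difference of the two sides of the component form of the Jacobi identity, for abstract double
sequences: `P j k` stands for a matrix coefficient of `u_j w_k`, `Q j k` for the one of `w_k u_j`,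
and `g j k` for the one of `(u_j w)_k`. -/
def borcherds (P Q g : ℤ → Γ → T) (l m : ℤ) (n : Γ) : T :=
  borcherdsFst P l m n - (l.negOnePow : ℤ) • borcherdsSnd Q l m n - borcherdsIter g l m n

/-- The first sum of the Jacobi identity is finite. -/
def FinFst (P : ℤ → Γ → T) : Prop := ∀ m n, EvZero fun i : ℕ => P (m - i) (n + ((i : ℤ) : Γ))

/-- The second sum of the Jacobi identity is finite. -/
def FinSnd (Q : ℤ → Γ → T) : Prop := ∀ m n, EvZero fun i : ℕ => Q (m + i) (n + ((-i : ℤ) : Γ))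

/-- The third sum of the Jacobi identity is finite. -/
def FinIter (g : ℤ → Γ → T) : Prop := ∃ K : ℤ, ∀ k ≥ K, ∀ n, g k n = 0

theorem FinFst.evZero {P : ℤ → Γ → T} (h : FinFst P) (a : ℤ) (n : Γ) (b : ℤ) :
    EvZero fun i : ℕ => P (a - i) (n + ((b + i : ℤ) : Γ)) := by
  refine (h a (n + (b : Γ))).congr fun i => ?_
  push_cast; rw [add_assoc]

theorem FinSnd.evZero {Q : ℤ → Γ → T} (h : FinSnd Q) (a : ℤ) (n : Γ) (b : ℤ) :
    EvZero fun i : ℕ => Q (a + i) (n + ((b - i : ℤ) : Γ)) := by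
  refine (h a (n + (b : Γ))).congr fun i => ?_
  push_cast; rw [add_assoc, sub_eq_add_neg]

theorem FinIter.evZero {Δ : Type*} {g : ℤ → Δ → T} (h : FinIter g) (a : ℤ) (n : ℕ → Δ) :
    EvZero fun i : ℕ => g (a + i) (n i) := by
  obtain ⟨K, hK⟩ := h
  exact ⟨(K - a).toNat, fun i hi => hK _ (by omega) _⟩

theorem borcherdsFst_succ {P : ℤ → Γ → T} (hP : FinFst P) (l m : ℤ) (n : Γ) :
    borcherdsFst P (l + 1) m n = borcherdsFst P l (m + 1) n - borcherdsFst P l m (n + 1) := by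
  unfold borcherdsFst
  have h := hP.evZero (m + l + 1) n 0
  have h' : EvZero fun i : ℕ => P (m + l - i) (n + ((i + 1 : ℤ) : Γ)) := by
    exact (hP.evZero (m + l) n 1).congr fun i => by rw [add_comm (1 : ℤ)]
  have e1 : ∀ i : ℕ, P (m + (l + 1) - i) (n + ((i : ℤ) : Γ))
      = P (m + l + 1 - i) (n + ((0 + i : ℤ) : Γ)) := fun i => by
    rw [zero_add, add_assoc m]
  have e2 : ∀ i : ℕ, P (m + 1 + l - i) (n + ((i : ℤ) : Γ))
      = P (m + l + 1 - i) (n + ((0 + i : ℤ) : Γ)) := fun i => by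
    rw [zero_add, add_right_comm]
  have e3 : ∀ i : ℕ, P (m + l - i) (n + 1 + ((i : ℤ) : Γ))
      = P (m + l - i) (n + ((i + 1 : ℤ) : Γ)) := fun i => by
    push_cast; rw [add_assoc n, add_comm (1 : Γ)]
  simp only [e1, e2, e3]
  rw [EvZero.finsum_succ (h.zsmul _), EvZero.finsum_succ (h.zsmul _)]
  have e4 : ∀ i : ℕ, P (m + l + 1 - (i + 1 : ℕ)) (n + ((0 + (i + 1 : ℕ) : ℤ) : Γ))
      = P (m + l - i) (n + ((i + 1 : ℤ) : Γ)) := fun i =>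
    congrArg₂ P (by push_cast; ring) (by push_cast; abel)
  simp only [e4, Ring.choose_succ_succ, Ring.choose_zero_right]
  rw [show ∀ a b c : T, a + b - c = a + (b - c) from add_sub_assoc, ← EvZero.finsum_sub (h'.zsmul _) (h'.zsmul _)]
  congr 1
  refine finsum_congr fun i => ?_
  rw [← sub_smul]
  congr 1
  ring

theorem borcherdsSnd_succ {Q : ℤ → Γ → T} (hQ : FinSnd Q) (l m : ℤ) (n : Γ) :
    borcherdsSnd Q (l + 1) m n = borcherdsSnd Q l m (n + 1) - borcherdsSnd Q l (m + 1) n := by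
  unfold borcherdsSnd
  have h := hQ.evZero m n (l + 1)
  have h' : EvZero fun i : ℕ => Q (m + 1 + i) (n + ((l - i : ℤ) : Γ)) := hQ.evZero (m + 1) n l
  have e1 : ∀ i : ℕ, Q (m + i) (n + 1 + ((l - i : ℤ) : Γ))
      = Q (m + i) (n + ((l + 1 - i : ℤ) : Γ)) := fun i => by
    congr 1; push_cast; abel
  simp only [e1]
  rw [EvZero.finsum_succ (h.zsmul _), EvZero.finsum_succ (h.zsmul _)]
  have e4 : ∀ i : ℕ, Q (m + (i + 1 : ℕ)) (n + ((l + 1 - (i + 1 : ℕ) : ℤ) : Γ))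
      = Q (m + 1 + i) (n + ((l - i : ℤ) : Γ)) := fun i =>
    congrArg₂ Q (by push_cast; ring) (by push_cast; abel)
  simp only [e4, Ring.choose_succ_succ, Ring.choose_zero_right]
  rw [show ∀ a b c : T, a + b - c = a + (b - c) from add_sub_assoc, ← EvZero.finsum_sub (h'.zsmul _) (h'.zsmul _)]
  congr 1
  refine finsum_congr fun i => ?_
  rw [← sub_smul]
  congr 1
  ring

theorem borcherdsIter_succ {g : ℤ → Γ → T} (hg : FinIter g) (l m : ℤ) (n : Γ) :
    borcherdsIter g (l + 1) m n = borcherdsIter g l (m + 1) n - borcherdsIter g l m (n + 1) := by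
  unfold borcherdsIter
  have h : EvZero fun i : ℕ => g (l + i) (n + ((m + 1 - i : ℤ) : Γ)) := hg.evZero _ _
  have h' : EvZero fun i : ℕ => g (l + 1 + i) (n + ((m - i : ℤ) : Γ)) := hg.evZero _ _
  have e1 : ∀ i : ℕ, g (l + i) (n + 1 + ((m - i : ℤ) : Γ))
      = g (l + i) (n + ((m + 1 - i : ℤ) : Γ)) := fun i => by
    congr 1; push_cast; abel
  simp only [e1]
  rw [EvZero.finsum_succ (h.zsmul _), EvZero.finsum_succ (h.zsmul _)]
  have e4 : ∀ i : ℕ, g (l + (i + 1 : ℕ)) (n + ((m + 1 - (i + 1 : ℕ) : ℤ) : Γ))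
      = g (l + 1 + i) (n + ((m - i : ℤ) : Γ)) := fun i =>
    congrArg₂ g (by push_cast; ring) (by push_cast; abel)
  simp only [e4, Ring.choose_succ_succ, Ring.choose_zero_right]
  rw [add_sub_add_left_eq_sub, ← EvZero.finsum_sub (h'.zsmul _) (h'.zsmul _)]
  refine finsum_congr fun i => ?_
  rw [← sub_smul]
  congr 1
  ring

/-- The identity at `l + 1` follows from the one at `l`: multiplication of the three delta-function
terms by `x₁ - x₂`. -/
theorem borcherds_succ {P Q g : ℤ → Γ → T} (hP : FinFst P) (hQ : FinSnd Q) (hg : FinIter g)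
    (l m : ℤ) (n : Γ) :
    borcherds P Q g (l + 1) m n = borcherds P Q g l (m + 1) n - borcherds P Q g l m (n + 1) := by
  unfold borcherds
  rw [borcherdsFst_succ hP, borcherdsSnd_succ hQ, borcherdsIter_succ hg, Int.negOnePow_succ,
    Units.val_neg, neg_smul, smul_sub]
  abel

/-- If the commutator formula holds, the case `l = -1` of the Jacobi identity at `(m, n)` depends
only on `m + n`. -/
theorem borcherds_neg_one_shift {P Q g : ℤ → Γ → T} (hP : FinFst P) (hQ : FinSnd Q)
    (hg : FinIter g) (h0 : ∀ m n, borcherds P Q g 0 m n = 0) (m : ℤ) (n : Γ) (j : ℤ) :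
    borcherds P Q g (-1) (m + j) n = borcherds P Q g (-1) m (n + (j : Γ)) := by
  have step : ∀ m n, borcherds P Q g (-1) (m + 1) n = borcherds P Q g (-1) m (n + 1) := by
    intro m n
    have := borcherds_succ hP hQ hg (-1) m n
    rw [neg_add_cancel, h0] at this
    exact (sub_eq_zero.mp this.symm)
  induction j using Int.induction_on generalizing m n with
  | zero => simp
  | succ j ih =>
    rw [← add_assoc, step, ih]
    congr 1; push_cast; abel
  | pred j ih =>
    have := step (m + (-j - 1)) (n - 1)
    rw [sub_add_cancel, add_assoc, sub_add_cancel, ih] at this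
    rw [← this]
    congr 1; push_cast; abel

section Derivative

variable [Module ℂ T]

theorem borcherdsFst_deriv {P P' : ℤ → Γ → T} (hP : FinFst P)
    (h : ∀ m n, P' m n = -(m : ℂ) • P (m - 1) n) (l m : ℤ) (n : Γ) :
    borcherdsFst P' l m n
      = -(l : ℂ) • borcherdsFst P (l - 1) m n - (m : ℂ) • borcherdsFst P l (m - 1) n := by
  unfold borcherdsFst
  have e0 : EvZero fun i : ℕ => P (m + l - 1 - i) (n + ((i : ℤ) : Γ)) := hP _ _
  have e1 : ∀ i : ℕ, P (m + (l - 1) - i) (n + ((i : ℤ) : Γ))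
      = P (m + l - 1 - i) (n + ((i : ℤ) : Γ)) := fun i => by rw [add_sub_assoc m l 1]
  have e2 : ∀ i : ℕ, P (m - 1 + l - i) (n + ((i : ℤ) : Γ))
      = P (m + l - 1 - i) (n + ((i : ℤ) : Γ)) := fun i => by rw [sub_add_eq_add_sub]
  have e3 : ∀ i : ℕ, P' (m + l - i) (n + ((i : ℤ) : Γ))
      = (-(m + l - i) : ℤ) • P (m + l - 1 - i) (n + ((i : ℤ) : Γ)) := fun i => by
    rw [h, ← Int.cast_smul_eq_zsmul ℂ, sub_right_comm]
    push_cast; rfl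
  simp only [e1, e2, e3, ← Int.cast_neg, Int.cast_smul_eq_zsmul]
  rw [(e0.zsmul _).smul_finsum, (e0.zsmul _).smul_finsum, ← EvZero.finsum_sub ((e0.zsmul _).zsmul _) ((e0.zsmul _).zsmul _)]
  refine finsum_congr fun i => ?_
  rw [smul_smul, smul_smul, smul_smul, ← sub_smul]
  congr 1
  linear_combination -(-1) ^ i * sub_mul_choose l i

theorem borcherdsSnd_deriv {Q Q' : ℤ → Γ → T} (hQ : FinSnd Q)
    (h : ∀ m n, Q' m n = -(m : ℂ) • Q (m - 1) n) (l m : ℤ) (n : Γ) :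
    borcherdsSnd Q' l m n
      = (l : ℂ) • borcherdsSnd Q (l - 1) m n - (m : ℂ) • borcherdsSnd Q l (m - 1) n := by
  unfold borcherdsSnd
  have e0 : EvZero fun i : ℕ => Q (m - 1 + i) (n + ((l - i : ℤ) : Γ)) := hQ.evZero _ _ _
  have e0' : EvZero fun i : ℕ => Q (m + i) (n + ((l - 1 - i : ℤ) : Γ)) := hQ.evZero _ _ _
  have e3 : ∀ i : ℕ, ((-1) ^ i * Ring.choose l i : ℤ) • Q' (m + i) (n + ((l - i : ℤ) : Γ))
      = (-(m * ((-1) ^ i * Ring.choose l i))) • Q (m - 1 + i) (n + ((l - i : ℤ) : Γ))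
        + (-(i * ((-1) ^ i * Ring.choose l i))) • Q (m - 1 + i) (n + ((l - i : ℤ) : Γ)) :=
    fun i => by
    rw [h, ← add_smul, ← Int.cast_neg, Int.cast_smul_eq_zsmul, smul_smul,
      show m + (i : ℤ) - 1 = m - 1 + i by ring]
    congr 1; ring
  simp only [e3, Int.cast_smul_eq_zsmul]
  rw [EvZero.finsum_add (e0.zsmul _) (e0.zsmul _), EvZero.finsum_succ (f := fun i : ℕ =>
      (-(i * ((-1) ^ i * Ring.choose l i))) • Q (m - 1 + i) (n + ((l - i : ℤ) : Γ))) (e0.zsmul _),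
    (e0'.zsmul _).smul_finsum, (e0.zsmul _).smul_finsum]
  have e4 : ∀ i : ℕ, Q (m - 1 + (i + 1 : ℕ)) (n + ((l - (i + 1 : ℕ) : ℤ) : Γ))
      = Q (m + i) (n + ((l - 1 - i : ℤ) : Γ)) := fun i =>
    congrArg₂ Q (by push_cast; ring) (by push_cast; abel)
  simp only [e4, Nat.cast_zero, zero_mul, neg_zero, zero_smul, zero_add]
  rw [add_comm, show ∀ a b : T, a - b = a + -b from sub_eq_add_neg, ← finsum_neg_distrib]
  congr 1
  · refine finsum_congr fun i => ?_
    rw [smul_smul]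
    congr 1
    linear_combination (-1) ^ i * succ_mul_choose_succ l i
  · refine finsum_congr fun i => ?_
    rw [smul_smul, neg_smul]

theorem borcherdsIter_deriv {g g' : ℤ → Γ → T} (hg : FinIter g)
    (h : ∀ m n, g' m n = -(m : ℂ) • g (m - 1) n) (l m : ℤ) (n : Γ) :
    borcherdsIter g' l m n
      = -(l : ℂ) • borcherdsIter g (l - 1) m n - (m : ℂ) • borcherdsIter g l (m - 1) n := by
  unfold borcherdsIter
  have e0 : EvZero fun i : ℕ => g (l - 1 + i) (n + ((m - i : ℤ) : Γ)) := hg.evZero _ _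
  have e0' : EvZero fun i : ℕ => g (l + i) (n + ((m - 1 - i : ℤ) : Γ)) := hg.evZero _ _
  have e3 : ∀ i : ℕ, Ring.choose m i • g' (l + i) (n + ((m - i : ℤ) : Γ))
      = (-(l * Ring.choose m i)) • g (l - 1 + i) (n + ((m - i : ℤ) : Γ))
        + (-(i * Ring.choose m i)) • g (l - 1 + i) (n + ((m - i : ℤ) : Γ)) :=
    fun i => by
    rw [h, ← add_smul, ← Int.cast_neg, Int.cast_smul_eq_zsmul, smul_smul,
      show l + (i : ℤ) - 1 = l - 1 + i by ring]
    congr 1; ring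
  simp only [e3, ← Int.cast_neg, Int.cast_smul_eq_zsmul]
  rw [EvZero.finsum_add (e0.zsmul _) (e0.zsmul _), EvZero.finsum_succ (f := fun i : ℕ =>
      (-(i * Ring.choose m i)) • g (l - 1 + i) (n + ((m - i : ℤ) : Γ))) (e0.zsmul _),
    (e0.zsmul _).smul_finsum, (e0'.zsmul _).smul_finsum]
  have e4 : ∀ i : ℕ, g (l - 1 + (i + 1 : ℕ)) (n + ((m - (i + 1 : ℕ) : ℤ) : Γ))
      = g (l + i) (n + ((m - 1 - i : ℤ) : Γ)) := fun i =>
    congrArg₂ g (by push_cast; ring) (by push_cast; abel)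
  simp only [e4, Nat.cast_zero, zero_mul, neg_zero, zero_smul, zero_add]
  rw [show ∀ a b : T, a - b = a + -b from sub_eq_add_neg, ← finsum_neg_distrib]
  congr 1
  · refine finsum_congr fun i => ?_
    rw [smul_smul, neg_mul]
  · refine finsum_congr fun i => ?_
    rw [smul_smul, ← neg_smul]
    congr 1
    linear_combination - succ_mul_choose_succ m i

/-- If the three families belong to `L(-1)u` instead of `u`, then the Jacobi identity at `l`
involves the one for `u` at `l - 1`. This allows `l` to be lowered. -/
theorem borcherds_deriv {P P' Q Q' g g' : ℤ → Γ → T} (hP : FinFst P) (hQ : FinSnd Q)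
    (hg : FinIter g) (h1 : ∀ m n, P' m n = -(m : ℂ) • P (m - 1) n)
    (h2 : ∀ m n, Q' m n = -(m : ℂ) • Q (m - 1) n) (h3 : ∀ m n, g' m n = -(m : ℂ) • g (m - 1) n)
    (l m : ℤ) (n : Γ) :
    borcherds P' Q' g' l m n
      = -(l : ℂ) • borcherds P Q g (l - 1) m n - (m : ℂ) • borcherds P Q g l (m - 1) n := by
  have hl := Int.negOnePow_succ (l - 1)
  rw [sub_add_cancel] at hl
  unfold borcherds
  rw [borcherdsFst_deriv hP h1, borcherdsSnd_deriv hQ h2, borcherdsIter_deriv hg h3,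
    hl, Units.val_neg]
  module

/-- Together with the `L(-1)`-derivative property, here in the form of an operator `d`, the case
`l = -1` of the Jacobi identity implies all of it. -/
theorem borcherds_of_neg_one {V : Type*} (d : V → V) (P Q g : V → ℤ → Γ → T)
    (hP : ∀ u, FinFst (P u)) (hQ : ∀ u, FinSnd (Q u)) (hg : ∀ u, FinIter (g u))
    (h1 : ∀ u m n, P (d u) m n = -(m : ℂ) • P u (m - 1) n)
    (h2 : ∀ u m n, Q (d u) m n = -(m : ℂ) • Q u (m - 1) n)
    (h3 : ∀ u m n, g (d u) m n = -(m : ℂ) • g u (m - 1) n)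
    (h : ∀ u m n, borcherds (P u) (Q u) (g u) (-1) m n = 0) (u : V) (l m : ℤ) (n : Γ) :
    borcherds (P u) (Q u) (g u) l m n = 0 := by
  -- multiplication by `x₁ - x₂` raises `l`
  have up : ∀ l : ℕ, ∀ u m n, borcherds (P u) (Q u) (g u) (-1 + l) m n = 0 := by
    intro l
    induction l with
    | zero => simpa using h
    | succ l ih =>
      intro u m n
      push_cast
      rw [← add_assoc, borcherds_succ (hP u) (hQ u) (hg u), ih, ih, sub_zero]
  -- the derivative lowers `l`, because its coefficient `-l` does not vanish for `l < 0`
  have down : ∀ l : ℕ, ∀ u m n, borcherds (P u) (Q u) (g u) (-1 - l) m n = 0 := by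
    intro l
    induction l with
    | zero => simpa using h
    | succ l ih =>
      intro u m n
      have := borcherds_deriv (hP u) (hQ u) (hg u) (h1 u) (h2 u) (h3 u) (-1 - l) m n
      rw [ih, ih, smul_zero, sub_zero] at this
      push_cast
      rw [← sub_sub]
      refine (smul_eq_zero.mp this.symm).resolve_left ?_
      have : (-1 - (l : ℤ)) ≠ 0 := by omega
      rw [neg_eq_zero]
      exact_mod_cast this
  rcases le_total (-1) l with hl | hl
  · obtain ⟨k, rfl⟩ := Int.le.dest hl
    exact up k u m n
  · obtain ⟨k, hk⟩ := Int.le.dest hl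
    rw [show l = -1 - k by omega]
    exact down k u m n

end Derivative

end Borcherds

/-! ### Additivity and covariance of the Jacobi identity -/

theorem EvZero.sum {X ι : Type*} [AddCommGroup X] (s : Finset ι) {f : ι → ℕ → X}
    (h : ∀ i ∈ s, EvZero (f i)) : EvZero fun t => ∑ i ∈ s, f i t := by
  classical
  induction s using Finset.induction_on with
  | empty => simpa using EvZero.zero'
  | insert i s hi ih =>
    simp only [Finset.sum_insert hi]
    exact (h i (by simp)).add (ih fun j hj => h j (by simp [hj]))

section Borcherds

variable {Γ T : Type*} [AddCommGroupWithOne Γ] [AddCommGroup T]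

theorem jacobiDefect_eq_borcherds {V A B : Type*} (yA : V → ℤ → A → A) (yB : V → ℤ → B → B)
    (yC : V → ℤ → T → T) (𝒴 : A → Γ → B → T) (v : V) (a : A) (b : B)
    (hP : FinFst fun j k => yC v j (𝒴 a k b)) (hQ : FinSnd fun j k => 𝒴 a k (yB v j b))
    (l m : ℤ) (n : Γ) :
    jacobiDefect yA yB yC 𝒴 v a b l m n
      = borcherds (fun j k => yC v j (𝒴 a k b)) (fun j k => 𝒴 a k (yB v j b))
          (fun j k => 𝒴 (yA v j a) k b) l m n := by
  unfold jacobiDefect borcherds borcherdsFst borcherdsSnd borcherdsIter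
  have h1 : EvZero fun i : ℕ => yC v (m + l - i) (𝒴 a (n + ((i : ℤ) : Γ)) b) := hP _ _
  have h2 : EvZero fun i : ℕ => 𝒴 a (n + ((l - i : ℤ) : Γ)) (yB v (m + i) b) := hQ.evZero _ _ _
  congr 1
  rw [(h2.zsmul _).smul_finsum, ← EvZero.finsum_sub (h1.zsmul _) ((h2.zsmul _).zsmul _)]
  exact finsum_congr fun i => by rw [smul_sub, smul_comm]

theorem borcherds_congr {P P' Q Q' g g' : ℤ → Γ → T} (h1 : ∀ j k, P j k = P' j k)
    (h2 : ∀ j k, Q j k = Q' j k) (h3 : ∀ j k, g j k = g' j k) (l m : ℤ) (n : Γ) :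
    borcherds P Q g l m n = borcherds P' Q' g' l m n := by
  rw [show P = P' from funext₂ h1, show Q = Q' from funext₂ h2, show g = g' from funext₂ h3]

/-- The commutator formula as the case `l = 0` of the Jacobi identity. -/
theorem borcherds_zero (P Q g : ℤ → Γ → T) (m : ℤ) (n : Γ) :
    borcherds P Q g 0 m n
      = P m n - Q m n - ∑ᶠ i : ℕ, Ring.choose m i • g i (n + ((m - i : ℤ) : Γ)) := by
  unfold borcherds borcherdsFst borcherdsSnd borcherdsIter
  rw [finsum_eq_single _ 0, finsum_eq_single _ 0]
  · simp
  · intro i hi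
    simp [Ring.choose_zero_pos ℤ (by omega : 0 < i)]
  · intro i hi
    simp [Ring.choose_zero_pos ℤ (by omega : 0 < i)]

/-- The case `l = -1` of the Jacobi identity. -/
theorem borcherds_neg_one (P Q g : ℤ → Γ → T) (m : ℤ) (n : Γ) :
    borcherds P Q g (-1) m n
      = ∑ᶠ i : ℕ, P (m - 1 - i) (n + ((i : ℤ) : Γ)) + ∑ᶠ i : ℕ, Q (m + i) (n + ((-1 - i : ℤ) : Γ))
        - ∑ᶠ i : ℕ, Ring.choose m i • g (-1 + i) (n + ((m - i : ℤ) : Γ)) := by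
  unfold borcherds borcherdsFst borcherdsSnd borcherdsIter
  simp only [WeakModule.neg_one_choose, one_smul, Int.negOnePow_neg, Int.negOnePow_one,
    Units.val_neg, Units.val_one, neg_smul, sub_neg_eq_add, ← sub_eq_add_neg]

theorem map_borcherds {T' : Type*} [AddCommGroup T'] (φ : T →+ T') {P Q g : ℤ → Γ → T}
    (hP : FinFst P) (hQ : FinSnd Q) (hg : FinIter g) (l m : ℤ) (n : Γ) :
    φ (borcherds P Q g l m n)
      = borcherds (fun j k => φ (P j k)) (fun j k => φ (Q j k)) (fun j k => φ (g j k)) l m n := by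
  unfold borcherds borcherdsFst borcherdsSnd borcherdsIter
  have h3 : EvZero fun i : ℕ => g (l + i) (n + ((m - i : ℤ) : Γ)) := hg.evZero _ _
  rw [map_sub, map_sub, map_zsmul, EvZero.map_finsum φ ((hP _ _).zsmul _),
    EvZero.map_finsum φ ((hQ.evZero _ _ _).zsmul _), EvZero.map_finsum φ (h3.zsmul _)]
  simp only [map_zsmul]

theorem borcherdsFst_add {P P' : ℤ → Γ → T} (hP : FinFst P) (hP' : FinFst P') (l m : ℤ) (n : Γ) :
    borcherdsFst (fun j k => P j k + P' j k) l m n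
      = borcherdsFst P l m n + borcherdsFst P' l m n := by
  unfold borcherdsFst
  rw [← EvZero.finsum_add ((hP _ _).zsmul _) ((hP' _ _).zsmul _)]
  exact finsum_congr fun i => smul_add _ _ _

theorem borcherdsSnd_add {P P' : ℤ → Γ → T} (hP : FinSnd P) (hP' : FinSnd P') (l m : ℤ) (n : Γ) :
    borcherdsSnd (fun j k => P j k + P' j k) l m n
      = borcherdsSnd P l m n + borcherdsSnd P' l m n := by
  unfold borcherdsSnd
  rw [← EvZero.finsum_add ((hP.evZero _ _ _).zsmul _) ((hP'.evZero _ _ _).zsmul _)]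
  exact finsum_congr fun i => smul_add _ _ _

theorem borcherdsIter_add {P P' : ℤ → Γ → T} (hP : FinIter P) (hP' : FinIter P') (l m : ℤ)
    (n : Γ) :
    borcherdsIter (fun j k => P j k + P' j k) l m n
      = borcherdsIter P l m n + borcherdsIter P' l m n := by
  unfold borcherdsIter
  have h1 : EvZero fun i : ℕ => P (l + i) (n + ((m - i : ℤ) : Γ)) := hP.evZero _ _
  have h2 : EvZero fun i : ℕ => P' (l + i) (n + ((m - i : ℤ) : Γ)) := hP'.evZero _ _
  rw [← EvZero.finsum_add (h1.zsmul _) (h2.zsmul _)]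
  exact finsum_congr fun i => smul_add _ _ _

/-- Additivity of the Jacobi identity. -/
theorem borcherds_add {P P' Q Q' g g' : ℤ → Γ → T} (hP : FinFst P) (hP' : FinFst P')
    (hQ : FinSnd Q) (hQ' : FinSnd Q') (hg : FinIter g) (hg' : FinIter g') (l m : ℤ) (n : Γ) :
    borcherds (fun j k => P j k + P' j k) (fun j k => Q j k + Q' j k) (fun j k => g j k + g' j k)
      l m n = borcherds P Q g l m n + borcherds P' Q' g' l m n := by
  unfold borcherds
  rw [borcherdsFst_add hP hP', borcherdsSnd_add hQ hQ', borcherdsIter_add hg hg', smul_add]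
  abel

end Borcherds

section Covariance

variable {Γ T : Type*} [AddCommGroupWithOne Γ] [AddCommGroup T]

/-- The first sum of the Jacobi identity for a finite combination of shifted families. The next two
lemmas are the analogues for the other sums. -/
theorem borcherdsFst_eq_sum {D : ℤ → Γ → T} (s : Finset ℕ) (c : ℕ → ℤ) (E F : ℕ → ℤ → Γ → T)
    (a : ℕ → ℤ) (b : ℕ → Γ) (hE : ∀ i, FinFst (E i)) (hF : ∀ i, FinFst (F i))
    (h : ∀ m n, D m n = ∑ i ∈ s, c i • (E i (m + a i) n + F i m (n + b i))) (l m : ℤ) (n : Γ) :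
    borcherdsFst D l m n = ∑ i ∈ s, c i • (borcherdsFst (E i) l (m + a i) n
      + borcherdsFst (F i) l m (n + b i)) := by
  have h1 : ∀ i, EvZero fun t : ℕ => E i (m + a i + l - t) (n + ((t : ℤ) : Γ)) := fun i => hE i _ _
  have h2 : ∀ i, EvZero fun t : ℕ => F i (m + l - t) (n + b i + ((t : ℤ) : Γ)) := fun i => hF i _ _
  unfold borcherdsFst
  simp only [h, Finset.smul_sum]
  rw [finsum_sum_comm]
  · refine Finset.sum_congr rfl fun i _ => ?_
    rw [← EvZero.finsum_add ((h1 i).zsmul _) ((h2 i).zsmul _),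
      (((h1 i).zsmul _).add ((h2 i).zsmul _)).smul_finsum]
    refine finsum_congr fun t => ?_
    rw [smul_comm, smul_add, show m + l - (t : ℤ) + a i = m + a i + l - t by ring,
      add_right_comm n]
  · intro i _
    refine EvZero.support_finite (EvZero.zsmul (EvZero.zsmul (EvZero.add ?_ ?_) _) _)
    · exact (h1 i).congr fun t => congrArg₂ (E i) (by ring) rfl
    · exact (h2 i).congr fun t => congrArg₂ (F i) (by ring) (by abel)

theorem borcherdsSnd_eq_sum {D : ℤ → Γ → T} (s : Finset ℕ) (c : ℕ → ℤ) (E F : ℕ → ℤ → Γ → T)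
    (a : ℕ → ℤ) (b : ℕ → Γ) (hE : ∀ i, FinSnd (E i)) (hF : ∀ i, FinSnd (F i))
    (h : ∀ m n, D m n = ∑ i ∈ s, c i • (E i (m + a i) n + F i m (n + b i))) (l m : ℤ) (n : Γ) :
    borcherdsSnd D l m n = ∑ i ∈ s, c i • (borcherdsSnd (E i) l (m + a i) n
      + borcherdsSnd (F i) l m (n + b i)) := by
  have h1 : ∀ i, EvZero fun t : ℕ => E i (m + a i + t) (n + ((l - t : ℤ) : Γ)) :=
    fun i => (hE i).evZero _ _ _
  have h2 : ∀ i, EvZero fun t : ℕ => F i (m + t) (n + b i + ((l - t : ℤ) : Γ)) :=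
    fun i => (hF i).evZero _ _ _
  unfold borcherdsSnd
  simp only [h, Finset.smul_sum]
  rw [finsum_sum_comm]
  · refine Finset.sum_congr rfl fun i _ => ?_
    rw [← EvZero.finsum_add ((h1 i).zsmul _) ((h2 i).zsmul _),
      (((h1 i).zsmul _).add ((h2 i).zsmul _)).smul_finsum]
    refine finsum_congr fun t => ?_
    rw [smul_comm, smul_add, show m + (t : ℤ) + a i = m + a i + t by ring,
      add_right_comm n]
  · intro i _
    refine EvZero.support_finite (EvZero.zsmul (EvZero.zsmul (EvZero.add ?_ ?_) _) _)
    · exact (h1 i).congr fun t => congrArg₂ (E i) (by ring) rfl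
    · exact (h2 i).congr fun t => congrArg₂ (F i) (by ring) (by abel)

/-- For the third sum, the families that belong to the iterate are themselves binomial convolutions;
they combine with the coefficients `(m choose t)` by the Vandermonde identity. -/
theorem borcherdsIter_eq_sum {D : ℤ → Γ → T} (s : Finset ℕ) (p : ℤ) (E F : ℕ → ℤ → Γ → T)
    (b : ℕ → Γ) (hE : ∀ i, FinIter (E i)) (hF : ∀ i, FinIter (F i))
    (h : ∀ m n, D m n = ∑ i ∈ s, Ring.choose p (i : ℕ) • ((∑ᶠ j : ℕ,
      Ring.choose (p - (i : ℤ)) j • E i (m + (j : ℤ)) (n + ((p - (i : ℤ) - (j : ℤ) : ℤ) : Γ)))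
      + F i m (n + b i))) (l m : ℤ) (n : Γ) :
    borcherdsIter D l m n = ∑ i ∈ s, Ring.choose p i • (borcherdsIter (E i) l (m + (p - i)) n
      + borcherdsIter (F i) l m (n + b i)) := by
  have h2 : ∀ i, EvZero fun t : ℕ => F i (l + t) (n + b i + ((m - t : ℤ) : Γ)) :=
    fun i => (hF i).evZero _ _
  have h1 : ∀ i : ℕ, EvZero fun t : ℕ => ∑ᶠ j : ℕ, Ring.choose (p - i) j •
      E i (l + t + j) (n + ((m - t : ℤ) : Γ) + ((p - i - j : ℤ) : Γ)) := by
    intro i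
    obtain ⟨K, hK⟩ := hE i
    refine ⟨(K - l).toNat, fun t ht => (finsum_congr fun j => ?_).trans finsum_zero⟩
    rw [hK _ (by omega), smul_zero]
  unfold borcherdsIter
  simp only [h, Finset.smul_sum]
  rw [finsum_sum_comm]
  · refine Finset.sum_congr rfl fun i _ => ?_
    have h3 : EvZero fun t : ℕ => E i (l + t) (n + ((m + (p - i) - t : ℤ) : Γ)) :=
      (hE i).evZero _ _
    have h4 := EvZero.finsum_choose_choose h3 m (p - i)
    rw [← h4]
    have h5 : ∀ t j : ℕ, E i (l + (t + j : ℕ)) (n + ((m + (p - i) - (t + j : ℕ) : ℤ) : Γ))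
        = E i (l + t + j) (n + ((m - t : ℤ) : Γ) + ((p - i - j : ℤ) : Γ)) := fun t j =>
      congrArg₂ (E i) (by push_cast; ring) (by push_cast; abel)
    simp only [h5]
    rw [← EvZero.finsum_add ((h1 i).zsmul _) ((h2 i).zsmul _),
      (((h1 i).zsmul _).add ((h2 i).zsmul _)).smul_finsum]
    refine finsum_congr fun t => ?_
    rw [smul_comm, smul_add, add_right_comm n (b i)]
  · intro i _
    refine EvZero.support_finite (EvZero.zsmul (EvZero.zsmul (EvZero.add (h1 i) ?_) _) _)
    exact (h2 i).congr fun t => congrArg₂ (F i) (by ring) (by abel)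

end Covariance

section Covariance

variable {V : Type u} [AddCommGroup V] [Module ℂ V] {𝒱 : VertexOperatorAlgebra V}
  {A : Type u} [AddCommGroup A] [Module ℂ A]
  {Γ T : Type*} [AddCommGroupWithOne Γ] [AddCommGroup T]

theorem WeakModule.finIter_mode {Γ : Type*} (M : WeakModule 𝒱 A) (R : A →+ Γ → T) (u : V) (w : A) :
    FinIter fun j k => R (M.mode u j w) k := by
  obtain ⟨K, hK⟩ := M.trunc u w
  exact ⟨K, fun k hk n => by simp [hK k hk]⟩

/-- Commuting `a_p` past an iterate `(u_k w)_n`. -/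
theorem WeakModule.iterate_commutator (M : WeakModule 𝒱 A) (a u : V) (w : A) (p : ℤ)
    (R : A →+ Γ → T) {N : ℕ} (hu : ∀ i ≥ N, 𝒱.adjoint.mode a (i : ℤ) u = 0)
    (hw : ∀ i ≥ N, M.mode a (i : ℤ) w = 0) (k : ℤ) (n : Γ) :
    ∑ᶠ i : ℕ, Ring.choose p i • R (M.mode a i (M.mode u k w)) (n + ((p - i : ℤ) : Γ))
      = ∑ i ∈ Finset.range N, Ring.choose p (i : ℕ) • ((∑ᶠ j : ℕ, Ring.choose (p - (i : ℤ)) j •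
          R (M.mode (𝒱.adjoint.mode a i u) (k + (j : ℤ)) w) (n + ((p - (i : ℤ) - (j : ℤ) : ℤ) : Γ)))
          + R (M.mode u k (M.mode a i w)) (n + ((p - i : ℤ) : Γ))) := by
  have hm : ∀ (i : ℕ), M.mode a i (M.mode u k w) = M.mode u k (M.mode a i w)
      + ∑ᶠ s : ℕ, Ring.choose (i : ℤ) s • M.mode (𝒱.adjoint.mode a s u) (k + (i - s)) w :=
    fun i => by rw [← M.mode_comm, add_sub_cancel]
  have hbd : ∃ N', ∀ s j : ℕ, N' ≤ s + j →
      M.mode (𝒱.adjoint.mode a s u) (k + (j : ℤ)) w = 0 := by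
    choose K hK using fun s : ℕ => M.trunc (𝒱.adjoint.mode a s u) w
    refine ⟨N + ∑ s ∈ Finset.range N, (K s - k).toNat, fun s j h => ?_⟩
    by_cases hs : s < N
    · have := Finset.single_le_sum (f := fun s => (K s - k).toNat) (fun _ _ => Nat.zero_le _)
        (Finset.mem_range.mpr hs)
      exact hK s _ (by omega)
    · rw [hu s (by omega)]
      simp
  obtain ⟨N', hN'⟩ := hbd
  have e1 : ∀ i : ℕ, Ring.choose p i • R (M.mode a i (M.mode u k w)) (n + ((p - i : ℤ) : Γ))
      = Ring.choose p i • R (M.mode u k (M.mode a i w)) (n + ((p - i : ℤ) : Γ))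
        + ∑ ij ∈ Finset.HasAntidiagonal.antidiagonal i, (Ring.choose p ij.1 *
          Ring.choose (p - ij.1) ij.2) • R (M.mode (𝒱.adjoint.mode a ij.1 u) (k + ij.2) w)
            (n + ((p - ij.1 - ij.2 : ℤ) : Γ)) := by
    intro i
    rw [hm, map_add, Pi.add_apply, smul_add, Finset.Nat.sum_antidiagonal_eq_sum_range_succ_mk,
      finsum_eq_sum_of_support_subset (s := Finset.range (i + 1)), map_sum, Finset.sum_apply,
      Finset.smul_sum]
    · congr 1
      refine Finset.sum_congr rfl fun s hs => ?_
      have hs : s ≤ i := by simpa [Nat.lt_succ_iff] using hs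
      obtain ⟨j, rfl⟩ := Nat.exists_eq_add_of_le hs
      rw [add_tsub_cancel_left, ← choose_mul_natCast_choose, mul_smul, map_zsmul, Pi.smul_apply]
      refine congrArg (fun x : T => Ring.choose p (s + j) • Ring.choose ((s + j : ℕ) : ℤ) s • x) ?_
      exact congrArg₂ (fun j k => R (M.mode (𝒱.adjoint.mode a s u) j w) k) (by push_cast; ring)
        (congrArg (fun z : ℤ => n + (z : Γ)) (by push_cast; ring))
    · intro s hs
      by_contra h
      refine hs ?_
      have : i < s := by simpa [Nat.lt_succ_iff] using h
      simp [Ring.choose_natCast, Nat.choose_eq_zero_of_lt this]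
  simp only [e1]
  rw [EvZero.finsum_add, ← EvZero.finsum_antidiagonal (F := fun s j => (Ring.choose p s *
          Ring.choose (p - (s : ℤ)) j) • R (M.mode (𝒱.adjoint.mode a s u) (k + j) w)
            (n + ((p - s - j : ℤ) : Γ))) ⟨N', fun i j h => by simp [hN' i j h]⟩]
  · simp only [smul_add, Finset.sum_add_distrib]
    rw [add_comm, EvZero.finsum_eq (N := N), EvZero.finsum_eq (N := N)]
    · congr 1
      refine Finset.sum_congr rfl fun s _ => ?_
      rw [EvZero.smul_finsum]
      · exact finsum_congr fun j => mul_smul _ _ _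
      · exact EvZero.zsmul ⟨N', fun i hi => by simp [hN' s i (by omega)]⟩ _
    · intro i hi
      simp [hw i hi]
    · intro i hi
      simp [hu i hi]
  · exact EvZero.zsmul ⟨N, fun i hi => by simp [hw i hi]⟩ _
  · refine ⟨N', fun i hi => Finset.sum_eq_zero fun ij hij => ?_⟩
    rw [Finset.HasAntidiagonal.mem_antidiagonal] at hij
    rw [hN' _ _ (by omega)]
    simp

/-- Covariance of the Jacobi identity. Suppose that each of the three families `P₁`, `Q₁`, `R₁`
differs from `P₂`, `Q₂`, `R₂` by the terms that the commutator formula gives when `a_p` is moved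
past the operators of `u` and `w`. These terms are the families for the pairs `(a_i u, w)` and `(u,
a_i w)`, for which the identity holds; so the two defects agree. -/
theorem borcherds_covariance (M : WeakModule 𝒱 A) (a : V) (p : ℤ) {P Q : V → A → ℤ → Γ → T}
    {R R₁ R₂ : A →+ Γ → T} {P₁ P₂ Q₁ Q₂ : ℤ → Γ → T} (u : V) (w : A)
    (hP : ∀ u w, FinFst (P u w)) (hQ : ∀ u w, FinSnd (Q u w)) (hP₂ : FinFst P₂) (hQ₂ : FinSnd Q₂)
    (hPV : ∀ w m n, P 0 w m n = 0) (hPA : ∀ u m n, P u 0 m n = 0)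
    (hQV : ∀ w m n, Q 0 w m n = 0) (hQA : ∀ u m n, Q u 0 m n = 0)
    (h1 : ∀ m n, P₁ m n = P₂ m n + ∑ᶠ i : ℕ, Ring.choose p i •
      (P (𝒱.adjoint.mode a i u) w (m + (p - i)) n + P u (M.mode a i w) m (n + ((p - i : ℤ) : Γ))))
    (h2 : ∀ m n, Q₁ m n = Q₂ m n + ∑ᶠ i : ℕ, Ring.choose p i •
      (Q (𝒱.adjoint.mode a i u) w (m + (p - i)) n + Q u (M.mode a i w) m (n + ((p - i : ℤ) : Γ))))
    (h3 : ∀ x n, R₁ x n = R₂ x n + ∑ᶠ i : ℕ, Ring.choose p i •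
      R (M.mode a i x) (n + ((p - i : ℤ) : Γ)))
    (hJ : ∀ u w l m n, borcherds (P u w) (Q u w) (fun j k => R (M.mode u j w) k) l m n = 0)
    (l m : ℤ) (n : Γ) :
    borcherds P₁ Q₁ (fun j k => R₁ (M.mode u j w) k) l m n
      = borcherds P₂ Q₂ (fun j k => R₂ (M.mode u j w) k) l m n := by
  obtain ⟨Nu, hNu⟩ := 𝒱.adjoint.evZero_mode a u 0
  obtain ⟨Nw, hNw⟩ := M.evZero_mode a w 0
  simp only [zero_add] at hNu hNw
  have hu : ∀ i ≥ max Nu Nw, 𝒱.adjoint.mode a (i : ℤ) u = 0 :=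
    fun i hi => hNu i (le_trans (le_max_left _ _) hi)
  have hw : ∀ i ≥ max Nu Nw, M.mode a (i : ℤ) w = 0 :=
    fun i hi => hNw i (le_trans (le_max_right _ _) hi)
  generalize max Nu Nw = N at hu hw
  have fin : ∀ {P : V → A → ℤ → Γ → T} (hPV : ∀ w m n, P 0 w m n = 0)
      (hPA : ∀ u m n, P u 0 m n = 0) (m : ℤ) (n : Γ), ∑ᶠ i : ℕ, Ring.choose p i •
      (P (𝒱.adjoint.mode a i u) w (m + (p - i)) n + P u (M.mode a i w) m (n + ((p - i : ℤ) : Γ)))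
      = ∑ i ∈ Finset.range N, Ring.choose p i •
      (P (𝒱.adjoint.mode a i u) w (m + (p - i)) n
        + P u (M.mode a i w) m (n + ((p - i : ℤ) : Γ))) := by
    intro P hPV hPA m n
    exact EvZero.finsum_eq fun i hi => by rw [hu i hi, hw i hi, hPV, hPA, add_zero, smul_zero]
  have hDP : ∀ {P : V → A → ℤ → Γ → T} (_ : ∀ u w, FinFst (P u w)),
      FinFst fun m n => ∑ i ∈ Finset.range N, Ring.choose p i •
      (P (𝒱.adjoint.mode a i u) w (m + (p - i)) n
        + P u (M.mode a i w) m (n + ((p - i : ℤ) : Γ))) := by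
    intro P hP m n
    refine EvZero.sum _ fun i _ => EvZero.zsmul (EvZero.add ?_ ?_) _
    · exact (hP (𝒱.adjoint.mode a i u) w (m + (p - i)) n).congr fun t =>
        congrArg₂ (P _ w) (by ring) rfl
    · exact (hP u (M.mode a i w) m (n + ((p - i : ℤ) : Γ))).congr fun t =>
        congrArg₂ (P u _) rfl (by abel)
  have hDQ : ∀ {P : V → A → ℤ → Γ → T} (_ : ∀ u w, FinSnd (P u w)),
      FinSnd fun m n => ∑ i ∈ Finset.range N, Ring.choose p i •
      (P (𝒱.adjoint.mode a i u) w (m + (p - i)) n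
        + P u (M.mode a i w) m (n + ((p - i : ℤ) : Γ))) := by
    intro P hP m n
    refine EvZero.sum _ fun i _ => EvZero.zsmul (EvZero.add ?_ ?_) _
    · exact (hP (𝒱.adjoint.mode a i u) w (m + (p - i)) n).congr fun t =>
        congrArg₂ (P _ w) (by ring) rfl
    · exact (hP u (M.mode a i w) m (n + ((p - i : ℤ) : Γ))).congr fun t =>
        congrArg₂ (P u _) rfl (by abel)
  have hDR : FinIter fun k n => ∑ᶠ i : ℕ, Ring.choose p i •
      R (M.mode a i (M.mode u k w)) (n + ((p - i : ℤ) : Γ)) := by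
    obtain ⟨K, hK⟩ := M.trunc u w
    exact ⟨K, fun k hk n => by simp [hK k hk]⟩
  rw [show P₁ = _ from funext₂ fun m n => (h1 m n).trans (by rw [fin hPV hPA]),
    show Q₁ = _ from funext₂ fun m n => (h2 m n).trans (by rw [fin hQV hQA]),
    show (fun j k => R₁ (M.mode u j w) k) = _ from funext₂ fun m n => h3 _ _,
    borcherds_add hP₂ (hDP hP) hQ₂ (hDQ hQ) (M.finIter_mode R₂ u w) hDR, add_eq_left]
  unfold borcherds
  rw [borcherdsFst_eq_sum (Finset.range N) (fun i => Ring.choose p i) (fun i => P (𝒱.adjoint.mode a i u) w)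
      (fun i => P u (M.mode a i w)) (fun i => p - i) (fun i => ((p - i : ℤ) : Γ))
      (fun i => hP _ _) (fun i => hP _ _) fun m n => rfl,
    borcherdsSnd_eq_sum (Finset.range N) (fun i => Ring.choose p i) (fun i => Q (𝒱.adjoint.mode a i u) w)
      (fun i => Q u (M.mode a i w)) (fun i => p - i) (fun i => ((p - i : ℤ) : Γ))
      (fun i => hQ _ _) (fun i => hQ _ _) fun m n => rfl,
    borcherdsIter_eq_sum (Finset.range N) p
      (fun i j k => R (M.mode (𝒱.adjoint.mode a i u) j w) k)
      (fun i j k => R (M.mode u j (M.mode a i w)) k) (fun i => ((p - i : ℤ) : Γ))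
      (fun i => M.finIter_mode R _ _) (fun i => M.finIter_mode R _ _)
      fun k n => M.iterate_commutator a u w p R hu hw k n,
    Finset.smul_sum, ← Finset.sum_sub_distrib, ← Finset.sum_sub_distrib]
  refine Finset.sum_eq_zero fun i _ => ?_
  have j1 := hJ (𝒱.adjoint.mode a i u) w l (m + (p - i)) n
  have j2 := hJ u (M.mode a i w) l m (n + ((p - i : ℤ) : Γ))
  unfold borcherds at j1 j2
  have j3 := congrArg (Ring.choose p i • ·) (congrArg₂ (· + ·) j1 j2)
  simp only [add_zero, smul_zero] at j3
  rw [← j3, smul_comm]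
  simp only [smul_add, smul_sub]
  abel

end Covariance

/-! ### Divided powers of `L(1)` -/

section DividedPowers

variable {V : Type u} [AddCommGroup V] [Module ℂ V] {𝒱 : VertexOperatorAlgebra V}
  {W : Type u} [AddCommGroup W] [Module ℂ W]

/-- The divided power `L(1)^j / j!` on `V`. -/
def VertexOperatorAlgebra.expL (𝒱 : VertexOperatorAlgebra V) (j : ℕ) : Module.End ℂ V :=
  (j.factorial : ℂ)⁻¹ • (𝒱.adjoint.L 1) ^ j

namespace VertexOperatorAlgebra

theorem expL_zero (v : V) : 𝒱.expL 0 v = v := by simp [expL]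

theorem evZero_expL (v : V) : EvZero fun j : ℕ => 𝒱.expL j v := by
  obtain ⟨N, hN⟩ := evZero_L_one_pow (𝒱 := 𝒱) v
  refine ⟨N, fun j hj => ?_⟩
  have := hN j hj
  simp only at this
  simp [expL, this]

theorem L_one_expL (j : ℕ) (v : V) :
    𝒱.adjoint.L 1 (𝒱.expL j v) = ((j + 1 : ℕ) : ℂ) • 𝒱.expL (j + 1) v := by
  simp only [expL, LinearMap.smul_apply, map_smul, smul_smul]
  rw [← Module.End.mul_apply, ← pow_succ', Nat.factorial_succ, Nat.cast_mul, mul_inv,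
    mul_inv_cancel_left₀ (by exact_mod_cast Nat.succ_ne_zero j)]

theorem expL_mem {k : ℤ} {v : V} (hv : v ∈ 𝒱.homog k) (j : ℕ) : 𝒱.expL j v ∈ 𝒱.homog (k - j) := by
  refine Submodule.smul_mem _ _ ?_
  induction j with
  | zero => simpa using hv
  | succ j ih =>
    rw [pow_succ']
    exact WeakModule.mode_mem_homog WeakModule.omega_mem ih _ (by push_cast; ring)

theorem L_one_omega : 𝒱.adjoint.L 1 𝒱.ω = 0 := by
  have h := congrArg (fun f => f 𝒱.one) (𝒱.virasoro 1 (-2))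
  have h1 := 𝒱.creation 𝒱.ω
  have h0 := 𝒱.creation_regular 𝒱.ω
  simp only [LinearMap.sub_apply, Module.End.mul_apply, LinearMap.add_apply,
    LinearMap.smul_apply] at h
  norm_num at h
  rw [h1, h0 2 (by norm_num), h0 0 (by norm_num)] at h
  exact (by simpa using h : VertexOperator.ncoeff (𝒱.Y 𝒱.ω) 2 𝒱.ω = 0)

end VertexOperatorAlgebra

namespace WeakModule

variable (M : WeakModule 𝒱 W)

/-- Commutator of `L(1)` with a mode. -/
theorem L_one_mode {p : ℤ} {u : V} (hu : u ∈ 𝒱.homog p) (n : ℤ) (w : W) :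
    M.L 1 (M.mode u n w) = M.mode u n (M.L 1 w) + M.mode (𝒱.adjoint.L 1 u) n w
      + (2 * p - n - 2) • M.mode u (n + 1) w := by
  have h := M.mode_comm 𝒱.ω u w 2 n
  rw [sub_eq_iff_eq_add] at h
  rw [L, show (1 : ℤ) + 1 = 2 from rfl, h, EvZero.finsum_eq (N := 3)]
  · rw [Finset.sum_range_succ, Finset.sum_range_succ, Finset.sum_range_one]
    have e0 : 𝒱.adjoint.mode 𝒱.ω 0 = 𝒱.adjoint.L (-1) := rfl
    have e1 : 𝒱.adjoint.mode 𝒱.ω 1 = 𝒱.adjoint.L 0 := rfl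
    have e2 : 𝒱.adjoint.mode 𝒱.ω 2 = 𝒱.adjoint.L 1 := rfl
    have c2 : Ring.choose (2 : ℤ) 2 = 1 := by
      have := Ring.choose_natCast (R := ℤ) 2 2
      simpa using this
    simp only [Nat.cast_zero, Nat.cast_one, Nat.cast_ofNat, e0, e1, e2, mem_homog.mp hu,
      mode_L_neg_one, Ring.choose_zero_right, Ring.choose_one_right, c2, one_smul, mode_smul,
      LinearMap.smul_apply]
    rw [show n + (2 - 0) - 1 = n + 1 by ring, show n + (2 - 1) = n + 1 by ring,
      show n + (2 - 2) = n by ring]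
    simp only [← Int.cast_smul_eq_zsmul ℂ]
    push_cast
    module
  · intro i hi
    have : Ring.choose (2 : ℤ) i = 0 := by
      have := Ring.choose_natCast (R := ℤ) 2 i
      rw [Nat.choose_eq_zero_of_lt (by omega)] at this
      simpa using this
    rw [this, zero_smul]

end WeakModule

namespace VertexOperatorAlgebra

/-- The operator `∑_{j+t=a} (2p-j-s-2 choose t) (L(1)^j/j! u)_{s+t}`, for `u` of weight `p`: the
part of `e^{xL(1)} u_s e^{-xL(1)}` of degree `a` in `x`. -/
def conjPart (𝒱 : VertexOperatorAlgebra V) (p s : ℤ) (u : V) (a : ℕ) (x : V) : V :=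
  ∑ jt ∈ Finset.HasAntidiagonal.antidiagonal a, Ring.choose (2 * p - jt.1 - s - 2) jt.2 •
    𝒱.adjoint.mode (𝒱.expL jt.1 u) (s + jt.2) x

theorem L_one_conjPart {p : ℤ} {u : V} (hu : u ∈ 𝒱.homog p) (s : ℤ) (a : ℕ) (x : V) :
    𝒱.adjoint.L 1 (𝒱.conjPart p s u a x) = 𝒱.conjPart p s u a (𝒱.adjoint.L 1 x)
      + (a + 1 : ℤ) • 𝒱.conjPart p s u (a + 1) x := by
  have key : ∀ jt ∈ Finset.HasAntidiagonal.antidiagonal (a + 1),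
      (a + 1 : ℤ) • Ring.choose (2 * p - (jt.1 : ℤ) - s - 2) jt.2 •
        𝒱.adjoint.mode (𝒱.expL jt.1 u) (s + jt.2) x
      = ((jt.1 : ℤ) * Ring.choose (2 * p - (jt.1 : ℤ) - s - 2 + 1) jt.2) •
          𝒱.adjoint.mode (𝒱.expL jt.1 u) (s + jt.2) x
        + (match jt.2 with
            | 0 => 0
            | t + 1 => (2 * p - jt.1 - s - 2 - jt.1 - t) *
                Ring.choose (2 * p - (jt.1 : ℤ) - s - 2) t : ℤ) •
          𝒱.adjoint.mode (𝒱.expL jt.1 u) (s + jt.2) x := by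
    rintro ⟨j, t⟩ h
    rw [Finset.HasAntidiagonal.mem_antidiagonal] at h
    simp only at h
    rw [smul_smul, ← add_smul]
    congr 1
    have h' : (a : ℤ) + 1 = j + t := by omega
    rw [h']
    cases t with
    | zero => simp
    | succ t =>
      simp only
      rw [Ring.choose_succ_succ]
      have := succ_mul_choose_succ (2 * p - (j : ℤ) - s - 2) t
      have h2 := sub_mul_choose (2 * p - (j : ℤ) - s - 2) t
      push_cast at this ⊢
      linear_combination this - h2
  rw [conjPart, conjPart, conjPart, map_sum, Finset.smul_sum, Finset.sum_congr rfl key,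
    Finset.sum_add_distrib, Finset.Nat.sum_antidiagonal_succ,
    Finset.Nat.sum_antidiagonal_succ', ]
  simp only [Nat.cast_zero, zero_mul, zero_smul, zero_add]
  rw [← Finset.sum_add_distrib, ← Finset.sum_add_distrib]
  refine Finset.sum_congr rfl fun jt _ => ?_
  rw [map_zsmul, WeakModule.L_one_mode _ (expL_mem hu _), L_one_expL]
  rw [show 2 * p - ((jt.1 + 1 : ℕ) : ℤ) - s - 2 + 1 = 2 * p - jt.1 - s - 2 by push_cast; ring,
    show s + ((jt.2 + 1 : ℕ) : ℤ) = s + jt.2 + 1 by push_cast; ring]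
  simp only [WeakModule.mode_smul, LinearMap.smul_apply, smul_add, smul_smul]
  simp only [← Int.cast_smul_eq_zsmul ℂ, smul_smul]
  push_cast
  module

/-- Conjugation of modes by `e^{xL(1)}`. -/
theorem expL_mode {p : ℤ} {u : V} (hu : u ∈ 𝒱.homog p) (s : ℤ) (v : V) (r : ℕ) :
    𝒱.expL r (𝒱.adjoint.mode u s v)
      = ∑ aj ∈ Finset.HasAntidiagonal.antidiagonal r,
          𝒱.conjPart p s u aj.1 (𝒱.expL aj.2 v) := by
  induction r with
  | zero => simp [conjPart, expL_zero]
  | succ r ih =>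
    have hz : ((r + 1 : ℕ) : ℂ) ≠ 0 := by exact_mod_cast Nat.succ_ne_zero r
    refine smul_right_injective V hz ?_
    simp only
    rw [← L_one_expL, ih, map_sum]
    have key : ∀ aj ∈ Finset.HasAntidiagonal.antidiagonal (r + 1),
        ((r + 1 : ℕ) : ℂ) • 𝒱.conjPart p s u aj.1 (𝒱.expL aj.2 v)
        = (aj.1 : ℂ) • 𝒱.conjPart p s u aj.1 (𝒱.expL aj.2 v)
          + (aj.2 : ℂ) • 𝒱.conjPart p s u aj.1 (𝒱.expL aj.2 v) := by
      rintro ⟨a, j⟩ h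
      rw [Finset.HasAntidiagonal.mem_antidiagonal] at h
      rw [← add_smul, ← Nat.cast_add, h]
    rw [Finset.smul_sum, Finset.sum_congr rfl key, Finset.sum_add_distrib,
      Finset.Nat.sum_antidiagonal_succ, Finset.Nat.sum_antidiagonal_succ']
    simp only [Nat.cast_zero, zero_smul, zero_add]
    rw [← Finset.sum_add_distrib]
    refine Finset.sum_congr rfl fun aj _ => ?_
    rw [L_one_conjPart hu, L_one_expL, add_comm]
    congr 1
    · rw [← Int.cast_smul_eq_zsmul ℂ]; push_cast; rfl
    · simp only [conjPart, Finset.smul_sum, map_smul]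
      exact Finset.sum_congr rfl fun _ _ => smul_comm _ _ _

/-- Commutator of `L(1)^j / j!` with `L(-1)`. -/
theorem expL_succ_L_neg_one {k : ℤ} {v : V} (hv : v ∈ 𝒱.homog k) (j : ℕ) :
    𝒱.expL (j + 1) (𝒱.adjoint.L (-1) v)
      = 𝒱.adjoint.L (-1) (𝒱.expL (j + 1) v) + (2 * k - j : ℤ) • 𝒱.expL j v := by
  have hc : ∀ x : V, 𝒱.adjoint.L 1 (𝒱.adjoint.L (-1) x)
      = 𝒱.adjoint.L (-1) (𝒱.adjoint.L 1 x) + (2 : ℂ) • 𝒱.adjoint.L 0 x := by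
    intro x
    have h := WeakModule.L_one_mode 𝒱.adjoint (WeakModule.omega_mem (𝒱 := 𝒱)) 0 x
    rw [L_one_omega, WeakModule.mode_zero] at h
    refine h.trans ?_
    norm_num
    rw [two_smul, two_smul]
    rfl
  induction j with
  | zero =>
    have e1 : ∀ x, 𝒱.expL 1 x = 𝒱.adjoint.L 1 x := by simp [expL]
    rw [e1, hc, e1, WeakModule.mem_homog.mp hv, expL_zero, smul_smul, ← Int.cast_smul_eq_zsmul ℂ]
    push_cast
    simp
  | succ j ih =>
    have hz : ((j + 1 + 1 : ℕ) : ℂ) ≠ 0 := by exact_mod_cast Nat.succ_ne_zero (j + 1)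
    refine smul_right_injective V hz ?_
    simp only
    rw [← L_one_expL, ih, map_add, hc, map_zsmul, L_one_expL, L_one_expL,
      WeakModule.mem_homog.mp (expL_mem hv (j + 1)), map_smul]
    simp only [← Int.cast_smul_eq_zsmul ℂ, smul_smul, smul_add]
    push_cast
    module

theorem expL_zero_L_neg_one (v : V) :
    𝒱.expL 0 (𝒱.adjoint.L (-1) v) = 𝒱.adjoint.L (-1) (𝒱.expL 0 v) := by
  rw [expL_zero, expL_zero]

end VertexOperatorAlgebra

end DividedPowers

/-! ### Representations of `g(V)` and their contragredients -/

theorem EvZero.finsum_finset_sum {X ι : Type*} [AddCommGroup X] (s : Finset ι) {f : ι → ℕ → X}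
    (h : ∀ i ∈ s, EvZero (f i)) : ∑ᶠ t, ∑ i ∈ s, f i t = ∑ i ∈ s, ∑ᶠ t, f i t :=
  finsum_sum_comm _ _ fun i hi => (h i hi).support_finite

section ModeRep

variable {V : Type u} [AddCommGroup V] [Module ℂ V]

/-- A representation of the Lie algebra `g(V)`: operators `y n v = v(n)` with the derivative relation
and the commutator formula. No truncation is required. -/
structure ModeRep (𝒱 : VertexOperatorAlgebra V) (X : Type*) [AddCommGroup X] [Module ℂ X] where
  y : ℤ → V →ₗ[ℂ] Module.End ℂ X
  deriv : ∀ (v : V) (n : ℤ) (x : X), y n (𝒱.adjoint.L (-1) v) x = -(n : ℂ) • y (n - 1) v x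
  bracket : ∀ (u v : V) (m n : ℤ) (x : X), y m u (y n v x) - y n v (y m u x)
    = ∑ᶠ i : ℕ, Ring.choose m i • y (n + (m - i)) (𝒱.adjoint.mode u i v) x

variable {𝒱 : VertexOperatorAlgebra V}

/-- The representation of `g(V)` on a weak module. -/
def WeakModule.rep {W : Type u} [AddCommGroup W] [Module ℂ W] (M : WeakModule 𝒱 W) :
    ModeRep 𝒱 W where
  y n := M.modeLin n
  deriv v n x := congrArg (fun f => f x) (M.mode_L_neg_one v n)
  bracket u v m n x := M.mode_comm u v x m n

namespace VertexOperatorAlgebra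

theorem bound_expL_expL (u v : V) : ∃ K : ℤ, ∀ j j' : ℕ, ∀ k ≥ K,
    𝒱.adjoint.mode (𝒱.expL j u) k (𝒱.expL j' v) = 0 := by
  obtain ⟨N, hN⟩ := 𝒱.evZero_expL u
  obtain ⟨N', hN'⟩ := 𝒱.evZero_expL v
  choose K hK using fun jj : ℕ × ℕ => 𝒱.adjoint.trunc (𝒱.expL jj.1 u) (𝒱.expL jj.2 v)
  refine ⟨∑ jj ∈ Finset.range N ×ˢ Finset.range N', |K jj|, fun j j' k hk => ?_⟩
  by_cases hj : j < N
  · by_cases hj' : j' < N'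
    · have := Finset.single_le_sum (f := fun jj => |K jj|) (fun _ _ => abs_nonneg _)
        (show (j, j') ∈ Finset.range N ×ˢ Finset.range N' by simp [hj, hj'])
      exact hK (j, j') k ((le_abs_self _).trans (this.trans hk))
    · rw [show 𝒱.expL j' v = 0 from hN' j' (by omega), map_zero]
  · rw [show 𝒱.expL j u = 0 from hN j (by omega), WeakModule.mode_zero, LinearMap.zero_apply]

/-- Summation of `φ r (L(1)^r / r! (u_s v))` over `r`, with the conjugation formula `expL_mode`
substituted. -/
theorem finsum_expL_mode {T : Type*} [AddCommGroup T] {p : ℤ} {u : V} (hu : u ∈ 𝒱.homog p)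
    (s : ℤ) (v : V) (φ : ℕ → V →+ T) {N : ℕ} (hNu : ∀ j ≥ N, 𝒱.expL j u = 0)
    (hNv : ∀ j ≥ N, 𝒱.expL j v = 0) :
    ∑ᶠ r : ℕ, φ r (𝒱.expL r (𝒱.adjoint.mode u s v))
      = ∑ j ∈ Finset.range N, ∑ j' ∈ Finset.range N, ∑ᶠ t : ℕ,
          Ring.choose (2 * p - (j : ℤ) - s - 2) t •
            φ (j + t + j') (𝒱.adjoint.mode (𝒱.expL j u) (s + (t : ℤ)) (𝒱.expL j' v)) := by
  obtain ⟨K, hK⟩ := 𝒱.bound_expL_expL u v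
  have hz : ∀ j j' t : ℕ, (K - s).toNat ≤ t →
      𝒱.adjoint.mode (𝒱.expL j u) (s + (t : ℤ)) (𝒱.expL j' v) = 0 :=
    fun j j' t ht => hK _ _ _ (by omega)
  generalize (K - s).toNat = N2 at hz
  have hc : ∀ a j', N + N2 ≤ a → 𝒱.conjPart p s u a (𝒱.expL j' v) = 0 := by
    intro a j' ha
    refine Finset.sum_eq_zero fun jt h => ?_
    rw [Finset.HasAntidiagonal.mem_antidiagonal] at h
    by_cases hj : N ≤ jt.1
    · rw [hNu _ hj, WeakModule.mode_zero, LinearMap.zero_apply, smul_zero]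
    · rw [hz _ _ _ (by omega), smul_zero]
  have hc' : ∀ a j', N ≤ j' → 𝒱.conjPart p s u a (𝒱.expL j' v) = 0 := by
    intro a j' ha
    rw [hNv _ ha]
    simp [conjPart]
  have e1 : ∀ r : ℕ, φ r (𝒱.expL r (𝒱.adjoint.mode u s v))
      = ∑ aj ∈ Finset.HasAntidiagonal.antidiagonal r,
        φ (aj.1 + aj.2) (𝒱.conjPart p s u aj.1 (𝒱.expL aj.2 v)) := by
    intro r
    rw [expL_mode hu, map_sum]
    refine Finset.sum_congr rfl fun aj h => ?_
    rw [Finset.HasAntidiagonal.mem_antidiagonal] at h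
    rw [h]
  simp only [e1]
  rw [← EvZero.finsum_antidiagonal
    (F := fun a j' => φ (a + j') (𝒱.conjPart p s u a (𝒱.expL j' v)))
    ⟨N + N2 + N, fun a j' h => by
      by_cases hj : N ≤ j'
      · rw [hc' _ _ hj, map_zero]
      · rw [hc _ _ (by omega), map_zero]⟩,
    finsum_congr fun a => EvZero.finsum_eq (N := N) fun j' hj => by rw [hc' _ _ hj, map_zero],
    EvZero.finsum_finset_sum _ (f := fun j' a => φ (a + j') (𝒱.conjPart p s u a (𝒱.expL j' v)))
      fun j' _ => ⟨N + N2, fun a ha => by simp only [hc _ _ ha, map_zero]⟩, Finset.sum_comm]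
  refine Finset.sum_congr rfl fun j' _ => ?_
  have e2 : ∀ a : ℕ, φ (a + j') (𝒱.conjPart p s u a (𝒱.expL j' v))
      = ∑ jt ∈ Finset.HasAntidiagonal.antidiagonal a, Ring.choose (2 * p - (jt.1 : ℤ) - s - 2) jt.2 •
        φ (jt.1 + jt.2 + j') (𝒱.adjoint.mode (𝒱.expL jt.1 u) (s + jt.2) (𝒱.expL j' v)) := by
    intro a
    rw [conjPart, map_sum]
    refine Finset.sum_congr rfl fun jt h => ?_
    rw [Finset.HasAntidiagonal.mem_antidiagonal] at h
    rw [map_zsmul, h]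
  simp only [e2]
  rw [← EvZero.finsum_antidiagonal (F := fun j t => Ring.choose (2 * p - (j : ℤ) - s - 2) t •
        φ (j + t + j') (𝒱.adjoint.mode (𝒱.expL j u) (s + (t : ℤ)) (𝒱.expL j' v)))
    ⟨N + N2, fun j t h => by
      by_cases hj : N ≤ j
      · rw [hNu _ hj, WeakModule.mode_zero, LinearMap.zero_apply, map_zero, smul_zero]
      · rw [hz _ _ _ (by omega), map_zero, smul_zero]⟩]
  refine EvZero.finsum_eq fun j hj => (finsum_congr fun t => ?_).trans finsum_zero
  rw [hNu _ hj, WeakModule.mode_zero, LinearMap.zero_apply, map_zero, smul_zero]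

end VertexOperatorAlgebra

namespace ModeRep

variable {X : Type*} [AddCommGroup X] [Module ℂ X] (R : ModeRep 𝒱 X)

theorem evZero_expL (v : V) (x : X) (k : ℕ → ℤ) : EvZero fun j : ℕ => R.y (k j) (𝒱.expL j v) x := by
  obtain ⟨N, hN⟩ := 𝒱.evZero_expL v
  exact ⟨N, fun i hi => by simp [hN i hi]⟩

/-- The coefficient of `x^(-m-1)` in `Y(e^{xL(1)} (-x⁻²)^{L(0)} v, x⁻¹)`, for a representation
of `g(V)`. -/
def opp (m : ℤ) : V →ₗ[ℂ] Module.End ℂ X := 𝒱.extend fun k => (-1 : ℂ) ^ k •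
  LinearMap.mk₂ ℂ (fun v x => ∑ᶠ j : ℕ, R.y (2 * k - j - m - 2) (𝒱.expL j v) x)
    (fun u v x => by
      rw [← EvZero.finsum_add (R.evZero_expL ..) (R.evZero_expL ..)]
      simp)
    (fun c v x => by
      rw [_root_.smul_finsum]
      exact finsum_congr fun j => by simp)
    (fun v x x' => by
      rw [← EvZero.finsum_add (R.evZero_expL ..) (R.evZero_expL ..)]
      simp)
    (fun c v x => by
      rw [_root_.smul_finsum]
      exact finsum_congr fun j => by simp)

theorem opp_apply {k : ℤ} {v : V} (hv : v ∈ 𝒱.homog k) (m : ℤ) (x : X) :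
    R.opp m v x = (k.negOnePow : ℤ) • ∑ᶠ j : ℕ, R.y (2 * k - j - m - 2) (𝒱.expL j v) x := by
  rw [opp, 𝒱.extend_apply _ hv, ← Int.cast_smul_eq_zsmul ℂ, Int.cast_negOnePow]
  rfl

theorem opp_eq_sum {k : ℤ} {v : V} (hv : v ∈ 𝒱.homog k) {N : ℕ} (hN : ∀ j ≥ N, 𝒱.expL j v = 0)
    (m : ℤ) (x : X) : R.opp m v x = (k.negOnePow : ℤ) •
      ∑ j ∈ Finset.range N, R.y (2 * k - j - m - 2) (𝒱.expL j v) x := by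
  rw [R.opp_apply hv, EvZero.finsum_eq fun i hi => by rw [hN i hi]; simp]

theorem _root_.WeakModule.opp_rep {W : Type u} [AddCommGroup W] [Module ℂ W] (M : WeakModule 𝒱 W)
    (m : ℤ) (v : V) : M.rep.opp m v = M.oppMode m v := by
  induction v using 𝒱.homog_induction with
  | h k v hv =>
    ext x
    rw [opp_apply _ hv, WeakModule.oppMode, 𝒱.extend_apply _ hv, ← Int.cast_smul_eq_zsmul ℂ,
      Int.cast_negOnePow, _root_.smul_finsum]
    refine finsum_congr fun j => ?_
    simp only [VertexOperatorAlgebra.expL, LinearMap.smul_apply, map_smul, smul_smul]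
    rfl
  | h0 => simp
  | hadd u v hu hv => simp [hu, hv]

theorem opp_L_neg_one (v : V) (m : ℤ) (x : X) :
    R.opp m (𝒱.adjoint.L (-1) v) x = -(m : ℂ) • R.opp (m - 1) v x := by
  induction v using 𝒱.homog_induction with
  | h k v hv =>
    rw [R.opp_apply hv, R.opp_apply (WeakModule.L_neg_one_mem hv), Int.negOnePow_succ,
      Units.val_neg, neg_smul, neg_smul, neg_inj, smul_comm]
    congr 1
    have h1 : EvZero fun j : ℕ => (2 * k - j - m : ℂ) • R.y (2 * k - j - m - 1) (𝒱.expL j v) x := by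
      obtain ⟨N, hN⟩ := 𝒱.evZero_expL v
      exact ⟨N, fun i hi => by simp [hN i hi]⟩
    have h2 : EvZero fun j : ℕ => (2 * k - j : ℂ) • R.y (2 * k - j - m - 1) (𝒱.expL j v) x := by
      obtain ⟨N, hN⟩ := 𝒱.evZero_expL v
      exact ⟨N, fun i hi => by simp [hN i hi]⟩
    have e0 : R.y (2 * (k + 1) - (0 : ℕ) - m - 2) (𝒱.expL 0 (𝒱.adjoint.L (-1) v)) x
        = -((2 * k - (0 : ℕ) - m : ℂ) • R.y (2 * k - (0 : ℕ) - m - 1) (𝒱.expL 0 v) x) := by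
      rw [VertexOperatorAlgebra.expL_zero_L_neg_one, R.deriv, neg_smul]
      congr 2
      · push_cast; ring
      · congr 2; push_cast; ring
    have e1 : ∀ j : ℕ, R.y (2 * (k + 1) - (j + 1 : ℕ) - m - 2)
          (𝒱.expL (j + 1) (𝒱.adjoint.L (-1) v)) x
        = -((2 * k - (j + 1 : ℕ) - m : ℂ) • R.y (2 * k - (j + 1 : ℕ) - m - 1) (𝒱.expL (j + 1) v) x)
          + (2 * k - j : ℂ) • R.y (2 * k - j - m - 1) (𝒱.expL j v) x := by
      intro j
      rw [VertexOperatorAlgebra.expL_succ_L_neg_one hv, map_add, LinearMap.add_apply, R.deriv,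
        neg_smul, map_zsmul, LinearMap.smul_apply, ← Int.cast_smul_eq_zsmul ℂ]
      rw [show 2 * (k + 1) - ((j + 1 : ℕ) : ℤ) - m - 2 - 1 = 2 * k - (j + 1 : ℕ) - m - 1 by
          push_cast; ring,
        show 2 * (k + 1) - ((j + 1 : ℕ) : ℤ) - m - 2 = 2 * k - j - m - 1 by push_cast; ring]
      push_cast
      congr 3
      ring
    have h3 : EvZero fun j : ℕ => -((2 * k - j - m : ℂ) •
        R.y (2 * k - j - m - 1) (𝒱.expL j v) x) := by simpa using EvZero.zero'.sub h1
    rw [EvZero.finsum_succ (R.evZero_expL ..), e0, finsum_congr e1,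
      EvZero.finsum_add (h3.shift 1) h2, ← add_assoc, ← h3.finsum_succ,
      ← EvZero.finsum_add h3 h2, _root_.smul_finsum]
    refine finsum_congr fun j => ?_
    rw [← neg_smul, ← add_smul, show 2 * k - j - (m - 1) - 2 = 2 * k - (j : ℤ) - m - 1 by ring]
    congr 1
    ring
  | h0 => simp
  | hadd u v hu hv => simp only [map_add, LinearMap.add_apply, hu, hv, smul_add]

section Iterate

variable {T : Type*} [AddCommGroup T] (β : X →+ T) (x : X) {p q : ℤ} {u v : V}
  (hu : u ∈ 𝒱.homog p) (hv : v ∈ 𝒱.homog q) {N : ℕ} (hNu : ∀ j ≥ N, 𝒱.expL j u = 0)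
  (hNv : ∀ j ≥ N, 𝒱.expL j v = 0)

include hu hv hNu hNv

/-- The iterates `(u_l v)` under the opposite operators, in terms of the modes of the iterates of
`L(1)^j u` and `L(1)^j' v`. The indices and signs come from the substitution of `x⁻¹` for `x`. -/
theorem opp_iterate (l m n : ℤ) :
    borcherdsIter (fun a k => β (R.opp k (𝒱.adjoint.mode u a v) x)) l m n
      = -(((p + q + l).negOnePow : ℤ) • ∑ j ∈ Finset.range N, ∑ j' ∈ Finset.range N,
          borcherdsIter (fun a k => β (R.y k (𝒱.adjoint.mode (𝒱.expL j u) a (𝒱.expL j' v)) x)) l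
            (2 * p - j - 2 - m - l) (2 * q - j' - 2 - n - l)) := by
  have key : ∀ i : ℕ, Ring.choose m i • β (R.opp (n + ((m - i : ℤ) : ℤ))
        (𝒱.adjoint.mode u (l + i) v) x)
      = -(((p + q + l).negOnePow : ℤ) • ∑ j ∈ Finset.range N, ∑ j' ∈ Finset.range N, ∑ᶠ t : ℕ,
          (((-1) ^ i * Ring.choose m i) * Ring.choose (2 * p - (j : ℤ) - 2 - l - i) t) •
          β (R.y (2 * q - j' - 2 - n - l + (2 * p - j - 2 - m - l - ((i + t : ℕ) : ℤ)))
            (𝒱.adjoint.mode (𝒱.expL j u) (l + ((i + t : ℕ) : ℤ)) (𝒱.expL j' v)) x)) := by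
    intro i
    have hw : 𝒱.adjoint.mode u (l + i) v ∈ 𝒱.homog (p + q - (l + i) - 1) :=
      WeakModule.mode_mem_homog hu hv _ rfl
    have hs : ((p + q - (l + i) - 1).negOnePow : ℤ)
        = -(((p + q + l).negOnePow : ℤ) * (-1) ^ i) := by
      rw [show p + q - (l + i) - 1 = (p + q + l) + (i : ℤ) + 1 - 2 * (l + i + 1) by ring,
        Int.negOnePow_sub, Int.negOnePow_even (2 * (l + i + 1)) ⟨l + i + 1, by ring⟩, mul_one,
        Int.negOnePow_succ, Int.negOnePow_add]
      simp [Int.negOnePow_def]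
    rw [R.opp_apply hw, map_zsmul, EvZero.map_finsum β (R.evZero_expL ..)]
    have := VertexOperatorAlgebra.finsum_expL_mode hu (l + i) v (T := T)
      (φ := fun r => (β.comp (((R.y (2 * (p + q - (l + i) - 1) - r
        - (n + ((m - i : ℤ) : ℤ)) - 2)).flip x).toAddMonoidHom))) hNu hNv
    simp only [AddMonoidHom.comp_apply, LinearMap.toAddMonoidHom_coe, LinearMap.flip_apply] at this
    rw [this, hs, neg_smul, smul_neg, neg_inj, mul_smul, smul_comm]
    congr 1
    rw [smul_smul, mul_comm, Finset.smul_sum]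
    refine Finset.sum_congr rfl fun j _ => ?_
    rw [Finset.smul_sum]
    refine Finset.sum_congr rfl fun j' _ => ?_
    obtain ⟨K, hK⟩ := 𝒱.bound_expL_expL u v
    rw [EvZero.smul_finsum]
    · refine finsum_congr fun t => ?_
      rw [smul_smul, show 2 * p - (j : ℤ) - (l + i) - 2 = 2 * p - j - 2 - l - i by ring]
      refine congrArg _ (congrArg β (congrArg₂ (fun a b => R.y a b x) ?_ ?_))
      · push_cast; ring
      · push_cast; rw [add_assoc]
    · refine EvZero.zsmul ⟨(K - (l + i)).toNat, fun t ht => ?_⟩ _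
      simp only [hK _ _ (l + (i : ℤ) + (t : ℤ)) (by omega)]
      simp
  unfold borcherdsIter
  have hK : ∀ j j' : ℕ, EvZero fun I : ℕ =>
      β (R.y (2 * q - j' - 2 - n - l + (2 * p - j - 2 - m - l - (I : ℤ)))
            (𝒱.adjoint.mode (𝒱.expL j u) (l + (I : ℤ)) (𝒱.expL j' v)) x) := by
    intro j j'
    obtain ⟨K, hK⟩ := 𝒱.bound_expL_expL u v
    refine ⟨(K - l).toNat, fun t ht => ?_⟩
    simp only [hK _ _ (l + (t : ℤ)) (by omega)]
    simp
  have hE : ∀ j j' : ℕ, EvZero fun i : ℕ => ∑ᶠ t : ℕ,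
          (((-1) ^ i * Ring.choose m i) * Ring.choose (2 * p - (j : ℤ) - 2 - l - i) t) •
          β (R.y (2 * q - j' - 2 - n - l + (2 * p - j - 2 - m - l - ((i + t : ℕ) : ℤ)))
            (𝒱.adjoint.mode (𝒱.expL j u) (l + ((i + t : ℕ) : ℤ)) (𝒱.expL j' v)) x) := by
    intro j j'
    obtain ⟨N, hN⟩ := hK j j'
    refine ⟨N, fun i hi => (finsum_congr fun t => ?_).trans finsum_zero⟩
    have := hN (i + t) (by omega)
    simp only at this
    rw [this, smul_zero]
  simp only [Int.cast_id]
  rw [finsum_congr key, finsum_neg_distrib, neg_inj, ← EvZero.smul_finsum]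
  · congr 1
    rw [EvZero.finsum_finset_sum _ fun j _ => EvZero.sum _ fun j' _ => hE j j']
    refine Finset.sum_congr rfl fun j _ => ?_
    rw [EvZero.finsum_finset_sum _ fun j' _ => hE j j']
    refine Finset.sum_congr rfl fun j' _ => ?_
    rw [EvZero.finsum_smul_antidiagonal (hK j j') (fun i t =>
      ((-1) ^ i * Ring.choose m i) * Ring.choose (2 * p - (j : ℤ) - 2 - l - i) t)]
    refine finsum_congr fun I => ?_
    rw [sum_neg_one_pow_choose_mul_choose]
    congr 2
    ring
  · exact EvZero.sum _ fun j _ => EvZero.sum _ fun j' _ => hE j j'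

/-- A product of two opposite operators, in terms of the modes of `L(1)^j u` and `L(1)^j' v`. -/
theorem opp_opp (m n : ℤ) : β (R.opp n v (R.opp m u x))
    = ((p + q).negOnePow : ℤ) • ∑ j ∈ Finset.range N, ∑ j' ∈ Finset.range N,
      β (R.y (2 * q - j' - 2 - n) (𝒱.expL j' v) (R.y (2 * p - j - 2 - m) (𝒱.expL j u) x)) := by
  rw [R.opp_eq_sum hu hNu, R.opp_eq_sum hv hNv, Finset.sum_comm, Int.negOnePow_add, Units.val_mul,
    mul_comm (p.negOnePow : ℤ), mul_smul, map_zsmul, map_sum]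
  refine congrArg ((q.negOnePow : ℤ) • ·) ?_
  refine Eq.trans ?_ Finset.smul_sum.symm
  refine Finset.sum_congr rfl fun j' _ => ?_
  rw [map_zsmul, map_zsmul, map_sum, map_sum]
  congr 1
  refine Finset.sum_congr rfl fun j _ => ?_
  rw [show 2 * q - (j' : ℤ) - n - 2 = 2 * q - j' - 2 - n by ring,
    show 2 * p - (j : ℤ) - m - 2 = 2 * p - j - 2 - m by ring]

end Iterate

theorem evZero_opp (u v : V) (x : X) (l : ℤ) (k : ℕ → ℤ) :
    EvZero fun i : ℕ => R.opp (k i) (𝒱.adjoint.mode u (l + i) v) x := by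
  obtain ⟨N, hN⟩ := 𝒱.adjoint.evZero_mode u v l
  refine ⟨N, fun i hi => ?_⟩
  have := hN i hi
  simp only at this
  simp [this]

theorem exists_expL_bound (u v : V) :
    ∃ N, (∀ j ≥ N, 𝒱.expL j u = 0) ∧ ∀ j ≥ N, 𝒱.expL j v = 0 := by
  obtain ⟨N, hN⟩ := 𝒱.evZero_expL u
  obtain ⟨N', hN'⟩ := 𝒱.evZero_expL v
  exact ⟨max N N', fun j hj => hN j ((le_max_left _ _).trans hj),
    fun j hj => hN' j ((le_max_right _ _).trans hj)⟩

/-- The opposite operators satisfy the commutator formula in reverse order. -/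
theorem opp_bracket (u v : V) (m n : ℤ) (x : X) :
    R.opp n v (R.opp m u x) - R.opp m u (R.opp n v x)
      = ∑ᶠ i : ℕ, Ring.choose m i • R.opp (n + (m - i)) (𝒱.adjoint.mode u i v) x := by
  have hz : ∀ u v : V, EvZero fun i : ℕ => R.opp (n + (m - i)) (𝒱.adjoint.mode u i v) x :=
    fun u v => by simpa using R.evZero_opp u v x 0 fun i => n + (m - i)
  induction u using 𝒱.homog_induction with
  | h p u hu =>
    induction v using 𝒱.homog_induction with
    | h q v hv =>
      obtain ⟨N, hNu, hNv⟩ := exists_expL_bound u v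
      have h := R.opp_iterate (AddMonoidHom.id X) x hu hv hNu hNv 0 m n
      unfold borcherdsIter at h
      simp only [zero_add, Int.cast_id, AddMonoidHom.id_apply, ← R.bracket, sub_zero,
        add_zero] at h
      have h1 := R.opp_opp (AddMonoidHom.id X) x hu hv hNu hNv m n
      have h2 := R.opp_opp (AddMonoidHom.id X) x hv hu hNv hNu n m
      rw [Finset.sum_comm, add_comm q p] at h2
      simp only [AddMonoidHom.id_apply] at h1 h2
      rw [h, h1, h2, ← smul_sub, ← smul_neg]
      congr 1
      simp only [Finset.sum_sub_distrib, neg_sub]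
    | h0 => simp
    | hadd v v' h h' =>
      simp only [map_add, LinearMap.add_apply, smul_add]
      rw [EvZero.finsum_add ((hz _ _).zsmul _) ((hz _ _).zsmul _), ← h, ← h']
      abel
  | h0 => simp
  | hadd u u' h h' =>
    simp only [WeakModule.mode_add, map_add, LinearMap.add_apply, smul_add]
    rw [EvZero.finsum_add ((hz _ _).zsmul _) ((hz _ _).zsmul _), ← h, ← h']
    abel

/-- The contragredient representation on the full dual space. -/
def dual : ModeRep 𝒱 (Module.Dual ℂ X) where
  y n := Module.Dual.transpose ∘ₗ R.opp n
  deriv v n β := by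
    ext x
    simp [Module.Dual.transpose_apply, R.opp_L_neg_one]
  bracket u v m n β := by
    ext x
    have hz : EvZero fun i : ℕ => R.opp (n + (m - i)) (𝒱.adjoint.mode u i v) x := by
      simpa using R.evZero_opp u v x 0 fun i => n + (m - i)
    obtain ⟨N, hN⟩ := 𝒱.adjoint.evZero_mode u v 0
    have hN : ∀ i ≥ N, 𝒱.adjoint.mode u (i : ℤ) v = 0 := by simpa using hN
    have hz' : EvZero fun i : ℕ => Ring.choose m i •
        (Module.Dual.transpose ∘ₗ R.opp (n + (m - i))) (𝒱.adjoint.mode u i v) β :=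
      ⟨N, fun i hi => by simp only [hN i hi]; simp⟩
    have h := congrArg β (R.opp_bracket u v m n x)
    rw [map_sub, ← LinearMap.toAddMonoidHom_coe β, EvZero.map_finsum _ (hz.zsmul _)] at h
    have e := EvZero.map_finsum (LinearMap.toAddMonoidHom (LinearMap.applyₗ (R := ℂ)
      (M := X) (M₂ := ℂ) x)) hz'
    refine Eq.trans ?_ (h.trans (Eq.trans ?_ e.symm))
    · rfl
    · exact finsum_congr fun i => by
        simp [Module.Dual.transpose_apply]

theorem dual_apply (n : ℤ) (v : V) (β : Module.Dual ℂ X) (x : X) :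
    R.dual.y n v β x = β (R.opp n v x) := rfl

section Jacobi

variable {T : Type*} [AddCommGroup T] (β : X →+ T) (x : X)
  (hP : ∀ u v, FinFst fun a b => β (R.y a u (R.y b v x)))
  (hQ : ∀ u v, FinSnd fun a b => β (R.y b v (R.y a u x)))
  (hJ : ∀ u v l m n, borcherds (fun a b => β (R.y a u (R.y b v x)))
    (fun a b => β (R.y b v (R.y a u x))) (fun a b => β (R.y b (𝒱.adjoint.mode u a v) x)) l m n = 0)

include hP hQ hJ

/-- If matrix coefficients satisfy the Jacobi identity, then so do the matrix coefficients of the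
opposite operators, in reverse order. -/
theorem opp_jacobi_homog {p q : ℤ} {u v : V} (hu : u ∈ 𝒱.homog p) (hv : v ∈ 𝒱.homog q) :
    (FinFst fun a b => β (R.opp b v (R.opp a u x))) ∧
    (FinSnd fun a b => β (R.opp a u (R.opp b v x))) ∧ ∀ l m n : ℤ,
    borcherds (fun a b => β (R.opp b v (R.opp a u x))) (fun a b => β (R.opp a u (R.opp b v x)))
      (fun a b => β (R.opp b (𝒱.adjoint.mode u a v) x)) l m n = 0 := by
  obtain ⟨N, hNu, hNv⟩ := exists_expL_bound u v
  have e1 : ∀ m n : ℤ, β (R.opp n v (R.opp m u x)) = _ := R.opp_opp β x hu hv hNu hNv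
  have e2 : ∀ m n : ℤ, β (R.opp m u (R.opp n v x)) = ((p + q).negOnePow : ℤ) •
      ∑ j ∈ Finset.range N, ∑ j' ∈ Finset.range N,
      β (R.y (2 * p - j - 2 - m) (𝒱.expL j u) (R.y (2 * q - j' - 2 - n) (𝒱.expL j' v) x)) := by
    intro m n
    rw [R.opp_opp β x hv hu hNv hNu, Finset.sum_comm, add_comm q p]
  have f1 : ∀ (m n : ℤ) (j j' : ℕ), EvZero fun i : ℕ => β (R.y (2 * q - j' - 2 - (n + i))
      (𝒱.expL j' v) (R.y (2 * p - j - 2 - (m - i)) (𝒱.expL j u) x)) := fun m n j j' =>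
    (hQ (𝒱.expL j u) (𝒱.expL j' v) (2 * p - j - 2 - m) (2 * q - j' - 2 - n)).congr fun i =>
      congrArg₂ (fun a b => β (R.y b (𝒱.expL j' v) (R.y a (𝒱.expL j u) x)))
        (by ring) (by push_cast; ring)
  have f2 : ∀ (m n : ℤ) (j j' : ℕ), EvZero fun i : ℕ => β (R.y (2 * p - j - 2 - (m + i))
      (𝒱.expL j u) (R.y (2 * q - j' - 2 - (n - i)) (𝒱.expL j' v) x)) := fun m n j j' =>
    (hP (𝒱.expL j u) (𝒱.expL j' v) (2 * p - j - 2 - m) (2 * q - j' - 2 - n)).congr fun i =>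
      congrArg₂ (fun a b => β (R.y a (𝒱.expL j u) (R.y b (𝒱.expL j' v) x)))
        (by ring) (by push_cast; ring)
  have g1 : ∀ l m n : ℤ, borcherdsFst (fun a b => β (R.opp b v (R.opp a u x))) l m n
      = ((p + q).negOnePow : ℤ) • ∑ j ∈ Finset.range N, ∑ j' ∈ Finset.range N,
        borcherdsSnd (fun a b => β (R.y b (𝒱.expL j' v) (R.y a (𝒱.expL j u) x))) l
          (2 * p - j - 2 - m - l) (2 * q - j' - 2 - n - l) := by
    intro l m n
    unfold borcherdsFst borcherdsSnd
    simp only [Int.cast_id, e1]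
    have := fun j j' => (f1 (m + l) n j j').zsmul fun i => (-1) ^ i * Ring.choose l i
    simp only [smul_comm _ ((p + q).negOnePow : ℤ), Finset.smul_sum]
    rw [EvZero.finsum_finset_sum _ fun j _ => EvZero.sum _ fun j' _ => (this j j').zsmul _]
    refine Finset.sum_congr rfl fun j _ => ?_
    rw [EvZero.finsum_finset_sum _ fun j' _ => (this j j').zsmul _]
    refine Finset.sum_congr rfl fun j' _ => ?_
    rw [← EvZero.smul_finsum (this j j')]
    refine congrArg (((p + q).negOnePow : ℤ) • ·) (finsum_congr fun i => ?_)
    exact congrArg (((-1) ^ i * Ring.choose l i) • ·)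
      (congrArg₂ (fun a b => β (R.y b (𝒱.expL j' v) (R.y a (𝒱.expL j u) x))) (by ring) (by ring))
  have g2 : ∀ l m n : ℤ, borcherdsSnd (fun a b => β (R.opp a u (R.opp b v x))) l m n
      = ((p + q).negOnePow : ℤ) • ∑ j ∈ Finset.range N, ∑ j' ∈ Finset.range N,
        borcherdsFst (fun a b => β (R.y a (𝒱.expL j u) (R.y b (𝒱.expL j' v) x))) l
          (2 * p - j - 2 - m - l) (2 * q - j' - 2 - n - l) := by
    intro l m n
    unfold borcherdsFst borcherdsSnd
    simp only [Int.cast_id, e2]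
    have : ∀ j j' : ℕ, EvZero fun i : ℕ => ((-1) ^ i * Ring.choose l i) •
      β (R.y (2 * p - j - 2 - (m + i))
      (𝒱.expL j u) (R.y (2 * q - j' - 2 - (n + (l - i))) (𝒱.expL j' v) x)) := fun j j' =>
      EvZero.zsmul ((f2 m (n + l) j j').congr fun i => congrArg₂ (fun a b =>
        β (R.y a (𝒱.expL j u) (R.y b (𝒱.expL j' v) x))) rfl (by ring)) _
    simp only [smul_comm _ ((p + q).negOnePow : ℤ), Finset.smul_sum]
    rw [EvZero.finsum_finset_sum _ fun j _ => EvZero.sum _ fun j' _ => (this j j').zsmul _]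
    refine Finset.sum_congr rfl fun j _ => ?_
    rw [EvZero.finsum_finset_sum _ fun j' _ => (this j j').zsmul _]
    refine Finset.sum_congr rfl fun j' _ => ?_
    rw [← EvZero.smul_finsum (this j j')]
    refine congrArg (((p + q).negOnePow : ℤ) • ·) (finsum_congr fun i => ?_)
    exact congrArg (((-1) ^ i * Ring.choose l i) • ·)
      (congrArg₂ (fun a b => β (R.y a (𝒱.expL j u) (R.y b (𝒱.expL j' v) x))) (by ring) (by ring))
  refine ⟨fun m n => ?_, fun m n => ?_, fun l m n => ?_⟩
  · simp only [e1, Int.cast_id]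
    exact (EvZero.sum _ fun j _ => EvZero.sum _ fun j' _ => f1 m n j j').zsmul _
  · simp only [e2, Int.cast_id]
    refine (EvZero.sum _ fun j _ => EvZero.sum _ fun j' _ => (f2 m n j j').congr fun i => ?_).zsmul _
    rw [sub_eq_add_neg n]
  · unfold borcherds
    rw [R.opp_iterate β x hu hv hNu hNv, g1, g2, sub_neg_eq_add, Int.negOnePow_add (p + q),
      Units.val_mul, mul_smul, smul_comm (l.negOnePow : ℤ), ← smul_sub, ← smul_add]
    simp only [Finset.smul_sum]
    simp only [← Finset.sum_sub_distrib, ← Finset.sum_add_distrib]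
    refine (congrArg (((p + q).negOnePow : ℤ) • ·) (Finset.sum_eq_zero fun j _ =>
      Finset.sum_eq_zero fun j' _ => ?_)).trans (smul_zero _)
    have h := hJ (𝒱.expL j u) (𝒱.expL j' v) l (2 * p - j - 2 - m - l) (2 * q - j' - 2 - n - l)
    unfold borcherds at h
    have h' := congrArg (fun t => -((l.negOnePow : ℤ) • t)) h
    simp only [smul_zero, neg_zero] at h'
    rw [← h']
    have hl : (l.negOnePow : ℤ) * (l.negOnePow : ℤ) = 1 := by
      rw [← Units.val_mul, ← Int.negOnePow_add, Int.negOnePow_even _ ⟨l, rfl⟩, Units.val_one]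
    simp only [smul_sub, smul_smul, hl]
    abel

/-- The Jacobi identity for the opposite operators, for vectors that need not be homogeneous. -/
theorem opp_jacobi (u v : V) :
    (FinFst fun a b => β (R.opp b v (R.opp a u x))) ∧
    (FinSnd fun a b => β (R.opp a u (R.opp b v x))) ∧ ∀ l m n : ℤ,
    borcherds (fun a b => β (R.opp b v (R.opp a u x))) (fun a b => β (R.opp a u (R.opp b v x)))
      (fun a b => β (R.opp b (𝒱.adjoint.mode u a v) x)) l m n = 0 := by
  have hI : ∀ u v, FinIter fun a b => β (R.opp b (𝒱.adjoint.mode u a v) x) := by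
    intro u v
    obtain ⟨K, hK⟩ := 𝒱.adjoint.trunc u v
    exact ⟨K, fun k hk n => by simp [hK k hk]⟩
  induction u using 𝒱.homog_induction with
  | h p u hu =>
    induction v using 𝒱.homog_induction with
    | h q v hv => exact R.opp_jacobi_homog β x hP hQ hJ hu hv
    | h0 =>
      refine ⟨fun _ _ => by simpa using EvZero.zero', fun _ _ => by simpa using EvZero.zero',
        fun l m n => ?_⟩
      simp [borcherds, borcherdsFst, borcherdsSnd, borcherdsIter]
    | hadd v v' h h' =>
      simp only [map_add, LinearMap.add_apply]
      refine ⟨fun m n => (h.1 m n).add (h'.1 m n), fun m n => (h.2.1 m n).add (h'.2.1 m n),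
        fun l m n => ?_⟩
      rw [borcherds_add h.1 h'.1 h.2.1 h'.2.1 (hI _ _) (hI _ _), h.2.2, h'.2.2, add_zero]
  | h0 =>
    refine ⟨fun _ _ => by simpa using EvZero.zero', fun _ _ => by simpa using EvZero.zero',
      fun l m n => ?_⟩
    simp [borcherds, borcherdsFst, borcherdsSnd, borcherdsIter]
  | hadd u u' h h' =>
    simp only [map_add, LinearMap.add_apply, WeakModule.mode_add]
    refine ⟨fun m n => (h.1 m n).add (h'.1 m n), fun m n => (h.2.1 m n).add (h'.2.1 m n),
      fun l m n => ?_⟩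
    rw [borcherds_add h.1 h'.1 h.2.1 h'.2.1 (hI _ _) (hI _ _), h.2.2, h'.2.2, add_zero]

end Jacobi

end ModeRep
end ModeRep

/-! ### The enveloping algebra -/

section Enveloping

variable {V : Type u} [AddCommGroup V] [Module ℂ V] {𝒱 : VertexOperatorAlgebra V}

namespace ModeRep

variable {X : Type*} [AddCommGroup X] [Module ℂ X] (R : ModeRep 𝒱 X)

theorem bracket_finsum_evZero (u v : V) (k : ℕ → ℤ) (x : X) :
    EvZero fun i : ℕ => R.y (k i) (𝒱.adjoint.mode u i v) x := by
  obtain ⟨N, hN⟩ := 𝒱.adjoint.evZero_mode u v 0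
  refine ⟨N, fun i hi => ?_⟩
  have := hN i hi
  simp only [zero_add] at this
  simp [this]

/-- The linear map `v ⊗ t^n ↦ v(n)`. -/
def lin : V ⊗[ℂ] ℂ[T;T⁻¹] →ₗ[ℂ] Module.End ℂ X :=
  TensorProduct.lift ((Finsupp.linearCombination ℂ R.y ∘ₗ
    (AddMonoidAlgebra.coeffLinearEquiv ℂ : ℂ[T;T⁻¹] ≃ₗ[ℂ] ℤ →₀ ℂ).toLinearMap).flip)

theorem lin_tmul_T (v : V) (n : ℤ) : R.lin (v ⊗ₜ LaurentPolynomial.T n) = R.y n v := by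
  simp only [lin, TensorProduct.lift.tmul, LinearMap.flip_apply, LinearMap.comp_apply]
  have : (AddMonoidAlgebra.coeffLinearEquiv ℂ : ℂ[T;T⁻¹] ≃ₗ[ℂ] ℤ →₀ ℂ).toLinearMap
      (LaurentPolynomial.T n) = Finsupp.single n 1 := rfl
  rw [this]
  simp

/-- The action of `U(g(V))` on a representation of `g(V)`. -/
def env : Env 𝒱 →ₐ[ℂ] Module.End ℂ X :=
  RingQuot.liftAlgHom ℂ (s := EnvRel 𝒱) ⟨TensorAlgebra.lift ℂ R.lin, by
    intro a b h
    cases h with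
    | deriv v m =>
      rw [TensorAlgebra.lift_ι_apply, map_add, map_smul, lin_tmul_T, lin_tmul_T, map_zero]
      ext x
      simp [R.deriv]
    | bracket u v m n =>
      obtain ⟨N, hN⟩ := 𝒱.adjoint.evZero_mode u v 0
      have hN : ∀ i ≥ N, 𝒱.adjoint.mode u (i : ℤ) v = 0 := by simpa using hN
      have h1 : ∀ i ≥ N, Ring.choose m i • ((𝒱.adjoint.mode u i v) ⊗ₜ[ℂ]
          (LaurentPolynomial.T (m + n - i) : ℂ[T;T⁻¹])) = 0 := fun i hi => by
        rw [hN i hi, TensorProduct.zero_tmul, smul_zero]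
      simp only [map_sub, map_mul, TensorAlgebra.lift_ι_apply, lin_tmul_T]
      rw [EvZero.finsum_eq h1, map_sum]
      ext x
      rw [LinearMap.sub_apply, Module.End.mul_apply, Module.End.mul_apply, R.bracket,
        EvZero.finsum_eq (N := N) fun i hi => by rw [hN i hi]; simp, LinearMap.sum_apply]
      refine Finset.sum_congr rfl fun i _ => ?_
      rw [map_zsmul, lin_tmul_T, LinearMap.smul_apply, show m + n - (i : ℤ) = n + (m - i) by ring]⟩

theorem env_gen (v : V) (n : ℤ) : R.env (Env.gen 𝒱 v n) = R.y n v := by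
  unfold env Env.gen
  refine (RingQuot.liftAlgHom_mkAlgHom_apply ℂ _ _ _).trans ?_
  rw [TensorAlgebra.lift_ι_apply, lin_tmul_T]

/-- All matrix entries of `Y(v,x)` have finitely many negative powers of `x`. -/
def Trunc : Prop := ∀ (v : V) (x : X), ∃ K : ℤ, ∀ n ≥ K, R.y n v x = 0

/-- The two sides of the Jacobi identity agree on `x`. -/
def JacobiAt (x : X) : Prop := ∀ (u v : V) (l m n : ℤ),
  jacobiDefect (fun v n => 𝒱.adjoint.mode v n) (fun v n x => R.y n v x)
      (fun v n x => R.y n v x) (fun v n x => R.y n v x) u v x l m n = 0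

variable {R} in
theorem Trunc.finFst (hT : R.Trunc) (u v : V) (x : X) :
    FinFst fun a b => R.y a u (R.y b v x) := by
  intro m n
  obtain ⟨K, hK⟩ := hT v x
  refine ⟨(K - n).toNat, fun i hi => ?_⟩
  simp only [Int.cast_id, hK (n + i) (by omega), map_zero]

variable {R} in
theorem Trunc.finSnd (hT : R.Trunc) (u v : V) (x : X) :
    FinSnd fun a b => R.y b v (R.y a u x) := by
  intro m n
  obtain ⟨K, hK⟩ := hT u x
  refine ⟨(K - m).toNat, fun i hi => ?_⟩
  simp only [hK (m + i) (by omega), map_zero]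

theorem finIter (u v : V) (x : X) : FinIter fun a b => R.y b (𝒱.adjoint.mode u a v) x := by
  obtain ⟨K, hK⟩ := 𝒱.adjoint.trunc u v
  exact ⟨K, fun k hk n => by simp [hK k hk]⟩

variable {R} in
theorem Trunc.jacobiDefect_eq (hT : R.Trunc) (u v : V) (x : X) (l m n : ℤ) :
    jacobiDefect (fun v n => 𝒱.adjoint.mode v n) (fun v n x => R.y n v x)
      (fun v n x => R.y n v x) (fun v n x => R.y n v x) u v x l m n
    = borcherds (fun a b => R.y a u (R.y b v x)) (fun a b => R.y b v (R.y a u x))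
      (fun a b => R.y b (𝒱.adjoint.mode u a v) x) l m n :=
  jacobiDefect_eq_borcherds (fun v n => 𝒱.adjoint.mode v n) (fun v n x => R.y n v x)
    (fun v n x => R.y n v x) (fun v n x => R.y n v x) u v x (hT.finFst u v x) (hT.finSnd u v x) l m n

variable {R} in
theorem Trunc.jacobiAt_iff (hT : R.Trunc) (x : X) : R.JacobiAt x ↔ ∀ (u v : V) (l m n : ℤ),
    borcherds (fun a b => R.y a u (R.y b v x)) (fun a b => R.y b v (R.y a u x))
      (fun a b => R.y b (𝒱.adjoint.mode u a v) x) l m n = 0 := by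
  unfold JacobiAt
  simp only [hT.jacobiDefect_eq]

end ModeRep

theorem _root_.WeakModule.rep_y {W : Type u} [AddCommGroup W] [Module ℂ W] (M : WeakModule 𝒱 W)
    (n : ℤ) (v : V) : M.rep.y n v = M.mode v n := rfl

theorem _root_.WeakModule.rep_trunc {W : Type u} [AddCommGroup W] [Module ℂ W]
    (M : WeakModule 𝒱 W) : M.rep.Trunc := fun v w => M.trunc v w

theorem _root_.WeakModule.jacobi_borcherds {W : Type u} [AddCommGroup W] [Module ℂ W]
    (M : WeakModule 𝒱 W) (u v : V) (w : W) (l m n : ℤ) :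
    borcherds (fun a b => M.mode u a (M.mode v b w)) (fun a b => M.mode v b (M.mode u a w))
      (fun a b => M.mode (𝒱.adjoint.mode u a v) b w) l m n = 0 :=
  (M.rep_trunc.jacobiDefect_eq u v w l m n).symm.trans (M.jacobi u v w l m n)

/-- A truncated representation of `g(V)` that satisfies the Jacobi identity and the vacuum property
is a weak module. -/
def ModeRep.toWeakModule {X : Type u} [AddCommGroup X] [Module ℂ X] (R : ModeRep 𝒱 X)
    (hT : R.Trunc) (hJ : ∀ x, R.JacobiAt x) (h1 : ∀ n, R.y n 𝒱.one = if n = -1 then 1 else 0) :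
    WeakModule 𝒱 X := by
  have hf : ∀ v x, BddBelow (Function.support fun n : ℤ => R.y (-n - 1) v x) := by
    intro v x
    obtain ⟨K, hK⟩ := hT v x
    refine ⟨-K, fun n hn => ?_⟩
    by_contra h
    exact hn (hK _ (by omega))
  have hn : ∀ v n, VertexOperator.ncoeff (VertexOperator.of_coeff (fun n => R.y (-n - 1) v) (hf v)) n
      = R.y n v := fun v n => by
    rw [VertexOperator.ncoeff_of_coeff]
    congr 1
    ring_nf
  have hinj : ∀ A B : VertexOperator ℂ X, (∀ n, VertexOperator.ncoeff A n
      = VertexOperator.ncoeff B n) → A = B := by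
    intro A B h
    refine HVertexOperator.coeff_inj ?_
    funext n
    have := h (-n - 1)
    rw [VertexOperator.ncoeff_apply, VertexOperator.ncoeff_apply] at this
    simpa using this
  exact
  { Y :=
      { toFun := fun v => VertexOperator.of_coeff (fun n => R.y (-n - 1) v) (hf v)
        map_add' := fun u v => hinj _ _ fun n => by
          rw [map_add, Pi.add_apply, hn, hn, hn, map_add]
        map_smul' := fun c v => hinj _ _ fun n => by
          rw [map_smul, Pi.smul_apply, hn, hn, map_smul, RingHom.id_apply] }
    vacuum := fun n => (hn _ n).trans (h1 n)
    jacobi := fun u v w l m n => by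
      simp only [LinearMap.coe_mk, AddHom.coe_mk, hn]
      exact hJ w u v l m n
    derivative := fun v n => by
      simp only [LinearMap.coe_mk, AddHom.coe_mk, hn]
      exact LinearMap.ext fun x => R.deriv v n x }

theorem ModeRep.toWeakModule_mode {X : Type u} [AddCommGroup X] [Module ℂ X] (R : ModeRep 𝒱 X)
    (hT : R.Trunc) (hJ : ∀ x, R.JacobiAt x) (h1 : ∀ n, R.y n 𝒱.one = if n = -1 then 1 else 0)
    (v : V) (n : ℤ) : (R.toWeakModule hT hJ h1).mode v n = R.y n v := by
  unfold WeakModule.mode ModeRep.toWeakModule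
  simp only [LinearMap.coe_mk, AddHom.coe_mk]
  rw [VertexOperator.ncoeff_of_coeff]
  congr 1
  ring_nf

namespace Env

/-- The quotient map from the tensor algebra onto `U(g(V))`. -/
def proj (𝒱 : VertexOperatorAlgebra V) : TensorAlgebra ℂ (V ⊗[ℂ] ℂ[T;T⁻¹]) →ₐ[ℂ] Env 𝒱 :=
  RingQuot.mkAlgHom ℂ (EnvRel 𝒱)

theorem gen_eq_proj (v : V) (n : ℤ) :
    gen 𝒱 v n = proj 𝒱 (TensorAlgebra.ι ℂ (v ⊗ₜ[ℂ] LaurentPolynomial.T n)) := rfl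

theorem gen_add (u v : V) (n : ℤ) : gen 𝒱 (u + v) n = gen 𝒱 u n + gen 𝒱 v n := by
  simp only [gen_eq_proj, TensorProduct.add_tmul, map_add]

theorem gen_smul (c : ℂ) (v : V) (n : ℤ) : gen 𝒱 (c • v) n = c • gen 𝒱 v n := by
  rw [gen_eq_proj, ← TensorProduct.smul_tmul', map_smul, map_smul, gen_eq_proj]

theorem gen_zero (n : ℤ) : gen 𝒱 (0 : V) n = 0 := by
  rw [gen_eq_proj, TensorProduct.zero_tmul, map_zero, map_zero]

theorem gen_deriv (v : V) (n : ℤ) :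
    gen 𝒱 (𝒱.adjoint.L (-1) v) n = -(n : ℂ) • gen 𝒱 v (n - 1) := by
  have h : proj 𝒱 _ = proj 𝒱 _ := RingQuot.mkAlgHom_rel ℂ (EnvRel.deriv (𝒱 := 𝒱) v n)
  rw [map_add, map_add, map_smul, map_smul, map_zero] at h
  rw [neg_smul]
  exact eq_neg_of_add_eq_zero_left h

theorem gen_bracket (u v : V) (m n : ℤ) : gen 𝒱 u m * gen 𝒱 v n - gen 𝒱 v n * gen 𝒱 u m
    = ∑ᶠ i : ℕ, Ring.choose m i • gen 𝒱 (𝒱.adjoint.mode u i v) (n + (m - i)) := by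
  have h : proj 𝒱 _ = proj 𝒱 _ := RingQuot.mkAlgHom_rel ℂ (EnvRel.bracket (𝒱 := 𝒱) u v m n)
  obtain ⟨N, hN⟩ := 𝒱.adjoint.evZero_mode u v 0
  have hN : ∀ i ≥ N, 𝒱.adjoint.mode u (i : ℤ) v = 0 := by simpa using hN
  rw [EvZero.finsum_eq (N := N) fun i hi => by rw [hN i hi, TensorProduct.zero_tmul, smul_zero],
    map_sum, map_sum, map_sub, map_mul, map_mul] at h
  rw [EvZero.finsum_eq (N := N) fun i hi => by rw [hN i hi, gen_zero, smul_zero]]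
  refine Eq.trans h (Finset.sum_congr rfl fun i _ => ?_)
  rw [map_zsmul, map_zsmul, show m + n - (i : ℤ) = n + (m - i) by ring]
  rfl

variable {X : Type*} [AddCommGroup X] [Module ℂ X] [Module (Env 𝒱) X] [IsScalarTower ℂ (Env 𝒱) X]

/-- A subspace stable under the generators is stable under `U(g(V))`. -/
theorem smul_mem_of_gen {N : Submodule ℂ X} (h : ∀ v n, ∀ x ∈ N, gen 𝒱 v n • x ∈ N) (a : Env 𝒱)
    {x : X} (hx : x ∈ N) : a • x ∈ N := by
  obtain ⟨t, rfl⟩ : ∃ t, proj 𝒱 t = a := RingQuot.mkAlgHom_surjective ℂ (EnvRel 𝒱) a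
  induction t using TensorAlgebra.induction generalizing x with
  | algebraMap r =>
    rw [AlgHom.commutes, algebraMap_smul]
    exact N.smul_mem r hx
  | ι y =>
    induction y using TensorProduct.induction_on with
    | zero =>
      rw [map_zero, map_zero, zero_smul]
      exact N.zero_mem
    | add y z hy hz =>
      rw [map_add, map_add, add_smul]
      exact N.add_mem hy hz
    | tmul v p =>
      induction p using LaurentPolynomial.induction_on' with
      | add p q hp hq =>
        rw [TensorProduct.tmul_add, map_add, map_add, add_smul]
        exact N.add_mem hp hq
      | C_mul_T n c =>
        rw [← LaurentPolynomial.smul_eq_C_mul, TensorProduct.tmul_smul, map_smul, map_smul,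
          ← gen_eq_proj, smul_assoc]
        exact N.smul_mem _ (h _ _ _ hx)
  | mul a b ha hb =>
    rw [map_mul, mul_smul]
    exact ha (hb hx)
  | add a b ha hb =>
    rw [map_add, add_smul]
    exact N.add_mem (ha hx) (hb hx)

end Env

/-- The representation of `g(V)` on a module for `U(g(V))`. -/
def ModeRep.ofEnv (𝒱 : VertexOperatorAlgebra V) (X : Type*) [AddCommGroup X] [Module ℂ X]
    [Module (Env 𝒱) X] [IsScalarTower ℂ (Env 𝒱) X] : ModeRep 𝒱 X where
  y n := LinearMap.mk₂ ℂ (fun v x => Env.gen 𝒱 v n • x)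
    (fun u v x => by rw [Env.gen_add, add_smul])
    (fun c v x => by rw [Env.gen_smul, smul_assoc])
    (fun v x x' => smul_add _ _ _)
    (fun c v x => by
      rw [← algebraMap_smul (Env 𝒱) c x, ← algebraMap_smul (Env 𝒱) c, smul_smul, smul_smul,
        Algebra.commutes])
  deriv v n x := by simp [Env.gen_deriv]
  bracket u v m n x := by
    obtain ⟨N, hN⟩ := 𝒱.adjoint.evZero_mode u v 0
    have hN : ∀ i ≥ N, 𝒱.adjoint.mode u (i : ℤ) v = 0 := by simpa using hN
    have h := congrArg (fun a : Env 𝒱 => a • x) (Env.gen_bracket u v m n)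
    simp only [sub_smul, mul_smul] at h
    refine Eq.trans h ?_
    rw [EvZero.finsum_eq (N := N) fun i hi => by rw [hN i hi, Env.gen_zero, smul_zero],
      EvZero.finsum_eq (N := N) fun i hi => by rw [hN i hi]; simp, Finset.sum_smul]
    exact Finset.sum_congr rfl fun i _ => by rw [smul_assoc]; rfl

end Enveloping

/-! ### The module `F(U)` -/

section UniversalModule

variable {V : Type u} [AddCommGroup V] [Module ℂ V] {𝒱 : VertexOperatorAlgebra V}

namespace ModeRep

variable {X : Type*} [AddCommGroup X] [Module ℂ X] (R : ModeRep 𝒱 X)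

/-- The subspace of the vectors `x` such that `Y(v,x₀)x` is truncated for all `v`. -/
def truncated : Submodule ℂ X where
  carrier := {x | ∀ v : V, ∃ K : ℤ, ∀ n ≥ K, R.y n v x = 0}
  zero_mem' := fun v => ⟨0, by simp⟩
  add_mem' := fun {x y} hx hy v => by
    obtain ⟨K, hK⟩ := hx v
    obtain ⟨K', hK'⟩ := hy v
    exact ⟨max K K', fun n hn => by
      rw [map_add, hK n ((le_max_left _ _).trans hn), hK' n ((le_max_right _ _).trans hn), add_zero]⟩
  smul_mem' := fun c x hx v => by
    obtain ⟨K, hK⟩ := hx v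
    exact ⟨K, fun n hn => by rw [map_smul, hK n hn, smul_zero]⟩

theorem truncated_stable (u : V) (m : ℤ) {x : X} (hx : x ∈ R.truncated) :
    R.y m u x ∈ R.truncated := by
  intro v
  obtain ⟨N, hN⟩ := 𝒱.adjoint.evZero_mode v u 0
  have hN : ∀ i ≥ N, 𝒱.adjoint.mode v (i : ℤ) u = 0 := by simpa using hN
  obtain ⟨K, hK⟩ := hx v
  choose K' hK' using fun i : ℕ => hx (𝒱.adjoint.mode v (i : ℤ) u)
  refine ⟨max K (∑ i ∈ Finset.range N, |K' i| + N - m), fun n hn => ?_⟩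
  have h := R.bracket v u n m x
  rw [hK n ((le_max_left _ _).trans hn), map_zero, sub_zero] at h
  rw [h]
  refine (finsum_congr fun i => ?_).trans finsum_zero
  by_cases hi : i < N
  · have h1 := Finset.single_le_sum (f := fun i => |K' i|) (fun _ _ => abs_nonneg _)
      (Finset.mem_range.mpr hi)
    have h2 := (le_max_right _ _).trans hn
    have h3 := le_abs_self (K' i)
    rw [hK' i _ (by omega), smul_zero]
  · rw [hN i (by omega)]
    simp

/-- It is enough to check truncation for homogeneous vectors. -/
theorem mem_truncated_of_homog {x : X}
    (h : ∀ k, ∀ v ∈ 𝒱.homog k, ∃ K : ℤ, ∀ n ≥ K, R.y n v x = 0) : x ∈ R.truncated := by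
  intro v
  induction v using 𝒱.homog_induction with
  | h k v hv => exact h k v hv
  | h0 => exact ⟨0, by simp⟩
  | hadd u v hu hv =>
    obtain ⟨K, hK⟩ := hu
    obtain ⟨K', hK'⟩ := hv
    exact ⟨max K K', fun n hn => by
      rw [map_add, LinearMap.add_apply, hK n ((le_max_left _ _).trans hn),
        hK' n ((le_max_right _ _).trans hn), add_zero]⟩

theorem trunc_of_truncated (h : R.truncated = ⊤) : R.Trunc := fun v x =>
  (h ▸ Submodule.mem_top : x ∈ R.truncated) v

theorem jacobiDefect_map {X' : Type*} [AddCommGroup X'] [Module ℂ X'] {R : ModeRep 𝒱 X}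
    (hT : R.Trunc) (R' : ModeRep 𝒱 X') (φ : X →ₗ[ℂ] X')
    (h : ∀ v n x, φ (R.y n v x) = R'.y n v (φ x)) (u v : V) (x : X) (l m n : ℤ) :
    φ (jacobiDefect (fun v n => 𝒱.adjoint.mode v n) (fun v n x => R.y n v x)
      (fun v n x => R.y n v x) (fun v n x => R.y n v x) u v x l m n)
    = jacobiDefect (fun v n => 𝒱.adjoint.mode v n) (fun v n x => R'.y n v x)
      (fun v n x => R'.y n v x) (fun v n x => R'.y n v x) u v (φ x) l m n := by
  have h1 : FinFst fun a b => R'.y a u (R'.y b v (φ x)) := fun m n =>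
    ((hT.finFst u v x m n).comp_zero φ (map_zero φ)).congr fun i => by simp only [h]
  have h2 : FinSnd fun a b => R'.y b v (R'.y a u (φ x)) := fun m n =>
    ((hT.finSnd u v x m n).comp_zero φ (map_zero φ)).congr fun i => by simp only [h]
  rw [hT.jacobiDefect_eq]
  refine (map_borcherds φ.toAddMonoidHom (hT.finFst u v x) (hT.finSnd u v x)
    (R.finIter u v x) l m n).trans ?_
  refine Eq.trans ?_ (jacobiDefect_eq_borcherds (fun v n => 𝒱.adjoint.mode v n)
    (fun v n x => R'.y n v x) (fun v n x => R'.y n v x) (fun v n x => R'.y n v x) u v (φ x)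
    h1 h2 l m n).symm
  exact borcherds_congr (fun j k => by simp [h]) (fun j k => by simp [h]) (fun j k => by simp [h])
    l m n

end ModeRep

variable {U : Type u} [AddCommGroup U] [Module ℂ U] (ρ : V →ₗ[ℂ] Module.End ℂ U)

namespace FInduced

/-- The natural map from `U` to the induced module. -/
def incl (𝒱 : VertexOperatorAlgebra V) (a : U) : FInduced ρ 𝒱 :=
  Submodule.Quotient.mk ((1 : Env 𝒱) ⊗ₜ[ℂ] a)

theorem mk_tmul (b : Env 𝒱) (a : U) :
    (Submodule.Quotient.mk (b ⊗ₜ[ℂ] a) : FInduced ρ 𝒱) = b • incl ρ 𝒱 a := by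
  rw [incl, ← Submodule.Quotient.mk_smul, TensorProduct.smul_tmul', smul_eq_mul, mul_one]

theorem gen_smul_incl_of_le {k : ℤ} {v : V} (hv : v ∈ 𝒱.homog k) {m : ℤ} (hm : k ≤ m) (a : U) :
    Env.gen 𝒱 v m • incl ρ 𝒱 a = 0 := by
  rw [← mk_tmul, Submodule.Quotient.mk_eq_zero]
  exact Submodule.subset_span ⟨k, v, a, hv, Or.inl ⟨m, hm, rfl⟩⟩

theorem gen_smul_incl {k : ℤ} {v : V} (hv : v ∈ 𝒱.homog k) (a : U) :
    Env.gen 𝒱 v (k - 1) • incl ρ 𝒱 a = incl ρ 𝒱 (ρ v a) := by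
  rw [← mk_tmul, incl, Submodule.Quotient.eq]
  exact Submodule.subset_span ⟨k, v, a, hv, Or.inr rfl⟩

variable {ρ} in
theorem eq_top {N : Submodule ℂ (FInduced ρ 𝒱)}
    (h : ∀ v n, ∀ x ∈ N, Env.gen 𝒱 v n • x ∈ N) (h1 : ∀ a, incl ρ 𝒱 a ∈ N) : N = ⊤ := by
  refine eq_top_iff.mpr fun x _ => ?_
  obtain ⟨t, rfl⟩ := Submodule.Quotient.mk_surjective _ x
  induction t using TensorProduct.induction_on with
  | zero => exact N.zero_mem
  | add s t hs ht => exact N.add_mem (hs trivial) (ht trivial)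
  | tmul b a =>
    rw [mk_tmul]
    exact Env.smul_mem_of_gen h b (h1 a)

theorem trunc : (ModeRep.ofEnv 𝒱 (FInduced ρ 𝒱)).Trunc :=
  ModeRep.trunc_of_truncated _ <| eq_top
    (fun v n _ hx => (ModeRep.ofEnv 𝒱 (FInduced ρ 𝒱)).truncated_stable v n hx)
    fun a => ModeRep.mem_truncated_of_homog _ fun k _ hv =>
      ⟨k, fun _ hn => gen_smul_incl_of_le ρ hv hn a⟩

end FInduced

namespace FModule

/-- The representation of `g(V)` on `F(U)`. -/
def rep (𝒱 : VertexOperatorAlgebra V) : ModeRep 𝒱 (FModule ρ 𝒱) := ModeRep.ofEnv 𝒱 (FModule ρ 𝒱)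

/-- The projection from the induced module. -/
def ofInduced (𝒱 : VertexOperatorAlgebra V) : FInduced ρ 𝒱 →ₗ[ℂ] FModule ρ 𝒱 :=
  (Submodule.mkQ _).restrictScalars ℂ

theorem ofInduced_surjective : Function.Surjective (ofInduced ρ 𝒱) := fun x => by
  obtain ⟨y, rfl⟩ := Submodule.Quotient.mk_surjective _ x
  exact ⟨y, rfl⟩

theorem ofInduced_y (v : V) (n : ℤ) (x : FInduced ρ 𝒱) :
    ofInduced ρ 𝒱 ((ModeRep.ofEnv 𝒱 (FInduced ρ 𝒱)).y n v x) = (rep ρ 𝒱).y n v (ofInduced ρ 𝒱 x) :=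
  rfl

theorem trunc : (rep ρ 𝒱).Trunc := by
  intro v x
  obtain ⟨x, rfl⟩ := ofInduced_surjective ρ x
  obtain ⟨K, hK⟩ := FInduced.trunc ρ v x
  exact ⟨K, fun n hn => by rw [← ofInduced_y, hK n hn, map_zero]⟩

theorem jacobiAt (x : FModule ρ 𝒱) : (rep ρ 𝒱).JacobiAt x := by
  intro u v l m n
  obtain ⟨x, rfl⟩ := ofInduced_surjective ρ x
  rw [← ModeRep.jacobiDefect_map (FInduced.trunc ρ) (rep ρ 𝒱) (ofInduced ρ 𝒱) (ofInduced_y ρ)]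
  exact (Submodule.Quotient.mk_eq_zero _).mpr (Submodule.subset_span ⟨u, v, x, l, m, n, rfl⟩)

/-- The natural map `U → F(U)` as a linear map. -/
def eLin (𝒱 : VertexOperatorAlgebra V) : U →ₗ[ℂ] FModule ρ 𝒱 :=
  ofInduced ρ 𝒱 ∘ₗ ((Submodule.mkQ _).restrictScalars ℂ ∘ₗ TensorProduct.mk ℂ (Env 𝒱) U 1)

theorem eLin_apply (a : U) : eLin ρ 𝒱 a = e ρ 𝒱 a := rfl

theorem mode_e_of_le {k : ℤ} {v : V} (hv : v ∈ 𝒱.homog k) {m : ℤ} (hm : k ≤ m) (a : U) :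
    mode ρ 𝒱 v m (e ρ 𝒱 a) = 0 :=
  congrArg (ofInduced ρ 𝒱) (FInduced.gen_smul_incl_of_le ρ hv hm a)

theorem mode_e {k : ℤ} {v : V} (hv : v ∈ 𝒱.homog k) (a : U) :
    mode ρ 𝒱 v (k - 1) (e ρ 𝒱 a) = e ρ 𝒱 (ρ v a) :=
  congrArg (ofInduced ρ 𝒱) (FInduced.gen_smul_incl ρ hv a)

variable {ρ} in
/-- `F(U)` is generated by the image of `U`. -/
theorem eq_top {N : Submodule ℂ (FModule ρ 𝒱)} (h : IsModeStable (mode ρ 𝒱) N)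
    (h1 : ∀ a, e ρ 𝒱 a ∈ N) : N = ⊤ := by
  have := FInduced.eq_top (ρ := ρ) (N := N.comap (ofInduced ρ 𝒱)) (fun v n x hx => h v n _ hx) h1
  refine eq_top_iff.mpr fun x _ => ?_
  obtain ⟨x, rfl⟩ := ofInduced_surjective ρ x
  exact (this ▸ Submodule.mem_top : x ∈ N.comap (ofInduced ρ 𝒱))

variable {ρ} in
/-- The vacuum property of `F(U)` is not among its defining relations. The operator `1_n` vanishes
for `n ≠ -1` by the derivative relation, and `1_{-1}` commutes with all modes and is the identity on
`U`. -/
theorem vacuum (hρ : ρ 𝒱.one = 1) (n : ℤ) :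
    (rep ρ 𝒱).y n 𝒱.one = if n = -1 then 1 else 0 := by
  have h0 : 𝒱.adjoint.L (-1) 𝒱.one = 0 := 𝒱.creation_regular _ _ le_rfl
  split_ifs with hn
  · subst hn
    have hcomm : ∀ (v : V) (n : ℤ) (x : FModule ρ 𝒱), (rep ρ 𝒱).y (-1) 𝒱.one ((rep ρ 𝒱).y n v x)
        = (rep ρ 𝒱).y n v ((rep ρ 𝒱).y (-1) 𝒱.one x) := by
      intro v n x
      rw [← sub_eq_zero, (rep ρ 𝒱).bracket]
      refine (finsum_congr fun i => ?_).trans finsum_zero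
      have : 𝒱.adjoint.mode 𝒱.one (i : ℤ) v = 0 := by
        rw [WeakModule.mode, 𝒱.adjoint.vacuum, if_neg (by omega), LinearMap.zero_apply]
      rw [this]
      simp
    have := eq_top (N := LinearMap.eqLocus ((rep ρ 𝒱).y (-1) 𝒱.one) 1) (fun v n x hx => by
        rw [LinearMap.mem_eqLocus] at hx ⊢
        exact (hcomm v n x).trans (by rw [hx]; rfl)) fun a => by
        rw [LinearMap.mem_eqLocus]
        have h := mode_e ρ 𝒱.one_mem a
        rw [hρ] at h
        exact h
    exact LinearMap.ext fun x => (this ▸ Submodule.mem_top :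
      x ∈ LinearMap.eqLocus ((rep ρ 𝒱).y (-1) 𝒱.one) 1)
  · refine LinearMap.ext fun x => ?_
    have h := (rep ρ 𝒱).deriv 𝒱.one (n + 1) x
    rw [h0, map_zero, LinearMap.zero_apply, add_sub_cancel_right, eq_comm, smul_eq_zero] at h
    refine h.resolve_left ?_
    rw [neg_eq_zero]
    exact_mod_cast (by omega : n + 1 ≠ 0)

/-- `F(U)` as a weak module. -/
def weak (hρ : ρ 𝒱.one = 1) : WeakModule 𝒱 (FModule ρ 𝒱) :=
  (rep ρ 𝒱).toWeakModule (trunc ρ) (jacobiAt ρ) (vacuum hρ)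

theorem weak_mode (hρ : ρ 𝒱.one = 1) (v : V) (n : ℤ) (x : FModule ρ 𝒱) :
    (weak ρ hρ).mode v n x = mode ρ 𝒱 v n x :=
  congrArg (fun f : Module.End ℂ (FModule ρ 𝒱) => f x)
    ((rep ρ 𝒱).toWeakModule_mode (trunc ρ) (jacobiAt ρ) (vacuum hρ) v n)

/-- The universal property of `F(U)`. The Jacobi identity is required only on some stable subspace
that contains the image of `U`. -/
theorem exists_lift {X : Type*} [AddCommGroup X] [Module ℂ X] (R : ModeRep 𝒱 X) (φ : U →ₗ[ℂ] X)
    (N : Submodule ℂ X) (hN : ∀ v n, ∀ x ∈ N, R.y n v x ∈ N) (hφ : ∀ a, φ a ∈ N)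
    (h0 : ∀ k, ∀ v ∈ 𝒱.homog k, ∀ m ≥ k, ∀ a, R.y m v (φ a) = 0)
    (h1 : ∀ k, ∀ v ∈ 𝒱.homog k, ∀ a, R.y (k - 1) v (φ a) = φ (ρ v a))
    (hJ : ∀ x ∈ N, R.JacobiAt x) :
    ∃ Φ : FModule ρ 𝒱 →ₗ[ℂ] X, (∀ v n x, Φ (mode ρ 𝒱 v n x) = R.y n v (Φ x)) ∧
      (∀ a, Φ (e ρ 𝒱 a) = φ a) ∧ ∀ x, Φ x ∈ N := by
  -- `X` as a module over `U(g(V))`; the map is then obtained from tensor-hom adjunction by passing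
  -- to the two quotients
  let _ : Module (Env 𝒱) X := Module.compHom X R.env.toRingHom
  have hsmul : ∀ (a : Env 𝒱) (x : X), a • x = R.env a x := fun _ _ => rfl
  have _ : IsScalarTower ℂ (Env 𝒱) X := ⟨fun c a x => by rw [hsmul, hsmul, map_smul]; rfl⟩
  have hgen : ∀ v n (x : X), Env.gen 𝒱 v n • x = R.y n v x := fun v n x => by
    rw [hsmul, R.env_gen]
  let ψ₀ : Env 𝒱 ⊗[ℂ] U →ₗ[Env 𝒱] X := TensorProduct.AlgebraTensorModule.lift
    { toFun := fun a => LinearMap.comp (R.env a) φ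
      map_add' := fun a b => by ext; simp
      map_smul' := fun a b => by ext; simp [hsmul] }
  have hψ₀ : ∀ a u, ψ₀ (a ⊗ₜ u) = a • φ u := fun a u => rfl
  let ψ₁ : FInduced ρ 𝒱 →ₗ[Env 𝒱] X := Submodule.liftQ _ ψ₀ (by
    rw [Submodule.span_le]
    rintro x ⟨k, v, a, hv, ⟨m, hm, rfl⟩ | rfl⟩
    · exact (hψ₀ _ _).trans ((hgen _ _ _).trans (h0 k v hv m hm a))
    · refine (map_sub ψ₀ _ _).trans ?_
      rw [hψ₀, hψ₀, hgen, one_smul, h1 k v hv, sub_self])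
  have hψ₁ : ∀ a, ψ₁ (FInduced.incl ρ 𝒱 a) = φ a := fun a => (hψ₀ 1 a).trans (one_smul _ _)
  have hmem : ∀ x, ψ₁ x ∈ N := by
    have := FInduced.eq_top (N := N.comap (ψ₁.restrictScalars ℂ))
      (fun v n x hx => by
        rw [Submodule.mem_comap, LinearMap.restrictScalars_apply] at hx ⊢
        rw [map_smul, hgen]
        exact hN _ _ _ hx)
      (fun a => by
        rw [Submodule.mem_comap, LinearMap.restrictScalars_apply, hψ₁]
        exact hφ a)
    exact fun x => (this ▸ Submodule.mem_top : x ∈ N.comap (ψ₁.restrictScalars ℂ))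
  have hy : ∀ v n x, ψ₁.restrictScalars ℂ ((ModeRep.ofEnv 𝒱 (FInduced ρ 𝒱)).y n v x)
      = R.y n v (ψ₁.restrictScalars ℂ x) := fun v n x => by
    rw [← hgen]
    exact map_smul ψ₁ _ _
  let ψ : FModule ρ 𝒱 →ₗ[Env 𝒱] X := Submodule.liftQ _ ψ₁ (by
    rw [Submodule.span_le]
    rintro x ⟨u, v, w, l, m, n, rfl⟩
    refine (ModeRep.jacobiDefect_map (FInduced.trunc ρ) R (ψ₁.restrictScalars ℂ) hy u v w
      l m n).trans ?_
    exact hJ _ (hmem w) u v l m n)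
  refine ⟨ψ.restrictScalars ℂ, fun v n x => ?_, fun a => hψ₁ a, fun x => ?_⟩
  · rw [← hgen]
    exact map_smul ψ _ _
  · obtain ⟨x, rfl⟩ := ofInduced_surjective ρ x
    exact hmem x

end FModule

end UniversalModule

section SpanOfModes

variable {V : Type u} [AddCommGroup V] [Module ℂ V] {𝒱 : VertexOperatorAlgebra V}
  {A B C : Type u} [AddCommGroup A] [Module ℂ A] [AddCommGroup B] [Module ℂ B]
  [AddCommGroup C] [Module ℂ C] {Γ : Type*} [AddCommGroupWithOne Γ]

/-- If `𝒴` satisfies the Jacobi identity, then for every vector `b` the coefficients of `𝒴(a,x)b`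
span a submodule. -/
theorem WeakModule.isSubmodule_span_modes (MA : WeakModule 𝒱 A) (MB : WeakModule 𝒱 B)
    (MC : WeakModule 𝒱 C) (𝒴 : A → Γ → B → C) (b : B)
    (h0 : ∀ a n, 𝒴 a n 0 = 0)
    (hT : ∀ a n, EvZero fun i : ℕ => 𝒴 a (n + ((i : ℤ) : Γ)) b)
    (hJ : ∀ u a l m n, borcherds (fun j k => MC.mode u j (𝒴 a k b)) (fun j k => 𝒴 a k (MB.mode u j b))
      (fun j k => 𝒴 (MA.mode u j a) k b) l m n = 0) :
    MC.IsSubmodule (Submodule.span ℂ (Set.range fun an : A × Γ => 𝒴 an.1 an.2 b)) := by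
  set S := Submodule.span ℂ (Set.range fun an : A × Γ => 𝒴 an.1 an.2 b) with hS
  have hmem : ∀ a n, 𝒴 a n b ∈ S := fun a n => Submodule.subset_span ⟨(a, n), rfl⟩
  suffices H : ∀ (v : V) (a : A) (n : Γ) (m : ℤ), MC.mode v m (𝒴 a n b) ∈ S by
    intro v m x hx
    simp only
    induction hx using Submodule.span_induction with
    | mem x hx =>
      obtain ⟨an, rfl⟩ := hx
      exact H v an.1 an.2 m
    | zero => rw [map_zero]; exact S.zero_mem
    | add x y _ _ hx hy => rw [map_add]; exact S.add_mem hx hy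
    | smul c x _ hx => rw [map_smul]; exact S.smul_mem c hx
  intro v a n
  obtain ⟨N, hN⟩ := hT a n
  obtain ⟨K, hK⟩ := MB.trunc v b
  -- downward induction on the exponent of `𝒴`
  have key : ∀ d i : ℕ, N ≤ i + d → ∀ m, MC.mode v m (𝒴 a (n + ((i : ℤ) : Γ)) b) ∈ S := by
    intro d
    induction d with
    | zero =>
      intro i hi m
      rw [show 𝒴 a (n + ((i : ℤ) : Γ)) b = 0 from hN i hi, map_zero]
      exact S.zero_mem
    | succ d ih =>
      intro i hi m
      have h := hJ v a (m - K) K (n + ((i : ℤ) : Γ))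
      unfold borcherds at h
      have h2 : borcherdsSnd (fun j k => 𝒴 a k (MB.mode v j b)) (m - K) K (n + ((i : ℤ) : Γ))
          = 0 := by
        refine (finsum_congr fun t => ?_).trans finsum_zero
        simp only [hK (K + (t : ℤ)) (by omega), h0, smul_zero]
      have h3 : borcherdsIter (fun j k => 𝒴 (MA.mode v j a) k b) (m - K) K (n + ((i : ℤ) : Γ))
          ∈ S := EvZero.finsum_mem S fun t => S.toAddSubgroup.zsmul_mem (hmem _ _) _
      rw [h2, smul_zero, sub_zero, sub_eq_zero] at h
      rw [← h] at h3
      unfold borcherdsFst at h3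
      rw [EvZero.finsum_succ] at h3
      · have h4 := S.sub_mem h3 (EvZero.finsum_mem S fun t : ℕ =>
          S.toAddSubgroup.zsmul_mem (ih (i + (t + 1)) (by omega) (m - (t + 1)))
            ((-1) ^ (t + 1) * Ring.choose (m - K) (t + 1)))
        convert h4 using 1
        rw [eq_sub_iff_add_eq]
        congr 1
        · simp
        · refine finsum_congr fun t => ?_
          congr 1
          refine congrArg₂ (fun j k => MC.mode v j (𝒴 a k b)) ?_ ?_
          · push_cast; ring
          · push_cast; abel
      · refine EvZero.zsmul ⟨N, fun t ht => ?_⟩ _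
        have := hN (i + t) (by omega)
        simp only at this ⊢
        rw [show n + ((i : ℤ) : Γ) + ((t : ℤ) : Γ) = n + (((i + t : ℕ) : ℤ) : Γ) by
          push_cast; abel, this, map_zero]
  intro m
  simpa using key N 0 (by omega) m

end SpanOfModes

/-! ### Residues of functions with poles at zero, one and infinity -/

section Sums

variable {X : Type*} [AddCommGroup X]

/-- A sequence that vanishes for large index is determined by binomial transforms of its tails. -/
theorem eq_zero_of_binomial {b : ℤ → X} (hb : ∃ N, ∀ n ≥ N, b n = 0)
    (h : ∀ m, ∃ s : ℤ, ∑ᶠ i : ℕ, ((-1) ^ i * Ring.choose s i : ℤ) • b (m + i) = 0) (m : ℤ) :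
    b m = 0 := by
  obtain ⟨N, hN⟩ := hb
  have key : ∀ d : ℕ, ∀ m, N ≤ m + d → b m = 0 := by
    intro d
    induction d with
    | zero => exact fun m hm => hN m (by simpa using hm)
    | succ d ih =>
      intro m hm
      -- only the term with `i = 0` is left, by downward induction on the index
      obtain ⟨s, hs⟩ := h m
      rw [finsum_eq_single _ 0 fun i hi => by rw [ih _ (by omega), smul_zero]] at hs
      simpa using hs
  exact key (N - m).toNat m (by omega)

theorem evZero_int {b : ℤ → X} (hb : ∃ N, ∀ n ≥ N, b n = 0) (m : ℤ) :
    EvZero fun i : ℕ => b (m + i) := by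
  obtain ⟨N, hN⟩ := hb
  exact ⟨(N - m).toNat, fun i hi => hN _ (by omega)⟩

/-- The recursion in `s` of the binomial transform. -/
theorem binomial_transform_succ {b : ℤ → X} (hb : ∃ N, ∀ n ≥ N, b n = 0) (s m : ℤ) :
    ∑ᶠ i : ℕ, ((-1) ^ i * Ring.choose s i : ℤ) • b (m + i)
      = ∑ᶠ i : ℕ, ((-1) ^ i * Ring.choose (s + 1) i : ℤ) • b (m + i)
        + ∑ᶠ i : ℕ, ((-1) ^ i * Ring.choose s i : ℤ) • b (m + 1 + i) := by
  have h0 := evZero_int hb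
  rw [EvZero.finsum_succ ((h0 m).zsmul _), EvZero.finsum_succ
    (f := fun i : ℕ => ((-1) ^ i * Ring.choose (s + 1) i : ℤ) • b (m + i)) ((h0 m).zsmul _)]
  have e : ∀ i : ℕ, m + ((i + 1 : ℕ) : ℤ) = m + 1 + i := fun i => by push_cast; ring
  simp only [e]
  rw [add_assoc, ← EvZero.finsum_add ((h0 _).zsmul _) ((h0 _).zsmul _)]
  congr 1
  · simp
  · refine finsum_congr fun i => ?_
    rw [← add_smul, Ring.choose_succ_succ]
    congr 1
    ring

/-- The binomial transform of `n ↦ n b_n`, which belongs to the derivative. -/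
theorem binomial_transform_mul {b : ℤ → X} (hb : ∃ N, ∀ n ≥ N, b n = 0) (s m : ℤ) :
    ∑ᶠ i : ℕ, ((-1) ^ i * Ring.choose s i : ℤ) • ((m + i : ℤ) • b (m + i))
      = m • ∑ᶠ i : ℕ, ((-1) ^ i * Ring.choose s i : ℤ) • b (m + i)
        - s • ∑ᶠ i : ℕ, ((-1) ^ i * Ring.choose (s - 1) i : ℤ) • b (m + 1 + i) := by
  have h0 := evZero_int hb
  rw [((h0 m).zsmul _).smul_finsum, ((h0 (m + 1)).zsmul _).smul_finsum]
  have e1 : ∑ᶠ i : ℕ, ((-1) ^ i * Ring.choose s i : ℤ) • ((i : ℤ) • b (m + i))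
      = -∑ᶠ i : ℕ, s • ((-1) ^ i * Ring.choose (s - 1) i : ℤ) • b (m + 1 + i) := by
    rw [EvZero.finsum_succ (((h0 m).zsmul _).zsmul _), ← finsum_neg_distrib]
    simp only [Nat.cast_zero, zero_smul, smul_zero, zero_add]
    refine finsum_congr fun i => ?_
    have e : m + ((i + 1 : ℕ) : ℤ) = m + 1 + i := by push_cast; ring
    rw [e, smul_smul, smul_smul, ← neg_smul]
    congr 1
    have := succ_mul_choose_succ s i
    rw [pow_succ]
    linear_combination (-1) * (-1) ^ i * this
  rw [sub_eq_add_neg, ← e1, ← EvZero.finsum_add (((h0 m).zsmul _).zsmul _)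
    (((h0 m).zsmul _).zsmul _)]
  refine finsum_congr fun i => ?_
  rw [smul_comm m, ← smul_add, ← add_smul]

end Sums

section Projection

variable {V : Type u} [AddCommGroup V] [Module ℂ V] (𝒱 : VertexOperatorAlgebra V)

/-- The projection of `V` onto its homogeneous subspace `V_(k)`. -/
def VertexOperatorAlgebra.proj (k : ℤ) : V →ₗ[ℂ] V :=
  𝒱.extend fun j => if j = k then LinearMap.id else 0

variable {𝒱}

theorem VertexOperatorAlgebra.proj_apply {k : ℤ} {v : V} (hv : v ∈ 𝒱.homog k) :
    𝒱.proj k v = v := by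
  rw [proj, 𝒱.extend_apply _ hv, if_pos rfl, LinearMap.id_apply]

theorem VertexOperatorAlgebra.proj_mem (k : ℤ) (v : V) : 𝒱.proj k v ∈ 𝒱.homog k := by
  induction v using 𝒱.homog_induction with
  | h j v hv =>
    rw [proj, 𝒱.extend_apply _ hv]
    split_ifs with h
    · rw [← h]; exact hv
    · exact Submodule.zero_mem _
  | h0 => rw [map_zero]; exact Submodule.zero_mem _
  | hadd u v hu hv => rw [map_add]; exact Submodule.add_mem _ hu hv

end Projection

section RightModule

variable {V : Type u} [AddCommGroup V] [Module ℂ V] {𝒱 : VertexOperatorAlgebra V}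
  {W : Type u} [AddCommGroup W] [Module ℂ W] (M : WeakModule 𝒱 W)
  {T : Type u} [AddCommGroup T] [Module ℂ T]

namespace WeakModule

/-- For `α : W → T`, regarded as `w ↦ ⟨t', 𝒴(w,1) ·⟩`, the negative of
`Res_{x = 1} (1-x)^s x^m α(Y(v,x-1)w) dx`.  For a form that is regular at infinity this is the residue
at `x = 0`. -/
def residueZero (α : W →ₗ[ℂ] T) (s m : ℤ) (v : V) : W →ₗ[ℂ] T :=
  -((s.negOnePow : ℤ) • (α ∘ₗ M.res s m v))

theorem residueZero_apply (α : W →ₗ[ℂ] T) (s m : ℤ) (v : V) (w : W) :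
    M.residueZero α s m v w = -((s.negOnePow : ℤ) • α (M.res s m v w)) := rfl

theorem residueZero_succ (α : W →ₗ[ℂ] T) (s m : ℤ) (v : V) : M.residueZero α s m v
    = M.residueZero α (s + 1) m v + M.residueZero α s (m + 1) v := by
  ext w
  simp only [residueZero_apply, LinearMap.add_apply, res_succ, map_add, Int.negOnePow_succ,
    Units.val_neg, neg_smul, smul_add]
  abel

theorem residueZero_deriv (α : W →ₗ[ℂ] T) (s m : ℤ) (v : V) :
    M.residueZero α s m (𝒱.adjoint.L (-1) v)
      = s • M.residueZero α (s - 1) m v - m • M.residueZero α s (m - 1) v := by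
  ext w
  have hs : (s.negOnePow : ℤ) = -((s - 1).negOnePow : ℤ) := by
    rw [← Units.val_neg, ← Int.negOnePow_succ, sub_add_cancel]
  simp only [residueZero_apply, LinearMap.sub_apply, LinearMap.smul_apply, res_deriv, map_neg,
    map_add, map_smul, hs, ← Int.cast_smul_eq_zsmul ℂ]
  push_cast
  module

/-- The maps `α : W → T` for which, for every homogeneous `v`, the function that is expanded as
`α(Y(v,x-1)w)` at `x = 1` has, if it is regular at infinity, a pole of bounded order at `x = 0`. -/
def meroHom (M : WeakModule 𝒱 W) (T : Type u) [AddCommGroup T] [Module ℂ T] :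
    Submodule ℂ (W →ₗ[ℂ] T) where
  carrier := {α | ∀ k, ∀ v ∈ 𝒱.homog k, ∃ N : ℤ, ∀ m ≥ N, ∀ s, s + m ≤ k - 2 →
    M.residueZero α s m v = 0}
  zero_mem' := fun k v hv => ⟨0, fun m _ s _ => by simp [residueZero]⟩
  add_mem' := fun {α β} hα hβ k v hv => by
    obtain ⟨N, hN⟩ := hα k v hv
    obtain ⟨N', hN'⟩ := hβ k v hv
    refine ⟨max N N', fun m hm s hs => ?_⟩
    have h1 := hN m ((le_max_left _ _).trans hm) s hs
    have h2 := hN' m ((le_max_right _ _).trans hm) s hs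
    rw [← add_zero (0 : W →ₗ[ℂ] T)]
    nth_rewrite 1 [← h1]
    rw [← h2]
    ext w
    simp [residueZero_apply]
    abel
  smul_mem' := fun c α hα k v hv => by
    obtain ⟨N, hN⟩ := hα k v hv
    refine ⟨N, fun m hm s hs => ?_⟩
    rw [← smul_zero c, ← hN m hm s hs]
    ext w
    simp only [residueZero_apply, LinearMap.smul_apply, smul_neg]
    rw [smul_comm c]

variable {M}

theorem meroHom_bound (α : M.meroHom T) {k : ℤ} {v : V} (hv : v ∈ 𝒱.homog k) :
    ∃ N : ℤ, ∀ j ≥ N, M.residueZero (α : W →ₗ[ℂ] T) (k - 2 - j) j v = 0 := by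
  obtain ⟨N, hN⟩ := α.2 k v hv
  exact ⟨N, fun j hj => hN j hj _ (by omega)⟩

variable (M)

theorem residueZero_add_right (α : W →ₗ[ℂ] T) (s m : ℤ) (u v : V) :
    M.residueZero α s m (u + v) = M.residueZero α s m u + M.residueZero α s m v := by
  ext w; simp [residueZero_apply]; abel

theorem residueZero_smul_right (α : W →ₗ[ℂ] T) (s m : ℤ) (c : ℂ) (v : V) :
    M.residueZero α s m (c • v) = c • M.residueZero α s m v := by
  ext w; simp [residueZero_apply, smul_comm c]

theorem residueZero_add_left (α β : W →ₗ[ℂ] T) (s m : ℤ) (v : V) :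
    M.residueZero (α + β) s m v = M.residueZero α s m v + M.residueZero β s m v := by
  ext w; simp [residueZero_apply]; abel

theorem residueZero_smul_left (α : W →ₗ[ℂ] T) (s m : ℤ) (c : ℂ) (v : V) :
    M.residueZero (c • α) s m v = c • M.residueZero α s m v := by
  ext w; simp [residueZero_apply, smul_comm c]

/-- The operator `v_n` on `meroHom`: the residue at `x = 0` of `x^n` times the correlation function,
computed from `x^n = ∑_i (k-2-n choose i) x^(n+i) (1-x)^(k-2-n-i)`. -/
def residueMode (n : ℤ) : V →ₗ[ℂ] M.meroHom T →ₗ[ℂ] (W →ₗ[ℂ] T) := 𝒱.extend fun k =>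
  have hz : ∀ (α : M.meroHom T) (v : V), EvZero fun i : ℕ =>
      M.residueZero (α : W →ₗ[ℂ] T) (k - 2 - (n + i)) (n + i) (𝒱.proj k v) := fun α v =>
    evZero_int (meroHom_bound α (𝒱.proj_mem k v)) n
  LinearMap.mk₂ ℂ (fun v α => ∑ᶠ i : ℕ, Ring.choose (k - 2 - n) i •
      M.residueZero (α : W →ₗ[ℂ] T) (k - 2 - (n + i)) (n + i) (𝒱.proj k v))
    (fun u v α => by
      rw [← EvZero.finsum_add ((hz _ _).zsmul _) ((hz _ _).zsmul _)]
      exact finsum_congr fun i => by rw [map_add, residueZero_add_right, smul_add])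
    (fun c v α => by
      rw [_root_.smul_finsum]
      exact finsum_congr fun i => by rw [map_smul, residueZero_smul_right, smul_comm])
    (fun v α β => by
      rw [← EvZero.finsum_add ((hz _ _).zsmul _) ((hz _ _).zsmul _)]
      exact finsum_congr fun i => by
        rw [Submodule.coe_add, residueZero_add_left, smul_add])
    (fun c v α => by
      rw [_root_.smul_finsum]
      exact finsum_congr fun i => by
        rw [Submodule.coe_smul, residueZero_smul_left, smul_comm])

theorem residueMode_apply {k : ℤ} {v : V} (hv : v ∈ 𝒱.homog k) (n : ℤ) (α : M.meroHom T) :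
    M.residueMode n v α = ∑ᶠ i : ℕ, Ring.choose (k - 2 - n) i •
      M.residueZero (α : W →ₗ[ℂ] T) (k - 2 - (n + i)) (n + i) v := by
  rw [residueMode, 𝒱.extend_apply _ hv]
  simp only [LinearMap.mk₂_apply, 𝒱.proj_apply hv]

theorem residueMode_trunc (v : V) (α : M.meroHom T) :
    ∃ K : ℤ, ∀ n ≥ K, M.residueMode n v α = 0 := by
  induction v using 𝒱.homog_induction with
  | h k v hv =>
    obtain ⟨N, hN⟩ := meroHom_bound α hv
    refine ⟨N, fun n hn => ?_⟩
    rw [M.residueMode_apply hv]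
    exact (finsum_congr fun i => by rw [hN _ (by omega), smul_zero]).trans finsum_zero
  | h0 => exact ⟨0, by simp⟩
  | hadd u v hu hv =>
    obtain ⟨K, hK⟩ := hu
    obtain ⟨K', hK'⟩ := hv
    exact ⟨max K K', fun n hn => by
      rw [map_add, LinearMap.add_apply, hK n ((le_max_left _ _).trans hn),
        hK' n ((le_max_right _ _).trans hn), add_zero]⟩

/-- The residue theorem for the forms `(1-x)^s x^m α(Y(v,x-1)w) dx` that are regular at infinity. -/
theorem residueMode_binomial {k : ℤ} {v : V} (hv : v ∈ 𝒱.homog k) (α : M.meroHom T) {s m : ℤ}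
    (h : s + m ≤ k - 2) :
    ∑ᶠ i : ℕ, ((-1) ^ i * Ring.choose s i : ℤ) • M.residueMode (m + i) v α
      = M.residueZero (α : W →ₗ[ℂ] T) s m v := by
  have key : ∀ d : ℕ, ∀ s m : ℤ, s + m = k - 2 - d →
      ∑ᶠ i : ℕ, ((-1) ^ i * Ring.choose s i : ℤ) • M.residueMode (m + i) v α
      = M.residueZero (α : W →ₗ[ℂ] T) s m v := by
    intro d
    induction d with
    | zero =>
      intro s m hs
      obtain rfl : s = k - 2 - m := by simp at hs; omega
      have hz := evZero_int (meroHom_bound α hv) m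
      have e1 : ∀ i : ℕ, ((-1) ^ i * Ring.choose (k - 2 - m) i : ℤ) • M.residueMode (m + i) v α
          = ∑ᶠ j : ℕ, (((-1) ^ i * Ring.choose (k - 2 - m) i) * Ring.choose (k - 2 - m - i) j) •
            M.residueZero (α : W →ₗ[ℂ] T) (k - 2 - (m + (i + j : ℕ))) (m + (i + j : ℕ)) v := by
        intro i
        rw [M.residueMode_apply hv, EvZero.smul_finsum
          ((evZero_int (meroHom_bound α hv) (m + i)).zsmul _)]
        refine finsum_congr fun j => ?_
        rw [smul_smul, show k - 2 - (m + i) = k - 2 - m - (i : ℤ) by ring,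
          show m + ((i + j : ℕ) : ℤ) = m + i + j by push_cast; ring]
      rw [finsum_congr e1, EvZero.finsum_smul_antidiagonal hz (fun i j =>
        ((-1) ^ i * Ring.choose (k - 2 - m) i) * Ring.choose (k - 2 - m - i) j),
        finsum_eq_single _ 0]
      · simp
      · intro t ht
        rw [sum_neg_one_pow_choose_mul_choose, sub_self,
          Ring.choose_zero_pos ℤ (by omega : 0 < t), zero_smul]
    | succ d ih =>
      intro s m hs
      rw [binomial_transform_succ (b := fun n => M.residueMode n v α) (M.residueMode_trunc v α),
        M.residueZero_succ, ih _ _ (by push_cast at hs; omega), ih _ _ (by push_cast at hs; omega)]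
  exact key (k - 2 - s - m).toNat s m (by omega)

end WeakModule

end RightModule

/-! ### Residues of iterated operators -/

section Sums

variable {X : Type*} [AddCommGroup X]

theorem EvZero.finsum_shift {f : ℕ → X} (hf : EvZero f) {a : ℕ} (h : ∀ i < a, f i = 0) :
    ∑ᶠ i, f i = ∑ᶠ i, f (a + i) := by
  induction a with
  | zero => simp
  | succ a ih =>
    rw [ih fun i hi => h i (by omega),
      EvZero.finsum_succ ((hf.shift a).congr fun i => by rw [add_comm]), add_zero, h a (by omega),
      zero_add]
    exact finsum_congr fun i => by rw [add_right_comm, add_assoc]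

/-- A double binomial transform of a sequence that depends only on the sum of the indices, with an
additional factor `(i choose a)`, is a single one. -/
theorem binomial_transform_double {D : ℕ → X} (hD : EvZero D) (s s' : ℤ) (a : ℕ) :
    ∑ᶠ i : ℕ, (((-1) ^ i * Ring.choose s i) * Ring.choose (i : ℤ) a) •
        ∑ᶠ j : ℕ, ((-1) ^ j * Ring.choose s' j) • D (i + j)
      = ((-1) ^ a * Ring.choose s a) •
        ∑ᶠ t : ℕ, ((-1) ^ t * Ring.choose (s + s' - a) t) • D (a + t) := by
  have hS : EvZero fun i : ℕ => ∑ᶠ j : ℕ, ((-1) ^ j * Ring.choose s' j) • D (i + j) := by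
    obtain ⟨N, hN⟩ := hD
    exact ⟨N, fun i hi => (finsum_congr fun j => by rw [hN _ (by omega), smul_zero]).trans
      finsum_zero⟩
  have hD' : EvZero fun t : ℕ => ((-1) ^ t : ℤ) • D (a + t) :=
    ((hD.shift a).congr fun i => by rw [add_comm]).zsmul _
  have h := EvZero.finsum_choose_choose hD' (s - a) s'
  rw [EvZero.finsum_shift (hS.zsmul _) (a := a) fun i hi => by
    rw [Ring.choose_natCast, Nat.choose_eq_zero_of_lt hi]; simp]
  have e : s - a + s' = s + s' - (a : ℤ) := by ring
  rw [e] at h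
  have h2 : ∀ t : ℕ, ((-1) ^ t * Ring.choose (s + s' - a) t) • D (a + t)
      = Ring.choose (s + s' - a) t • ((-1) ^ t : ℤ) • D (a + t) := fun t => by
    rw [smul_smul, mul_comm]
  rw [finsum_congr h2, ← h, EvZero.smul_finsum]
  · refine finsum_congr fun i => ?_
    rw [mul_assoc, choose_mul_natCast_choose, smul_smul, EvZero.smul_finsum,
      EvZero.smul_finsum]
    · refine finsum_congr fun j => ?_
      rw [smul_smul, smul_smul, smul_smul, ← add_assoc, pow_add, pow_add]
      congr 1
      ring
    · exact EvZero.zsmul ((hD'.shift i).congr fun j => by rw [add_comm]) _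
    · exact EvZero.zsmul ((hD.shift (a + i)).congr fun j => by rw [add_comm]) _
  · refine EvZero.zsmul ?_ _
    obtain ⟨N, hN⟩ := hD'
    exact ⟨N, fun i hi => (finsum_congr fun j => by
      have := hN (i + j) (by omega)
      simp only at this
      rw [this, smul_zero]).trans finsum_zero⟩

end Sums

section RightModule

variable {V : Type u} [AddCommGroup V] [Module ℂ V] {𝒱 : VertexOperatorAlgebra V}
  {W : Type u} [AddCommGroup W] [Module ℂ W] (M : WeakModule 𝒱 W)
  {T : Type u} [AddCommGroup T] [Module ℂ T]

namespace WeakModule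

/-- The commutator formula for residues at `x = 1`, with the terms sorted by `u_r v`. -/
theorem res_comm_antidiagonal (u v : V) (w : W) (s s' m n : ℤ) {R : ℕ}
    (hR : ∀ r ≥ R, 𝒱.adjoint.mode u (r : ℤ) v = 0) :
    M.res s m u (M.res s' n v w) - M.res s' n v (M.res s m u w)
      = ∑ r ∈ Finset.range R, ∑ at' ∈ Finset.HasAntidiagonal.antidiagonal r,
        (Ring.choose s at'.1 * Ring.choose m at'.2) •
          M.res (s + s' - at'.1) (m + n - at'.2) (𝒱.adjoint.mode u r v) w := by
  rw [M.res_comm]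
  have h1 : ∀ i : ℕ, Ring.choose s i • M.js u v w i (s' + (s - i)) m n
      = ∑ᶠ j : ℕ, (Ring.choose s i * Ring.choose m j) •
        M.res (s + s' - i) (m + n - j) (𝒱.adjoint.mode u ((i + j : ℕ) : ℤ) v) w := by
    intro i
    rw [js, EvZero.smul_finsum ((M.js_evZero ..).zsmul _)]
    refine finsum_congr fun j => ?_
    rw [smul_smul, show s' + (s - i) = s + s' - (i : ℤ) by ring, Nat.cast_add]
  rw [finsum_congr h1, EvZero.finsum_antidiagonal (F := fun i j : ℕ =>
    (Ring.choose s i * Ring.choose m j) •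
        M.res (s + s' - i) (m + n - j) (𝒱.adjoint.mode u ((i + j : ℕ) : ℤ) v) w)
    ⟨R, fun i j h => by rw [hR _ h]; simp⟩, EvZero.finsum_eq (N := R)]
  · refine Finset.sum_congr rfl fun r _ => Finset.sum_congr rfl fun at' h => ?_
    rw [Finset.HasAntidiagonal.mem_antidiagonal] at h
    rw [h]
  · intro r hr
    refine Finset.sum_eq_zero fun at' h => ?_
    rw [Finset.HasAntidiagonal.mem_antidiagonal] at h
    rw [h, hR r hr]
    simp

theorem residueZero_eq_zero_iff (α : W →ₗ[ℂ] T) (s m : ℤ) (v : V) :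
    M.residueZero α s m v = 0 ↔ ∀ w, α (M.res s m v w) = 0 := by
  rw [LinearMap.ext_iff]
  refine forall_congr' fun w => ?_
  rw [residueZero_apply, LinearMap.zero_apply, neg_eq_zero]
  constructor
  · intro h
    have := congrArg ((s.negOnePow : ℤ) • ·) h
    simpa [smul_smul, ← Units.val_mul] using this
  · intro h
    rw [h, smul_zero]

theorem exists_mode_bound (u v : V) : ∃ R : ℕ, ∀ r ≥ R, 𝒱.adjoint.mode u (r : ℤ) v = 0 := by
  obtain ⟨N, hN⟩ := 𝒱.adjoint.evZero_mode u v 0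
  exact ⟨N, by simpa using hN⟩

/-- `meroHom` is stable under residues at `x = 1`. By the commutator formula the poles at `x = 0` of
the new function are bounded in terms of those of `α` for `u` and for the finitely many nonzero
vectors `u_r v`. -/
theorem residueZero_mem (α : M.meroHom T) {k : ℤ} {v : V} (hv : v ∈ 𝒱.homog k) {s n : ℤ}
    (hs : s + n ≤ k - 2) : M.residueZero (α : W →ₗ[ℂ] T) s n v ∈ M.meroHom T := by
  intro p u hu
  obtain ⟨R, hR⟩ := exists_mode_bound u v
  obtain ⟨N, hN⟩ := α.2 p u hu
  choose N' hN' using fun r : ℕ =>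
    α.2 _ (𝒱.adjoint.mode u (r : ℤ) v) (mode_mem_homog hu hv (r : ℤ) rfl)
  refine ⟨max N (∑ r ∈ Finset.range R, |N' r| + R - n), fun m hm s' hs' => ?_⟩
  rw [residueZero_eq_zero_iff]
  intro w
  rw [residueZero_apply, neg_eq_zero]
  refine (congrArg _ ?_).trans (smul_zero (s.negOnePow : ℤ))
  have h := congrArg (α : W →ₗ[ℂ] T) (M.res_comm_antidiagonal u v w s' s m n hR)
  rw [map_sub, (M.residueZero_eq_zero_iff _ _ _ _).mp
    (hN m ((le_max_left _ _).trans hm) s' hs') _, zero_sub, neg_eq_iff_eq_neg] at h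
  rw [h, neg_eq_zero, map_sum]
  refine Finset.sum_eq_zero fun r hr => ?_
  rw [map_sum]
  refine Finset.sum_eq_zero fun at' hat => ?_
  rw [Finset.HasAntidiagonal.mem_antidiagonal] at hat
  have h1 := Finset.single_le_sum (f := fun i => |N' i|) (fun _ _ => abs_nonneg _) hr
  have h2 := (le_max_right _ _).trans hm
  have h3 := le_abs_self (N' r)
  rw [Finset.mem_range] at hr
  rw [map_zsmul, (M.residueZero_eq_zero_iff _ _ _ _).mp (hN' r _ (by omega) _ (by omega)) w,
    smul_zero]

theorem residueMode_mem (n : ℤ) (v : V) (α : M.meroHom T) : M.residueMode n v α ∈ M.meroHom T := by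
  induction v using 𝒱.homog_induction with
  | h k v hv =>
    rw [M.residueMode_apply hv]
    exact EvZero.finsum_mem _ fun i => (M.meroHom T).toAddSubgroup.zsmul_mem
      (M.residueZero_mem α hv (by omega)) _
  | h0 => simp
  | hadd u v hu hv =>
    rw [map_add, LinearMap.add_apply]
    exact Submodule.add_mem _ hu hv

/-- The operators `v_n` on `meroHom`. -/
def residueEnd (n : ℤ) : V →ₗ[ℂ] Module.End ℂ (M.meroHom T) :=
  LinearMap.mk₂ ℂ (fun v α => ⟨M.residueMode n v α, M.residueMode_mem n v α⟩)
    (fun u v α => Subtype.ext (by simp)) (fun c v α => Subtype.ext (by simp))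
    (fun v α β => Subtype.ext (by simp)) (fun c v α => Subtype.ext (by simp))

theorem coe_residueEnd (n : ℤ) (v : V) (α : M.meroHom T) :
    (M.residueEnd n v α : W →ₗ[ℂ] T) = M.residueMode n v α := rfl

theorem residueEnd_trunc (v : V) (α : M.meroHom T) :
    ∃ K : ℤ, ∀ n ≥ K, M.residueEnd n v α = 0 := by
  obtain ⟨K, hK⟩ := M.residueMode_trunc v α
  exact ⟨K, fun n hn => Subtype.ext (hK n hn)⟩

/-- The derivative property, by partial integration. -/
theorem residueEnd_deriv (v : V) (n : ℤ) (α : M.meroHom T) :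
    M.residueEnd n (𝒱.adjoint.L (-1) v) α = -(n : ℂ) • M.residueEnd (n - 1) v α := by
  induction v using 𝒱.homog_induction with
  | h k v hv =>
    refine Subtype.ext ?_
    rw [Submodule.coe_smul, coe_residueEnd, coe_residueEnd, neg_smul, ← add_eq_zero_iff_eq_neg,
      Int.cast_smul_eq_zsmul]
    have hT : ∃ N, ∀ n ≥ N, M.residueMode (n - 1) v α = 0 := by
      obtain ⟨N, hN⟩ := M.residueMode_trunc v α
      exact ⟨N + 1, fun n hn => hN _ (by omega)⟩
    have hT' := M.residueMode_trunc (𝒱.adjoint.L (-1) v) α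
    have hb : ∃ N, ∀ n ≥ N, n • M.residueMode (n - 1) v α = 0 := by
      obtain ⟨N, hN⟩ := hT
      exact ⟨N, fun n hn => by rw [hN n hn, smul_zero]⟩
    refine eq_zero_of_binomial (b := fun n => M.residueMode n (𝒱.adjoint.L (-1) v) α
      + n • M.residueMode (n - 1) v α) ?_ (fun m => ⟨k - 1 - m, ?_⟩) n
    · obtain ⟨N, hN⟩ := hb
      obtain ⟨N', hN'⟩ := hT'
      exact ⟨max N N', fun n hn => by
        rw [hN n ((le_max_left _ _).trans hn), hN' n ((le_max_right _ _).trans hn), add_zero]⟩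
    · simp only [smul_add]
      rw [EvZero.finsum_add ((evZero_int hT' m).zsmul _) ((evZero_int hb m).zsmul _),
        M.residueMode_binomial (L_neg_one_mem hv) α (by omega),
        binomial_transform_mul hT (k - 1 - m) m, residueZero_deriv]
      have h1 := M.residueMode_binomial hv α (s := k - 1 - m) (m := m - 1) (by omega)
      have h2 := M.residueMode_binomial hv α (s := k - 1 - m - 1) (m := m) (by omega)
      simp only [show ∀ i : ℕ, m - 1 + (i : ℤ) = m + i - 1 from fun i => by ring] at h1
      simp only [show ∀ i : ℕ, m + 1 + (i : ℤ) - 1 = m + i from fun i => by ring]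
      rw [h1, h2]
      abel
  | h0 => simp
  | hadd u v hu hv => simp only [map_add, LinearMap.add_apply, hu, hv, smul_add]

section Bracket

variable {p q : ℤ} {u v : V} (hu : u ∈ 𝒱.homog p) (hv : v ∈ 𝒱.homog q) (α : M.meroHom T)

include hu hv

/-- The double binomial transform of the right-hand side of the commutator formula, computed by the
residue theorem for the vectors `u_r v`. -/
theorem residue_iterate_binomial (R : ℕ) (s s' m n : ℤ) (hs : s + m ≤ p - 2) (hs' : s' + n ≤ q - 2) :
    ∑ᶠ i : ℕ, ((-1) ^ i * Ring.choose s i : ℤ) • ∑ᶠ j : ℕ, ((-1) ^ j * Ring.choose s' j : ℤ) •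
      ∑ r ∈ Finset.range R, Ring.choose (m + i) r •
        M.residueMode (n + j + (m + i - r)) (𝒱.adjoint.mode u r v) α
    = ∑ r ∈ Finset.range R, ∑ at' ∈ Finset.HasAntidiagonal.antidiagonal r,
        ((-1) ^ at'.1 * (Ring.choose s at'.1 * Ring.choose m at'.2)) •
          M.residueZero (α : W →ₗ[ℂ] T) (s + s' - at'.1) (m + n - at'.2)
            (𝒱.adjoint.mode u r v) := by
  have hD : ∀ r : ℕ, EvZero fun e : ℕ =>
      M.residueMode (n + m - r + e) (𝒱.adjoint.mode u r v) α := fun r =>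
    evZero_int (M.residueMode_trunc _ α) _
  have hS : ∀ r : ℕ, EvZero fun i : ℕ => ∑ᶠ j : ℕ, ((-1) ^ j * Ring.choose s' j : ℤ) •
      M.residueMode (n + m - r + ((i + j : ℕ) : ℤ)) (𝒱.adjoint.mode u r v) α := by
    intro r
    obtain ⟨N, hN⟩ := hD r
    exact ⟨N, fun i hi => (finsum_congr fun j => by
      have := hN (i + j) (by omega)
      simp only at this
      rw [this, smul_zero]).trans finsum_zero⟩
  have e1 : ∀ i : ℕ, ((-1) ^ i * Ring.choose s i : ℤ) •
      ∑ᶠ j : ℕ, ((-1) ^ j * Ring.choose s' j : ℤ) • ∑ r ∈ Finset.range R, Ring.choose (m + i) r •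
        M.residueMode (n + j + (m + i - r)) (𝒱.adjoint.mode u r v) α
      = ∑ r ∈ Finset.range R, ∑ at' ∈ Finset.HasAntidiagonal.antidiagonal r,
        Ring.choose m at'.2 • (((-1) ^ i * Ring.choose s i) * Ring.choose (i : ℤ) at'.1) •
        ∑ᶠ j : ℕ, ((-1) ^ j * Ring.choose s' j : ℤ) •
          M.residueMode (n + m - r + ((i + j : ℕ) : ℤ)) (𝒱.adjoint.mode u r v) α := by
    intro i
    have hz : ∀ r : ℕ, EvZero fun j : ℕ =>
        M.residueMode (n + m - r + ((i + j : ℕ) : ℤ)) (𝒱.adjoint.mode u r v) α :=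
      fun r => ((hD r).shift i).congr fun j => by rw [add_comm i j]
    have e2 : ∀ j : ℕ, ((-1) ^ j * Ring.choose s' j : ℤ) • ∑ r ∈ Finset.range R,
        Ring.choose (m + i) r • M.residueMode (n + j + (m + i - r)) (𝒱.adjoint.mode u r v) α
        = ∑ r ∈ Finset.range R, Ring.choose (m + i) r • ((-1) ^ j * Ring.choose s' j : ℤ) •
          M.residueMode (n + m - r + ((i + j : ℕ) : ℤ)) (𝒱.adjoint.mode u r v) α := by
      intro j
      rw [Finset.smul_sum]
      refine Finset.sum_congr rfl fun r _ => ?_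
      rw [smul_comm, show n + j + (m + i - r) = n + m - (r : ℤ) + ((i + j : ℕ) : ℤ) by
        push_cast; ring]
    rw [finsum_congr e2, EvZero.finsum_finset_sum _ fun r _ => ((hz r).zsmul _).zsmul _,
      Finset.smul_sum]
    refine Finset.sum_congr rfl fun r _ => ?_
    rw [← EvZero.smul_finsum ((hz r).zsmul _), add_comm m (i : ℤ),
      Ring.add_choose_eq r (Commute.all (i : ℤ) m), Finset.sum_smul, Finset.smul_sum]
    refine Finset.sum_congr rfl fun at' _ => ?_
    rw [smul_smul, smul_smul]
    congr 1
    ring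
  rw [finsum_congr e1, EvZero.finsum_finset_sum _ fun r _ => EvZero.sum _ fun at' _ =>
    ((hS r).zsmul _).zsmul _]
  refine Finset.sum_congr rfl fun r _ => ?_
  rw [EvZero.finsum_finset_sum _ fun at' _ => ((hS r).zsmul _).zsmul _]
  refine Finset.sum_congr rfl fun at' hat => ?_
  rw [Finset.HasAntidiagonal.mem_antidiagonal] at hat
  rw [← EvZero.smul_finsum ((hS r).zsmul _), binomial_transform_double (hD r)]
  have h := M.residueMode_binomial (mode_mem_homog hu hv (r : ℤ) rfl) α (s := s + s' - at'.1)
    (m := m + n - at'.2) (by omega)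
  rw [← h, smul_smul]
  congr 1
  · ring
  · refine finsum_congr fun t => ?_
    rw [show n + m - (r : ℤ) + ((at'.1 + t : ℕ) : ℤ) = m + n - at'.2 + t by omega]

end Bracket

end WeakModule

end RightModule

/-! ### The commutator formula for residues -/

section RightModule

variable {V : Type u} [AddCommGroup V] [Module ℂ V] {𝒱 : VertexOperatorAlgebra V}
  {W : Type u} [AddCommGroup W] [Module ℂ W] (M : WeakModule 𝒱 W)
  {T : Type u} [AddCommGroup T] [Module ℂ T]

namespace WeakModule

section Bracket

variable {p q : ℤ} {u v : V} (hu : u ∈ 𝒱.homog p) (hv : v ∈ 𝒱.homog q) (α : M.meroHom T)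

include hv in
theorem residueEnd_binomial {s n : ℤ} (hs : s + n ≤ q - 2) :
    ∑ᶠ j : ℕ, ((-1) ^ j * Ring.choose s j : ℤ) • M.residueEnd (n + j) v α
      = ⟨M.residueZero (α : W →ₗ[ℂ] T) s n v, M.residueZero_mem α hv hs⟩ := by
  refine Subtype.ext ?_
  have h := EvZero.map_finsum (M.meroHom T).subtype.toAddMonoidHom
    ((evZero_int (b := fun n => M.residueEnd n v α) (M.residueEnd_trunc v α) n).zsmul
      fun j => (-1) ^ j * Ring.choose s j)
  refine h.trans (Eq.trans (finsum_congr fun j => ?_) (M.residueMode_binomial hv α hs))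
  rw [map_zsmul]
  rfl

theorem residueZero_finsum {f : ℕ → W →ₗ[ℂ] T} (hf : EvZero f) (c : ℕ → ℤ) (s m : ℤ) (v : V) :
    ∑ᶠ i, c i • M.residueZero (f i) s m v = M.residueZero (∑ᶠ i, c i • f i) s m v := by
  have h := EvZero.map_finsum (AddMonoidHom.mk' (fun β : W →ₗ[ℂ] T => M.residueZero β s m v)
    fun β β' => M.residueZero_add_left β β' s m v) (hf.zsmul c)
  refine Eq.trans (finsum_congr fun i => ?_) h.symm
  rw [map_zsmul]
  rfl

include hu hv in
/-- The commutator formula for the operators `u_m` and `v_n` on `meroHom`. A sequence is determined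
by its binomial transforms, so it is enough to take them in both indices. By the residue theorem the
two products then become iterated residues at `x = 1`, for which `res_comm_antidiagonal` is the
commutator formula of the module `W`. -/
theorem residueMode_bracket_homog {R : ℕ} (hR : ∀ r ≥ R, 𝒱.adjoint.mode u (r : ℤ) v = 0) (m n : ℤ) :
    M.residueMode m u (M.residueEnd n v α) - M.residueMode n v (M.residueEnd m u α)
      - ∑ r ∈ Finset.range R, Ring.choose m r •
        M.residueMode (n + (m - r)) (𝒱.adjoint.mode u r v) α = 0 := by
  have hC : ∃ K, ∀ k ≥ K, ∀ r ∈ Finset.range R,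
      M.residueMode k (𝒱.adjoint.mode u (r : ℤ) v) α = 0 := by
    choose K hK using fun r : ℕ => M.residueMode_trunc (𝒱.adjoint.mode u (r : ℤ) v) α
    refine ⟨∑ r ∈ Finset.range R, |K r|, fun k hk r hr => hK r k ?_⟩
    have h1 := Finset.single_le_sum (f := fun i => |K i|) (fun _ _ => abs_nonneg _) hr
    have h2 := le_abs_self (K r)
    omega
  obtain ⟨K, hK⟩ := hC
  obtain ⟨K₁, hK₁⟩ := M.residueEnd_trunc v α
  obtain ⟨K₂, hK₂⟩ := M.residueEnd_trunc u α
  have hA : ∀ m, ∃ N, ∀ n ≥ N, M.residueMode m u (M.residueEnd n v α) = 0 := fun m =>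
    ⟨K₁, fun n hn => by rw [hK₁ n hn, map_zero]⟩
  have hB : ∀ m, ∃ N, ∀ n ≥ N, M.residueMode n v (M.residueEnd m u α) = 0 := fun m =>
    M.residueMode_trunc v _
  have hC' : ∀ m, ∃ N, ∀ n ≥ N, ∑ r ∈ Finset.range R, Ring.choose m r •
        M.residueMode (n + (m - r)) (𝒱.adjoint.mode u r v) α = 0 := fun m =>
    ⟨K - m + R, fun n hn => Finset.sum_eq_zero fun r hr => by
      have := Finset.mem_range.mp hr
      rw [hK _ (by omega) r hr, smul_zero]⟩
  -- the binomial transform in `n` is computed by the residue theorem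
  have inner : ∀ m n, ∑ᶠ j : ℕ, ((-1) ^ j * Ring.choose (q - 2 - n) j : ℤ) •
      (M.residueMode m u (M.residueEnd (n + j) v α) - M.residueMode (n + j) v (M.residueEnd m u α)
      - ∑ r ∈ Finset.range R, Ring.choose m r •
        M.residueMode (n + j + (m - r)) (𝒱.adjoint.mode u r v) α)
      = M.residueMode m u ⟨M.residueZero (α : W →ₗ[ℂ] T) (q - 2 - n) n v,
          M.residueZero_mem α hv (by omega)⟩
        - M.residueZero (M.residueEnd m u α : W →ₗ[ℂ] T) (q - 2 - n) n v
        - ∑ᶠ j : ℕ, ((-1) ^ j * Ring.choose (q - 2 - n) j : ℤ) • ∑ r ∈ Finset.range R,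
          Ring.choose m r • M.residueMode (n + j + (m - r)) (𝒱.adjoint.mode u r v) α := by
    intro m n
    simp only [smul_sub]
    have hA' := (evZero_int (hA m) n).zsmul fun j => (-1) ^ j * Ring.choose (q - 2 - n) j
    have hB' := (evZero_int (hB m) n).zsmul fun j => (-1) ^ j * Ring.choose (q - 2 - n) j
    rw [EvZero.finsum_sub (hA'.sub hB') ((evZero_int (hC' m) n).zsmul _),
      EvZero.finsum_sub hA' hB', M.residueMode_binomial hv _ (by omega)]
    congr 2
    rw [← M.residueEnd_binomial hv α (by omega : q - 2 - n + n ≤ q - 2)]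
    refine Eq.trans (finsum_congr fun j => ?_) (EvZero.map_finsum
      (M.residueMode m u).toAddMonoidHom ((evZero_int (b := fun n => M.residueEnd n v α)
        (M.residueEnd_trunc v α) n).zsmul fun j => (-1) ^ j * Ring.choose (q - 2 - n) j)).symm
    rw [map_zsmul]
    rfl
  refine eq_zero_of_binomial (b := fun n => M.residueMode m u (M.residueEnd n v α)
    - M.residueMode n v (M.residueEnd m u α) - ∑ r ∈ Finset.range R, Ring.choose m r •
        M.residueMode (n + (m - r)) (𝒱.adjoint.mode u r v) α) ?_ (fun n => ⟨q - 2 - n, ?_⟩) n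
  · obtain ⟨N, hN⟩ := hB m
    obtain ⟨N', hN'⟩ := hC' m
    refine ⟨max K₁ (max N N'), fun n hn => ?_⟩
    rw [hK₁ n (by omega), hN n (by omega), hN' n (by omega), map_zero, sub_zero, sub_zero]
  rw [inner]
  -- the binomial transform in `m`
  have hA2 := M.residueMode_trunc u (⟨M.residueZero (α : W →ₗ[ℂ] T) (q - 2 - n) n v,
          M.residueZero_mem α hv (by omega)⟩ : M.meroHom T)
  have hB2 : ∃ N, ∀ m ≥ N, M.residueZero (M.residueEnd m u α : W →ₗ[ℂ] T) (q - 2 - n) n v = 0 :=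
    ⟨K₂, fun m hm => by rw [hK₂ m hm]; simp [residueZero]⟩
  have hC2 : ∃ N, ∀ m ≥ N, ∑ᶠ j : ℕ, ((-1) ^ j * Ring.choose (q - 2 - n) j : ℤ) •
      ∑ r ∈ Finset.range R,
          Ring.choose m r • M.residueMode (n + j + (m - r)) (𝒱.adjoint.mode u r v) α = 0 :=
    ⟨K - n + R, fun m hm => (finsum_congr fun j => (congrArg _ (Finset.sum_eq_zero fun r hr => by
      have := Finset.mem_range.mp hr
      rw [hK _ (by omega) r hr, smul_zero])).trans (smul_zero _)).trans finsum_zero⟩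
  refine eq_zero_of_binomial (b := fun m =>
    M.residueMode m u ⟨M.residueZero (α : W →ₗ[ℂ] T) (q - 2 - n) n v,
          M.residueZero_mem α hv (by omega)⟩
        - M.residueZero (M.residueEnd m u α : W →ₗ[ℂ] T) (q - 2 - n) n v
        - ∑ᶠ j : ℕ, ((-1) ^ j * Ring.choose (q - 2 - n) j : ℤ) • ∑ r ∈ Finset.range R,
          Ring.choose m r • M.residueMode (n + j + (m - r)) (𝒱.adjoint.mode u r v) α)
      ?_ (fun m => ⟨p - 2 - m, ?_⟩) m
  · obtain ⟨N, hN⟩ := hA2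
    obtain ⟨N', hN'⟩ := hB2
    obtain ⟨N'', hN''⟩ := hC2
    refine ⟨max N (max N' N''), fun m hm => ?_⟩
    rw [hN m (by omega), hN' m (by omega), hN'' m (by omega), sub_zero, sub_zero]
  simp only [smul_sub]
  have hA' := (evZero_int hA2 m).zsmul fun j => (-1) ^ j * Ring.choose (p - 2 - m) j
  have hB' := (evZero_int hB2 m).zsmul fun j => (-1) ^ j * Ring.choose (p - 2 - m) j
  rw [EvZero.finsum_sub (hA'.sub hB') ((evZero_int hC2 m).zsmul _), EvZero.finsum_sub hA' hB',
    M.residueMode_binomial hu _ (by omega),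
    M.residueZero_finsum (f := fun i : ℕ => (M.residueEnd (m + i) u α : W →ₗ[ℂ] T)) 
      (evZero_int (M.residueMode_trunc u α) m),
    M.residue_iterate_binomial hu hv α R _ _ m n (by omega) (by omega)]
  simp only [coe_residueEnd]
  rw [M.residueMode_binomial hu α (by omega), sub_eq_zero]
  ext w
  -- what is left is the commutator formula in `W`
  have h := congrArg (α : W →ₗ[ℂ] T)
    (M.res_comm_antidiagonal u v w (p - 2 - m) (q - 2 - n) m n hR)
  rw [map_sub, map_sum] at h
  simp only [LinearMap.sub_apply, residueZero_apply, LinearMap.sum_apply, LinearMap.smul_apply,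
    smul_neg, neg_neg]
  rw [← neg_inj, neg_sub] at h
  rw [smul_comm ((q - 2 - n).negOnePow : ℤ), ← smul_sub, ← smul_sub, h, smul_neg,
    smul_neg, Finset.smul_sum, Finset.smul_sum, ← Finset.sum_neg_distrib]
  refine Finset.sum_congr rfl fun r _ => ?_
  rw [map_sum, Finset.smul_sum, Finset.smul_sum, ← Finset.sum_neg_distrib]
  refine Finset.sum_congr rfl fun at' _ => ?_
  generalize p - 2 - m = s
  generalize q - 2 - n = s'
  rw [neg_inj, map_zsmul, smul_smul, smul_smul, smul_smul, Int.negOnePow_sub, Int.negOnePow_add,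
    Int.negOnePow_def (at'.1 : ℤ)]
  congr 1
  have h1 : ((-1) ^ at'.1 * (-1) ^ at'.1 : ℤ) = 1 := by rw [← mul_pow]; simp
  simp only [zpow_natCast, Units.val_mul, Units.val_pow_eq_pow_val, Units.val_neg, Units.val_one]
  linear_combination (-(s.negOnePow * s'.negOnePow * (Ring.choose s at'.1
    * Ring.choose m at'.2) : ℤ)) * h1

end Bracket

theorem residueEnd_bracket (u v : V) (m n : ℤ) (α : M.meroHom T) :
    M.residueEnd m u (M.residueEnd n v α) - M.residueEnd n v (M.residueEnd m u α)
      = ∑ᶠ i : ℕ, Ring.choose m i • M.residueEnd (n + (m - i)) (𝒱.adjoint.mode u i v) α := by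
  have hz : ∀ u v : V, EvZero fun i : ℕ =>
      M.residueEnd (n + (m - i)) (𝒱.adjoint.mode u (i : ℤ) v) α := by
    intro u v
    obtain ⟨R, hR⟩ := exists_mode_bound u v
    exact ⟨R, fun i hi => by simp only; rw [hR i hi, map_zero, LinearMap.zero_apply]⟩
  induction u using 𝒱.homog_induction with
  | h p u hu =>
    induction v using 𝒱.homog_induction with
    | h q v hv =>
      obtain ⟨R, hR⟩ := exists_mode_bound u v
      rw [EvZero.finsum_eq (N := R) fun i hi => by
        rw [hR i hi, map_zero, LinearMap.zero_apply, smul_zero], ← sub_eq_zero]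
      refine Subtype.ext ?_
      rw [Submodule.coe_zero, ← M.residueMode_bracket_homog hu hv α hR m n]
      simp only [Submodule.coe_sub, Submodule.coe_sum, coe_residueEnd, Submodule.coe_smul_of_tower]
    | h0 => simp
    | hadd v v' h h' =>
      simp only [map_add, LinearMap.add_apply, smul_add]
      rw [EvZero.finsum_add ((hz _ _).zsmul _) ((hz _ _).zsmul _), ← h, ← h']
      abel
  | h0 => simp
  | hadd u u' h h' =>
    simp only [map_add, mode_add, LinearMap.add_apply, smul_add]
    rw [EvZero.finsum_add ((hz _ _).zsmul _) ((hz _ _).zsmul _), ← h, ← h']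
    abel

/-- The representation of `g(V)` on `meroHom`. -/
def meroHomRep (T : Type u) [AddCommGroup T] [Module ℂ T] : ModeRep 𝒱 (M.meroHom T) where
  y n := M.residueEnd n
  deriv := M.residueEnd_deriv
  bracket := M.residueEnd_bracket

theorem meroHomRep_trunc : (M.meroHomRep T).Trunc := M.residueEnd_trunc

theorem coe_meroHomRep (n : ℤ) (v : V) (α : M.meroHom T) :
    ((M.meroHomRep T).y n v α : W →ₗ[ℂ] T) = M.residueMode n v α := rfl

end WeakModule

end RightModule

/-! ### Vectors on which the Jacobi identity holds, and forms that vanish on `O(W)` -/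

section JacobiVectors

variable {V : Type u} [AddCommGroup V] [Module ℂ V] {𝒱 : VertexOperatorAlgebra V}

namespace ModeRep

variable {X : Type*} [AddCommGroup X] [Module ℂ X] {R : ModeRep 𝒱 X}

/-- The vectors on which the Jacobi identity holds. -/
def jacobiVectors (hT : R.Trunc) : Submodule ℂ X where
  carrier := {x | R.JacobiAt x}
  zero_mem' := by
    change R.JacobiAt 0
    rw [hT.jacobiAt_iff]
    intro u v l m n
    refine (borcherds_congr (P' := fun _ _ => 0) (Q' := fun _ _ => 0) (g' := fun _ _ => 0)
      (by simp) (by simp) (by simp) l m n).trans ?_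
    simp [borcherds, borcherdsFst, borcherdsSnd, borcherdsIter]
  add_mem' := fun {x x'} hx hx' => by
    change R.JacobiAt (x + x')
    have hx : R.JacobiAt x := hx
    have hx' : R.JacobiAt x' := hx'
    rw [hT.jacobiAt_iff] at hx hx' ⊢
    intro u v l m n
    have h := borcherds_add (hT.finFst u v x) (hT.finFst u v x') (hT.finSnd u v x)
      (hT.finSnd u v x') (R.finIter u v x) (R.finIter u v x') l m n
    rw [hx, hx', add_zero] at h
    rw [← h]
    exact borcherds_congr (by simp) (by simp) (by simp) l m n
  smul_mem' := fun c x hx => by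
    change R.JacobiAt (c • x)
    have hx : R.JacobiAt x := hx
    rw [hT.jacobiAt_iff] at hx ⊢
    intro u v l m n
    have h := map_borcherds (DistribSMul.toAddMonoidHom X c) (hT.finFst u v x)
      (hT.finSnd u v x) (R.finIter u v x) l m n
    rw [hx, map_zero] at h
    rw [h]
    exact borcherds_congr (by simp) (by simp) (by simp) l m n

theorem mem_jacobiVectors (hT : R.Trunc) {x : X} : x ∈ jacobiVectors hT ↔ R.JacobiAt x := Iff.rfl

/-- Moving an operator past two others. -/
theorem y_y_y (R : ModeRep 𝒱 X) (a u v : V) (p m n : ℤ) (x : X) :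
    R.y p a (R.y m u (R.y n v x)) = R.y m u (R.y n v (R.y p a x)) + ∑ᶠ i : ℕ, Ring.choose p i •
      (R.y (m + (p - i)) (𝒱.adjoint.mode a i u) (R.y n v x)
        + R.y m u (R.y (n + (p - i)) (𝒱.adjoint.mode a i v) x)) := by
  have h1 := R.bracket a u p m (R.y n v x)
  have h2 := congrArg (R.y m u) (R.bracket a v p n x)
  have hz := R.bracket_finsum_evZero a v (fun i => n + (p - i)) x
  have h3 := EvZero.map_finsum (R.y m u).toAddMonoidHom (hz.zsmul fun i => Ring.choose p i)
  rw [map_sub] at h2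
  simp only [LinearMap.toAddMonoidHom_coe, map_zsmul] at h3
  rw [h3] at h2
  simp only [smul_add]
  rw [EvZero.finsum_add ((R.bracket_finsum_evZero a u (fun i => m + (p - i)) _).zsmul _)
    ((hz.comp_zero (R.y m u) (map_zero _)).zsmul _), ← h1, ← h2]
  abel

/-- The coefficients of `Y(v,x₀)x`, additively in `v`. -/
def coeffHom (R : ModeRep 𝒱 X) (x : X) : V →+ ℤ → X where
  toFun v n := R.y n v x
  map_zero' := by ext; simp
  map_add' u v := by ext; simp

/-- The subspace on which the Jacobi identity holds is stable. -/
theorem jacobiVectors_stable (hT : R.Trunc) (a : V) (p : ℤ) {x : X} (hx : x ∈ jacobiVectors hT) :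
    R.y p a x ∈ jacobiVectors hT := by
  rw [mem_jacobiVectors, hT.jacobiAt_iff] at hx ⊢
  intro u v l m n
  have h := borcherds_covariance 𝒱.adjoint a p (P := fun u v m n => R.y m u (R.y n v x))
    (Q := fun u v m n => R.y n v (R.y m u x)) (R := R.coeffHom x)
    (R₁ := (AddMonoidHom.compLeft (R.y p a).toAddMonoidHom ℤ).comp (R.coeffHom x))
    (R₂ := R.coeffHom (R.y p a x))
    (P₁ := fun m n => R.y p a (R.y m u (R.y n v x))) (P₂ := fun m n => R.y m u (R.y n v (R.y p a x)))
    (Q₁ := fun m n => R.y p a (R.y n v (R.y m u x))) (Q₂ := fun m n => R.y n v (R.y m u (R.y p a x)))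
    u v (fun u v => hT.finFst u v x) (fun u v => hT.finSnd u v x) (hT.finFst u v _)
    (hT.finSnd u v _) (by simp) (by simp) (by simp) (by simp)
    (fun m n => R.y_y_y a u v p m n x) (fun m n => ?_) (fun v n => ?_) hx l m n
  · refine Eq.trans h.symm ?_
    have h' := map_borcherds (R.y p a).toAddMonoidHom (hT.finFst u v x)
      (hT.finSnd u v x) (R.finIter u v x) l m n
    rw [hx, map_zero] at h'
    exact h'.symm
  · rw [R.y_y_y]
    simp only [add_comm, Int.cast_id]
  · have h' := R.bracket a v p n x
    rw [sub_eq_iff_eq_add'] at h'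
    exact h'

end ModeRep

end JacobiVectors

section LowestForms

variable {V : Type u} [AddCommGroup V] [Module ℂ V] {𝒱 : VertexOperatorAlgebra V}
  {W : Type u} [AddCommGroup W] [Module ℂ W] (M : WeakModule 𝒱 W)
  {T : Type u} [AddCommGroup T] [Module ℂ T]

namespace WeakModule

/-- The expansion of `(1+y)⁻¹` under the residue in `y`. -/
theorem finsum_neg_one_pow_res (a : ℤ) (v : V) (w : W) :
    ∑ᶠ i : ℕ, ((-1) ^ i : ℤ) • M.res i a v w = M.res 0 (a - 1) v w := by
  have h0 := M.evZero_res 0 (a - 1) v w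
  have h1 := M.evZero_res 1 (a - 1) v w
  have e : ∀ i : ℕ, ((-1) ^ i : ℤ) • M.res i a v w
      = ((-1) ^ i : ℤ) • M.res (0 + i) (a - 1) v w
        + ((-1) ^ i : ℤ) • M.res (1 + i) (a - 1) v w := by
    intro i
    rw [← smul_add, ← sub_add_cancel a 1, res_succ, add_sub_cancel_right, zero_add, add_comm (1 : ℤ)]
  rw [finsum_congr e, EvZero.finsum_add (h0.zsmul _) (h1.zsmul _), EvZero.finsum_succ (h0.zsmul _)]
  have e' : ∀ i : ℕ, ((-1) ^ (i + 1) : ℤ) • M.res (0 + ((i + 1 : ℕ) : ℤ)) (a - 1) v w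
      = (-1 : ℤ) • ((-1) ^ i : ℤ) • M.res (1 + i) (a - 1) v w := by
    intro i
    rw [smul_smul, pow_succ', show 0 + ((i + 1 : ℕ) : ℤ) = 1 + i by push_cast; ring]
  rw [finsum_congr e', ← EvZero.smul_finsum (h1.zsmul _)]
  simp

variable {M} {α : W →ₗ[ℂ] T} (hα : ∀ x ∈ M.O, α x = 0)

include hα

theorem mem_meroHom_of_O : α ∈ M.meroHom T := by
  intro k v hv
  refine ⟨k, fun m hm s hs => (M.residueZero_eq_zero_iff _ _ _ _).mpr fun w => hα _ ?_⟩
  exact M.res_mem_O hv w (-2 - s).toNat (m - k).toNat (by omega) (by omega) (by omega)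

/-- Modulo `O(W)` the factor `y^(-1-i)` may be replaced by `(-1)^i y^(-1)`, since `y^(-2-i) (1+y)^k`
gives an element of `O(W)`. -/
theorem apply_res_neg {k : ℤ} {v : V} (hv : v ∈ 𝒱.homog k) (w : W) (i : ℕ) :
    α (M.res (-1 - i) (k - 1) v w) = ((-1) ^ i : ℤ) • α (M.res (-1) (k - 1) v w) := by
  induction i with
  | zero => simp
  | succ i ih =>
    have h := hα _ (M.res_mem_O hv w i 0 (Nat.zero_le _) rfl (by simp : k = k + ((0 : ℕ) : ℤ)))
    have h' := M.res_succ (-2 - i) (k - 1) v w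
    rw [sub_add_cancel] at h'
    rw [h', map_add, add_eq_zero_iff_eq_neg, show -2 - (i : ℤ) + 1 = -1 - i by ring, ih] at h
    rw [show -1 - ((i + 1 : ℕ) : ℤ) = -2 - i by push_cast; ring, h, pow_succ]
    simp

theorem comp_right_O (v : V) : ∀ x ∈ M.O, (α ∘ₗ M.right v) x = 0 :=
  fun _ hx => hα _ (M.right_mem_O v hx)

/-- On a form that vanishes on `O(W)`, the weight-lowering modes vanish. -/
theorem residueMode_of_le {k : ℤ} {v : V} (hv : v ∈ 𝒱.homog k) {m : ℤ} (hm : k ≤ m) :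
    M.residueMode m v ⟨α, mem_meroHom_of_O hα⟩ = 0 := by
  rw [M.residueMode_apply hv]
  refine (finsum_congr fun i => ?_).trans finsum_zero
  rw [(M.residueZero_eq_zero_iff _ _ _ _).mpr fun w => hα _
    (M.res_mem_O hv w (m + i - k).toNat (m + i - k).toNat le_rfl (by omega) (by omega)), smul_zero]

/-- On a form that vanishes on `O(W)`, the weight-preserving mode is the right action of `A(V)`:
only the first term of the sum that defines `residueMode` survives. -/
theorem residueMode_lowest {k : ℤ} {v : V} (hv : v ∈ 𝒱.homog k) :
    M.residueMode (k - 1) v ⟨α, mem_meroHom_of_O hα⟩ = α ∘ₗ M.right v := by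
  have h := M.residueMode_binomial hv ⟨α, mem_meroHom_of_O hα⟩ (s := -1) (m := k - 1) (by omega)
  rw [finsum_eq_single _ 0 fun i hi => by
    rw [residueMode_of_le hα hv (by omega), smul_zero]] at h
  simp only [pow_zero, Ring.choose_zero_right, mul_one, one_smul, Nat.cast_zero, add_zero] at h
  rw [h, right_apply hv]
  ext w
  simp [residueZero_apply]

omit hα in
/-- For `m ≤ k - 2` the form `x^m α(Y(v,x-1)w) dx` is regular at infinity, so that its residue at `x
= 0` is the negative of the one at `x = 1`. -/
theorem residueMode_of_lt (β : M.meroHom T) {k : ℤ} {v : V} (hv : v ∈ 𝒱.homog k) {m : ℤ}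
    (hm : m ≤ k - 2) (w : W) : M.residueMode m v β w = -(β : W →ₗ[ℂ] T) (M.res 0 m v w) := by
  have h := M.residueMode_binomial hv β (s := 0) (m := m) (by omega)
  rw [finsum_eq_single _ 0 fun i hi => by
    rw [Ring.choose_zero_pos ℤ (by omega : 0 < i), mul_zero, zero_smul]] at h
  simp only [pow_zero, Ring.choose_zero_right, mul_one, one_smul, Nat.cast_zero, add_zero] at h
  rw [h, residueZero_apply]
  simp

end WeakModule

end LowestForms

/-! ### The Jacobi identity for forms that vanish on `O(W)` -/

section LowestForms

variable {V : Type u} [AddCommGroup V] [Module ℂ V] {𝒱 : VertexOperatorAlgebra V}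
  {W : Type u} [AddCommGroup W] [Module ℂ W] (M : WeakModule 𝒱 W)
  {T : Type u} [AddCommGroup T] [Module ℂ T]

namespace WeakModule

theorem jl_neg_one_zero (u v : V) (w : W) (a b : ℤ) : M.jl u v w (-1) 0 0 a b
    = ∑ᶠ i : ℕ, M.res (-1 - i) a u (M.res i b v w)
      + ∑ᶠ i : ℕ, M.res (-1 - i) b v (M.res i a u w) := by
  have h (u v : V) (a b : ℤ) : EvZero fun i : ℕ => M.res (-1 - i) a u (M.res i b v w) := by
    obtain ⟨N, hN⟩ := M.evZero_res 0 b v w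
    exact ⟨N, fun i hi => by
      have := hN i hi
      simp only [zero_add] at this ⊢
      rw [this, map_zero]⟩
  rw [← EvZero.finsum_add (h u v a b) (h v u b a), jl]
  refine finsum_congr fun i => ?_
  rw [neg_one_choose, one_smul]
  simp

theorem evZero_res_res (u v : V) (w : W) (n a b : ℤ) (k : ℕ → ℤ) :
    EvZero fun i : ℕ => M.res (k i) a u (M.res (n + i) b v w) := by
  obtain ⟨N, hN⟩ := M.evZero_res n b v w
  exact ⟨N, fun i hi => by
    have := hN i hi
    simp only at this ⊢
    rw [this, map_zero]⟩

/-- One step of the telescoping sum used for `finsum_res_res_telescope`. -/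
theorem finsum_res_res_succ (u v : V) (w : W) (m b : ℤ) :
    ∑ᶠ i : ℕ, M.res (-1 - i) (m + 1) u (M.res i b v w)
      = ∑ᶠ i : ℕ, M.res (-1 - i) m u (M.res i (b + 1) v w)
        + M.res 0 m u (M.res 0 b v w) := by
  have h1 : EvZero fun i : ℕ => M.res (-1 - i) m u (M.res i b v w) := by
    simpa using M.evZero_res_res u v w 0 m b fun i => -1 - i
  have h2 : EvZero fun i : ℕ => M.res (-i) m u (M.res i b v w) := by
    simpa using M.evZero_res_res u v w 0 m b fun i => -i
  have h3 : EvZero fun i : ℕ => M.res (-1 - i) m u (M.res (i + 1) b v w) :=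
    (M.evZero_res_res u v w 1 m b fun i => -1 - i).congr fun i => by rw [add_comm]
  have e1 : ∀ i : ℕ, M.res (-1 - i) (m + 1) u (M.res i b v w)
      = M.res (-1 - i) m u (M.res i b v w) + M.res (-i) m u (M.res i b v w) := fun i => by
    rw [res_succ, show -1 - (i : ℤ) + 1 = -i by ring]
  have e2 : ∀ i : ℕ, M.res (-1 - i) m u (M.res i (b + 1) v w)
      = M.res (-1 - i) m u (M.res i b v w) + M.res (-1 - i) m u (M.res (i + 1) b v w) := fun i => by
    rw [res_succ, map_add]
  rw [finsum_congr e1, finsum_congr e2, EvZero.finsum_add h1 h2, EvZero.finsum_add h1 h3,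
    EvZero.finsum_succ h2, add_assoc, add_comm (M.res _ _ u _) ]
  simp only [Nat.cast_zero, neg_zero, Nat.cast_add, Nat.cast_one, neg_add_rev, ← sub_eq_add_neg]

/-- The two sides are expansions of iterated residues with the factor `(1+y₁)^d` moved to
`(1+y₂)^d`; the difference of these factors is divisible by `y₁ - y₂`, with quotient `∑ i, (1+y₁)^i
(1+y₂)^(d-1-i)`. -/
theorem finsum_res_res_telescope (u v : V) (w : W) (m b : ℤ) (d : ℕ) :
    ∑ᶠ i : ℕ, M.res (-1 - i) (m + d) u (M.res i b v w)
      = ∑ᶠ i : ℕ, M.res (-1 - i) m u (M.res i (b + d) v w)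
        + ∑ i ∈ Finset.range d, M.res 0 (m + i) u (M.res 0 (b + d - 1 - i) v w) := by
  induction d generalizing b with
  | zero => simp
  | succ d ih =>
    rw [show m + ((d + 1 : ℕ) : ℤ) = m + d + 1 by push_cast; ring, finsum_res_res_succ, ih,
      Finset.sum_range_succ, show b + ((d + 1 : ℕ) : ℤ) = b + 1 + d by push_cast; ring,
      show b + 1 + (d : ℤ) - 1 - d = b by ring, add_assoc]

variable {M} {α : W →ₗ[ℂ] T} (hα : ∀ x ∈ M.O, α x = 0)

include hα

/-- Modulo `O(W)` the expansion of `(y₁ - y₂)⁻¹` collapses to `y₁⁻¹ (1 + y₂)⁻¹`. -/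
theorem map_finsum_res_res {p : ℤ} {u : V} (hu : u ∈ 𝒱.homog p) (v : V) (w : W) (b : ℤ) :
    α (∑ᶠ i : ℕ, M.res (-1 - i) (p - 1) u (M.res i b v w))
      = α (M.res (-1) (p - 1) u (M.res 0 (b - 1) v w)) := by
  have h1 : EvZero fun i : ℕ => M.res (-1 - i) (p - 1) u (M.res i b v w) := by
    simpa using M.evZero_res_res u v w 0 (p - 1) b fun i => -1 - i
  have h2 : EvZero fun i : ℕ => M.res i b v w := by simpa using M.evZero_res 0 b v w
  have h3 := EvZero.map_finsum α.toAddMonoidHom h1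
  have h4 := EvZero.map_finsum (α ∘ₗ M.res (-1) (p - 1) u).toAddMonoidHom (h2.zsmul fun i => (-1) ^ i)
  rw [finsum_neg_one_pow_res] at h4
  refine h3.trans (Eq.trans (finsum_congr fun i => ?_) h4.symm)
  rw [map_zsmul]
  exact apply_res_neg hα hu _ i

/-- The case `l = -1` of the Jacobi identity on a form that vanishes on `O(W)`. By the commutator
formula the identity at `(m, n)` depends only on `m + n`, so that for each value of `m + n` one
convenient pair suffices. -/
theorem borcherds_neg_one_lowest {p q : ℤ} {u v : V} (hu : u ∈ 𝒱.homog p) (hv : v ∈ 𝒱.homog q)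
    (m n : ℤ) :
    borcherds
      (fun a b => (M.meroHomRep T).y a u ((M.meroHomRep T).y b v ⟨α, mem_meroHom_of_O hα⟩))
      (fun a b => (M.meroHomRep T).y b v ((M.meroHomRep T).y a u ⟨α, mem_meroHom_of_O hα⟩))
      (fun a b => (M.meroHomRep T).y b (𝒱.adjoint.mode u a v) ⟨α, mem_meroHom_of_O hα⟩) (-1) m n
      = 0 := by
  have hT := M.meroHomRep_trunc (T := T)
  set R := M.meroHomRep T with hR
  set γ : M.meroHom T := ⟨α, mem_meroHom_of_O hα⟩ with hγ
  have hP := hT.finFst u v γ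
  have hQ := hT.finSnd u v γ
  have hg := R.finIter u v γ
  have h0 : ∀ m n, borcherds (fun a b => R.y a u (R.y b v γ)) (fun a b => R.y b v (R.y a u γ))
      (fun a b => R.y b (𝒱.adjoint.mode u a v) γ) 0 m n = 0 := by
    intro m n
    rw [borcherds_zero, sub_eq_zero]
    simpa using R.bracket u v m n γ
  have hu0 : ∀ m, p ≤ m → R.y m u γ = 0 := fun m hm => Subtype.ext (residueMode_of_le hα hu hm)
  have hv0 : ∀ m, q ≤ m → R.y m v γ = 0 := fun m hm => Subtype.ext (residueMode_of_le hα hv hm)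
  have huv : ∀ i : ℤ, 𝒱.adjoint.mode u (-1 + i) v ∈ 𝒱.homog (p + q - i) := fun i =>
    mode_mem_homog hu hv _ (by ring)
  have hv1 : R.y (q - 1) v γ = ⟨α ∘ₗ M.right v, mem_meroHom_of_O (comp_right_O hα v)⟩ :=
    Subtype.ext (residueMode_lowest hα hv)
  have hu1 : R.y (p - 1) u γ = ⟨α ∘ₗ M.right u, mem_meroHom_of_O (comp_right_O hα u)⟩ :=
    Subtype.ext (residueMode_lowest hα hu)
  have hmove : ∀ m' n', m' + n' = m + n →
      borcherds (fun a b => R.y a u (R.y b v γ)) (fun a b => R.y b v (R.y a u γ))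
        (fun a b => R.y b (𝒱.adjoint.mode u a v) γ) (-1) m' n' = 0 →
      borcherds (fun a b => R.y a u (R.y b v γ)) (fun a b => R.y b v (R.y a u γ))
        (fun a b => R.y b (𝒱.adjoint.mode u a v) γ) (-1) m n = 0 := by
    intro m' n' h h'
    have h2 := borcherds_neg_one_shift hP hQ hg h0 m n' (m' - m)
    rw [show m + (m' - m) = m' by ring, h', Int.cast_id, show n' + (m' - m) = n by omega] at h2
    exact h2.symm
  rcases lt_trichotomy (m + n) (p + q - 1) with hs | hs | hs
  -- For `n = q - 1` the first sum has one term and the second one `d + 1` terms. All of them are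
  -- residues at `x = 1`, and the identity is the Jacobi identity of `W` up to a telescoping sum.
  · obtain ⟨d, hd⟩ : ∃ d : ℕ, p - 1 = m + n - q + 1 + d := ⟨(p + q - 2 - m - n).toNat, by omega⟩
    refine hmove (m + n - q + 1) (q - 1) (by ring) ?_
    generalize m + n - q + 1 = m' at *
    refine Subtype.ext (LinearMap.ext fun w => ?_)
    let E : M.meroHom T →ₗ[ℂ] T := (LinearMap.applyₗ w) ∘ₗ (M.meroHom T).subtype
    have h := map_borcherds E.toAddMonoidHom hP hQ hg (-1) m' (q - 1)
    refine h.trans ?_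
    rw [borcherds_neg_one]
    simp only [Int.cast_id]
    have hE (k : ℤ) (v : V) (β : M.meroHom T) : E.toAddMonoidHom (R.y k v β)
      = M.residueMode k v β w := rfl
    have e1 : ∑ᶠ i : ℕ, E.toAddMonoidHom (R.y (m' - 1 - i) u (R.y (q - 1 + i) v γ))
        = -α (M.res (-1) (q - 1) v (M.res 0 (m' - 1) u w)) := by
      rw [finsum_eq_single _ 0 fun i hi => by rw [hv0 _ (by omega), map_zero, map_zero]]
      simp only [Nat.cast_zero, sub_zero, add_zero]
      rw [hv1, hE, residueMode_of_lt _ hu (by omega), LinearMap.comp_apply, right_apply hv]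
    have e2 : ∑ᶠ i : ℕ, E.toAddMonoidHom (R.y (q - 1 + (-1 - i)) v (R.y (m' + i) u γ))
        = ∑ i ∈ Finset.range d, α (M.res 0 (m' + i) u (M.res 0 (q - 2 - i) v w))
          + -α (M.res (-1) (p - 1) u (M.res 0 (q - 2 - d) v w)) := by
      rw [EvZero.finsum_eq (N := d + 1) fun i hi => by rw [hu0 _ (by omega), map_zero, map_zero],
        Finset.sum_range_succ]
      congr 1
      · refine Finset.sum_congr rfl fun i hi => ?_
        rw [Finset.mem_range] at hi
        rw [hE, residueMode_of_lt _ hv (by omega)]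
        have h1 := residueMode_of_lt γ hu (m := m' + i) (by omega)
          (M.res 0 (q - 1 + (-1 - i)) v w)
        refine (congrArg Neg.neg h1).trans ?_
        rw [neg_neg, show q - 1 + (-1 - i) = q - 2 - i by ring]
      · rw [hE, ← hd, hu1, residueMode_of_lt _ hv (by omega), LinearMap.comp_apply,
          right_apply hu, show q - 1 + (-1 - d) = q - 2 - d by ring]
    have e3 : ∑ᶠ i : ℕ, Ring.choose m' i • E.toAddMonoidHom
        (R.y (q - 1 + (m' - i)) (𝒱.adjoint.mode u (-1 + i) v) γ)
        = -α (M.jl u v w (-1) 0 0 m' (q - 1)) := by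
      have hz := (M.js_evZero u v w (-1) 0 fun j => m' + (q - 1) - j).zsmul fun j =>
        Ring.choose m' (j : ℕ)
      have h1 := EvZero.map_finsum (-α).toAddMonoidHom hz
      rw [M.res_assoc]
      refine Eq.trans (finsum_congr fun i => ?_) h1.symm
      rw [map_zsmul, hE, residueMode_of_lt _ (huv i) (by omega),
        show q - 1 + (m' - i) = m' + (q - 1) - i by ring]
      rfl
    rw [e1, e2, e3, jl_neg_one_zero, map_add, map_finsum_res_res hα hv]
    have h4 := congrArg α (M.finsum_res_res_telescope u v w m' (q - 1 - d) d)
    rw [← hd, map_finsum_res_res hα hu, map_add, map_sum] at h4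
    rw [show q - 1 - (d : ℤ) - 1 = q - 2 - d by ring, show q - 1 - (d : ℤ) + d = q - 1 by ring] at h4
    rw [h4]
    simp only [show ∀ i : ℕ, q - 1 - 1 - (i : ℤ) = q - 2 - i from fun i => by ring]
    rw [Submodule.coe_zero, LinearMap.zero_apply]
    abel
  -- The only nonzero term of the first two sums is `u_{p-1} v_{q-1}`, and the identity says that
  -- the right action is compatible with the product of `A(V)`.
  · refine hmove p (q - 1) (by omega) ?_
    refine Subtype.ext (LinearMap.ext fun w => ?_)
    let E : M.meroHom T →ₗ[ℂ] T := (LinearMap.applyₗ w) ∘ₗ (M.meroHom T).subtype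
    have h := map_borcherds E.toAddMonoidHom hP hQ hg (-1) p (q - 1)
    refine h.trans ?_
    have hE (k : ℤ) (v : V) (β : M.meroHom T) : E.toAddMonoidHom (R.y k v β)
      = M.residueMode k v β w := rfl
    rw [borcherds_neg_one]
    simp only [Int.cast_id]
    rw [finsum_eq_single _ 0 fun i hi => by rw [hv0 _ (by omega), map_zero, map_zero],
      finsum_eq_zero_of_forall_eq_zero (f := fun i : ℕ =>
        E.toAddMonoidHom (R.y (q - 1 + (-1 - i)) v (R.y (p + i) u γ)))
        fun i => by rw [hu0 _ (by omega), map_zero, map_zero], add_zero]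
    simp only [Nat.cast_zero, sub_zero, add_zero]
    rw [hv1, hE, residueMode_lowest (comp_right_O hα v) hu]
    have h1 := EvZero.map_finsum (α ∘ₗ (LinearMap.applyₗ w).comp M.right : V →ₗ[ℂ] T).toAddMonoidHom
      (evZero_adjoint (𝒱 := 𝒱) u v (-1) (fun j => Ring.choose p j))
    rw [← adjoint_left hu] at h1
    rw [Submodule.coe_zero, LinearMap.zero_apply, sub_eq_zero]
    have h2 := hα _ (M.right_left u v w)
    rw [map_sub, sub_eq_zero] at h2
    refine h2.symm.trans (h1.trans (finsum_congr fun i => ?_))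
    rw [map_zsmul, hE, show q - 1 + (p - i) = p + q - i - 1 by ring,
      residueMode_lowest hα (huv i)]
    rfl
  -- all terms vanish
  · refine hmove p (m + n - p) (by ring) ?_
    rw [borcherds_neg_one]
    simp only [Int.cast_id]
    rw [finsum_eq_zero_of_forall_eq_zero fun i => by rw [hv0 _ (by omega), map_zero],
      finsum_eq_zero_of_forall_eq_zero (f := fun i : ℕ =>
        R.y (m + n - p + (-1 - i)) v (R.y (p + i) u γ))
        fun i => by rw [hu0 _ (by omega), map_zero],
      finsum_eq_zero_of_forall_eq_zero (f := fun i : ℕ => Ring.choose p i •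
        R.y (m + n - p + (p - i)) (𝒱.adjoint.mode u (-1 + i) v) γ) fun i => by
        rw [show R.y (m + n - p + (p - i)) (𝒱.adjoint.mode u (-1 + i) v) γ = 0 from
          Subtype.ext (residueMode_of_le hα (huv i) (by omega)), smul_zero]]
    simp

/-- A form that vanishes on `O(W)` satisfies the Jacobi identity. -/
theorem jacobiAt_lowest : (M.meroHomRep T).JacobiAt ⟨α, mem_meroHom_of_O hα⟩ := by
  have hT := M.meroHomRep_trunc (T := T)
  rw [hT.jacobiAt_iff]
  intro u v
  set R := M.meroHomRep T with hR
  set γ : M.meroHom T := ⟨α, mem_meroHom_of_O hα⟩ with hγ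
  refine borcherds_of_neg_one (𝒱.adjoint.L (-1)) (fun u a b => R.y a u (R.y b v γ))
    (fun u a b => R.y b v (R.y a u γ)) (fun u a b => R.y b (𝒱.adjoint.mode u a v) γ)
    (fun u => hT.finFst u v γ) (fun u => hT.finSnd u v γ) (fun u => R.finIter u v γ)
    (fun u m n => R.deriv u m _) (fun u m n => ?_) (fun u m n => ?_) (fun u m n => ?_) u
  · rw [R.deriv, map_smul]
  · rw [mode_L_neg_one, LinearMap.smul_apply, map_smul, LinearMap.smul_apply]
  · induction u using 𝒱.homog_induction with
    | h p u hu =>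
      induction v using 𝒱.homog_induction with
      | h q v hv => exact borcherds_neg_one_lowest hα hu hv m n
      | h0 => simp [borcherds, borcherdsFst, borcherdsSnd, borcherdsIter]
      | hadd v v' h h' =>
        have e := borcherds_add (hT.finFst u v γ) (hT.finFst u v' γ) (hT.finSnd u v γ)
          (hT.finSnd u v' γ) (R.finIter u v γ) (R.finIter u v' γ) (-1) m n
        rw [h, h', add_zero] at e
        refine Eq.trans (borcherds_congr ?_ ?_ ?_ _ m n) e <;> simp
    | h0 => simp [borcherds, borcherdsFst, borcherdsSnd, borcherdsIter]
    | hadd u u' h h' =>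
      have e := borcherds_add (hT.finFst u v γ) (hT.finFst u' v γ) (hT.finSnd u v γ)
        (hT.finSnd u' v γ) (R.finIter u v γ) (R.finIter u' v γ) (-1) m n
      rw [h, h', add_zero] at e
      refine Eq.trans (borcherds_congr ?_ ?_ ?_ _ m n) e <;> simp

omit hα in
/-- The maps `W → T` given by the vectors of an `A(V)`-module `U` extend to the `g(V)`-module
`F(U)`. -/
theorem exists_meroHom_lift {U : Type u} [AddCommGroup U] [Module ℂ U]
    (ρ : V →ₗ[ℂ] Module.End ℂ U) (f : U →ₗ[ℂ] W →ₗ[ℂ] T) (hO : ∀ a, ∀ x ∈ M.O, f a x = 0)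
    (hr : ∀ v a w, f a (M.right v w) = f (ρ v a) w) :
    ∃ Φ : FModule ρ 𝒱 →ₗ[ℂ] M.meroHom T,
      (∀ v n x, Φ (FModule.mode ρ 𝒱 v n x) = (M.meroHomRep T).y n v (Φ x)) ∧
      ∀ a, (Φ (FModule.e ρ 𝒱 a) : W →ₗ[ℂ] T) = f a := by
  have hT := M.meroHomRep_trunc (T := T)
  obtain ⟨Φ, h1, h2, -⟩ := FModule.exists_lift ρ (M.meroHomRep T)
    (f.codRestrict (M.meroHom T) fun a => mem_meroHom_of_O (hO a)) (ModeRep.jacobiVectors hT)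
    (fun v n x hx => ModeRep.jacobiVectors_stable hT v n hx) (fun a => jacobiAt_lowest (hO a))
    (fun k v hv m hm a => Subtype.ext (residueMode_of_le (hO a) hv hm))
    (fun k v hv a => Subtype.ext ((residueMode_lowest (hO a) hv).trans
      (LinearMap.ext fun w => hr v a w))) (fun x hx => hx)
  exact ⟨Φ, h1, fun a => congrArg Subtype.val (h2 a)⟩

end WeakModule

end LowestForms

/-! ### The action of `g(V)` on `W ⊗ W₁` -/

section TensorRep

variable {V : Type u} [AddCommGroup V] [Module ℂ V] {𝒱 : VertexOperatorAlgebra V}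
  {W W₁ : Type u} [AddCommGroup W] [Module ℂ W] [AddCommGroup W₁] [Module ℂ W₁]
  (M : WeakModule 𝒱 W) (M₁ : WeakModule 𝒱 W₁) {T : Type u} [AddCommGroup T] [Module ℂ T]

namespace WeakModule

/-- The commutator formula for the operators `∑ i, (m choose i) u_i`, which come from the expansion
of `x^m` in powers of `x - 1`. -/
theorem res_zero_comm (u v : V) (m s n : ℤ) (w : W) :
    M.res 0 m u (M.res s n v w) - M.res s n v (M.res 0 m u w)
      = ∑ᶠ i : ℕ, Ring.choose m i • M.res s (n + (m - i)) (𝒱.adjoint.mode u i v) w := by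
  rw [M.res_comm, finsum_eq_single _ 0]
  · rw [Ring.choose_zero_right, one_smul]
    refine finsum_congr fun i => ?_
    simp only [Nat.cast_zero, zero_add, sub_zero, add_zero]
    rw [show n + (m - i) = m + n - (i : ℤ) by ring]
  · intro i hi
    rw [Ring.choose_zero_pos ℤ (by omega : 0 < i), zero_smul]

/-- The operators `1 ⊗ v_n + ∑ i, (n choose i) v_i ⊗ 1` on `W ⊗ W₁`. -/
def tensorMode (n : ℤ) : V →ₗ[ℂ] Module.End ℂ (W ⊗[ℂ] W₁) :=
  LinearMap.lTensorHom W ∘ₗ M₁.modeLin n + LinearMap.rTensorHom W₁ ∘ₗ M.res 0 n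

theorem tensorMode_tmul (n : ℤ) (v : V) (w : W) (w₁ : W₁) :
    M.tensorMode M₁ n v (w ⊗ₜ w₁) = w ⊗ₜ M₁.mode v n w₁ + M.res 0 n v w ⊗ₜ w₁ := rfl

/-- The action of `g(V)` on `W ⊗ W₁` for which `w ⊗ w₁ ↦ 𝒴(w,1)w₁` is equivariant: by the commutator
formula `v_n 𝒴(w,1) w₁ = 𝒴(w,1) v_n w₁ + ∑ i, (n choose i) 𝒴(v_i w,1) w₁`. -/
def tensorRep : ModeRep 𝒱 (W ⊗[ℂ] W₁) where
  y n := M.tensorMode M₁ n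
  deriv v n x := by
    induction x with
    | zero => simp
    | add x y hx hy => rw [map_add, hx, hy, map_add, smul_add]
    | tmul w w₁ =>
      rw [tensorMode_tmul, tensorMode_tmul, M₁.mode_L_neg_one, M.res_deriv]
      rw [LinearMap.smul_apply, TensorProduct.tmul_smul, Int.cast_zero, zero_smul, zero_add,
        ← neg_smul, ← TensorProduct.smul_tmul', smul_add]
  bracket u v m n x := by
    induction x with
    | zero => simp
    | add x y hx hy =>
      obtain ⟨R, hR⟩ := exists_mode_bound u v
      rw [EvZero.finsum_eq (N := R) fun i hi => by rw [hR i hi]; simp] at hx hy ⊢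
      simp only [map_add, smul_add, Finset.sum_add_distrib]
      rw [← hx, ← hy]
      abel
    | tmul w w₁ =>
      obtain ⟨R, hR⟩ := exists_mode_bound u v
      have h1 := congrArg (TensorProduct.mk ℂ W W₁ w) (M₁.mode_comm u v w₁ m n)
      have h2 := congrArg ((TensorProduct.mk ℂ W W₁).flip w₁) (M.res_zero_comm u v m 0 n w)
      rw [EvZero.finsum_eq (N := R) fun i hi => by rw [hR i hi]; simp] at h1 h2 ⊢
      simp only [map_sub, map_sum, map_zsmul, TensorProduct.mk_apply, LinearMap.flip_apply] at h1 h2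
      simp only [tensorMode_tmul, map_add, smul_add, Finset.sum_add_distrib]
      rw [← h1, ← h2]
      abel

theorem tensorRep_tmul (n : ℤ) (v : V) (w : W) (w₁ : W₁) :
    (M.tensorRep M₁).y n v (w ⊗ₜ w₁) = w ⊗ₜ M₁.mode v n w₁ + M.res 0 n v w ⊗ₜ w₁ := rfl

/-- Moving `v_n` past the multiplication by `x^p (1-x)^s Y(a,x-1)` under the residue. -/
theorem residueMode_residueZero {q k : ℤ} {a v : V} (ha : a ∈ 𝒱.homog q) (hv : v ∈ 𝒱.homog k)
    (α : M.meroHom T) {s p n : ℤ} (hs : s + p ≤ q - 2) (hn : n ≤ k - 1) :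
    M.residueMode n v ⟨M.residueZero (α : W →ₗ[ℂ] T) s p a, M.residueZero_mem α ha hs⟩
      = M.residueZero (M.residueMode n v α) s p a
        + ∑ᶠ r : ℕ, Ring.choose n r •
          M.residueZero (α : W →ₗ[ℂ] T) s (p + (n - r)) (𝒱.adjoint.mode v r a) := by
  obtain ⟨R, hR⟩ := exists_mode_bound v a
  rw [← M.residueEnd_binomial ha α hs]
  have hz := (evZero_int (b := fun n => M.residueEnd n a α) (M.residueEnd_trunc a α) p).zsmul
    fun j => (-1) ^ j * Ring.choose s j
  have h1 := EvZero.map_finsum (M.residueMode n v).toAddMonoidHom hz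
  refine h1.trans ?_
  have h2 : ∀ i : ℕ, (M.residueMode n v).toAddMonoidHom
      (((-1) ^ i * Ring.choose s i) • M.residueEnd (p + i) a α)
      = ((-1) ^ i * Ring.choose s i) • M.residueMode (p + i) a (M.residueEnd n v α)
        + ∑ r ∈ Finset.range R, Ring.choose n r • ((-1) ^ i * Ring.choose s i) •
          M.residueMode (p + (n - r) + i) (𝒱.adjoint.mode v r a) α := by
    intro i
    have h3 := congrArg (M.meroHom T).subtype (M.residueEnd_bracket v a n (p + i) α)
    rw [EvZero.finsum_eq (N := R) fun i hi => by rw [hR i hi]; simp, map_sub, map_sum,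
      sub_eq_iff_eq_add'] at h3
    rw [map_zsmul]
    refine (congrArg _ h3).trans ?_
    rw [smul_add, Finset.smul_sum]
    congr 1
    refine Finset.sum_congr rfl fun r _ => ?_
    rw [map_zsmul, smul_comm, show p + i + (n - r) = p + (n - r) + (i : ℤ) by ring]
    rfl
  have hz1 : ∀ r : ℕ, EvZero fun i : ℕ => M.residueMode (p + (n - r) + i) (𝒱.adjoint.mode v r a) α :=
    fun r => evZero_int (M.residueMode_trunc _ α) _
  rw [finsum_congr h2, EvZero.finsum_add ((evZero_int (M.residueMode_trunc a _) p).zsmul _)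
    (EvZero.sum _ fun r _ => ((hz1 r).zsmul _).zsmul _), M.residueMode_binomial ha _ hs,
    EvZero.finsum_finset_sum _ fun r _ => ((hz1 r).zsmul _).zsmul _,
    EvZero.finsum_eq (N := R) fun i hi => by rw [hR i hi]; simp [residueZero]]
  congr 1
  refine Finset.sum_congr rfl fun r _ => ?_
  rw [← EvZero.smul_finsum ((hz1 r).zsmul _),
    M.residueMode_binomial (mode_mem_homog hv ha (r : ℤ) rfl) α (by omega)]

variable {M} in
/-- The forms `α : W → T` on which `o(v)`, acting on `𝒴(w,1) ·`, is given by `σ v`. -/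
def IsEquivariantForm (σ : V →ₗ[ℂ] Module.End ℂ T) (α : M.meroHom T) : Prop :=
  ∀ k, ∀ v ∈ 𝒱.homog k, ∀ w, M.residueMode (k - 1) v α w + (α : W →ₗ[ℂ] T) (M.res 0 (k - 1) v w)
    = σ v ((α : W →ₗ[ℂ] T) w)

/-- The subspace of equivariant forms is stable under `g(V)`. -/
theorem isEquivariantForm_y {σ : V →ₗ[ℂ] Module.End ℂ T} {α : M.meroHom T}
    (h : IsEquivariantForm σ α) (a : V) (p : ℤ) :
    IsEquivariantForm σ ((M.meroHomRep T).y p a α) := by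
  induction a using 𝒱.homog_induction with
  | h q a ha =>
    intro k v hv
    -- It is enough to show this for the binomial transforms in `p`, which are given by residues at
    -- `x = 1`; there it is the commutator formula in `W`.
    suffices h0 : M.residueMode (k - 1) v ((M.meroHomRep T).y p a α)
      + M.residueMode p a α ∘ₗ M.res 0 (k - 1) v - σ v ∘ₗ M.residueMode p a α = 0 from
        fun w => sub_eq_zero.mp (LinearMap.congr_fun h0 w)
    obtain ⟨K, hK⟩ := M.residueEnd_trunc a α
    refine eq_zero_of_binomial (b := fun p => M.residueMode (k - 1) v ((M.meroHomRep T).y p a α)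
      + M.residueMode p a α ∘ₗ M.res 0 (k - 1) v - σ v ∘ₗ M.residueMode p a α)
      ⟨K, fun n hn => ?_⟩ (fun p => ⟨q - 2 - p, ?_⟩) p
    · have h1 := hK n hn
      have h2 : M.residueMode n a α = 0 := congrArg Subtype.val h1
      change M.residueMode (k - 1) v (M.residueEnd n a α) + _ - _ = 0
      rw [h1, h2]
      simp
    · let L : M.meroHom T →ₗ[ℂ] (W →ₗ[ℂ] T) := M.residueMode (k - 1) v
        + LinearMap.lcomp ℂ T (M.res 0 (k - 1) v) ∘ₗ (M.meroHom T).subtype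
        - LinearMap.compRight ℂ (M := W) (σ v) ∘ₗ (M.meroHom T).subtype
      have hz := (evZero_int (b := fun n => M.residueEnd n a α) ⟨K, hK⟩ p).zsmul
        fun j => (-1) ^ j * Ring.choose (q - 2 - p) j
      have h1 := EvZero.map_finsum L.toAddMonoidHom hz
      rw [M.residueEnd_binomial ha α (by omega)] at h1
      refine Eq.trans (finsum_congr fun i => ?_) (h1.symm.trans ?_)
      · rw [map_zsmul]
        rfl
      · change M.residueMode (k - 1) v ⟨_, M.residueZero_mem α ha (by omega)⟩
          + M.residueZero α.1 (q - 2 - p) p a ∘ₗ M.res 0 (k - 1) v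
          - σ v ∘ₗ M.residueZero α.1 (q - 2 - p) p a = 0
        rw [M.residueMode_residueZero ha hv α (by omega) le_rfl]
        ext w
        have h2 := h k v hv (M.res (q - 2 - p) p a w)
        have h3 := congrArg α.1 (M.res_zero_comm v a (k - 1) (q - 2 - p) p w)
        obtain ⟨R, hR⟩ := exists_mode_bound v a
        rw [EvZero.finsum_eq (N := R) fun i hi => by rw [hR i hi]; simp, map_sub, map_sum] at h3
        rw [EvZero.finsum_eq (N := R) fun i hi => by rw [hR i hi]; simp [residueZero]]
        simp only [LinearMap.sub_apply, LinearMap.add_apply, LinearMap.comp_apply,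
          residueZero_apply, LinearMap.sum_apply, LinearMap.smul_apply, smul_neg, map_neg, map_zsmul,
          ← h2, LinearMap.zero_apply] at h3 ⊢
        rw [Finset.sum_neg_distrib, Finset.sum_congr rfl fun i _ => smul_comm _ _ _,
          ← Finset.smul_sum, ← h3]
        simp only [smul_sub, smul_add]
        abel
  | h0 =>
    intro k v hv w
    simp
  | hadd u v hu hv =>
    intro k x hx w
    have h1 := congrArg₂ (· + ·) (hu k x hx w) (hv k x hx w)
    simp only [map_add, LinearMap.add_apply, Submodule.coe_add] at h1 ⊢
    rw [← h1]
    abel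

end WeakModule

end TensorRep

/-! ### Forms that satisfy the Jacobi identity -/

section JacobiForms

variable {V : Type u} [AddCommGroup V] [Module ℂ V] {𝒱 : VertexOperatorAlgebra V}

namespace ModeRep

variable {X : Type*} [AddCommGroup X] [Module ℂ X] (R : ModeRep 𝒱 X)

/-- The restriction of a representation of `g(V)` to a stable subspace. -/
def restrict (N : Submodule ℂ X) (hN : ∀ v n, ∀ x ∈ N, R.y n v x ∈ N) : ModeRep 𝒱 N where
  y n := LinearMap.mk₂ ℂ (fun v x => ⟨R.y n v x, hN v n x x.2⟩)
    (fun u v x => Subtype.ext (by simp)) (fun c v x => Subtype.ext (by simp))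
    (fun v x x' => Subtype.ext (by simp)) (fun c v x => Subtype.ext (by simp))
  deriv v n x := Subtype.ext (R.deriv v n x)
  bracket u v m n x := by
    obtain ⟨K, hK⟩ := WeakModule.exists_mode_bound u v
    have h := R.bracket u v m n x
    rw [EvZero.finsum_eq (N := K) fun i hi => by rw [hK i hi]; simp] at h ⊢
    refine Subtype.ext (h.trans ?_)
    simp

variable {T : Type*} [AddCommGroup T] [Module ℂ T]

/-- All sufficiently low modes of every vector are annihilated by `β`. -/
def IsLowerTrunc (β : X →ₗ[ℂ] T) : Prop := ∀ v : V, ∃ K : ℤ, ∀ n ≤ K, ∀ x, β (R.y n v x) = 0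

variable {R} {β : X →ₗ[ℂ] T}

theorem IsLowerTrunc.finFst (h : R.IsLowerTrunc β) (u v : V) (x : X) :
    FinFst fun a b : ℤ => β (R.y a u (R.y b v x)) := by
  intro m n
  obtain ⟨K, hK⟩ := h u
  exact ⟨(m - K).toNat, fun i hi => hK _ (by omega) _⟩

theorem IsLowerTrunc.finSnd (h : R.IsLowerTrunc β) (u v : V) (x : X) :
    FinSnd fun a b : ℤ => β (R.y b v (R.y a u x)) := by
  intro m n
  obtain ⟨K, hK⟩ := h v
  exact ⟨(n - K).toNat, fun i hi => hK _ (by simp; omega) _⟩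

theorem finIter_form (β : X →ₗ[ℂ] T) (u v : V) (x : X) :
    FinIter fun a b : ℤ => β (R.y b (𝒱.adjoint.mode u a v) x) := by
  obtain ⟨K, hK⟩ := R.finIter u v x
  exact ⟨K, fun k hk n => (congrArg β (hK k hk n)).trans (map_zero β)⟩

theorem IsLowerTrunc.comp_y (h : R.IsLowerTrunc β) (a : V) (p : ℤ) :
    R.IsLowerTrunc (β ∘ₗ R.y p a) := by
  intro v
  obtain ⟨N, hN⟩ := WeakModule.exists_mode_bound a v
  obtain ⟨K, hK⟩ := h v
  choose K' hK' using fun i : ℕ => h (𝒱.adjoint.mode a (i : ℤ) v)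
  refine ⟨min K (-(∑ i ∈ Finset.range N, |K' i|) - p), fun n hn x => ?_⟩
  have h1 := congrArg β (R.bracket a v p n x)
  rw [EvZero.finsum_eq (N := N) fun i hi => by rw [hN i hi]; simp, map_sub, map_sum,
    hK n (hn.trans (min_le_left _ _)), sub_zero] at h1
  rw [LinearMap.comp_apply, h1]
  refine Finset.sum_eq_zero fun i hi => ?_
  have h2 := Finset.single_le_sum (f := fun i => |K' i|) (fun _ _ => abs_nonneg _) hi
  have h3 := neg_abs_le (K' i)
  have h4 := hn.trans (min_le_right _ _)
  rw [map_zsmul, hK' i _ (by omega), smul_zero]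

variable (R T) in
/-- The forms `β` on a representation of `g(V)` such that the Jacobi identity holds after
applying `β`. -/
def jacobiForms : Submodule ℂ (X →ₗ[ℂ] T) where
  carrier := {β | R.IsLowerTrunc β ∧ ∀ (u v : V) (x : X) (l m n : ℤ),
    borcherds (fun a b => β (R.y a u (R.y b v x))) (fun a b => β (R.y b v (R.y a u x)))
      (fun a b => β (R.y b (𝒱.adjoint.mode u a v) x)) l m n = 0}
  zero_mem' := ⟨fun v => ⟨0, by simp⟩, fun u v x l m n => by
    simp [borcherds, borcherdsFst, borcherdsSnd, borcherdsIter]⟩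
  add_mem' := fun {β β'} h h' => by
    refine ⟨fun v => ?_, fun u v x l m n => ?_⟩
    · obtain ⟨K, hK⟩ := h.1 v
      obtain ⟨K', hK'⟩ := h'.1 v
      exact ⟨min K K', fun n hn x => by
        rw [LinearMap.add_apply, hK n (hn.trans (min_le_left _ _)),
          hK' n (hn.trans (min_le_right _ _)), add_zero]⟩
    · refine (borcherds_add (h.1.finFst u v x) (h'.1.finFst u v x) (h.1.finSnd u v x)
        (h'.1.finSnd u v x) (finIter_form β u v x) (finIter_form β' u v x) l m n).trans ?_
      rw [h.2, h'.2, add_zero]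
  smul_mem' := fun c β h => by
    refine ⟨fun v => ?_, fun u v x l m n => ?_⟩
    · obtain ⟨K, hK⟩ := h.1 v
      exact ⟨K, fun n hn x => by rw [LinearMap.smul_apply, hK n hn, smul_zero]⟩
    · refine (map_borcherds (DistribSMul.toAddMonoidHom T c) (h.1.finFst u v x)
        (h.1.finSnd u v x) (finIter_form β u v x) l m n).symm.trans ?_
      rw [h.2, map_zero]

/-- Composition of a form with the coefficients of `Y(v,x₀)x`, additively in `v`. -/
def formHom (R : ModeRep 𝒱 X) (β : X →ₗ[ℂ] T) (x : X) : V →+ ℤ → T :=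
  (AddMonoidHom.compLeft β.toAddMonoidHom ℤ).comp (R.coeffHom x)

/-- If the Jacobi identity holds for `β` at `x`, then it holds for `β ∘ a_p` at `x` if and only if it
holds for `β` at `a_p x`. -/
theorem borcherds_comp_y (ht : R.IsLowerTrunc β) {x : X}
    (hJ : ∀ (u v : V) (l m n : ℤ), borcherds (fun a b => β (R.y a u (R.y b v x)))
      (fun a b => β (R.y b v (R.y a u x))) (fun a b => β (R.y b (𝒱.adjoint.mode u a v) x)) l m n = 0)
    (a : V) (p : ℤ) (u v : V) (l m n : ℤ) :
    borcherds (fun j k => β (R.y p a (R.y j u (R.y k v x))))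
      (fun j k => β (R.y p a (R.y k v (R.y j u x))))
      (fun j k => β (R.y p a (R.y k (𝒱.adjoint.mode u j v) x))) l m n
    = borcherds (fun j k => β (R.y j u (R.y k v (R.y p a x))))
      (fun j k => β (R.y k v (R.y j u (R.y p a x))))
      (fun j k => β (R.y k (𝒱.adjoint.mode u j v) (R.y p a x))) l m n := by
  obtain ⟨N, hN⟩ := WeakModule.exists_mode_bound a u
  obtain ⟨N', hN'⟩ := WeakModule.exists_mode_bound a v
  have hyyy : ∀ m n, β (R.y p a (R.y m u (R.y n v x))) = β (R.y m u (R.y n v (R.y p a x)))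
      + ∑ᶠ i : ℕ, Ring.choose p i • (β (R.y (m + (p - i)) (𝒱.adjoint.mode a i u) (R.y n v x))
        + β (R.y m u (R.y (n + (p - i)) (𝒱.adjoint.mode a i v) x))) := by
    intro m n
    rw [R.y_y_y, map_add]
    congr 1
    have hz : EvZero fun i : ℕ => R.y (m + (p - i)) (𝒱.adjoint.mode a i u) (R.y n v x)
        + R.y m u (R.y (n + (p - i)) (𝒱.adjoint.mode a i v) x) :=
      ⟨max N N', fun i hi => by
        simp only
        rw [hN i (by omega), hN' i (by omega)]; simp⟩
    refine (EvZero.map_finsum β.toAddMonoidHom (hz.zsmul fun i => Ring.choose p i)).trans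
      (finsum_congr fun i => ?_)
    rw [map_zsmul]
    exact congrArg _ (map_add β _ _)
  have hyyy' : ∀ m n, β (R.y p a (R.y n v (R.y m u x))) = β (R.y n v (R.y m u (R.y p a x)))
      + ∑ᶠ i : ℕ, Ring.choose p i • (β (R.y n v (R.y (m + (p - i)) (𝒱.adjoint.mode a i u) x))
        + β (R.y (n + (p - i)) (𝒱.adjoint.mode a i v) (R.y m u x))) := by
    intro m n
    rw [R.y_y_y, map_add]
    congr 1
    have hz : EvZero fun i : ℕ => R.y (n + (p - i)) (𝒱.adjoint.mode a i v) (R.y m u x)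
        + R.y n v (R.y (m + (p - i)) (𝒱.adjoint.mode a i u) x) :=
      ⟨max N N', fun i hi => by
        simp only
        rw [hN i (by omega), hN' i (by omega)]; simp⟩
    refine (EvZero.map_finsum β.toAddMonoidHom (hz.zsmul fun i => Ring.choose p i)).trans
      (finsum_congr fun i => ?_)
    rw [map_zsmul, add_comm (β _) (β _)]
    exact congrArg _ (map_add β _ _)
  refine borcherds_covariance 𝒱.adjoint a p (P := fun u v m n => β (R.y m u (R.y n v x)))
    (Q := fun u v m n => β (R.y n v (R.y m u x))) (R := R.formHom β x)
    (R₁ := R.formHom (β ∘ₗ R.y p a) x) (R₂ := R.formHom β (R.y p a x))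
    u v (fun u v => ht.finFst u v x) (fun u v => ht.finSnd u v x) (ht.finFst u v _)
    (ht.finSnd u v _) (by simp) (by simp) (by simp) (by simp)
    (fun m n => ?_) (fun m n => ?_) (fun v n => ?_) hJ l m n
  · simpa only [Int.cast_id] using hyyy m n
  · simpa only [Int.cast_id] using hyyy' m n
  · have h' := R.bracket a v p n x
    rw [sub_eq_iff_eq_add'] at h'
    have h2 := congrArg β h'
    have hz := (R.bracket_finsum_evZero a v (fun i => n + (p - i)) x).zsmul fun i => Ring.choose p i
    rw [map_add] at h2
    refine h2.trans (congrArg _ ((EvZero.map_finsum β.toAddMonoidHom hz).trans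
      (finsum_congr fun i => ?_)))
    rw [map_zsmul]
    rfl

theorem comp_y_mem_jacobiForms (h : β ∈ R.jacobiForms T) (a : V) (p : ℤ) :
    β ∘ₗ R.y p a ∈ R.jacobiForms T :=
  ⟨h.1.comp_y a p, fun u v x l m n =>
    (borcherds_comp_y h.1 (fun u v => h.2 u v x) a p u v l m n).trans (h.2 u v _ l m n)⟩

/-- A space of forms that is stable under composition with the modes is stable under the dual
action. -/
theorem dual_mem_of_comp {N : Submodule ℂ (Module.Dual ℂ X)}
    (hN : ∀ (a : V) (p : ℤ), ∀ β ∈ N, β ∘ₗ R.y p a ∈ N) (v : V) (n : ℤ) {β : Module.Dual ℂ X}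
    (hβ : β ∈ N) : R.dual.y n v β ∈ N := by
  induction v using 𝒱.homog_induction with
  | h k v hv =>
    obtain ⟨K, hK⟩ := 𝒱.evZero_expL v
    have h : R.dual.y n v β = (k.negOnePow : ℤ) •
        ∑ j ∈ Finset.range K, β ∘ₗ R.y (2 * k - j - n - 2) (𝒱.expL j v) := by
      ext x
      rw [dual_apply, R.opp_eq_sum hv hK, map_zsmul, map_sum]
      simp
    rw [h]
    exact N.toAddSubgroup.zsmul_mem (sum_mem fun j _ => hN _ _ _ hβ) _
  | h0 => simp
  | hadd u v hu hv =>
    rw [map_add, LinearMap.add_apply]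
    exact N.add_mem hu hv

theorem dual_trunc_of_isLowerTrunc {β : Module.Dual ℂ X} (hβ : R.IsLowerTrunc β) (v : V) :
    ∃ K : ℤ, ∀ n ≥ K, R.dual.y n v β = 0 := by
  induction v using 𝒱.homog_induction with
  | h k v hv =>
    obtain ⟨N, hN⟩ := 𝒱.evZero_expL v
    choose K hK using fun j : ℕ => hβ (𝒱.expL j v)
    refine ⟨2 * k + ∑ j ∈ Finset.range N, |K j|, fun n hn => LinearMap.ext fun x => ?_⟩
    rw [dual_apply, R.opp_eq_sum hv hN, map_zsmul, map_sum]
    refine (congrArg _ (Finset.sum_eq_zero fun j hj => ?_)).trans (smul_zero _)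
    have h2 := Finset.single_le_sum (f := fun i => |K i|) (fun _ _ => abs_nonneg _) hj
    have h3 := neg_abs_le (K j)
    exact hK j _ (by omega) x
  | h0 => exact ⟨0, by simp⟩
  | hadd u v hu hv =>
    obtain ⟨K, hK⟩ := hu
    obtain ⟨K', hK'⟩ := hv
    exact ⟨max K K', fun n hn => by
      rw [map_add, LinearMap.add_apply, hK n ((le_max_left _ _).trans hn),
        hK' n ((le_max_right _ _).trans hn), add_zero]⟩

/-- On a stable space of forms that satisfy the Jacobi identity, the dual action satisfies the
Jacobi identity. -/
theorem jacobiAt_dual {N : Submodule ℂ (Module.Dual ℂ X)}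
    (hN : ∀ v n, ∀ β ∈ N, R.dual.y n v β ∈ N) (hJ : N ≤ R.jacobiForms ℂ) :
    (R.dual.restrict N hN).Trunc ∧ ∀ β : N, (R.dual.restrict N hN).JacobiAt β := by
  have hT : (R.dual.restrict N hN).Trunc := fun v β => by
    obtain ⟨K, hK⟩ := dual_trunc_of_isLowerTrunc (hJ β.2).1 v
    exact ⟨K, fun n hn => Subtype.ext (hK n hn)⟩
  refine ⟨hT, fun β => (hT.jacobiAt_iff β).mpr fun u v l m n => ?_⟩
  refine Subtype.ext (LinearMap.ext fun x => ?_)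
  have h := map_borcherds ((LinearMap.applyₗ x) ∘ₗ N.subtype).toAddMonoidHom (hT.finFst u v β)
    (hT.finSnd u v β) ((R.dual.restrict N hN).finIter u v β) l m n
  have hβ := hJ β.2
  exact h.trans ((R.opp_jacobi (β : Module.Dual ℂ X).toAddMonoidHom x
    (fun u v => hβ.1.finFst u v x) (fun u v => hβ.1.finSnd u v x)
    (fun u v => hβ.2 u v x) u v).2.2 l m n)

end ModeRep

end JacobiForms

/-! ### Intertwining forms -/

section TensorForms

variable {V : Type u} [AddCommGroup V] [Module ℂ V] {𝒱 : VertexOperatorAlgebra V}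
  {W W₁ : Type u} [AddCommGroup W] [Module ℂ W] [AddCommGroup W₁] [Module ℂ W₁]
  (M : WeakModule 𝒱 W) (M₁ : WeakModule 𝒱 W₁) {T : Type*} [AddCommGroup T] [Module ℂ T]

namespace WeakModule

theorem evZero_form (β : W ⊗[ℂ] W₁ →ₗ[ℂ] T) (a : V) (w : W) (w₁ : W₁) (c : ℕ → ℤ) :
    EvZero fun i : ℕ => c i • β (M.mode a i w ⊗ₜ w₁) := by
  obtain ⟨N, hN⟩ := M.evZero_mode a w 0
  exact ⟨N, fun i hi => by
    have := hN i hi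
    simp only [zero_add] at this
    simp [this]⟩

/-- The finite sum `∑ i, (p choose i) a_i w ⊗ w₁` under a form. -/
theorem form_res_zero (β : W ⊗[ℂ] W₁ →ₗ[ℂ] T) (a : V) (p : ℤ) (w : W) (w₁ : W₁) :
    β (M.res 0 p a w ⊗ₜ w₁) = ∑ᶠ i : ℕ, Ring.choose p i • β (M.mode a i w ⊗ₜ w₁) := by
  have h := EvZero.map_finsum (β ∘ₗ (TensorProduct.mk ℂ W W₁).flip w₁).toAddMonoidHom
    ((M.evZero_mode a w 0).zsmul fun i => Ring.choose p i)
  rw [res_apply]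
  refine h.trans (finsum_congr fun i => ?_)
  rw [map_zsmul, zero_add]
  rfl

/-- The Jacobi identity at `x₂ = 1` for `w ⊗ w₁ ↦ 𝒴(w,1)w₁`, after applying the form `β`. -/
def IsIntertwiningForm (β : W ⊗[ℂ] W₁ →ₗ[ℂ] T) : Prop :=
  ∀ (u : V) (w : W) (w₁ : W₁) (l m n : ℤ),
    borcherds (fun j _ : ℤ => β ((M.tensorRep M₁).y j u (w ⊗ₜ w₁)))
      (fun j _ => β (w ⊗ₜ M₁.mode u j w₁)) (fun j _ => β (M.mode u j w ⊗ₜ w₁)) l m n = 0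

section Finiteness

variable {M M₁} {β : W ⊗[ℂ] W₁ →ₗ[ℂ] T}

theorem finFst_form (h : (M.tensorRep M₁).IsLowerTrunc β) (u : V) (z : W ⊗[ℂ] W₁) :
    FinFst fun j _ : ℤ => β ((M.tensorRep M₁).y j u z) := by
  intro m n
  obtain ⟨K, hK⟩ := h u
  exact ⟨(m - K).toNat, fun i hi => hK _ (by omega) _⟩

variable (M M₁ β)

theorem finSnd_form (u : V) (w : W) (w₁ : W₁) :
    FinSnd fun j _ : ℤ => β (w ⊗ₜ M₁.mode u j w₁) := by
  intro m n
  obtain ⟨K, hK⟩ := M₁.trunc u w₁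
  exact ⟨(K - m).toNat, fun i hi => by
    simp only
    rw [hK _ (by omega), TensorProduct.tmul_zero, map_zero]⟩

theorem finIter_form (u : V) (w : W) (w₁ : W₁) :
    FinIter fun j _ : ℤ => β (M.mode u j w ⊗ₜ w₁) := by
  obtain ⟨K, hK⟩ := M.trunc u w
  exact ⟨K, fun k hk n => by
    simp only
    rw [hK _ hk, TensorProduct.zero_tmul, map_zero]⟩

end Finiteness

/-- The forms on `W ⊗ W₁` that satisfy all instances of the Jacobi identity. -/
def tensorForms (T : Type*) [AddCommGroup T] [Module ℂ T] : Submodule ℂ (W ⊗[ℂ] W₁ →ₗ[ℂ] T) where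
  carrier := {β | β ∈ (M.tensorRep M₁).jacobiForms T ∧ M.IsIntertwiningForm M₁ β}
  zero_mem' := ⟨Submodule.zero_mem _, fun u w w₁ l m n => by
    simp [borcherds, borcherdsFst, borcherdsSnd, borcherdsIter]⟩
  add_mem' := fun {β β'} h h' => ⟨Submodule.add_mem _ h.1 h'.1, fun u w w₁ l m n => by
    refine (borcherds_add (finFst_form h.1.1 u _) (finFst_form h'.1.1 u _)
      (finSnd_form M₁ β u w w₁) (finSnd_form M₁ β' u w w₁) (finIter_form M β u w w₁)
      (finIter_form M β' u w w₁) l m n).trans ?_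
    rw [h.2, h'.2, add_zero]⟩
  smul_mem' := fun c β h => ⟨Submodule.smul_mem _ c h.1, fun u w w₁ l m n => by
    refine (map_borcherds (DistribSMul.toAddMonoidHom T c) (finFst_form h.1.1 u _)
      (finSnd_form M₁ β u w w₁) (finIter_form M β u w w₁) l m n).symm.trans ?_
    rw [h.2, map_zero]⟩

theorem comp_mem_tensorForms {T' : Type*} [AddCommGroup T'] [Module ℂ T'] (g : T →ₗ[ℂ] T')
    {β : W ⊗[ℂ] W₁ →ₗ[ℂ] T} (h : β ∈ M.tensorForms M₁ T) : g ∘ₗ β ∈ M.tensorForms M₁ T' := by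
  refine ⟨⟨fun v => ?_, fun u v x l m n => ?_⟩, fun u w w₁ l m n => ?_⟩
  · obtain ⟨K, hK⟩ := h.1.1 v
    exact ⟨K, fun n hn x => (congrArg g (hK n hn x)).trans (map_zero g)⟩
  · refine (map_borcherds g.toAddMonoidHom (h.1.1.finFst u v x)
        (h.1.1.finSnd u v x) (ModeRep.finIter_form β u v x) l m n).symm.trans ?_
    rw [h.1.2, map_zero]
  · refine (map_borcherds g.toAddMonoidHom (finFst_form h.1.1 u _)
      (finSnd_form M₁ β u w w₁) (finIter_form M β u w w₁) l m n).symm.trans ?_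
    rw [h.2, map_zero]

/-- The map `w ↦ β(w ⊗ w₁)`, as a family of coefficients. -/
def tensorHom (β : W ⊗[ℂ] W₁ →ₗ[ℂ] T) (w₁ : W₁) : W →+ ℤ → T where
  toFun w _ := β (w ⊗ₜ w₁)
  map_zero' := by ext; simp
  map_add' u v := by ext; simp [TensorProduct.add_tmul]

theorem comp_y_mem_tensorForms {β : W ⊗[ℂ] W₁ →ₗ[ℂ] T} (h : β ∈ M.tensorForms M₁ T) (a : V) (p : ℤ) :
    β ∘ₗ (M.tensorRep M₁).y p a ∈ M.tensorForms M₁ T := by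
  refine ⟨ModeRep.comp_y_mem_jacobiForms h.1 a p, fun u w w₁ l m n => ?_⟩
  have hΔ : ∀ w w₁, β ((M.tensorRep M₁).y p a (w ⊗ₜ w₁)) = β (w ⊗ₜ M₁.mode a p w₁)
      + ∑ᶠ i : ℕ, Ring.choose p i • β (M.mode a i w ⊗ₜ w₁) := fun w w₁ => by
    rw [tensorRep_tmul, map_add, form_res_zero]
  have hu : ∀ (k : ℕ → ℤ), EvZero fun i : ℕ =>
      M₁.mode (𝒱.adjoint.mode a i u) (k i) w₁ := fun k => by
    obtain ⟨N, hN⟩ := exists_mode_bound a u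
    exact ⟨N, fun i hi => by simp only; rw [hN i hi, mode_zero, LinearMap.zero_apply]⟩
  refine (borcherds_covariance M a p (P := fun u w m _ => β ((M.tensorRep M₁).y m u (w ⊗ₜ w₁)))
    (Q := fun u w m _ => β (w ⊗ₜ M₁.mode u m w₁)) (R := tensorHom β w₁)
    (R₁ := tensorHom (β ∘ₗ (M.tensorRep M₁).y p a) w₁) (R₂ := tensorHom β (M₁.mode a p w₁))
    (Q₁ := fun j _ => (β ∘ₗ (M.tensorRep M₁).y p a) (w ⊗ₜ M₁.mode u j w₁))
    (P₁ := fun j _ => (β ∘ₗ (M.tensorRep M₁).y p a) ((M.tensorRep M₁).y j u (w ⊗ₜ w₁)))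
    (P₂ := fun j _ => β ((M.tensorRep M₁).y j u (w ⊗ₜ M₁.mode a p w₁)))
    (Q₂ := fun j _ => β (w ⊗ₜ M₁.mode u j (M₁.mode a p w₁))) u w
    (fun u w => finFst_form h.1.1 u _) (fun u w => finSnd_form M₁ β u w w₁)
    (finFst_form h.1.1 u _) (finSnd_form M₁ β u w _) (by simp) (by simp) (by simp) (by simp)
    (fun m n => ?_) (fun m n => ?_) (fun x n => hΔ x w₁) (fun u w => h.2 u w w₁) l m n).trans
    (h.2 u w _ l m n)
  · have h1 := congrArg β ((M.tensorRep M₁).bracket a u p m (w ⊗ₜ w₁))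
    have hz := ((M.tensorRep M₁).bracket_finsum_evZero a u (fun i => m + (p - i))
      (w ⊗ₜ w₁)).zsmul fun i => Ring.choose p i
    rw [map_sub, sub_eq_iff_eq_add'] at h1
    have h2 := M.form_res_zero (W₁ := W₁) (β ∘ₗ (M.tensorRep M₁).y m u) a p w w₁
    have h3 := EvZero.map_finsum β.toAddMonoidHom hz
    have hz' := M.evZero_form (β ∘ₗ (M.tensorRep M₁).y m u) a w w₁ fun i => Ring.choose p i
    simp only [LinearMap.comp_apply] at hz' h2
    simp only [smul_add]
    rw [EvZero.finsum_add ((hz.comp_zero β (map_zero β)).congr fun i => by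
      rw [map_zsmul]) hz']
    refine h1.trans ?_
    rw [tensorRep_tmul, map_add, map_add]
    refine (congrArg₂ (· + ·) (congrArg _ h2) h3).trans ?_
    simp only [LinearMap.toAddMonoidHom_coe, map_zsmul]
    abel
  · have h1 := congrArg (fun z => β (w ⊗ₜ z)) (M₁.mode_comm a u w₁ p m)
    have hz := (hu fun i => m + (p - i)).zsmul fun i => Ring.choose p i
    simp only [TensorProduct.tmul_sub, map_sub] at h1
    rw [sub_eq_iff_eq_add'] at h1
    have h3 := EvZero.map_finsum (β ∘ₗ TensorProduct.mk ℂ W W₁ w).toAddMonoidHom hz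
    have hz' := M.evZero_form β a w (M₁.mode u m w₁) fun i => Ring.choose p i
    refine (hΔ w (M₁.mode u m w₁)).trans ?_
    simp only [smul_add]
    rw [EvZero.finsum_add ((hz.comp_zero (β ∘ₗ TensorProduct.mk ℂ W W₁ w) (map_zero _)).congr
      fun i => by rw [map_zsmul]; rfl) hz', h1, add_assoc]
    refine congrArg _ (congrArg (· + _) (h3.trans (finsum_congr fun i => ?_)))
    rw [map_zsmul]
    rfl

section Lowest

variable {M M₁} {ψ : W ⊗[ℂ] W₁ →ₗ[ℂ] T}
  (ha : ∀ k, ∀ v ∈ 𝒱.homog k, ∀ m ≤ k - 2, ∀ z, ψ ((M.tensorRep M₁).y m v z) = 0)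

include ha

theorem isLowerTrunc_of_le : (M.tensorRep M₁).IsLowerTrunc ψ := by
  intro v
  induction v using 𝒱.homog_induction with
  | h k v hv => exact ⟨k - 2, fun n hn z => ha k v hv n hn z⟩
  | h0 => exact ⟨0, by simp⟩
  | hadd u v hu hv =>
    obtain ⟨K, hK⟩ := hu
    obtain ⟨K', hK'⟩ := hv
    exact ⟨min K K', fun n hn z => by
      rw [map_add, LinearMap.add_apply, map_add, hK n (hn.trans (min_le_left _ _)),
        hK' n (hn.trans (min_le_right _ _)), add_zero]⟩

/-- For a form that annihilates the images of the weight-raising modes, the Jacobi identity follows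
from a single instance: `hc` is the case `l = -1`, `m = k - 1`, where the first sum vanishes. The
case `l = 0` holds by the definition of `tensorRep`, so that the case `l = -1` depends only on `m +
n`. -/
theorem isIntertwiningForm_of_lowest
    (hc : ∀ k, ∀ v ∈ 𝒱.homog k, ∀ w w₁, ∑ᶠ i : ℕ, ψ (w ⊗ₜ M₁.mode v (k - 1 + i) w₁)
      = ψ (M.res (-1) (k - 1) v w ⊗ₜ w₁)) : M.IsIntertwiningForm M₁ ψ := by
  have ht := isLowerTrunc_of_le ha
  intro u w w₁
  refine borcherds_of_neg_one (Γ := ℤ) (𝒱.adjoint.L (-1))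
    (fun u j _ => ψ ((M.tensorRep M₁).y j u (w ⊗ₜ w₁)))
    (fun u j _ => ψ (w ⊗ₜ M₁.mode u j w₁)) (fun u j _ => ψ (M.mode u j w ⊗ₜ w₁))
    (fun u => finFst_form ht u _) (fun u => finSnd_form M₁ ψ u w w₁)
    (fun u => finIter_form M ψ u w w₁) (fun u m n => ?_) (fun u m n => ?_) (fun u m n => ?_)
    (fun u m n => ?_) u
  · rw [(M.tensorRep M₁).deriv, map_smul]
  · rw [mode_L_neg_one, LinearMap.smul_apply, TensorProduct.tmul_smul, map_smul]
  · rw [mode_L_neg_one, LinearMap.smul_apply, ← TensorProduct.smul_tmul', map_smul]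
  induction u using 𝒱.homog_induction with
  | h k u hu =>
    have h0 : ∀ m n : ℤ, borcherds (fun j _ : ℤ => ψ ((M.tensorRep M₁).y j u (w ⊗ₜ w₁)))
        (fun j _ => ψ (w ⊗ₜ M₁.mode u j w₁)) (fun j _ => ψ (M.mode u j w ⊗ₜ w₁)) 0 m n = 0 := by
      intro m n
      rw [borcherds_zero, tensorRep_tmul, map_add, form_res_zero]
      abel
    have hs := borcherds_neg_one_shift (finFst_form ht u _) (finSnd_form M₁ ψ u w w₁)
      (finIter_form M ψ u w w₁) h0 (k - 1) n (m - (k - 1))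
    have e : ∀ n : ℤ, borcherds (fun j _ : ℤ => ψ ((M.tensorRep M₁).y j u (w ⊗ₜ w₁)))
        (fun j _ => ψ (w ⊗ₜ M₁.mode u j w₁)) (fun j _ => ψ (M.mode u j w ⊗ₜ w₁)) (-1) (k - 1)
        n = 0 := by
      intro n
      rw [borcherds_neg_one,
        finsum_eq_zero_of_forall_eq_zero fun i => ha k u hu _ (by omega) _, zero_add,
        hc k u hu, sub_eq_zero]
      have h := EvZero.map_finsum (ψ ∘ₗ (TensorProduct.mk ℂ W W₁).flip w₁).toAddMonoidHom
        ((M.evZero_mode u w (-1)).zsmul fun i => Ring.choose (k - 1) i)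
      refine h.trans (finsum_congr fun i => ?_)
      rw [map_zsmul]
      rfl
    rw [show k - 1 + (m - (k - 1)) = m by ring] at hs
    exact hs.trans (e _)
  | h0 => simp [borcherds, borcherdsFst, borcherdsSnd, borcherdsIter]
  | hadd u u' h h' =>
    have e := borcherds_add (finFst_form ht u (w ⊗ₜ w₁)) (finFst_form ht u' (w ⊗ₜ w₁))
      (finSnd_form M₁ ψ u w w₁) (finSnd_form M₁ ψ u' w w₁) (finIter_form M ψ u w w₁)
      (finIter_form M ψ u' w w₁) (-1) m n
    rw [h, h', add_zero] at e
    refine Eq.trans (borcherds_congr ?_ ?_ ?_ _ m n) e <;>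
      simp [TensorProduct.add_tmul, TensorProduct.tmul_add]

end Lowest

end WeakModule

end TensorForms

/-! ### The Jacobi identity for lowest weight components -/

section JacobiPoints

variable {V : Type u} [AddCommGroup V] [Module ℂ V] {𝒱 : VertexOperatorAlgebra V}
  {X : Type*} [AddCommGroup X] [Module ℂ X] {R : ModeRep 𝒱 X}
  {T : Type*} [AddCommGroup T] [Module ℂ T] {β : X →ₗ[ℂ] T}

/-- The vectors at which the Jacobi identity holds after applying `β`. -/
def ModeRep.jacobiPoints (ht : R.IsLowerTrunc β) : Submodule ℂ X where
  carrier := {x | ∀ (u v : V) (l m n : ℤ),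
    borcherds (fun a b => β (R.y a u (R.y b v x))) (fun a b => β (R.y b v (R.y a u x)))
      (fun a b => β (R.y b (𝒱.adjoint.mode u a v) x)) l m n = 0}
  zero_mem' := fun u v l m n => by simp [borcherds, borcherdsFst, borcherdsSnd, borcherdsIter]
  add_mem' := fun {x x'} h h' u v l m n => by
    have e := borcherds_add (ht.finFst u v x) (ht.finFst u v x') (ht.finSnd u v x)
      (ht.finSnd u v x') (finIter_form (R := R) β u v x) (finIter_form (R := R) β u v x') l m n
    rw [h, h', add_zero] at e
    refine Eq.trans (borcherds_congr ?_ ?_ ?_ _ m n) e <;> simp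
  smul_mem' := fun c x h u v l m n => by
    have e := map_borcherds (DistribSMul.toAddMonoidHom T c) (ht.finFst u v x)
      (ht.finSnd u v x) (finIter_form (R := R) β u v x) l m n
    rw [h, map_zero] at e
    refine Eq.trans (borcherds_congr ?_ ?_ ?_ _ m n) e.symm <;> simp

end JacobiPoints

section TensorForms

variable {V : Type u} [AddCommGroup V] [Module ℂ V] {𝒱 : VertexOperatorAlgebra V}
  {W W₁ : Type u} [AddCommGroup W] [Module ℂ W] [AddCommGroup W₁] [Module ℂ W₁]
  {M : WeakModule 𝒱 W} {M₁ : WeakModule 𝒱 W₁} {T : Type u} [AddCommGroup T] [Module ℂ T]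

namespace WeakModule

/-- Modulo `O(W)` only the first term of the expansion of `(y₁ - y₂)⁻¹` counts. -/
theorem map_finsum_res_res_of_O {α : W →ₗ[ℂ] T} (hα : ∀ x ∈ M.O, α x = 0) {p : ℤ} {u : V}
    (hu : u ∈ 𝒱.homog p) (v : V) (w : W) (b : ℤ) :
    α (∑ᶠ i : ℕ, M.res (-1 - i) p u (M.res i b v w)) = α (M.res (-1) p u (M.res 0 b v w)) := by
  have h1 : EvZero fun i : ℕ => M.res (-1 - i) p u (M.res i b v w) := by
    simpa using M.evZero_res_res u v w 0 p b fun i => -1 - i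
  refine (EvZero.map_finsum α.toAddMonoidHom h1).trans ?_
  refine (finsum_eq_single _ 0 fun i hi => hα _ (M.res_mem_O hu _ (i - 1) 0 (Nat.zero_le _)
    (by omega) (by simp))).trans ?_
  simp

section Lowest

variable {ψ : W ⊗[ℂ] W₁ →ₗ[ℂ] T} {σ : V →ₗ[ℂ] Module.End ℂ T}
  (ha : ∀ k, ∀ v ∈ 𝒱.homog k, ∀ m ≤ k - 2, ∀ z, ψ ((M.tensorRep M₁).y m v z) = 0)
  (hb : ∀ k, ∀ v ∈ 𝒱.homog k, ∀ z, ψ ((M.tensorRep M₁).y (k - 1) v z) = σ v (ψ z))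
  (hσ : ∀ u v, σ (𝒱.adjoint.left u v) = σ u * σ v)
  (hc : ∀ k, ∀ v ∈ 𝒱.homog k, ∀ w w₁, ∑ᶠ i : ℕ, ψ (w ⊗ₜ M₁.mode v (k - 1 + i) w₁)
      = ψ (M.res (-1) (k - 1) v w ⊗ₜ w₁))
  {x : W₁} (hx : ∀ k, ∀ v ∈ 𝒱.homog k, ∀ m ≥ k, M₁.mode v m x = 0)
  (hO : ∀ y ∈ M.O, ψ (y ⊗ₜ x) = 0)

include hb hc hx in
/-- At a lowest weight vector `x` the form `ψ( · ⊗ x)` is compatible with the left action of `A(V)`.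
-/
theorem left_equivariant_of_lowest {k : ℤ} {v : V} (hv : v ∈ 𝒱.homog k) (w : W) :
    ψ (M.res (-1) k v w ⊗ₜ x) = σ v (ψ (w ⊗ₜ x)) := by
  have h1 := hc k v hv w x
  rw [finsum_eq_single _ 0 fun i hi => by
    rw [hx k v hv _ (by omega), TensorProduct.tmul_zero, map_zero]] at h1
  have h2 := M.res_succ (-1) (k - 1) v w
  rw [sub_add_cancel, neg_add_cancel] at h2
  rw [h2, TensorProduct.add_tmul, map_add, ← h1, ← hb k v hv, tensorRep_tmul, map_add]
  simp

include ha hb hσ hc hx hO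

/-- The case `l = -1` of the Jacobi identity after applying `ψ`, at `w ⊗ x` for a lowest weight
vector `x`. As in `borcherds_neg_one_lowest`, one pair `(m, n)` suffices for each value of `m + n`.
-/
theorem borcherds_neg_one_tensor {p q : ℤ} {u v : V} (hu : u ∈ 𝒱.homog p) (hv : v ∈ 𝒱.homog q)
    (w : W) (m n : ℤ) :
    borcherds (fun a b => ψ ((M.tensorRep M₁).y a u ((M.tensorRep M₁).y b v (w ⊗ₜ x))))
      (fun a b => ψ ((M.tensorRep M₁).y b v ((M.tensorRep M₁).y a u (w ⊗ₜ x))))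
      (fun a b => ψ ((M.tensorRep M₁).y b (𝒱.adjoint.mode u a v) (w ⊗ₜ x))) (-1) m n = 0 := by
  have ht := isLowerTrunc_of_le ha
  set R := M.tensorRep M₁ with hR
  set z : W ⊗[ℂ] W₁ := w ⊗ₜ x with hz
  have hP := ht.finFst u v z
  have hQ := ht.finSnd u v z
  have hg := ModeRep.finIter_form (R := R) ψ u v z
  have h0 : ∀ m n, borcherds (fun a b => ψ (R.y a u (R.y b v z))) (fun a b => ψ (R.y b v (R.y a u z)))
      (fun a b => ψ (R.y b (𝒱.adjoint.mode u a v) z)) 0 m n = 0 := by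
    intro m n
    have h := congrArg ψ (R.bracket u v m n z)
    rw [borcherds_zero, sub_eq_zero, ← map_sub, h]
    refine (EvZero.map_finsum ψ.toAddMonoidHom ((R.bracket_finsum_evZero u v _ z).zsmul _)).trans
      (finsum_congr fun i => ?_)
    rw [map_zsmul, Int.cast_id]
    rfl
  have huv : ∀ i : ℤ, 𝒱.adjoint.mode u (-1 + i) v ∈ 𝒱.homog (p + q - i) := fun i =>
    mode_mem_homog hu hv _ (by ring)
  have hmove : ∀ m' n', m' + n' = m + n →
      borcherds (fun a b => ψ (R.y a u (R.y b v z))) (fun a b => ψ (R.y b v (R.y a u z)))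
      (fun a b => ψ (R.y b (𝒱.adjoint.mode u a v) z)) (-1) m' n' = 0 →
      borcherds (fun a b => ψ (R.y a u (R.y b v z))) (fun a b => ψ (R.y b v (R.y a u z)))
      (fun a b => ψ (R.y b (𝒱.adjoint.mode u a v) z)) (-1) m n = 0 := by
    intro m' n' h h'
    have h2 := borcherds_neg_one_shift hP hQ hg h0 m n' (m' - m)
    rw [show m + (m' - m) = m' by ring, h', Int.cast_id, show n' + (m' - m) = n by omega] at h2
    exact h2.symm
  rcases lt_trichotomy (m + n) (p + q - 1) with hs | hs | hs
  -- all terms vanish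
  · refine hmove (p - 1) (m + n - p + 1) (by ring) ?_
    rw [borcherds_neg_one]
    simp only [Int.cast_id]
    rw [finsum_eq_zero_of_forall_eq_zero fun i => ha p u hu _ (by omega) _,
      finsum_eq_zero_of_forall_eq_zero fun i => ha q v hv _ (by omega) _,
      finsum_eq_zero_of_forall_eq_zero fun i => by
        rw [ha _ _ (huv i) _ (by omega) _, smul_zero]]
    simp
  -- the identity says that `σ` is multiplicative
  · refine hmove p (q - 1) (by omega) ?_
    rw [borcherds_neg_one]
    simp only [Int.cast_id]
    rw [finsum_eq_single _ 0 fun i hi => ha p u hu _ (by omega) _,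
      finsum_eq_zero_of_forall_eq_zero (f := fun i : ℕ => ψ (R.y (q - 1 + (-1 - i)) v _))
        fun i => ha q v hv _ (by omega) _]
    simp only [Nat.cast_zero, sub_zero, add_zero]
    rw [hb p u hu, hb q v hv, sub_eq_zero]
    have h1 := EvZero.map_finsum ((LinearMap.applyₗ (ψ z)).comp σ : V →ₗ[ℂ] T).toAddMonoidHom
      (evZero_adjoint (𝒱 := 𝒱) u v (-1) (fun j => Ring.choose p j))
    rw [← adjoint_left hu] at h1
    have h2 := LinearMap.congr_fun (hσ u v) (ψ z)
    refine h2.symm.trans (h1.trans (finsum_congr fun i => ?_))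
    rw [map_zsmul, show q - 1 + (p - i) = p + q - (i : ℤ) - 1 by ring, hb _ _ (huv i)]
    rfl
  -- For `n = q` the modes act only on the factor in `W`. The identity is the Jacobi identity of
  -- `W` up to a telescoping sum.
  · obtain ⟨d, hd⟩ : ∃ d : ℕ, m + n - q = p + d := ⟨(m + n - p - q).toNat, by omega⟩
    refine hmove (p + d) q (by omega) ?_
    let α : W →ₗ[ℂ] T := ψ ∘ₗ (TensorProduct.mk ℂ W W₁).flip x
    have hα : ∀ y ∈ M.O, α y = 0 := hO
    have hy : ∀ k, ∀ a ∈ 𝒱.homog k, ∀ i ≥ k, ∀ w, R.y i a (w ⊗ₜ x) = M.res 0 i a w ⊗ₜ x := by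
      intro k a hak i hi w
      rw [hR, tensorRep_tmul, hx k a hak i hi, TensorProduct.tmul_zero, zero_add]
    have hl : ∀ {k v}, v ∈ 𝒱.homog k → ∀ w, α (M.res (-1) k v w) = σ v (α w) := fun hv w =>
      left_equivariant_of_lowest hb hc hx hv w
    rw [borcherds_neg_one]
    simp only [Int.cast_id]
    have e1 : ∑ᶠ i : ℕ, ψ (R.y (p + d - 1 - i) u (R.y (q + i) v z))
        = ∑ i ∈ Finset.range d, α (M.res 0 (p + i) u (M.res 0 (q + d - 1 - i) v w))
          + α (M.res (-1) p u (M.res 0 (q + d) v w)) := by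
      rw [EvZero.finsum_eq (N := d + 1) fun i hi => ha p u hu _ (by omega) _,
        Finset.sum_range_succ, ← Finset.sum_range_reflect]
      congr 1
      · refine Finset.sum_congr rfl fun i hi => ?_
        rw [Finset.mem_range] at hi
        rw [hz, hy q v hv _ (by omega), hy p u hu _ (by omega),
          show p + d - 1 - ((d - 1 - i : ℕ) : ℤ) = p + i by omega,
          show q + ((d - 1 - i : ℕ) : ℤ) = q + d - 1 - i by omega]
        rfl
      · rw [show p + d - 1 - (d : ℤ) = p - 1 by ring, hb p u hu, hz, hy q v hv _ (by omega), hl hu]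
        rfl
    have e2 : ∑ᶠ i : ℕ, ψ (R.y (q + (-1 - i)) v (R.y (p + d + i) u z))
        = α (M.res (-1) q v (M.res 0 (p + d) u w)) := by
      rw [finsum_eq_single _ 0 fun i hi => ha q v hv _ (by omega) _]
      simp only [Nat.cast_zero, sub_zero, add_zero]
      rw [show q + -1 = q - 1 by ring, hb q v hv, hz, hy p u hu _ (by omega), hl hv]
      rfl
    have e3 : ∑ᶠ i : ℕ, Ring.choose (p + d : ℤ) i •
        ψ (R.y (q + (p + d - i)) (𝒱.adjoint.mode u (-1 + i) v) z)
        = α (M.jl u v w (-1) 0 0 (p + d) q) := by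
      have hzz := (M.js_evZero u v w (-1) 0 fun j => p + d + q - j).zsmul fun j =>
        Ring.choose (p + d : ℤ) (j : ℕ)
      have h1 := EvZero.map_finsum α.toAddMonoidHom hzz
      rw [M.res_assoc]
      refine Eq.trans (finsum_congr fun i => ?_) h1.symm
      rw [map_zsmul, hz, hy _ _ (huv i) _ (by omega),
        show q + (p + d - i) = p + d + q - (i : ℤ) by ring]
      rfl
    have h4 := congrArg α (M.finsum_res_res_telescope u v w p q d)
    rw [map_add, map_sum, map_finsum_res_res_of_O hα hu] at h4
    rw [e1, e2, e3, jl_neg_one_zero, map_add, map_finsum_res_res_of_O hα hv, h4]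
    abel

theorem tmul_mem_jacobiPoints (w : W) :
    (w ⊗ₜ x : W ⊗[ℂ] W₁) ∈ ModeRep.jacobiPoints (isLowerTrunc_of_le ha) := by
  have ht := isLowerTrunc_of_le ha
  intro u v
  set R := M.tensorRep M₁ with hR
  set z : W ⊗[ℂ] W₁ := w ⊗ₜ x with hz
  refine borcherds_of_neg_one (𝒱.adjoint.L (-1)) (fun u a b => ψ (R.y a u (R.y b v z)))
    (fun u a b => ψ (R.y b v (R.y a u z))) (fun u a b => ψ (R.y b (𝒱.adjoint.mode u a v) z))
    (fun u => ht.finFst u v z) (fun u => ht.finSnd u v z) (fun u => ModeRep.finIter_form (R := R) ψ u v z)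
    (fun u m n => ?_) (fun u m n => ?_) (fun u m n => ?_) (fun u m n => ?_) u
  · rw [R.deriv, map_smul]
  · rw [R.deriv, map_smul, map_smul]
  · rw [mode_L_neg_one, LinearMap.smul_apply, map_smul, LinearMap.smul_apply, map_smul]
  · induction u using 𝒱.homog_induction with
    | h p u hu =>
      induction v using 𝒱.homog_induction with
      | h q v hv => exact borcherds_neg_one_tensor ha hb hσ hc hx hO hu hv w m n
      | h0 => simp [borcherds, borcherdsFst, borcherdsSnd, borcherdsIter]
      | hadd v v' h h' =>
        have e := borcherds_add (ht.finFst u v z) (ht.finFst u v' z) (ht.finSnd u v z)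
          (ht.finSnd u v' z) (ModeRep.finIter_form (R := R) ψ u v z) (ModeRep.finIter_form (R := R) ψ u v' z) (-1) m n
        rw [h, h', add_zero] at e
        refine Eq.trans (borcherds_congr ?_ ?_ ?_ _ m n) e <;> simp
    | h0 => simp [borcherds, borcherdsFst, borcherdsSnd, borcherdsIter]
    | hadd u u' h h' =>
      have e := borcherds_add (ht.finFst u v z) (ht.finFst u' v z) (ht.finSnd u v z)
        (ht.finSnd u' v z) (ModeRep.finIter_form (R := R) ψ u v z) (ModeRep.finIter_form (R := R) ψ u' v z) (-1) m n
      rw [h, h', add_zero] at e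
      refine Eq.trans (borcherds_congr ?_ ?_ ?_ _ m n) e <;> simp

end Lowest

/-- A map on `W ⊗ W₁` with the properties of `w ⊗ w₁ ↦` the lowest weight component of `𝒴(w,1)w₁`
satisfies all instances of the Jacobi identity. -/
theorem mem_tensorForms_of_lowest {ψ : W ⊗[ℂ] W₁ →ₗ[ℂ] T} {σ : V →ₗ[ℂ] Module.End ℂ T}
    (ha : ∀ k, ∀ v ∈ 𝒱.homog k, ∀ m ≤ k - 2, ∀ z, ψ ((M.tensorRep M₁).y m v z) = 0)
    (hb : ∀ k, ∀ v ∈ 𝒱.homog k, ∀ z, ψ ((M.tensorRep M₁).y (k - 1) v z) = σ v (ψ z))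
    (hσ : ∀ u v, σ (𝒱.adjoint.left u v) = σ u * σ v)
    (hc : ∀ k, ∀ v ∈ 𝒱.homog k, ∀ w w₁, ∑ᶠ i : ℕ, ψ (w ⊗ₜ M₁.mode v (k - 1 + i) w₁)
      = ψ (M.res (-1) (k - 1) v w ⊗ₜ w₁)) {L : Submodule ℂ W₁}
    (hL : ∀ x ∈ L, ∀ k, ∀ v ∈ 𝒱.homog k, ∀ m ≥ k, M₁.mode v m x = 0)
    (hO : ∀ x ∈ L, ∀ y ∈ M.O, ψ (y ⊗ₜ x) = 0)
    (htop : ∀ N : Submodule ℂ W₁, L ≤ N →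
      (∀ k, ∀ v ∈ 𝒱.homog k, ∀ m ≤ k - 2, ∀ x ∈ L, M₁.mode v m x ∈ N) → N = ⊤) :
    ψ ∈ M.tensorForms M₁ T := by
  have ht := isLowerTrunc_of_le ha
  refine ⟨⟨ht, ?_⟩, isIntertwiningForm_of_lowest ha hc⟩
  suffices h : ModeRep.jacobiPoints ht = ⊤ from fun u v z l m n => by
    have : z ∈ ModeRep.jacobiPoints ht := h ▸ Submodule.mem_top
    exact this u v l m n
  have hlow : ∀ x ∈ L, ∀ w, (w ⊗ₜ x : W ⊗[ℂ] W₁) ∈ ModeRep.jacobiPoints ht := fun x hx w =>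
    tmul_mem_jacobiPoints ha hb hσ hc (hL x hx) (hO x hx) w
  have hw : ∀ w, (ModeRep.jacobiPoints ht).comap (TensorProduct.mk ℂ W W₁ w) = ⊤ := by
    intro w
    refine htop _ (fun x hx => hlow x hx w) fun k v hv m hm x hx => ?_
    -- Up to a vector at which the identity is known, `w ⊗ v_m x` is `v_m (w ⊗ x)`. There the
    -- identity holds by covariance, since `ψ ∘ v_m = 0`.
    have h1 : (w ⊗ₜ M₁.mode v m x : W ⊗[ℂ] W₁)
        = (M.tensorRep M₁).y m v (w ⊗ₜ x) - M.res 0 m v w ⊗ₜ x := by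
      rw [tensorRep_tmul, add_sub_cancel_right]
    change (w ⊗ₜ M₁.mode v m x : W ⊗[ℂ] W₁) ∈ ModeRep.jacobiPoints ht
    rw [h1]
    refine Submodule.sub_mem _ ?_ (hlow x hx _)
    intro u v' l m' n'
    rw [← ModeRep.borcherds_comp_y ht (hlow x hx w) v m u v' l m' n']
    refine (borcherds_congr (P' := fun _ _ => 0) (Q' := fun _ _ => 0) (g' := fun _ _ => 0)
      (fun _ _ => ha k v hv m hm _) (fun _ _ => ha k v hv m hm _) (fun _ _ => ha k v hv m hm _)
      l m' n').trans ?_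
    simp [borcherds, borcherdsFst, borcherdsSnd, borcherdsIter]
  rw [eq_top_iff, ← TensorProduct.span_tmul_eq_top, Submodule.span_le]
  rintro z ⟨w, w₁, rfl⟩
  have : w₁ ∈ (ModeRep.jacobiPoints ht).comap (TensorProduct.mk ℂ W W₁ w) := by
    rw [hw]; exact Submodule.mem_top
  exact this

end WeakModule

end TensorForms

/-! ### Eigenspaces and lowest weight spaces -/

section Eigenspaces

namespace Module.End

variable {Z X : Type*} [AddCommGroup Z] [Module ℂ Z] [AddCommGroup X] [Module ℂ X]
  {D : Module.End ℂ Z}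

theorem eigenspace_induction (hD : ⨆ h, D.eigenspace h = ⊤) {P : Z → Prop}
    (h : ∀ c, ∀ z ∈ D.eigenspace c, P z) (h0 : P 0) (hadd : ∀ x y, P x → P y → P (x + y))
    (z : Z) : P z :=
  Submodule.iSup_induction _ (motive := P) (hD ▸ Submodule.mem_top : z ∈ ⨆ h, D.eigenspace h)
    h h0 hadd

theorem bijective_coeLinearMap_eigenspace (hD : ⨆ h, D.eigenspace h = ⊤) :
    Function.Bijective (DirectSum.coeLinearMap D.eigenspace) := by
  change DirectSum.IsInternal D.eigenspace
  exact DirectSum.isInternal_submodule_of_iSupIndep_of_iSup_eq_top D.eigenspaces_iSupIndep hD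

/-- The linear map that is `φ h` on the eigenspace for `h`, for a diagonalizable `D`. -/
def eigenExtend (hD : ⨆ h, D.eigenspace h = ⊤) (φ : ℂ → Z →ₗ[ℂ] X) : Z →ₗ[ℂ] X :=
  DirectSum.toModule ℂ ℂ X (fun h => (φ h).domRestrict (D.eigenspace h)) ∘ₗ
    (LinearEquiv.ofBijective (DirectSum.coeLinearMap D.eigenspace)
      (bijective_coeLinearMap_eigenspace hD)).symm.toLinearMap

theorem eigenExtend_apply (hD : ⨆ h, D.eigenspace h = ⊤) (φ : ℂ → Z →ₗ[ℂ] X) {h : ℂ} {z : Z}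
    (hz : z ∈ D.eigenspace h) : eigenExtend hD φ z = φ h z := by
  have : (LinearEquiv.ofBijective (DirectSum.coeLinearMap D.eigenspace)
      (bijective_coeLinearMap_eigenspace hD)).symm z
      = DirectSum.lof ℂ ℂ (fun h => D.eigenspace h) h ⟨z, hz⟩ := by
    rw [LinearEquiv.symm_apply_eq]
    simp
  simp only [eigenExtend, LinearMap.comp_apply, LinearEquiv.coe_coe, this,
    DirectSum.toModule_lof]
  rfl

/-- The projection onto the eigenspace for `h` along the other eigenspaces. -/
def eigenProj (hD : ⨆ h, D.eigenspace h = ⊤) (h : ℂ) : Z →ₗ[ℂ] Z :=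
  eigenExtend hD fun h' => if h' = h then LinearMap.id else 0

theorem eigenProj_self (hD : ⨆ h, D.eigenspace h = ⊤) {h : ℂ} {z : Z}
    (hz : z ∈ D.eigenspace h) : eigenProj hD h z = z := by
  rw [eigenProj, eigenExtend_apply hD _ hz, if_pos rfl, LinearMap.id_apply]

theorem eigenProj_of_ne (hD : ⨆ h, D.eigenspace h = ⊤) {h h' : ℂ} {z : Z}
    (hz : z ∈ D.eigenspace h') (hne : h' ≠ h) : eigenProj hD h z = 0 := by
  rw [eigenProj, eigenExtend_apply hD _ hz, if_neg hne, LinearMap.zero_apply]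

theorem eigenProj_mem (hD : ⨆ h, D.eigenspace h = ⊤) (h : ℂ) (z : Z) :
    eigenProj hD h z ∈ D.eigenspace h := by
  induction z using eigenspace_induction hD with
  | h c z hz =>
    by_cases hc : c = h
    · subst hc
      rwa [eigenProj_self hD hz]
    · rw [eigenProj_of_ne hD hz hc]
      exact zero_mem _
  | h0 => simp
  | hadd x y hx hy =>
    rw [map_add]
    exact add_mem hx hy

theorem exists_sum_eigenProj (hD : ⨆ h, D.eigenspace h = ⊤) (z : Z) :
    ∃ S : Finset ℂ, z = ∑ h ∈ S, eigenProj hD h z := by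
  suffices ∃ S : Finset ℂ, ∀ S' ⊇ S, z = ∑ h ∈ S', eigenProj hD h z from
    this.imp fun S h => h S subset_rfl
  induction z using eigenspace_induction hD with
  | h c z hz =>
    refine ⟨{c}, fun S hS => ?_⟩
    rw [Finset.sum_eq_single c (fun h _ hne => eigenProj_of_ne hD hz hne.symm)
      (fun hc => absurd (hS (Finset.mem_singleton_self c)) hc), eigenProj_self hD hz]
  | h0 => exact ⟨∅, fun S _ => by simp⟩
  | hadd x y hx hy =>
    classical
    obtain ⟨S, hS⟩ := hx
    obtain ⟨S', hS'⟩ := hy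
    refine ⟨S ∪ S', fun T hT => ?_⟩
    simp only [map_add, Finset.sum_add_distrib]
    rw [← hS T (Finset.union_subset_left hT), ← hS' T (Finset.union_subset_right hT)]

/-- An invariant subspace contains the eigencomponents of its vectors. -/
theorem mem_of_sum_eigenvectors_mem {N : Submodule ℂ Z} (hN : ∀ x ∈ N, D x ∈ N) (S : Finset ℂ)
    {f : ℂ → Z} (hf : ∀ h ∈ S, f h ∈ D.eigenspace h) (hs : ∑ h ∈ S, f h ∈ N) :
    ∀ h ∈ S, f h ∈ N := by
  classical
  induction S using Finset.induction_on generalizing f with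
  | empty => simp
  | insert c S hc ih =>
    have h1 : ∑ h ∈ S, (h - c) • f h ∈ N := by
      have := N.sub_mem (hN _ hs) (N.smul_mem c hs)
      rw [map_sum, Finset.smul_sum, ← Finset.sum_sub_distrib, Finset.sum_insert hc,
        mem_eigenspace_iff.mp (hf c (Finset.mem_insert_self c S)), sub_self, zero_add] at this
      convert this using 1
      refine Finset.sum_congr rfl fun h hh => ?_
      rw [mem_eigenspace_iff.mp (hf h (Finset.mem_insert_of_mem hh)), sub_smul]
    have h2 := ih (f := fun h => (h - c) • f h)
      (fun h hh => Submodule.smul_mem _ _ (hf h (Finset.mem_insert_of_mem hh))) h1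
    have h3 : ∀ h ∈ S, f h ∈ N := fun h hh =>
      (N.smul_mem_iff (sub_ne_zero.mpr fun e : h = c => hc (e ▸ hh))).mp (h2 h hh)
    intro h hh
    rcases Finset.mem_insert.mp hh with rfl | hh
    · rw [Finset.sum_insert hc] at hs
      exact (N.add_mem_iff_left (sum_mem h3)).mp hs
    · exact h3 h hh

theorem eigenProj_mem_of_stable (hD : ⨆ h, D.eigenspace h = ⊤) {N : Submodule ℂ Z}
    (hN : ∀ x ∈ N, D x ∈ N) {z : Z} (hz : z ∈ N) (h : ℂ) : eigenProj hD h z ∈ N := by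
  classical
  obtain ⟨S, hS⟩ := exists_sum_eigenProj hD z
  by_cases hh : h ∈ S
  · exact mem_of_sum_eigenvectors_mem hN S (fun h _ => eigenProj_mem hD h z) (hS ▸ hz) h hh
  · rw [hS, map_sum]
    rw [Finset.sum_eq_zero fun c hc => eigenProj_of_ne hD (eigenProj_mem hD c z)
      fun e : c = h => hh (e ▸ hc)]
    exact N.zero_mem

end Module.End

end Eigenspaces

section LowestWeight

variable {V : Type u} [AddCommGroup V] [Module ℂ V] {𝒱 : VertexOperatorAlgebra V}
  {W : Type u} [AddCommGroup W] [Module ℂ W]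

namespace WeakModule

variable {M : WeakModule 𝒱 W}

theorem IsLowestWeight.unique {h h' : ℂ} (hh : M.IsLowestWeight h) (hh' : M.IsLowestWeight h') :
    h' = h := by
  obtain ⟨n, hn⟩ : ∃ n : ℕ, h' = h + n := by
    by_contra hc
    exact hh'.1 (hh.eq_bot fun n hn => hc ⟨n, hn⟩)
  obtain ⟨n', hn'⟩ : ∃ n : ℕ, h = h' + n := by
    by_contra hc
    exact hh.1 (hh'.eq_bot fun n hn => hc ⟨n, hn⟩)
  have : ((n + n' : ℕ) : ℂ) = 0 := by
    push_cast
    linear_combination -hn - hn'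
  have : n + n' = 0 := by exact_mod_cast this
  obtain rfl : n = 0 := by omega
  simpa using hn

theorem IsLowestWeight.lowest_eq {h : ℂ} (hh : M.IsLowestWeight h) :
    M.lowest = M.weightSpace h := by
  refine le_antisymm (iSup₂_le fun h' hh' => ?_) (le_iSup₂_of_le h hh le_rfl)
  rw [hh.unique hh']

theorem mode_one (x : W) : M.mode 𝒱.one (-1) x = x := by
  simp [mode, M.vacuum]

/-- A nonzero vector of an irreducible module generates it under single modes. -/
theorem IsIrreducible.span_modes_eq_top (irr : M.IsIrreducible) {x : W} (hx : x ≠ 0) :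
    Submodule.span ℂ (Set.range fun an : V × ℤ => M.mode an.1 an.2 x) = ⊤ := by
  have h := isSubmodule_span_modes 𝒱.adjoint M M (fun a (n : ℤ) x => M.mode a n x) x (by simp)
    (fun a n => by simpa using M.evZero_mode a x n)
    (fun u a l m n => by simpa using M.jacobi_borcherds u a x l m n)
  refine (irr.2 _ h).resolve_left fun h0 => hx ?_
  have : x ∈ Submodule.span ℂ (Set.range fun an : V × ℤ => M.mode an.1 an.2 x) :=
    Submodule.subset_span ⟨(𝒱.one, -1), mode_one x⟩
  rwa [h0, Submodule.mem_bot] at this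

theorem IsIrreducible.eq_top_of_modes (irr : M.IsIrreducible) {x : W} (hx : x ≠ 0)
    {N : Submodule ℂ W} (h : ∀ k, ∀ v ∈ 𝒱.homog k, ∀ m : ℤ, M.mode v m x ∈ N) : N = ⊤ := by
  rw [← top_le_iff, ← irr.span_modes_eq_top hx, Submodule.span_le]
  rintro _ ⟨⟨v, m⟩, rfl⟩
  change M.mode v m x ∈ N
  induction v using 𝒱.homog_induction with
  | h k v hv => exact h k v hv m
  | h0 => simp
  | hadd u v hu hv => simpa using N.add_mem hu hv

/-- By the lower bound on the grading there is a weight `h` such that no `h - n` with `n > 0` is a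
weight. A vector of weight `h` generates the irreducible module, so that all weights are `h + n`
with `n ∈ ℕ`. -/
theorem IsOrdinary.exists_isLowestWeight (hM : M.IsOrdinary) (irr : M.IsIrreducible) :
    ∃ h, M.IsLowestWeight h := by
  classical
  obtain ⟨h₀, hh₀⟩ : ∃ h, M.weightSpace h ≠ ⊥ := by
    by_contra! hc
    have := hM.generalized
    rw [IsGeneralized, iSup_eq_bot.mpr hc] at this
    exact (@bot_ne_top (Submodule ℂ W) _ _ (@Submodule.instNontrivial _ _ _ _ _ irr.1)) this
  obtain ⟨N, hN⟩ := hM.lower h₀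
  have hp : M.weightSpace (h₀ - (0 : ℕ)) ≠ ⊥ := by simpa using hh₀
  set n := Nat.findGreatest (fun n : ℕ => M.weightSpace (h₀ - n) ≠ ⊥) N
  have h1 : M.weightSpace (h₀ - n) ≠ ⊥ :=
    Nat.findGreatest_spec (P := fun n : ℕ => M.weightSpace (h₀ - n) ≠ ⊥) (Nat.zero_le N) hp
  have h2 : ∀ m : ℕ, n < m → M.weightSpace (h₀ - m) = ⊥ := fun m hm => by
    rcases le_or_gt m N with hmN | hmN
    · exact not_not.mp (Nat.findGreatest_is_greatest hm hmN)
    · exact hN m hmN.le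
  refine ⟨h₀ - n, h1, ?_⟩
  obtain ⟨x, hx, hx0⟩ := Submodule.exists_mem_ne_zero_of_ne_bot h1
  refine irr.eq_top_of_modes hx0 fun k v hv m => ?_
  have h3 := M.mode_mem hv hx m
  rcases le_or_gt 0 (k - m - 1) with hk | hk
  · refine Submodule.mem_iSup_of_mem (k - m - 1).toNat ?_
    convert h3 using 3
    have : ((k - m - 1).toNat : ℤ) = k - m - 1 := Int.toNat_of_nonneg hk
    exact_mod_cast congrArg (Int.cast : ℤ → ℂ) this
  · have h4 := h2 (n + (m + 1 - k).toNat) (by omega)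
    have e : h₀ - ((n + (m + 1 - k).toNat : ℕ) : ℂ) = h₀ - n + (k - m - 1) := by
      have : ((m + 1 - k).toNat : ℤ) = m + 1 - k := Int.toNat_of_nonneg (by omega)
      have := congrArg (Int.cast : ℤ → ℂ) this
      push_cast at this ⊢
      linear_combination -this
    rw [e] at h4
    rw [h4, Submodule.mem_bot] at h3
    rw [h3]
    exact zero_mem _

theorem IsLowestWeight.mode_lowest_eq_zero {h : ℂ} (hh : M.IsLowestWeight h) {k : ℤ} {v : V}
    (hv : v ∈ 𝒱.homog k) {w : W} (hw : w ∈ M.lowest) {n : ℤ} (hn : k ≤ n) : M.mode v n w = 0 :=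
  hh.mode_eq_zero hv (hh.lowest_eq ▸ hw) hn

/-- An irreducible module is spanned by its lowest weight subspace and the images of this subspace
under the weight-raising modes `v_m`, `m ≤ wt v - 2`. -/
theorem IsLowestWeight.eq_top_of_lowest {h : ℂ} (hh : M.IsLowestWeight h)
    (irr : M.IsIrreducible) {N : Submodule ℂ W} (h0 : M.lowest ≤ N)
    (h1 : ∀ k, ∀ v ∈ 𝒱.homog k, ∀ m ≤ k - 2, ∀ x ∈ M.lowest, M.mode v m x ∈ N) : N = ⊤ := by
  obtain ⟨x, hx, hx0⟩ := Submodule.exists_mem_ne_zero_of_ne_bot hh.1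
  rw [← hh.lowest_eq] at hx
  refine irr.eq_top_of_modes hx0 fun k v hv m => ?_
  rcases le_or_gt m (k - 2) with hm | hm
  · exact h1 k v hv m hm x hx
  · rcases eq_or_lt_of_le (show k - 1 ≤ m by omega) with rfl | hm
    · rw [← M.o_apply hv]
      exact h0 (M.o_mem_lowest v hx)
    · rw [hh.mode_lowest_eq_zero hv hx (by omega)]
      exact zero_mem _

theorem oLowest_left (u v : V) : M.oLowest (𝒱.adjoint.left u v) = M.oLowest u * M.oLowest v :=
  LinearMap.ext fun w => Subtype.ext (M.o_left u v w.2)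

theorem oLowest_one : M.oLowest 𝒱.one = 1 := LinearMap.ext fun w => Subtype.ext (M.o_one w)

theorem coe_oLowest {k : ℤ} {v : V} (hv : v ∈ 𝒱.homog k) (x : M.lowest) :
    (M.oLowest v x : W) = M.mode v (k - 1) x :=
  congrArg (fun f : Module.End ℂ W => f x) (M.o_apply hv)

end WeakModule

end LowestWeight

section Theta

variable {V : Type u} [AddCommGroup V] [Module ℂ V] {𝒱 : VertexOperatorAlgebra V}

theorem VertexOperatorAlgebra.theta_eq_sum {k : ℤ} {v : V} (hv : v ∈ 𝒱.homog k) {N : ℕ}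
    (hN : ∀ j ≥ N, 𝒱.expL j v = 0) :
    𝒱.θ v = (k.negOnePow : ℤ) • ∑ j ∈ Finset.range N, 𝒱.expL j v := by
  rw [θ, 𝒱.extend_apply _ hv, ← Int.cast_smul_eq_zsmul ℂ, Int.cast_negOnePow,
    ← EvZero.finsum_eq hN, _root_.smul_finsum]
  exact finsum_congr fun j => by simp [expL, smul_smul]

theorem VertexOperatorAlgebra.expL_of_L_one_eq_zero {v : V} (h : 𝒱.adjoint.L 1 v = 0) :
    ∀ j ≥ 1, 𝒱.expL j v = 0 := by
  intro j hj
  obtain ⟨j, rfl⟩ := Nat.exists_eq_add_of_le' hj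
  rw [expL, LinearMap.smul_apply, pow_succ, Module.End.mul_apply, h, map_zero, smul_zero]

theorem VertexOperatorAlgebra.L_one_one : 𝒱.adjoint.L 1 𝒱.one = 0 :=
  𝒱.creation_regular _ _ (by norm_num)

theorem VertexOperatorAlgebra.theta_omega : 𝒱.θ 𝒱.ω = 𝒱.ω := by
  rw [theta_eq_sum WeakModule.omega_mem (expL_of_L_one_eq_zero L_one_omega)]
  simp [expL_zero, Int.negOnePow_even]

theorem VertexOperatorAlgebra.theta_one : 𝒱.θ 𝒱.one = 𝒱.one := by
  rw [theta_eq_sum 𝒱.one_mem (expL_of_L_one_eq_zero L_one_one)]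
  simp [expL_zero]

theorem WeakModule.oLowestDual_one {W : Type u} [AddCommGroup W] [Module ℂ W]
    (M : WeakModule 𝒱 W) : M.oLowestDual 𝒱.one = 1 := by
  ext f x
  simp [oLowestDual, VertexOperatorAlgebra.theta_one, oLowest_one, Module.Dual.transpose_apply]

namespace ModeRep

variable {X X' : Type*} [AddCommGroup X] [Module ℂ X] [AddCommGroup X'] [Module ℂ X']
  {T : Type*} [AddCommGroup T] [Module ℂ T]

/-- If the weight-preserving modes act on the values of `ψ` by `σ`, then the weight-preserving
opposite operators act by `σ ∘ θ`. -/
theorem map_opp_eq_theta (R : ModeRep 𝒱 X) (ψ : X →ₗ[ℂ] T) (σ : V →ₗ[ℂ] Module.End ℂ T) {x : X}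
    (h : ∀ k, ∀ v ∈ 𝒱.homog k, ψ (R.y (k - 1) v x) = σ v (ψ x)) {k : ℤ} {v : V}
    (hv : v ∈ 𝒱.homog k) : ψ (R.opp (k - 1) v x) = σ (𝒱.θ v) (ψ x) := by
  obtain ⟨N, hN⟩ := 𝒱.evZero_expL v
  rw [R.opp_eq_sum hv hN, 𝒱.theta_eq_sum hv hN, map_zsmul, map_zsmul, map_sum, map_sum,
    LinearMap.smul_apply, LinearMap.sum_apply]
  congr 1
  refine Finset.sum_congr rfl fun j _ => ?_
  rw [← h _ _ (𝒱.expL_mem hv j)]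
  congr 3
  ring

theorem opp_omega (R : ModeRep 𝒱 X) (m : ℤ) : R.opp m 𝒱.ω = R.y (2 - m) 𝒱.ω := by
  ext x
  rw [R.opp_eq_sum WeakModule.omega_mem
    (VertexOperatorAlgebra.expL_of_L_one_eq_zero VertexOperatorAlgebra.L_one_omega)]
  simp only [Finset.range_one, Finset.sum_singleton, VertexOperatorAlgebra.expL_zero]
  rw [Int.negOnePow_even 2 even_two, Units.val_one, one_smul]
  congr 3
  push_cast
  ring

/-- The definition of the opposite operator, solved for its leading term. -/
theorem y_eq_opp_sub_sum (R : ModeRep 𝒱 X) {k : ℤ} {v : V} (hv : v ∈ 𝒱.homog k) {K : ℕ}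
    (hK : ∀ j ≥ K, 𝒱.expL j v = 0) (n : ℤ) : R.y n v
      = (k.negOnePow : ℤ) • R.opp (2 * k - n - 2) v
        - ∑ j ∈ Finset.range K, R.y (n - (j + 1)) (𝒱.expL (j + 1) v) := by
  ext x
  have h2 := R.opp_eq_sum hv (N := K + 1) (fun j hj => hK j (by omega)) (2 * k - n - 2) x
  rw [Finset.sum_range_succ', 𝒱.expL_zero] at h2
  rw [LinearMap.sub_apply, LinearMap.smul_apply, h2, smul_smul, Int.units_coe_mul_self,
    one_smul, LinearMap.sum_apply]
  have h3 : ∀ j : ℕ, 2 * k - ((j + 1 : ℕ) : ℤ) - (2 * k - n - 2) - 2 = n - (j + 1) :=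
    fun j => by push_cast; ring
  simp only [h3]
  rw [show 2 * k - ((0 : ℕ) : ℤ) - (2 * k - n - 2) - 2 = n by push_cast; ring, add_sub_cancel_left]

/-- The modes are linear combinations of the opposite modes, with coefficients that do not depend
on the representation. -/
theorem pair_mem_of_opp (R : ModeRep 𝒱 X) (R' : ModeRep 𝒱 X')
    {S : Submodule ℂ (Module.End ℂ X × Module.End ℂ X')}
    (hS : ∀ n v, (R.opp n v, R'.opp n v) ∈ S) (n : ℤ) (v : V) : (R.y n v, R'.y n v) ∈ S := by
  -- induction on the weight of `v`, since `L(1)` lowers the weight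
  have key : ∀ d : ℕ, ∀ N : ℤ, (∀ k < N, 𝒱.homog k = ⊥) → ∀ k : ℤ, k < N + d →
      ∀ v ∈ 𝒱.homog k, ∀ n, (R.y n v, R'.y n v) ∈ S := by
    intro d N hN
    induction d with
    | zero =>
      intro k hk v hv n
      rw [hN _ (by simpa using hk), Submodule.mem_bot] at hv
      subst hv
      simp only [map_zero]
      exact S.zero_mem
    | succ d ih =>
      intro k hk v hv n
      obtain ⟨K, hK⟩ := 𝒱.evZero_expL v
      rw [R.y_eq_opp_sub_sum hv hK, R'.y_eq_opp_sub_sum hv hK]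
      have h1 := S.sub_mem (S.toAddSubgroup.zsmul_mem (hS (2 * k - n - 2) v) (k.negOnePow : ℤ))
        (sum_mem fun j (_ : j ∈ Finset.range K) => ih (k - (j + 1 : ℕ)) (by push_cast at hk ⊢; omega)
          (𝒱.expL (j + 1) v) (𝒱.expL_mem hv (j + 1)) (n - (j + 1)))
      rwa [← prod_mk_sum, Prod.smul_mk, Prod.mk_sub_mk] at h1
  obtain ⟨N, hN⟩ := 𝒱.lower_grading
  induction v using 𝒱.homog_induction with
  | h k v hv => exact key (k - N + 1).toNat N hN k (by omega) v hv n
  | h0 =>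
    simp only [map_zero]
    exact S.zero_mem
  | hadd u v hu hv =>
    simp only [map_add]
    exact S.add_mem hu hv

end ModeRep

end Theta

/-! ### Forms from bimodule homomorphisms -/

section FormOfHom

variable {V : Type u} [AddCommGroup V] [Module ℂ V] {𝒱 : VertexOperatorAlgebra V}
  {W W₁ W₂ : Type u} [AddCommGroup W] [Module ℂ W] [AddCommGroup W₁] [Module ℂ W₁]
  [AddCommGroup W₂] [Module ℂ W₂]
  {M : WeakModule 𝒱 W} {M₁ : WeakModule 𝒱 W₁} {M₂ : WeakModule 𝒱 W₂}

namespace WeakModule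

/-- A bimodule homomorphism extends to a form on `W ⊗ W₁` that satisfies all instances of the Jacobi
identity. -/
theorem EqF.exists_form (he : M₁.EqF) {h₁ : ℂ} (hh₁ : M₁.IsLowestWeight h₁)
    (irr₁ : M₁.IsIrreducible) (f : M₁.lowest →ₗ[ℂ] W →ₗ[ℂ] M₂.lowest)
    (hO : ∀ a, ∀ x ∈ M.O, f a x = 0)
    (hr : ∀ v a w, f a (M.right v w) = f (M₁.oLowest v a) w)
    (hl : ∀ v a w, f a (M.left v w) = M₂.oLowest v (f a w)) :
    ∃ ψ : W ⊗[ℂ] W₁ →ₗ[ℂ] M₂.lowest, (∀ (a : M₁.lowest) w, ψ (w ⊗ₜ (a : W₁)) = f a w) ∧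
      (∀ k, ∀ v ∈ 𝒱.homog k, ∀ m ≤ k - 2, ∀ z, ψ ((M.tensorRep M₁).y m v z) = 0) ∧
      (∀ k, ∀ v ∈ 𝒱.homog k, ∀ z, ψ ((M.tensorRep M₁).y (k - 1) v z) = M₂.oLowest v (ψ z)) ∧
      ψ ∈ M.tensorForms M₁ M₂.lowest := by
  -- `Ψ` extends `f` from `W₁(0)` to `W₁ = F(W₁(0))`, with values in the maps `W → W₂(0)` on which
  -- `g(V)` acts by residues
  obtain ⟨Φ, hΦ, hΦe⟩ := exists_meroHom_lift M₁.oLowest f hO hr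
  obtain ⟨e, he, hee⟩ := he
  set Ψ : W₁ →ₗ[ℂ] M.meroHom M₂.lowest := Φ ∘ₗ e.symm.toLinearMap with hΨ
  have hy : ∀ v n x, Ψ (M₁.mode v n x) = (M.meroHomRep M₂.lowest).y n v (Ψ x) := fun v n x => by
    have : e.symm (M₁.mode v n x) = FModule.mode M₁.oLowest 𝒱 v n (e.symm x) := by
      rw [LinearEquiv.symm_apply_eq, he, LinearEquiv.apply_symm_apply]
    change Φ (e.symm _) = _
    rw [this, hΦ]
    rfl
  have hbase : ∀ a : M₁.lowest, (Ψ a : W →ₗ[ℂ] M₂.lowest) = f a := fun a => by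
    have : e.symm (a : W₁) = FModule.e M₁.oLowest 𝒱 a := by
      rw [LinearEquiv.symm_apply_eq, hee]
    change (Φ (e.symm _) : W →ₗ[ℂ] M₂.lowest) = _
    rw [this, hΦe]
  have hcoe : ∀ v n x, (Ψ (M₁.mode v n x) : W →ₗ[ℂ] M₂.lowest) = M.residueMode n v (Ψ x) :=
    fun v n x => by rw [hy, coe_meroHomRep]
  -- the vectors with equivariant image are stable under the modes, and contain `W₁(0)` because `f`
  -- is compatible with the left action of `A(V)`
  have heq : ∀ x, IsEquivariantForm M₂.oLowest (Ψ x) := by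
    let S : Submodule ℂ W₁ :=
      { carrier := {x | IsEquivariantForm M₂.oLowest (Ψ x)}
        zero_mem' := fun k v _ w => by simp
        add_mem' := fun {x y} hx hy k v hv w => by
          rw [map_add, map_add, Submodule.coe_add, LinearMap.add_apply, LinearMap.add_apply,
            LinearMap.add_apply, map_add, ← hx k v hv, ← hy k v hv]
          abel
        smul_mem' := fun c x hx k v hv w => by
          rw [map_smul, map_smul, Submodule.coe_smul, LinearMap.smul_apply, LinearMap.smul_apply,
            LinearMap.smul_apply, map_smul, ← hx k v hv, smul_add] }
    have hst : ∀ v n, ∀ x ∈ S, M₁.mode v n x ∈ S := fun v n x hx => by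
      change IsEquivariantForm M₂.oLowest (Ψ (M₁.mode v n x))
      rw [hy]
      exact isEquivariantForm_y M hx v n
    have hlow : M₁.lowest ≤ S := fun a ha k v hv w => by
      have h1 : Ψ a = ⟨f ⟨a, ha⟩, mem_meroHom_of_O (hO _)⟩ := Subtype.ext (hbase ⟨a, ha⟩)
      rw [h1, residueMode_lowest (hO _) hv, LinearMap.comp_apply, right_apply hv, ← map_add,
        ← hl, left_apply hv]
      have h2 := M.res_succ (-1) (k - 1) v w
      rw [sub_add_cancel, neg_add_cancel] at h2
      rw [h2]
    have : S = ⊤ := hh₁.eq_top_of_lowest irr₁ hlow fun k v _ m _ x hx => hst v m x (hlow hx)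
    exact fun x => (this ▸ Submodule.mem_top : x ∈ S)
  set ψ : W ⊗[ℂ] W₁ →ₗ[ℂ] M₂.lowest := TensorProduct.lift ((M.meroHom M₂.lowest).subtype ∘ₗ Ψ).flip
    with hψ
  have hψt : ∀ w w₁, ψ (w ⊗ₜ w₁) = (Ψ w₁ : W →ₗ[ℂ] M₂.lowest) w := fun w w₁ => rfl
  have ha : ∀ k, ∀ v ∈ 𝒱.homog k, ∀ m ≤ k - 2, ∀ z, ψ ((M.tensorRep M₁).y m v z) = 0 := by
    intro k v hv m hm z
    induction z with
    | zero => simp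
    | add x y hx hy => rw [map_add, map_add, hx, hy, add_zero]
    | tmul w w₁ =>
      rw [tensorRep_tmul, map_add, hψt, hψt, hcoe, M.residueMode_of_lt _ hv hm, neg_add_cancel]
  have hb : ∀ k, ∀ v ∈ 𝒱.homog k, ∀ z,
      ψ ((M.tensorRep M₁).y (k - 1) v z) = M₂.oLowest v (ψ z) := by
    intro k v hv z
    induction z with
    | zero => simp
    | add x y hx hy => rw [map_add, map_add, hx, hy, map_add, map_add]
    | tmul w w₁ =>
      rw [tensorRep_tmul, map_add, hψt, hψt, hcoe]
      exact heq w₁ k v hv w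
  refine ⟨ψ, fun a w => by rw [hψt, hbase], ha, hb, mem_tensorForms_of_lowest ha hb oLowest_left
    ?_ (L := M₁.lowest) (fun x hx k v hv m hm => hh₁.mode_lowest_eq_zero hv hx hm)
    (fun x hx y hy => ?_) fun N => hh₁.eq_top_of_lowest irr₁⟩
  · intro k v hv w w₁
    -- the residue theorem for `(1-x)^(-1) x^(k-1)`
    have h1 := M.residueMode_binomial hv (Ψ w₁) (s := -1) (m := k - 1) (by omega)
    have h2 := EvZero.map_finsum (LinearMap.applyₗ w : (W →ₗ[ℂ] M₂.lowest) →ₗ[ℂ] _).toAddMonoidHom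
      ((evZero_int (M.residueMode_trunc v (Ψ w₁)) (k - 1)).zsmul
        fun i => (-1) ^ i * Ring.choose (-1) i)
    rw [h1] at h2
    simp only [neg_one_choose, one_smul] at h2
    refine Eq.trans (finsum_congr fun i => ?_) (h2.symm.trans ?_)
    · rw [hψt, hcoe]
      rfl
    · refine (M.residueZero_apply _ _ _ _ _).trans ?_
      rw [hψt]
      simp
  · rw [hψt, hbase ⟨x, hx⟩, hO _ y hy]

/-- The forms `g ∘ ψ` extend to a homomorphism from `F(W₂(0)^*)` to the dual of `W ⊗ W₁`. -/
theorem exists_dual_lift {ψ : W ⊗[ℂ] W₁ →ₗ[ℂ] M₂.lowest}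
    (ha : ∀ k, ∀ v ∈ 𝒱.homog k, ∀ m ≤ k - 2, ∀ z, ψ ((M.tensorRep M₁).y m v z) = 0)
    (hb : ∀ k, ∀ v ∈ 𝒱.homog k, ∀ z,
      ψ ((M.tensorRep M₁).y (k - 1) v z) = M₂.oLowest v (ψ z))
    (hψ : ψ ∈ M.tensorForms M₁ M₂.lowest) :
    ∃ Ξ : FModule M₂.oLowestDual 𝒱 →ₗ[ℂ] Module.Dual ℂ (W ⊗[ℂ] W₁),
      (∀ v n x z, Ξ (FModule.mode M₂.oLowestDual 𝒱 v n x) z = Ξ x ((M.tensorRep M₁).opp n v z)) ∧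
      (∀ g, Ξ (FModule.e M₂.oLowestDual 𝒱 g) = g ∘ₗ ψ) ∧ ∀ x, Ξ x ∈ M.tensorForms M₁ ℂ := by
  have hN : ∀ v n, ∀ β ∈ M.tensorForms M₁ ℂ, (M.tensorRep M₁).dual.y n v β ∈ M.tensorForms M₁ ℂ :=
    fun v n β hβ => ModeRep.dual_mem_of_comp
      (fun a p β hβ => M.comp_y_mem_tensorForms M₁ hβ a p) v n hβ
  have hJ := ModeRep.jacobiAt_dual hN fun β hβ => hβ.1
  have hφ : ∀ g : Module.Dual ℂ M₂.lowest, g ∘ₗ ψ ∈ M.tensorForms M₁ ℂ := fun g =>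
    M.comp_mem_tensorForms M₁ g hψ
  let φ : Module.Dual ℂ M₂.lowest →ₗ[ℂ] M.tensorForms M₁ ℂ :=
    LinearMap.codRestrict _ (ψ.dualMap) hφ
  have h0 : ∀ k, ∀ v ∈ 𝒱.homog k, ∀ m ≥ k, ∀ g,
      ((M.tensorRep M₁).dual.restrict _ hN).y m v (φ g) = 0 := fun k v hv m hm g => by
    refine Subtype.ext (LinearMap.ext fun z => ?_)
    obtain ⟨N, hN⟩ := 𝒱.evZero_expL v
    change g (ψ ((M.tensorRep M₁).opp m v z)) = 0
    rw [ModeRep.opp_eq_sum _ hv hN, map_zsmul, map_sum,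
      Finset.sum_eq_zero fun j _ => ha _ _ (𝒱.expL_mem hv j) _ (by omega) z, smul_zero, map_zero]
  have h1 : ∀ k, ∀ v ∈ 𝒱.homog k, ∀ g, ((M.tensorRep M₁).dual.restrict _ hN).y (k - 1) v (φ g)
      = φ (M₂.oLowestDual v g) := fun k v hv g => by
    refine Subtype.ext (LinearMap.ext fun z => ?_)
    change g (ψ ((M.tensorRep M₁).opp (k - 1) v z)) = g (M₂.oLowest (𝒱.θ v) (ψ z))
    rw [ModeRep.map_opp_eq_theta _ ψ M₂.oLowest (fun k v hv => hb k v hv z) hv]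
  obtain ⟨Φ, hΦ, hΦe, -⟩ := FModule.exists_lift M₂.oLowestDual
    ((M.tensorRep M₁).dual.restrict _ hN) φ ⊤ (fun _ _ _ _ => trivial) (fun _ => trivial)
    h0 h1 fun x _ => hJ.2 x
  refine ⟨(M.tensorForms M₁ ℂ).subtype ∘ₗ Φ, fun v n x z => ?_, fun g => ?_, fun x => (Φ x).2⟩
  · rw [LinearMap.comp_apply, hΦ]
    rfl
  · rw [LinearMap.comp_apply, hΦe]
    rfl

/-- Composition with modes on the two sides of a homomorphism from the contragredient module. -/
theorem exists_comp_mode {e : FModule M₂.oLowestDual 𝒱 →ₗ[ℂ] Module.Dual ℂ W₂}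
    (he : ∀ v n x w, e (FModule.mode M₂.oLowestDual 𝒱 v n x) w = e x (M₂.oppMode n v w))
    {X : Type*} [AddCommGroup X] [Module ℂ X] {R : ModeRep 𝒱 X}
    {Ξ : FModule M₂.oLowestDual 𝒱 →ₗ[ℂ] Module.Dual ℂ X}
    (hΞ : ∀ v n x z, Ξ (FModule.mode M₂.oLowestDual 𝒱 v n x) z = Ξ x (R.opp n v z))
    (v : V) (n : ℤ) (x : FModule M₂.oLowestDual 𝒱) :
    ∃ y, e y = e x ∘ₗ M₂.mode v n ∧ Ξ y = Ξ x ∘ₗ R.y n v := by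
  let S : Submodule ℂ (Module.End ℂ W₂ × Module.End ℂ X) :=
    { carrier := {A | ∀ x, ∃ y, e y = e x ∘ₗ A.1 ∧ Ξ y = Ξ x ∘ₗ A.2}
      zero_mem' := fun x => ⟨0, by simp⟩
      add_mem' := fun {A B} hA hB x => by
        obtain ⟨y, h1, h2⟩ := hA x
        obtain ⟨y', h1', h2'⟩ := hB x
        exact ⟨y + y', by rw [map_add, h1, h1', Prod.fst_add, LinearMap.comp_add],
          by rw [map_add, h2, h2', Prod.snd_add, LinearMap.comp_add]⟩
      smul_mem' := fun c A hA x => by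
        obtain ⟨y, h1, h2⟩ := hA x
        exact ⟨c • y, by rw [map_smul, h1, Prod.smul_fst, LinearMap.comp_smul],
          by rw [map_smul, h2, Prod.smul_snd, LinearMap.comp_smul]⟩ }
  refine ModeRep.pair_mem_of_opp M₂.rep R (S := S) (fun n v x => ?_) n v x
  refine ⟨FModule.mode M₂.oLowestDual 𝒱 v n x, LinearMap.ext fun w => ?_, LinearMap.ext fun z => ?_⟩
  · rw [he, ← M₂.opp_rep]
    rfl
  · rw [hΞ]
    rfl

end WeakModule

end FormOfHom

/-! ### Homogeneous components -/

section Components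

variable {V : Type u} [AddCommGroup V] [Module ℂ V] {𝒱 : VertexOperatorAlgebra V}
  {W W₁ W₂ : Type u} [AddCommGroup W] [Module ℂ W] [AddCommGroup W₁] [Module ℂ W₁]
  [AddCommGroup W₂] [Module ℂ W₂]
  {M : WeakModule 𝒱 W} {M₁ : WeakModule 𝒱 W₁} {M₂ : WeakModule 𝒱 W₂}

namespace WeakModule

/-- The projection onto a homogeneous subspace. -/
def weightProj (hg : M.IsGeneralized) (c : ℂ) : W →ₗ[ℂ] M.weightSpace c :=
  (Module.End.eigenProj (D := M.L 0) hg c).codRestrict _ (Module.End.eigenProj_mem (D := M.L 0) hg c)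

theorem weightProj_self (hg : M.IsGeneralized) {c : ℂ} (w : M.weightSpace c) :
    M.weightProj hg c w = w :=
  Subtype.ext (Module.End.eigenProj_self (D := M.L 0) hg w.2)

theorem weightProj_of_ne (hg : M.IsGeneralized) {c c' : ℂ} {w : W} (hw : w ∈ M.weightSpace c')
    (hne : c' ≠ c) : M.weightProj hg c w = 0 :=
  Subtype.ext (Module.End.eigenProj_of_ne (D := M.L 0) hg hw hne)

theorem weight_induction (hg : M.IsGeneralized) {P : W → Prop}
    (h : ∀ c, ∀ w ∈ M.weightSpace c, P w) (h0 : P 0) (hadd : ∀ x y, P x → P y → P (x + y))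
    (w : W) : P w :=
  Module.End.eigenspace_induction (D := M.L 0) hg h h0 hadd w

/-- A form that vanishes on the homogeneous subspaces of weight different from `c` factors through
the one of weight `c`. -/
theorem eq_comp_weightProj (hg : M.IsGeneralized) {c : ℂ} {β : Module.Dual ℂ W}
    (h : ∀ c' ≠ c, ∀ w ∈ M.weightSpace c', β w = 0) :
    β = (β ∘ₗ (M.weightSpace c).subtype) ∘ₗ M.weightProj hg c := by
  refine LinearMap.ext fun w => ?_
  induction w using weight_induction hg with
  | h c' w hw =>
    by_cases hc : c' = c
    · subst hc
      have := M.weightProj_self hg ⟨w, hw⟩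
      simp only at this
      simp [this]
    · rw [LinearMap.comp_apply, M.weightProj_of_ne hg hw hc, map_zero, h c' hc w hw]
  | h0 => simp
  | hadd x y hx hy => rw [map_add, map_add, hx, hy]

theorem comp_weightProj_mem_gradedDual (hg : M.IsGeneralized) {c : ℂ}
    (η : Module.Dual ℂ (M.weightSpace c)) : η ∘ₗ M.weightProj hg c ∈ M.gradedDual := by
  refine Submodule.mem_iSup_of_mem c ((Submodule.mem_dualAnnihilator _).mpr fun w hw => ?_)
  suffices ⨆ (h' : ℂ) (_ : h' ≠ c), M.weightSpace h' ≤ LinearMap.ker (η ∘ₗ M.weightProj hg c) from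
    this hw
  refine iSup₂_le fun h' hne w hw => ?_
  rw [LinearMap.mem_ker, LinearMap.comp_apply, M.weightProj_of_ne hg hw hne, map_zero]

theorem IsLowestWeight.eq_bot_of_re_lt {h c : ℂ} (hh : M.IsLowestWeight h) (hc : c.re < h.re) :
    M.weightSpace c = ⊥ :=
  hh.eq_bot fun n hn => by
    rw [hn, Complex.add_re, Complex.natCast_re] at hc
    have : (0 : ℝ) ≤ n := n.cast_nonneg
    linarith

/-- If the contragredient module is `F(W₂(0)^*)`, a form with values in `W₂(0)` is the component of
weight `h₂` of a family of maps that commutes with the modes. -/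
theorem DualEqF.exists_components (he : M₂.DualEqF) (hM₂ : M₂.IsOrdinary) {h₂ : ℂ}
    (hh₂ : M₂.IsLowestWeight h₂) {ψ : W ⊗[ℂ] W₁ →ₗ[ℂ] M₂.lowest}
    (ha : ∀ k, ∀ v ∈ 𝒱.homog k, ∀ m ≤ k - 2, ∀ z, ψ ((M.tensorRep M₁).y m v z) = 0)
    (hb : ∀ k, ∀ v ∈ 𝒱.homog k, ∀ z,
      ψ ((M.tensorRep M₁).y (k - 1) v z) = M₂.oLowest v (ψ z))
    (hψ : ψ ∈ M.tensorForms M₁ M₂.lowest) :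
    ∃ κ : ℂ → W ⊗[ℂ] W₁ →ₗ[ℂ] W₂, (∀ c z, κ c z ∈ M₂.weightSpace c) ∧
      (∀ k, ∀ v ∈ 𝒱.homog k, ∀ c n z,
        M₂.mode v n (κ c z) = κ (c + (k - n - 1)) ((M.tensorRep M₁).y n v z)) ∧
      (∀ c, M.IsIntertwiningForm M₁ (κ c)) ∧ ∀ z, κ h₂ z = ψ z := by
  obtain ⟨e, hinj, hrange, hmode, hlow⟩ := he
  obtain ⟨Ξ, hΞ, hΞe, hΞt⟩ := exists_dual_lift ha hb hψ
  have hg := hM₂.generalized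
  have := hM₂.finite
  have hmem : ∀ c (η : Module.Dual ℂ (M₂.weightSpace c)),
      (M₂.weightProj hg c).dualMap η ∈ LinearMap.range e := fun c η => by
    rw [hrange]
    exact M₂.comp_weightProj_mem_gradedDual hg η
  let E := LinearEquiv.ofInjective e hinj
  -- `s c` inverts the isomorphism of `F(W₂(0)^*)` with the contragredient module on the forms of
  -- weight `c`, and `κ c` is the transpose of `Ξ ∘ s c`; the weight spaces are finite-dimensional,
  -- hence reflexive
  obtain ⟨s, hs⟩ : ∃ s : ∀ c, Module.Dual ℂ (M₂.weightSpace c) →ₗ[ℂ] FModule M₂.oLowestDual 𝒱,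
      ∀ c η, e (s c η) = η ∘ₗ M₂.weightProj hg c :=
    ⟨fun c => E.symm.toLinearMap ∘ₗ LinearMap.codRestrict _ (M₂.weightProj hg c).dualMap (hmem c),
      fun c η => congrArg Subtype.val (E.apply_symm_apply ⟨_, hmem c η⟩)⟩
  obtain ⟨κ, hκ⟩ : ∃ κ : ∀ c, W ⊗[ℂ] W₁ →ₗ[ℂ] M₂.weightSpace c,
      ∀ c (η : Module.Dual ℂ (M₂.weightSpace c)) z, η (κ c z) = Ξ (s c η) z :=
    ⟨fun c => (Module.evalEquiv ℂ (M₂.weightSpace c)).symm.toLinearMap ∘ₗ (Ξ ∘ₗ s c).flip,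
      fun c η z => Module.apply_evalEquiv_symm_apply ℂ _ η _⟩
  have huniq : ∀ c (η : Module.Dual ℂ (M₂.weightSpace c)) x z, e x = η ∘ₗ M₂.weightProj hg c →
      Ξ x z = η (κ c z) := fun c η x z h => by
    rw [hκ, hinj (h.trans (hs c η).symm)]
  -- both `Ξ` and the isomorphism intertwine the composition with modes
  have hcomm : ∀ k, ∀ v ∈ 𝒱.homog k, ∀ c n z,
      M₂.mode v n (κ c z) = κ (c + (k - n - 1)) ((M.tensorRep M₁).y n v z) := by
    intro k v hv c n z
    have h1 : M₂.mode v n (κ c z) ∈ M₂.weightSpace (c + (k - n - 1)) := M₂.mode_mem hv (κ c z).2 n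
    suffices (⟨_, h1⟩ : M₂.weightSpace (c + (k - n - 1))) = κ _ ((M.tensorRep M₁).y n v z) from
      congrArg Subtype.val this
    refine sub_eq_zero.mp ((Module.forall_dual_apply_eq_zero_iff ℂ _).mp fun η => ?_)
    rw [map_sub, sub_eq_zero]
    obtain ⟨y, hy1, hy2⟩ := exists_comp_mode hmode hΞ v n (s _ η)
    have h2 : e y = (e y ∘ₗ (M₂.weightSpace c).subtype) ∘ₗ M₂.weightProj hg c := by
      refine eq_comp_weightProj hg fun c' hne w hw => ?_
      rw [hy1, hs, LinearMap.comp_apply, LinearMap.comp_apply,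
        M₂.weightProj_of_ne hg (M₂.mode_mem hv hw n) (by simpa using hne), map_zero]
    have h3 := huniq c _ y z h2
    rw [hy2, LinearMap.comp_apply, ← hκ, LinearMap.comp_apply, hy1, hs] at h3
    rw [h3]
    exact congrArg η (M₂.weightProj_self hg ⟨_, h1⟩).symm
  -- the weights of `W₂` are bounded below
  have htr : ∀ c, (M.tensorRep M₁).IsLowerTrunc (κ c) := by
    intro c v
    induction v using 𝒱.homog_induction with
    | h k v hv =>
      obtain ⟨N, hN⟩ := exists_nat_ge (c.re - h₂.re)
      refine ⟨k - 2 - N, fun n hn z => Subtype.ext ?_⟩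
      have h1 := hcomm k v hv (c - (k - n - 1)) n z
      have hbot : M₂.weightSpace (c - (k - n - 1)) = ⊥ := hh₂.eq_bot_of_re_lt (by
        have h2 : ((n : ℤ) : ℝ) ≤ k - 2 - N := by exact_mod_cast hn
        have h3 : (c - (k - n - 1) : ℂ).re = c.re - (k - n - 1) := by simp
        rw [h3]
        linarith)
      have h4 : (κ (c - (k - n - 1)) z : W₂) = 0 :=
        (Submodule.mem_bot ℂ).mp (hbot.le (κ (c - (k - n - 1)) z).2)
      rw [h4, map_zero, sub_add_cancel] at h1
      exact h1.symm
    | h0 => exact ⟨0, by simp⟩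
    | hadd u v hu hv =>
      obtain ⟨K, hK⟩ := hu
      obtain ⟨K', hK'⟩ := hv
      exact ⟨min K K', fun n hn z => by
        rw [map_add, LinearMap.add_apply, map_add, hK n (hn.trans (min_le_left _ _)),
          hK' n (hn.trans (min_le_right _ _)), add_zero]⟩
  have hint : ∀ c, M.IsIntertwiningForm M₁ (κ c) := by
    intro c u w w₁ l m n
    refine (Module.forall_dual_apply_eq_zero_iff ℂ _).mp fun η => ?_
    refine (map_borcherds η.toAddMonoidHom (finFst_form (htr c) u _) (finSnd_form M₁ (κ c) u w w₁)
      (finIter_form M (κ c) u w w₁) l m n).trans ?_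
    have h1 := (hΞt (s c η)).2 u w w₁ l m n
    simp only [← hκ] at h1
    exact h1
  refine ⟨fun c => (M₂.weightSpace c).subtype ∘ₗ κ c, fun c z => (κ c z).2, hcomm,
    fun c u w w₁ l m n => ?_, fun z => ?_⟩
  · refine (map_borcherds (M₂.weightSpace c).subtype.toAddMonoidHom (finFst_form (htr c) u _)
      (finSnd_form M₁ (κ c) u w w₁) (finIter_form M (κ c) u w w₁) l m n).symm.trans ?_
    rw [hint c u w w₁ l m n, map_zero]
  · have h0 : (ψ z : W₂) ∈ M₂.weightSpace h₂ := hh₂.lowest_eq ▸ (ψ z).2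
    suffices κ h₂ z = ⟨ψ z, h0⟩ from congrArg Subtype.val this
    refine sub_eq_zero.mp ((Module.forall_dual_apply_eq_zero_iff ℂ _).mp fun η => ?_)
    rw [map_sub, sub_eq_zero]
    -- the forms of weight `h₂` come from `W₂(0)^*` itself, since `L(0)` acts there as `h₂`
    let g : Module.Dual ℂ M₂.lowest := η ∘ₗ Submodule.inclusion hh₂.lowest_eq.le
    have h1 : M₂.oLowestDual 𝒱.ω g = h₂ • g := by
      refine LinearMap.ext fun x => ?_
      change g (M₂.oLowest (𝒱.θ 𝒱.ω) x) = h₂ • g x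
      rw [𝒱.theta_omega, ← map_smul]
      refine congrArg g (Subtype.ext ?_)
      rw [coe_oLowest omega_mem]
      exact M₂.mem_weightSpace.mp (hh₂.lowest_eq ▸ x.2)
    have h2 : ∀ w, e (FModule.e M₂.oLowestDual 𝒱 g) (M₂.L 0 w)
        = h₂ • e (FModule.e M₂.oLowestDual 𝒱 g) w := fun w => by
      have h3 := hmode 𝒱.ω (2 - 1) (FModule.e M₂.oLowestDual 𝒱 g) w
      rw [FModule.mode_e _ omega_mem, h1, ← M₂.opp_rep, ModeRep.opp_omega, ← FModule.eLin_apply,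
        map_smul, map_smul, FModule.eLin_apply] at h3
      exact h3.symm
    have h4 : e (FModule.e M₂.oLowestDual 𝒱 g) = η ∘ₗ M₂.weightProj hg h₂ := by
      rw [eq_comp_weightProj hg (c := h₂) (β := e (FModule.e M₂.oLowestDual 𝒱 g))]
      · congr 1
        refine LinearMap.ext fun w => ?_
        exact hlow g ⟨w, hh₂.lowest_eq.ge w.2⟩
      · intro c' hne w hw
        have h5 := h2 w
        rw [M₂.mem_weightSpace.mp hw, map_smul, ← sub_eq_zero, ← sub_smul] at h5
        exact (smul_eq_zero.mp h5).resolve_left (sub_ne_zero.mpr hne)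
    rw [← huniq h₂ η _ z h4, hΞe]
    rfl

end WeakModule

end Components

/-! ### Construction of intertwining operators -/

section Operators

variable {V : Type u} [AddCommGroup V] [Module ℂ V] {𝒱 : VertexOperatorAlgebra V}
  {W W₁ W₂ : Type u} [AddCommGroup W] [Module ℂ W] [AddCommGroup W₁] [Module ℂ W₁]
  [AddCommGroup W₂] [Module ℂ W₂]
  {M : WeakModule 𝒱 W} {M₁ : WeakModule 𝒱 W₁} {M₂ : WeakModule 𝒱 W₂}

/-- The Jacobi identity in components uses only the values of the coefficients on a line. -/
theorem borcherds_eq_of_line {Γ T : Type*} [AddCommGroupWithOne Γ] [AddCommGroup T]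
    {P Q g : ℤ → Γ → T} {P' Q' g' : ℤ → T} {l m : ℤ} {n : Γ}
    (hP : ∀ (j : ℤ) (k : Γ), (j : Γ) + k = l + m + n → P j k = P' j)
    (hQ : ∀ (j : ℤ) (k : Γ), (j : Γ) + k = l + m + n → Q j k = Q' j)
    (hg : ∀ (j : ℤ) (k : Γ), (j : Γ) + k = l + m + n → g j k = g' j) :
    borcherds P Q g l m n
      = borcherds (fun j _ : ℤ => P' j) (fun j _ => Q' j) (fun j _ => g' j) l m 0 := by
  unfold borcherds borcherdsFst borcherdsSnd borcherdsIter
  congr 1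
  · congr 1
    · exact finsum_congr fun i => by rw [hP _ _ (by push_cast; abel)]
    · exact congrArg _ (finsum_congr fun i => by rw [hQ _ _ (by push_cast; abel)])
  · exact finsum_congr fun i => by rw [hg _ _ (by push_cast; abel)]

namespace WeakModule

section Finiteness

variable {𝒴 : W →ₗ[ℂ] ℂ → (W₁ →ₗ[ℂ] W₂)}

theorem evZero_operator (h : ∀ w w₁, ∃ K : ℝ, ∀ n : ℂ, K ≤ n.re → 𝒴 w n w₁ = 0) (w : W) (n : ℂ)
    (w₁ : W₁) : EvZero fun i : ℕ => 𝒴 w (n + ((i : ℤ) : ℂ)) w₁ := by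
  obtain ⟨K, hK⟩ := h w w₁
  obtain ⟨N, hN⟩ := exists_nat_ge (K - n.re)
  refine ⟨N, fun i hi => hK _ ?_⟩
  have hi' : (N : ℝ) ≤ i := by exact_mod_cast hi
  simp only [Int.cast_natCast, Complex.add_re, Complex.natCast_re]
  linarith

theorem finFst_operator (M₂ : WeakModule 𝒱 W₂) (h : ∀ w w₁, ∃ K : ℝ, ∀ n : ℂ, K ≤ n.re → 𝒴 w n w₁ = 0) (u : V) (w : W)
    (w₁ : W₁) : FinFst fun j k => M₂.mode u j (𝒴 w k w₁) := fun m n => by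
  obtain ⟨N, hN⟩ := evZero_operator h w n w₁
  exact ⟨N, fun i hi => by
    have := hN i hi
    simp only at this ⊢
    rw [this, map_zero]⟩

theorem finSnd_operator (M₁ : WeakModule 𝒱 W₁) (𝒴 : W →ₗ[ℂ] ℂ → (W₁ →ₗ[ℂ] W₂)) (u : V) (w : W) (w₁ : W₁) :
    FinSnd fun j k => 𝒴 w k (M₁.mode u j w₁) := fun m n => by
  obtain ⟨N, hN⟩ := M₁.evZero_mode u w₁ m
  exact ⟨N, fun i hi => by
    have := hN i hi
    simp only at this ⊢
    rw [this, map_zero]⟩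

theorem finIter_operator (M : WeakModule 𝒱 W) (𝒴 : W →ₗ[ℂ] ℂ → (W₁ →ₗ[ℂ] W₂)) (u : V) (w : W) (w₁ : W₁) :
    FinIter fun j k => 𝒴 (M.mode u j w) k w₁ := by
  obtain ⟨K, hK⟩ := M.trunc u w
  exact ⟨K, fun k hk n => by simp [hK k hk]⟩

end Finiteness

section Grading

/-- The operator `L(0) ⊗ 1 + 1 ⊗ L(0)`, which gives the total weight. -/
def totalWeight (M : WeakModule 𝒱 W) (M₁ : WeakModule 𝒱 W₁) : Module.End ℂ (W ⊗[ℂ] W₁) :=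
  LinearMap.rTensor W₁ (M.L 0) + LinearMap.lTensor W (M₁.L 0)

theorem tmul_mem_totalWeight {a b : ℂ} {w : W} {w₁ : W₁} (hw : w ∈ M.weightSpace a)
    (hw₁ : w₁ ∈ M₁.weightSpace b) :
    w ⊗ₜ w₁ ∈ Module.End.eigenspace (M.totalWeight M₁) (a + b) := by
  rw [Module.End.mem_eigenspace_iff]
  change M.L 0 w ⊗ₜ w₁ + w ⊗ₜ M₁.L 0 w₁ = _
  rw [M.mem_weightSpace.mp hw, M₁.mem_weightSpace.mp hw₁, add_smul, TensorProduct.tmul_smul,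
    TensorProduct.smul_tmul', TensorProduct.smul_tmul']

theorem iSup_totalWeight (hM : M.IsGeneralized) (hM₁ : M₁.IsGeneralized) :
    ⨆ c, Module.End.eigenspace (M.totalWeight M₁) c = ⊤ := by
  refine eq_top_iff.mpr fun z hz => ?_
  clear hz
  induction z with
  | zero => exact zero_mem _
  | add x y hx hy => exact add_mem hx hy
  | tmul w w₁ =>
    induction w using weight_induction hM with
    | h a w hw =>
      induction w₁ using weight_induction hM₁ with
      | h b w₁ hw₁ => exact Submodule.mem_iSup_of_mem _ (tmul_mem_totalWeight hw hw₁)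
      | h0 => simp
      | hadd x y hx hy =>
        rw [TensorProduct.tmul_add]
        exact add_mem hx hy
    | h0 => simp
    | hadd x y hx hy =>
      rw [TensorProduct.add_tmul]
      exact add_mem hx hy

end Grading

/-- A family of maps as in `DualEqF.exists_components` consists of the components of the values at
`x = 1` of an intertwining operator. -/
theorem exists_intertwiningOperator (hM : M.IsGeneralized) (hM₁ : M₁.IsGeneralized) {h₂ : ℂ}
    (hh₂ : M₂.IsLowestWeight h₂) {κ : ℂ → W ⊗[ℂ] W₁ →ₗ[ℂ] W₂}
    (hw : ∀ c z, κ c z ∈ M₂.weightSpace c)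
    (hcomm : ∀ k, ∀ v ∈ 𝒱.homog k, ∀ c n z,
        M₂.mode v n (κ c z) = κ (c + (k - n - 1)) ((M.tensorRep M₁).y n v z))
    (hJ : ∀ c, M.IsIntertwiningForm M₁ (κ c)) :
    ∃ 𝒴 ∈ intertwiningOperators M M₁ M₂, ∀ a b n, ∀ w ∈ M.weightSpace a, ∀ w₁ ∈ M₁.weightSpace b,
      𝒴 w n w₁ = κ (a + b - n - 1) (w ⊗ₜ w₁) := by
  have hD := iSup_totalWeight hM hM₁
  -- `w_n w₁` is the component of weight `a + b - n - 1`, for `w` of weight `a` and `w₁` of weight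
  -- `b`
  let 𝒴 : W →ₗ[ℂ] ℂ → (W₁ →ₗ[ℂ] W₂) := LinearMap.pi fun n =>
    TensorProduct.curry (Module.End.eigenExtend hD fun h => κ (h - n - 1))
  have h𝒴 : ∀ a b n, ∀ w ∈ M.weightSpace a, ∀ w₁ ∈ M₁.weightSpace b,
      𝒴 w n w₁ = κ (a + b - n - 1) (w ⊗ₜ w₁) := fun a b n w hw w₁ hw₁ =>
    Module.End.eigenExtend_apply hD _ (tmul_mem_totalWeight hw hw₁)
  clear_value 𝒴
  have htr : ∀ (w : W) (w₁ : W₁), ∃ K : ℝ, ∀ n : ℂ, K ≤ n.re → 𝒴 w n w₁ = 0 := by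
    intro w w₁
    induction w using weight_induction hM with
    | h a w hwa =>
      induction w₁ using weight_induction hM₁ with
      | h b w₁ hwb =>
        refine ⟨a.re + b.re - h₂.re, fun n hn => ?_⟩
        have h1 := hw (a + b - n - 1) (w ⊗ₜ w₁)
        rw [hh₂.eq_bot_of_re_lt (by
          simp only [Complex.sub_re, Complex.add_re, Complex.one_re]
          linarith), Submodule.mem_bot] at h1
        rw [h𝒴 a b n w hwa w₁ hwb, h1]
      | h0 => exact ⟨0, by simp⟩
      | hadd x y hx hy =>
        obtain ⟨K, hK⟩ := hx
        obtain ⟨K', hK'⟩ := hy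
        exact ⟨max K K', fun n hn => by
          rw [map_add, hK n ((le_max_left _ _).trans hn), hK' n ((le_max_right _ _).trans hn),
            add_zero]⟩
    | h0 => exact ⟨0, by simp⟩
    | hadd x y hx hy =>
      obtain ⟨K, hK⟩ := hx
      obtain ⟨K', hK'⟩ := hy
      exact ⟨max K K', fun n hn => by
        rw [map_add, Pi.add_apply, LinearMap.add_apply, hK n ((le_max_left _ _).trans hn),
          hK' n ((le_max_right _ _).trans hn), add_zero]⟩
  refine ⟨𝒴, ⟨htr, fun v w w₁ l m n => ?_, fun w n => ?_⟩, h𝒴⟩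
  · rw [jacobiDefect_eq_borcherds (fun v n w => M.mode v n w) (fun v n w => M₁.mode v n w)
      (fun v n w => M₂.mode v n w) (fun w n w₁ => 𝒴 w n w₁) v w w₁ (finFst_operator M₂ htr v w w₁)
      (finSnd_operator M₁ 𝒴 v w w₁)]
    induction v using 𝒱.homog_induction with
    | h k v hv =>
      induction w using weight_induction hM with
      | h a w hwa =>
        induction w₁ using weight_induction hM₁ with
        | h b w₁ hwb =>
          refine Eq.trans ?_ (hJ (a + b + k - 2 - l - m - n) v w w₁ l m 0)
          refine borcherds_eq_of_line (fun j i hj => ?_) (fun j i hj => ?_) fun j i hj => ?_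
          · rw [h𝒴 a b i w hwa w₁ hwb, hcomm k v hv]
            congr 2
            linear_combination -hj
          · rw [h𝒴 a _ i w hwa _ (M₁.mode_mem hv hwb j)]
            congr 2
            linear_combination -hj
          · rw [h𝒴 _ b i _ (M.mode_mem hv hwa j) w₁ hwb]
            congr 2
            linear_combination -hj
        | h0 => simp [borcherds, borcherdsFst, borcherdsSnd, borcherdsIter]
        | hadd x y hx hy =>
          have e := borcherds_add (finFst_operator M₂ htr v w x)
            (finFst_operator M₂ htr v w y) (finSnd_operator M₁ 𝒴 v w x)
            (finSnd_operator M₁ 𝒴 v w y) (finIter_operator M 𝒴 v w x)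
            (finIter_operator M 𝒴 v w y) l m n
          rw [hx, hy, add_zero] at e
          refine Eq.trans (borcherds_congr ?_ ?_ ?_ _ m n) e <;> simp
      | h0 => simp [borcherds, borcherdsFst, borcherdsSnd, borcherdsIter]
      | hadd x y hx hy =>
        have e := borcherds_add (finFst_operator M₂ htr v x w₁)
          (finFst_operator M₂ htr v y w₁) (finSnd_operator M₁ 𝒴 v x w₁)
          (finSnd_operator M₁ 𝒴 v y w₁) (finIter_operator M 𝒴 v x w₁)
          (finIter_operator M 𝒴 v y w₁) l m n
        rw [hx, hy, add_zero] at e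
        refine Eq.trans (borcherds_congr ?_ ?_ ?_ _ m n) e <;> simp
    | h0 => simp [borcherds, borcherdsFst, borcherdsSnd, borcherdsIter]
    | hadd x y hx hy =>
      have e := borcherds_add (finFst_operator M₂ htr x w w₁)
        (finFst_operator M₂ htr y w w₁) (finSnd_operator M₁ 𝒴 x w w₁)
        (finSnd_operator M₁ 𝒴 y w w₁) (finIter_operator M 𝒴 x w w₁)
        (finIter_operator M 𝒴 y w w₁) l m n
      rw [hx, hy, add_zero] at e
      refine Eq.trans (borcherds_congr ?_ ?_ ?_ _ m n) e <;> simp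
  · refine LinearMap.ext fun w₁ => ?_
    rw [LinearMap.smul_apply]
    induction w using weight_induction hM with
    | h a w hwa =>
      induction w₁ using weight_induction hM₁ with
      | h b w₁ hwb =>
        have h1 : M.L (-1) w ∈ M.weightSpace (a + 1) := by
          rw [show a + 1 = a + (((2 : ℤ) : ℂ) - ((0 : ℤ) : ℂ) - 1) by push_cast; ring]
          exact M.mode_mem omega_mem hwa 0
        rw [h𝒴 _ b n _ h1 w₁ hwb, h𝒴 a b _ w hwa w₁ hwb,
          show a + 1 + b - n - 1 = a + b - n by ring,
          show a + b - (n - 1) - 1 = a + b - n by ring]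
        -- the commutation with `L(0)` gives the derivative property
        have h2 := hcomm 2 𝒱.ω omega_mem (a + b - n) 1 (w ⊗ₜ w₁)
        have h3 : M.res 0 1 𝒱.ω w = M.L (-1) w + a • w := by
          rw [← M.mem_weightSpace.mp hwa, show M.res 0 1 𝒱.ω w = M.res 0 (0 + 1) 𝒱.ω w from rfl,
            M.res_succ, M.res_zero, M.res_zero]
          rfl
        have h4 : M₁.mode 𝒱.ω 1 w₁ = b • w₁ := M₁.mem_weightSpace.mp hwb
        have h5 : M₂.mode 𝒱.ω 1 (κ (a + b - n) (w ⊗ₜ w₁)) = (a + b - n) • κ (a + b - n) (w ⊗ₜ w₁) :=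
          M₂.mem_weightSpace.mp (hw _ _)
        rw [tensorRep_tmul, h3, h4, h5, TensorProduct.tmul_smul, TensorProduct.add_tmul,
          ← TensorProduct.smul_tmul', map_add, map_add, map_smul, map_smul,
          show a + b - n + (((2 : ℤ) : ℂ) - ((1 : ℤ) : ℂ) - 1) = a + b - n by push_cast; ring] at h2
        have h6 : ∀ x y : W₂, (a + b - n) • x = b • x + (y + a • x) → y = -n • x := fun x y h => by
          rw [← sub_eq_iff_eq_add'] at h
          rw [eq_sub_of_add_eq h.symm]
          module
        exact h6 _ _ h2
      | h0 => simp
      | hadd x y hx hy => rw [map_add, hx, hy, map_add, smul_add]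
    | h0 => simp
    | hadd x y hx hy =>
      rw [map_add, map_add, map_add, Pi.add_apply, Pi.add_apply, LinearMap.add_apply,
        LinearMap.add_apply, hx, hy, smul_add]

end WeakModule

end Operators

/-! ### The lowest component of an intertwining operator -/

section LowestComponent

variable {V : Type u} [AddCommGroup V] [Module ℂ V] {𝒱 : VertexOperatorAlgebra V}
  {W W₁ W₂ : Type u} [AddCommGroup W] [Module ℂ W] [AddCommGroup W₁] [Module ℂ W₁]
  [AddCommGroup W₂] [Module ℂ W₂]
  {M : WeakModule 𝒱 W} {M₁ : WeakModule 𝒱 W₁} {M₂ : WeakModule 𝒱 W₂}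

theorem Module.End.eigenExtend_add {Z X : Type*} [AddCommGroup Z] [Module ℂ Z] [AddCommGroup X]
    [Module ℂ X] {D : Module.End ℂ Z} (hD : ⨆ h, D.eigenspace h = ⊤) (φ φ' : ℂ → Z →ₗ[ℂ] X) :
    eigenExtend hD (fun h => φ h + φ' h) = eigenExtend hD φ + eigenExtend hD φ' := by
  refine LinearMap.ext fun z => ?_
  induction z using eigenspace_induction hD with
  | h c z hz =>
    rw [LinearMap.add_apply, eigenExtend_apply hD _ hz, eigenExtend_apply hD _ hz,
      eigenExtend_apply hD _ hz, LinearMap.add_apply]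
  | h0 => simp
  | hadd x y hx hy => rw [map_add, map_add, hx, hy]

theorem Module.End.eigenExtend_smul {Z X : Type*} [AddCommGroup Z] [Module ℂ Z] [AddCommGroup X]
    [Module ℂ X] {D : Module.End ℂ Z} (hD : ⨆ h, D.eigenspace h = ⊤) (c : ℂ) (φ : ℂ → Z →ₗ[ℂ] X) :
    eigenExtend hD (fun h => c • φ h) = c • eigenExtend hD φ := by
  refine LinearMap.ext fun z => ?_
  induction z using eigenspace_induction hD with
  | h c z hz =>
    rw [LinearMap.smul_apply, eigenExtend_apply hD _ hz, eigenExtend_apply hD _ hz,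
      LinearMap.smul_apply]
  | h0 => simp
  | hadd x y hx hy => rw [map_add, map_add, hx, hy]

namespace WeakModule

/-- The maps `W₁(0) → Hom(W, W₂(0))` that correspond to the `A(V)`-homomorphisms from
`A(W) ⊗_{A(V)} W₁(0)` to `W₂(0)`. -/
def bimoduleForms (M : WeakModule 𝒱 W) (M₁ : WeakModule 𝒱 W₁) (M₂ : WeakModule 𝒱 W₂) :
    Submodule ℂ (M₁.lowest →ₗ[ℂ] W →ₗ[ℂ] M₂.lowest) where
  carrier := {f | (∀ a, ∀ x ∈ M.O, f a x = 0) ∧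
    (∀ v a w, f a (M.right v w) = f (M₁.oLowest v a) w) ∧
    ∀ v a w, f a (M.left v w) = M₂.oLowest v (f a w)}
  zero_mem' := by simp
  add_mem' := fun {f g} hf hg => ⟨fun a x hx => by simp [hf.1 a x hx, hg.1 a x hx],
    fun v a w => by simp [hf.2.1, hg.2.1], fun v a w => by simp [hf.2.2, hg.2.2]⟩
  smul_mem' := fun c f hf => ⟨fun a x hx => by simp [hf.1 a x hx],
    fun v a w => by simp [hf.2.1], fun v a w => by simp [hf.2.2]⟩

section Operator

variable {𝒴 : W →ₗ[ℂ] ℂ → (W₁ →ₗ[ℂ] W₂)} (h𝒴 : 𝒴 ∈ intertwiningOperators M M₁ M₂)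

include h𝒴

theorem operator_borcherds (u : V) (w : W) (w₁ : W₁) (l m : ℤ) (n : ℂ) :
    borcherds (fun j k => M₂.mode u j (𝒴 w k w₁)) (fun j k => 𝒴 w k (M₁.mode u j w₁))
      (fun j k => 𝒴 (M.mode u j w) k w₁) l m n = 0 :=
  (jacobiDefect_eq_borcherds (fun v n w => M.mode v n w) (fun v n w => M₁.mode v n w)
    (fun v n w => M₂.mode v n w) (fun w n w₁ => 𝒴 w n w₁) u w w₁ (finFst_operator M₂ h𝒴.1 u w w₁)
    (finSnd_operator M₁ 𝒴 u w w₁) l m n).symm.trans (h𝒴.2.1 u w w₁ l m n)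

/-- The coefficients of an intertwining operator shift weights, by the commutator formula for `L(0)`
and the derivative property. -/
theorem operator_mem_weightSpace {a b : ℂ} {w : W} {w₁ : W₁} (hw : w ∈ M.weightSpace a)
    (hw₁ : w₁ ∈ M₁.weightSpace b) (n : ℂ) : 𝒴 w n w₁ ∈ M₂.weightSpace (a + b - n - 1) := by
  have h1 := operator_borcherds h𝒴 𝒱.ω w w₁ 0 1 n
  rw [borcherds_zero, finsum_eq_sum_of_support_subset (s := Finset.range 2)] at h1
  · simp only [Finset.sum_range_succ, Finset.sum_range_zero, zero_add, Ring.choose_zero_right,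
      Ring.choose_one_right, one_smul, Nat.cast_zero, Nat.cast_one, sub_zero, sub_self,
      Int.cast_one, Int.cast_zero, add_zero] at h1
    have e0 : M.mode 𝒱.ω 0 w = M.L (-1) w := rfl
    have e1 : M.mode 𝒱.ω 1 w = a • w := M.mem_weightSpace.mp hw
    have e2 : M₁.mode 𝒱.ω 1 w₁ = b • w₁ := M₁.mem_weightSpace.mp hw₁
    have e3 : M₂.mode 𝒱.ω 1 = M₂.L 0 := rfl
    rw [e0, e1, e2, e3, h𝒴.2.2, map_smul, map_smul, add_sub_cancel_right] at h1
    rw [M₂.mem_weightSpace]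
    simp only [Pi.smul_apply, LinearMap.smul_apply] at h1
    rw [sub_sub, sub_eq_zero] at h1
    rw [h1]
    module
  · intro i hi
    by_contra h
    apply hi
    have : Ring.choose (1 : ℤ) i = 0 := by
      have := Ring.choose_natCast (R := ℤ) 1 i
      rw [Nat.choose_eq_zero_of_lt (by simpa using h)] at this
      simpa using this
    simp [this]

end Operator

section Component

variable (hM : M.IsGeneralized) (hM₂ : M₂.IsGeneralized) {h₁ h₂ : ℂ} (hh₁ : M₁.IsLowestWeight h₁)
  (hh₂ : M₂.IsLowestWeight h₂)

/-- The projection onto the lowest weight subspace. -/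
def lowestProj (hM₂ : M₂.IsGeneralized) (hh₂ : M₂.IsLowestWeight h₂) : W₂ →ₗ[ℂ] M₂.lowest :=
  Submodule.inclusion hh₂.lowest_eq.ge ∘ₗ M₂.weightProj hM₂ h₂

theorem coe_lowestProj {w : W₂} (hw : w ∈ M₂.weightSpace h₂) :
    (M₂.lowestProj hM₂ hh₂ w : W₂) = w :=
  congrArg Subtype.val (M₂.weightProj_self hM₂ ⟨w, hw⟩)

theorem lowestProj_of_ne {c : ℂ} {w : W₂} (hw : w ∈ M₂.weightSpace c) (hne : c ≠ h₂) :
    M₂.lowestProj hM₂ hh₂ w = 0 := by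
  rw [lowestProj, LinearMap.comp_apply, M₂.weightProj_of_ne hM₂ hw hne, map_zero]

/-- The restriction to `W₁(0)` of the component of `𝒴` that maps `W₁(0)` to `W₂(0)`: the vector `w`
of weight `a` gives the coefficient `w_n` with `n = a + h₁ - h₂ - 1`. -/
def lowestComponent (M₁ : WeakModule 𝒱 W₁) (hM : M.IsGeneralized) (hM₂ : M₂.IsGeneralized) (h₁ : ℂ)
    (hh₂ : M₂.IsLowestWeight h₂) :
    (W →ₗ[ℂ] ℂ → (W₁ →ₗ[ℂ] W₂)) →ₗ[ℂ] M₁.lowest →ₗ[ℂ] W →ₗ[ℂ] M₂.lowest :=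
  LinearMap.mk₂ ℂ (fun 𝒴 u => Module.End.eigenExtend (D := M.L 0) hM fun a =>
      M₂.lowestProj hM₂ hh₂ ∘ₗ LinearMap.applyₗ (u : W₁) ∘ₗ
        LinearMap.proj (a + h₁ - h₂ - 1) ∘ₗ 𝒴)
    (fun 𝒴 𝒴' u => by
      refine Eq.trans (congrArg _ (funext fun a => LinearMap.ext fun w => ?_))
        (Module.End.eigenExtend_add (D := M.L 0) hM _ _)
      simp)
    (fun c 𝒴 u => by
      refine Eq.trans (congrArg _ (funext fun a => LinearMap.ext fun w => ?_))
        (Module.End.eigenExtend_smul (D := M.L 0) hM _ _)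
      simp)
    (fun 𝒴 u u' => by
      refine Eq.trans (congrArg _ (funext fun a => LinearMap.ext fun w => ?_))
        (Module.End.eigenExtend_add (D := M.L 0) hM _ _)
      simp)
    (fun c 𝒴 u => by
      refine Eq.trans (congrArg _ (funext fun a => LinearMap.ext fun w => ?_))
        (Module.End.eigenExtend_smul (D := M.L 0) hM _ _)
      simp)

theorem lowestComponent_apply (𝒴 : W →ₗ[ℂ] ℂ → (W₁ →ₗ[ℂ] W₂)) (u : M₁.lowest) {a : ℂ} {w : W}
    (hw : w ∈ M.weightSpace a) : lowestComponent M₁ hM hM₂ h₁ hh₂ 𝒴 u w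
      = M₂.lowestProj hM₂ hh₂ (𝒴 w (a + h₁ - h₂ - 1) u) :=
  Module.End.eigenExtend_apply (D := M.L 0) hM _ hw

variable {𝒴 : W →ₗ[ℂ] ℂ → (W₁ →ₗ[ℂ] W₂)} (h𝒴 : 𝒴 ∈ intertwiningOperators M M₁ M₂)

include hh₁ h𝒴

theorem operator_lowest_mem (u : M₁.lowest) {a : ℂ} {w : W} (hw : w ∈ M.weightSpace a) (n : ℂ) :
    𝒴 w n u ∈ M₂.weightSpace (a + h₁ - n - 1) :=
  operator_mem_weightSpace h𝒴 hw (hh₁.lowest_eq.le u.2) n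

theorem coe_lowestComponent (u : M₁.lowest) {a : ℂ} {w : W} (hw : w ∈ M.weightSpace a) :
    (lowestComponent M₁ hM hM₂ h₁ hh₂ 𝒴 u w : W₂) = 𝒴 w (a + h₁ - h₂ - 1) u := by
  rw [lowestComponent_apply hM hM₂ hh₂ 𝒴 u hw, coe_lowestProj]
  have := operator_lowest_mem hh₁ h𝒴 u hw (a + h₁ - h₂ - 1)
  rwa [show a + h₁ - (a + h₁ - h₂ - 1) - 1 = h₂ by ring] at this

/-- The lowest component at a residue is the third sum of the Jacobi identity. -/
theorem coe_lowestComponent_res (u : M₁.lowest) {a : ℂ} {w : W} (hw : w ∈ M.weightSpace a) {k : ℤ}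
    {v : V} (hv : v ∈ 𝒱.homog k) {l m : ℤ} {n : ℂ} (hn : n = a + h₁ - h₂ + (k - l - m - 2)) :
    (lowestComponent M₁ hM hM₂ h₁ hh₂ 𝒴 u (M.res l m v w) : W₂)
      = borcherdsIter (fun j k => 𝒴 (M.mode v j w) k u) l m n := by
  have h1 := EvZero.map_finsum (M₂.lowest.subtype ∘ₗ
    lowestComponent M₁ hM hM₂ h₁ hh₂ 𝒴 u).toAddMonoidHom
    ((M.evZero_mode v w l).zsmul fun i => Ring.choose m i)
  rw [← res_apply] at h1
  refine h1.trans (finsum_congr fun i => ?_)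
  rw [map_zsmul]
  refine congrArg _ ((coe_lowestComponent hM hM₂ hh₁ hh₂ h𝒴 u (M.mode_mem hv hw (l + i))).trans ?_)
  rw [hn]
  congr 2
  push_cast
  ring

include hh₂ in
/-- By weights, `w_n u = 0` for a lowest weight vector `u` and `n` above the index of the lowest
component. -/
theorem operator_lowest_eq_zero (u : M₁.lowest) {a : ℂ} {w : W} (hw : w ∈ M.weightSpace a) {n : ℂ}
    {j : ℕ} (hj : 0 < j) (hn : n = a + h₁ - h₂ - 1 + j) : 𝒴 w n u = 0 := by
  have h1 := operator_lowest_mem hh₁ h𝒴 u hw n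
  rw [hh₂.eq_bot_of_re_lt, Submodule.mem_bot] at h1
  · exact h1
  · have : (0 : ℝ) < j := by exact_mod_cast hj
    rw [hn]
    simp only [Complex.sub_re, Complex.add_re, Complex.one_re, Complex.natCast_re]
    linarith

/-- The lowest component of an intertwining operator vanishes on `O(W)` and is compatible with the
two actions of `A(V)`. These are the instances `(l, m) = (-2, k)`, `(-1, k - 1)` and `(-1, k)` of
the Jacobi identity, for `v` of weight `k`: at a lowest weight vector at most one term of its
left-hand side is nonzero. -/
theorem lowestComponent_mem_bimoduleForms :
    lowestComponent M₁ hM hM₂ h₁ hh₂ 𝒴 ∈ bimoduleForms M M₁ M₂ := by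
  have hQ : ∀ k, ∀ v ∈ 𝒱.homog k, ∀ u : M₁.lowest, ∀ n ≥ k, M₁.mode v n u = 0 :=
    fun k v hv u n hn => hh₁.mode_lowest_eq_zero hv u.2 hn
  refine ⟨fun u x hx => ?_, fun v u w => ?_, fun v u w => ?_⟩
  · suffices M.O ≤ LinearMap.ker (lowestComponent M₁ hM hM₂ h₁ hh₂ 𝒴 u) from this hx
    refine Submodule.span_le.mpr ?_
    rintro _ ⟨k, v, w, hv, rfl⟩
    rw [SetLike.mem_coe, LinearMap.mem_ker]
    induction w using weight_induction hM with
    | h a w hw =>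
      refine Subtype.ext ?_
      rw [coe_lowestComponent_res hM hM₂ hh₁ hh₂ h𝒴 u hw hv (n := a + h₁ - h₂) (by
        push_cast; ring)]
      have h1 := operator_borcherds h𝒴 v w u (-2) k (a + h₁ - h₂)
      unfold borcherds at h1
      rw [show borcherdsFst (fun j k => M₂.mode v j (𝒴 w k u)) (-2) k (a + h₁ - h₂) = 0 from
        (finsum_congr fun i => by
          beta_reduce
          rw [operator_lowest_eq_zero hh₁ hh₂ h𝒴 u hw (j := i + 1) (by omega) (by push_cast; ring),
            map_zero, smul_zero]).trans finsum_zero,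
        show borcherdsSnd (fun j k => 𝒴 w k (M₁.mode v j u)) (-2) k (a + h₁ - h₂) = 0 from
        (finsum_congr fun i => by
          beta_reduce
          rw [hQ k v hv u _ (by omega), map_zero, smul_zero]).trans finsum_zero, smul_zero,
        sub_zero, zero_sub, neg_eq_zero] at h1
      rw [h1]
      rfl
    | h0 => simp
    | hadd x y hx hy => rw [map_add, map_add, hx, hy, add_zero]
  · induction v using 𝒱.homog_induction with
    | h k v hv =>
      induction w using weight_induction hM with
      | h a w hw =>
        refine Subtype.ext ?_
        rw [right_apply hv, coe_lowestComponent_res hM hM₂ hh₁ hh₂ h𝒴 u hw hv (n := a + h₁ - h₂) (by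
          push_cast; ring), coe_lowestComponent hM hM₂ hh₁ hh₂ h𝒴 _ hw, coe_oLowest hv]
        have h1 := operator_borcherds h𝒴 v w u (-1) (k - 1) (a + h₁ - h₂)
        unfold borcherds at h1
        rw [show borcherdsFst (fun j k => M₂.mode v j (𝒴 w k u)) (-1) (k - 1) (a + h₁ - h₂) = 0 from
          (finsum_congr fun i => by
            beta_reduce
            rw [operator_lowest_eq_zero hh₁ hh₂ h𝒴 u hw (j := i + 1) (by omega)
              (by push_cast; ring), map_zero, smul_zero]).trans finsum_zero,
          show borcherdsSnd (fun j k => 𝒴 w k (M₁.mode v j u)) (-1) (k - 1) (a + h₁ - h₂)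
            = 𝒴 w (a + h₁ - h₂ - 1) (M₁.mode v (k - 1) u) from
          (finsum_eq_single _ 0 fun i hi => by
            beta_reduce
            rw [hQ k v hv u _ (by omega), map_zero, smul_zero]).trans (by
              simp [sub_eq_add_neg]), zero_sub, ← neg_smul, Int.negOnePow_neg,
          Int.negOnePow_one, Units.val_neg, Units.val_one, neg_neg, one_smul, sub_eq_zero] at h1
        exact h1.symm
      | h0 => simp
      | hadd x y hx hy => rw [map_add, map_add, map_add, hx, hy]
    | h0 => simp
    | hadd x y hx hy =>
      rw [map_add, map_add, LinearMap.add_apply, LinearMap.add_apply, map_add, map_add,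
        LinearMap.add_apply, hx, hy]
  · induction v using 𝒱.homog_induction with
    | h k v hv =>
      induction w using weight_induction hM with
      | h a w hw =>
        refine Subtype.ext ?_
        rw [left_apply hv, coe_lowestComponent_res hM hM₂ hh₁ hh₂ h𝒴 u hw hv
          (n := a + h₁ - h₂ - 1) (by push_cast; ring), coe_oLowest hv,
          coe_lowestComponent hM hM₂ hh₁ hh₂ h𝒴 _ hw]
        have h1 := operator_borcherds h𝒴 v w u (-1) k (a + h₁ - h₂ - 1)
        unfold borcherds at h1
        rw [show borcherdsFst (fun j k => M₂.mode v j (𝒴 w k u)) (-1) k (a + h₁ - h₂ - 1)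
            = M₂.mode v (k - 1) (𝒴 w (a + h₁ - h₂ - 1) u) from
          (finsum_eq_single _ 0 fun i hi => by
            beta_reduce
            rw [operator_lowest_eq_zero hh₁ hh₂ h𝒴 u hw (j := i) (by omega)
              (by push_cast; ring), map_zero, smul_zero]).trans (by
              simp [sub_eq_add_neg]),
          show borcherdsSnd (fun j k => 𝒴 w k (M₁.mode v j u)) (-1) k (a + h₁ - h₂ - 1) = 0 from
          (finsum_congr fun i => by
            beta_reduce
            rw [hQ k v hv u _ (by omega), map_zero, smul_zero]).trans finsum_zero,
          smul_zero, sub_zero, sub_eq_zero] at h1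
        exact h1.symm
      | h0 => simp
      | hadd x y hx hy => rw [map_add, map_add, map_add, map_add, hx, hy]
    | h0 => simp
    | hadd x y hx hy =>
      rw [map_add, map_add, LinearMap.add_apply, LinearMap.add_apply, map_add, hx, hy]

/-- An intertwining operator is determined by its component from `W₁(0)` to `W₂(0)`, since the modules
are irreducible. -/
theorem eq_zero_of_lowestComponent (irr₁ : M₁.IsIrreducible) (irr₂ : M₂.IsIrreducible)
    (h0 : lowestComponent M₁ hM hM₂ h₁ hh₂ 𝒴 = 0) : 𝒴 = 0 := by
  have hP : ∀ (u : M₁.lowest) w n, M₂.lowestProj hM₂ hh₂ (𝒴 w n u) = 0 := by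
    intro u w n
    induction w using weight_induction hM with
    | h a w hw =>
      by_cases hn : n = a + h₁ - h₂ - 1
      · rw [hn, ← lowestComponent_apply hM hM₂ hh₂ 𝒴 u hw, h0]
        rfl
      · refine lowestProj_of_ne hM₂ hh₂ (operator_lowest_mem hh₁ h𝒴 u hw n) fun h => hn ?_
        linear_combination -h
    | h0 => simp
    | hadd x y hx hy => rw [map_add, Pi.add_apply, LinearMap.add_apply, map_add, hx, hy, add_zero]
  -- the coefficients of `𝒴` at `u` span a submodule of `W₂` without component in `W₂(0)`, which is
  -- zero because `W₂` is irreducible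
  have hz : ∀ (u : M₁.lowest) w n, 𝒴 w n u = 0 := by
    intro u w n
    have h1 := isSubmodule_span_modes M M₁ M₂ (fun w n w₁ => 𝒴 w n w₁) (u : W₁) (by simp)
      (fun w n => evZero_operator h𝒴.1 w n u)
      (fun v w l m n => operator_borcherds h𝒴 v w u l m n)
    have h2 : 𝒴 w n u ∈ Submodule.span ℂ (Set.range fun an : W × ℂ => 𝒴 an.1 an.2 (u : W₁)) :=
      Submodule.subset_span ⟨(w, n), rfl⟩
    rcases irr₂.2 _ h1 with h3 | h3
    · rwa [h3, Submodule.mem_bot] at h2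
    · exfalso
      obtain ⟨x, hx, hx0⟩ := Submodule.exists_mem_ne_zero_of_ne_bot hh₂.1
      have h4 : Submodule.span ℂ (Set.range fun an : W × ℂ => 𝒴 an.1 an.2 (u : W₁))
          ≤ LinearMap.ker (M₂.lowestProj hM₂ hh₂) := by
        rw [Submodule.span_le]
        rintro _ ⟨⟨w, n⟩, rfl⟩
        exact hP u w n
      have h5 : M₂.lowestProj hM₂ hh₂ x = 0 := h4 (h3 ▸ Submodule.mem_top)
      exact hx0 ((coe_lowestProj hM₂ hh₂ hx).symm.trans (congrArg Subtype.val h5))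
  -- by the commutator formula the vanishing spreads from `W₁(0)` to `W₁`
  let K : Submodule ℂ W₁ := ⨅ (w : W) (n : ℂ), LinearMap.ker (𝒴 w n)
  have hmK : ∀ x, x ∈ K ↔ ∀ w n, 𝒴 w n x = 0 := fun x => by simp [K]
  have hK : K = ⊤ := by
    refine hh₁.eq_top_of_lowest irr₁ (fun u hu => (hmK _).mpr fun w n => hz ⟨u, hu⟩ w n)
      fun k v _ m _ x hx => (hmK _).mpr fun w n => ?_
    have h1 := operator_borcherds h𝒴 v w x 0 m n
    rw [borcherds_zero, finsum_congr (fun i => by rw [hz ⟨x, hx⟩, smul_zero]), finsum_zero,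
      hz ⟨x, hx⟩, map_zero, sub_zero, zero_sub, neg_eq_zero] at h1
    exact h1
  refine LinearMap.ext fun w => funext fun n => LinearMap.ext fun x => ?_
  exact (hmK x).mp (hK ▸ Submodule.mem_top) w n

end Component

/-- The intertwining operators correspond to the bimodule forms, if `W₁ = F(W₁(0))` and
`W₂' = F(W₂(0)^*)`. -/
theorem rank_intertwiningOperators (hM : M.IsOrdinary) (hM₁ : M₁.IsOrdinary)
    (irr₁ : M₁.IsIrreducible) (hM₂ : M₂.IsOrdinary) (irr₂ : M₂.IsIrreducible) (he₁ : M₁.EqF)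
    (he₂ : M₂.DualEqF) :
    Module.rank ℂ (intertwiningOperators M M₁ M₂) = Module.rank ℂ (bimoduleForms M M₁ M₂) := by
  obtain ⟨h₁, hh₁⟩ := hM₁.exists_isLowestWeight irr₁
  obtain ⟨h₂, hh₂⟩ := hM₂.exists_isLowestWeight irr₂
  have hg := hM.generalized
  have hg₂ := hM₂.generalized
  refine LinearEquiv.rank_eq (LinearEquiv.ofBijective (LinearMap.codRestrict _
    (lowestComponent M₁ hg hg₂ h₁ hh₂ ∘ₗ (intertwiningOperators M M₁ M₂).subtype) fun 𝒴 =>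
      lowestComponent_mem_bimoduleForms hg hg₂ hh₁ hh₂ 𝒴.2) ⟨?_, ?_⟩)
  · rw [injective_iff_map_eq_zero]
    intro 𝒴 h
    exact Subtype.ext (eq_zero_of_lowestComponent hg hg₂ hh₁ hh₂ 𝒴.2 irr₁ irr₂
      (congrArg Subtype.val h))
  · rintro ⟨f, hf⟩
    obtain ⟨ψ, hψf, ha, hb, hψ⟩ := he₁.exists_form hh₁ irr₁ f hf.1 hf.2.1 hf.2.2
    obtain ⟨κ, hw, hcomm, hJ, hκ⟩ := he₂.exists_components hM₂ hh₂ ha hb hψ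
    obtain ⟨𝒴, h𝒴, hval⟩ := exists_intertwiningOperator hg hM₁.generalized hh₂ hw hcomm hJ
    refine ⟨⟨𝒴, h𝒴⟩, Subtype.ext (LinearMap.ext fun u => LinearMap.ext fun w => Subtype.ext ?_)⟩
    change (lowestComponent M₁ hg hg₂ h₁ hh₂ 𝒴 u w : W₂) = f u w
    induction w using weight_induction hg with
    | h a w hw =>
      rw [coe_lowestComponent hg hg₂ hh₁ hh₂ h𝒴 u hw,
        hval a h₁ _ w hw u (hh₁.lowest_eq.le u.2), ← hψf, ← hκ]
      congr 2
      ring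
    | h0 => simp
    | hadd x y hx hy => rw [map_add, map_add, Submodule.coe_add, Submodule.coe_add, hx, hy]

end WeakModule

end LowestComponent

/-! ### Homomorphisms from the balanced tensor product -/

section BimoduleHom

variable {V : Type u} [AddCommGroup V] [Module ℂ V] {𝒱 : VertexOperatorAlgebra V}
  {W W₁ W₂ : Type u} [AddCommGroup W] [Module ℂ W] [AddCommGroup W₁] [Module ℂ W₁]
  [AddCommGroup W₂] [Module ℂ W₂]
  {M : WeakModule 𝒱 W} {M₁ : WeakModule 𝒱 W₁} {M₂ : WeakModule 𝒱 W₂}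

namespace WeakModule

/-- The class of `w ⊗ u` in `A(W) ⊗_{A(V)} W₁(0)`. -/
def balancedMk (M : WeakModule 𝒱 W) (M₁ : WeakModule 𝒱 W₁) :
    M.A →ₗ[ℂ] M₁.lowest →ₗ[ℂ] BalancedTensor 𝒱.A M.A M₁.lowest :=
  (TensorProduct.mk ℂ M.A M₁.lowest).compr₂ ((Submodule.mkQ _).restrictScalars ℂ)

theorem toA_smul_toA (v : V) (w : W) : 𝒱.toA v • M.toA w = M.toA (M.left v w) := rfl

theorem op_toA_smul_toA (v : V) (w : W) :
    MulOpposite.op (𝒱.toA v) • M.toA w = M.toA (M.right v w) := rfl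

theorem toA_smul_lowest (v : V) (u : M.lowest) : 𝒱.toA v • u = M.oLowest v u := rfl

theorem smul_balancedMk (a : 𝒱.A) (b : M.A) (u : M₁.lowest) :
    a • M.balancedMk M₁ b u = M.balancedMk M₁ (a • b) u := rfl

theorem balancedMk_balanced (a : 𝒱.A) (b : M.A) (u : M₁.lowest) :
    M.balancedMk M₁ (MulOpposite.op a • b) u = M.balancedMk M₁ b (a • u) :=
  (Submodule.Quotient.eq _).mpr (Submodule.subset_span ⟨b, a, u, rfl⟩)

/-- A homomorphism from the balanced tensor product, as a map on `W₁(0)` and `W`. -/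
def toBimoduleForm (M : WeakModule 𝒱 W) (M₁ : WeakModule 𝒱 W₁) (M₂ : WeakModule 𝒱 W₂) :
    (BalancedTensor 𝒱.A M.A M₁.lowest →ₗ[𝒱.A] M₂.lowest) →ₗ[ℂ]
      (M₁.lowest →ₗ[ℂ] W →ₗ[ℂ] M₂.lowest) where
  toFun φ := ((M.balancedMk M₁).flip.compl₂ M.toA).compr₂ (φ.restrictScalars ℂ)
  map_add' _ _ := rfl
  map_smul' _ _ := rfl

theorem toBimoduleForm_apply (φ : BalancedTensor 𝒱.A M.A M₁.lowest →ₗ[𝒱.A] M₂.lowest)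
    (u : M₁.lowest) (w : W) : toBimoduleForm M M₁ M₂ φ u w = φ (M.balancedMk M₁ (M.toA w) u) := rfl

theorem toBimoduleForm_injective : Function.Injective (toBimoduleForm M M₁ M₂) := by
  intro φ φ' h
  refine LinearMap.ext fun x => ?_
  obtain ⟨z, rfl⟩ := Submodule.Quotient.mk_surjective _ x
  induction z with
  | zero => exact (map_zero φ).trans (map_zero φ').symm
  | add x y hx hy =>
    exact (map_add φ _ _).trans ((congrArg₂ (· + ·) hx hy).trans (map_add φ' _ _).symm)
  | tmul b u =>
    obtain ⟨w, rfl⟩ := M.toA_surjective b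
    exact congrArg (fun f => f u w) h

theorem toBimoduleForm_mem (φ : BalancedTensor 𝒱.A M.A M₁.lowest →ₗ[𝒱.A] M₂.lowest) :
    toBimoduleForm M M₁ M₂ φ ∈ bimoduleForms M M₁ M₂ := by
  refine ⟨fun u x hx => ?_, fun v u w => ?_, fun v u w => ?_⟩
  · rw [toBimoduleForm_apply, M.toA_eq_zero.mpr hx, map_zero, LinearMap.zero_apply, map_zero]
  · rw [toBimoduleForm_apply, toBimoduleForm_apply, ← op_toA_smul_toA, balancedMk_balanced,
      toA_smul_lowest]
  · rw [toBimoduleForm_apply, toBimoduleForm_apply, ← toA_smul_toA, ← smul_balancedMk, map_smul,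
      toA_smul_lowest]

theorem exists_toBimoduleForm_eq {f : M₁.lowest →ₗ[ℂ] W →ₗ[ℂ] M₂.lowest}
    (hf : f ∈ bimoduleForms M M₁ M₂) : ∃ φ, toBimoduleForm M M₁ M₂ φ = f := by
  let g : M.A →ₗ[ℂ] M₁.lowest →ₗ[ℂ] M₂.lowest := Submodule.liftQ M.O f.flip fun x hx =>
    LinearMap.ext fun u => hf.1 u x hx
  have hg : ∀ w u, g (M.toA w) u = f u w := fun _ _ => rfl
  let G : M.A ⊗[ℂ] M₁.lowest →ₗ[𝒱.A] M₂.lowest :=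
    { TensorProduct.lift g with
      map_smul' := fun a z => by
        change TensorProduct.lift g (a • z) = a • TensorProduct.lift g z
        induction z with
        | zero => simp
        | add x y hx hy => rw [smul_add, map_add, map_add, hx, hy, smul_add]
        | tmul b u =>
          obtain ⟨w, rfl⟩ := M.toA_surjective b
          obtain ⟨v, rfl⟩ := 𝒱.toA_surjective a
          rw [TensorProduct.smul_tmul', toA_smul_toA, TensorProduct.lift.tmul,
            TensorProduct.lift.tmul, hg, hg, hf.2.2, toA_smul_lowest] }
  have hG : ∀ b u, G (b ⊗ₜ u) = g b u := fun _ _ => rfl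
  refine ⟨Submodule.liftQ _ G (Submodule.span_le.mpr ?_), LinearMap.ext fun u =>
    LinearMap.ext fun w => rfl⟩
  rintro _ ⟨b, a, u, rfl⟩
  obtain ⟨w, rfl⟩ := M.toA_surjective b
  obtain ⟨v, rfl⟩ := 𝒱.toA_surjective a
  rw [SetLike.mem_coe, LinearMap.mem_ker, map_sub, hG, hG, op_toA_smul_toA, toA_smul_lowest, hg, hg,
    hf.2.1, sub_self]

variable (M M₁ M₂) in
/-- The homomorphisms from `A(W) ⊗_{A(V)} W₁(0)` to `W₂(0)` correspond to the bimodule forms. -/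
theorem rank_balancedTensor_hom :
    Module.rank ℂ (BalancedTensor 𝒱.A M.A M₁.lowest →ₗ[𝒱.A] M₂.lowest)
      = Module.rank ℂ (bimoduleForms M M₁ M₂) :=
  LinearEquiv.rank_eq (LinearEquiv.ofBijective
    (LinearMap.codRestrict _ (toBimoduleForm M M₁ M₂) toBimoduleForm_mem)
    ⟨fun φ φ' h => toBimoduleForm_injective (congrArg Subtype.val h), fun f => by
      obtain ⟨φ, hφ⟩ := exists_toBimoduleForm_eq f.2
      exact ⟨φ, Subtype.ext hφ⟩⟩)

/-- The fusion rule formula, if `W₁ = F(W₁(0))` and `W₂' = F(W₂(0)^*)`. -/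
theorem rank_balancedTensor_hom_eq (hM : M.IsOrdinary) (hM₁ : M₁.IsOrdinary)
    (irr₁ : M₁.IsIrreducible) (hM₂ : M₂.IsOrdinary) (irr₂ : M₂.IsIrreducible) (he₁ : M₁.EqF)
    (he₂ : M₂.DualEqF) :
    Module.rank ℂ (BalancedTensor 𝒱.A M.A M₁.lowest →ₗ[𝒱.A] M₂.lowest)
      = Module.rank ℂ (intertwiningOperators M M₁ M₂) :=
  (rank_balancedTensor_hom M M₁ M₂).trans
    (rank_intertwiningOperators hM hM₁ irr₁ hM₂ irr₂ he₁ he₂).symm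

end WeakModule

end BimoduleHom

/-! ### Contragredient modules and the irreducibility of `F(U)` -/

section Contragredient

variable {V : Type u} [AddCommGroup V] [Module ℂ V] {𝒱 : VertexOperatorAlgebra V}
  {W : Type u} [AddCommGroup W] [Module ℂ W] {M : WeakModule 𝒱 W}

namespace WeakModule

theorem mem_dualAnnihilator_weight {c : ℂ} {β : Module.Dual ℂ W} :
    β ∈ (⨆ (c' : ℂ) (_ : c' ≠ c), M.weightSpace c').dualAnnihilator ↔
      ∀ c' ≠ c, ∀ w ∈ M.weightSpace c', β w = 0 := by
  rw [Submodule.mem_dualAnnihilator]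
  refine ⟨fun h c' hc w hw => h w (Submodule.mem_iSup_of_mem c' (Submodule.mem_iSup_of_mem hc hw)),
    fun h w hw => ?_⟩
  suffices ⨆ (c' : ℂ) (_ : c' ≠ c), M.weightSpace c' ≤ LinearMap.ker β from this hw
  exact iSup₂_le fun c' hc w hw => h c' hc w hw

variable (M) in
/-- The form `β` is homogeneous of weight `c`. -/
def IsHomogeneousForm (c : ℂ) (β : Module.Dual ℂ W) : Prop :=
  ∀ c' ≠ c, ∀ w ∈ M.weightSpace c', β w = 0

theorem IsHomogeneousForm.mem {c : ℂ} {β : Module.Dual ℂ W} (h : M.IsHomogeneousForm c β) :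
    β ∈ M.gradedDual :=
  Submodule.mem_iSup_of_mem c (mem_dualAnnihilator_weight.mpr h)

theorem gradedDual_induction {P : Module.Dual ℂ W → Prop}
    (h : ∀ c β, M.IsHomogeneousForm c β → P β) (h0 : P 0)
    (hadd : ∀ x y, P x → P y → P (x + y)) {β : Module.Dual ℂ W} (hβ : β ∈ M.gradedDual) : P β :=
  Submodule.iSup_induction _ (motive := P) hβ (fun c β hβ => h c β (mem_dualAnnihilator_weight.mp hβ))
    h0 hadd

theorem IsHomogeneousForm.comp_mode {c : ℂ} {β : Module.Dual ℂ W} (h : M.IsHomogeneousForm c β)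
    {k : ℤ} {v : V} (hv : v ∈ 𝒱.homog k) (n : ℤ) :
    M.IsHomogeneousForm (c - (k - n - 1)) (β ∘ₗ M.mode v n) := fun c' hc w hw =>
  h _ (fun e => hc (by rw [← e]; ring)) _ (M.mode_mem hv hw n)

theorem comp_mode_mem_gradedDual (v : V) (n : ℤ) {β : Module.Dual ℂ W} (hβ : β ∈ M.gradedDual) :
    β ∘ₗ M.mode v n ∈ M.gradedDual := by
  induction v using 𝒱.homog_induction with
  | h k v hv =>
    refine gradedDual_induction (P := fun β => β ∘ₗ M.mode v n ∈ M.gradedDual)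
      (fun c β h => (h.comp_mode hv n).mem) (by simp) (fun x y hx hy => ?_) hβ
    rw [LinearMap.add_comp]
    exact add_mem hx hy
  | h0 => simp
  | hadd x y hx hy =>
    rw [mode_add, LinearMap.comp_add]
    exact add_mem hx hy

theorem IsLowestWeight.isLowerTrunc {h : ℂ} (hh : M.IsLowestWeight h) (hg : M.IsGeneralized)
    {β : Module.Dual ℂ W} (hβ : β ∈ M.gradedDual) : M.rep.IsLowerTrunc β := by
  intro v
  induction v using 𝒱.homog_induction with
  | h k v hv =>
    refine gradedDual_induction
      (P := fun β => ∃ K : ℤ, ∀ n ≤ K, ∀ w, β (M.rep.y n v w) = 0) (fun c β hc => ?_)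
      ⟨0, by simp⟩ (fun x y ⟨K, hK⟩ ⟨K', hK'⟩ => ?_) hβ
    · obtain ⟨N, hN⟩ := exists_nat_ge (c.re - h.re)
      refine ⟨k - 2 - N, fun n hn w => ?_⟩
      rw [rep_y]
      induction w using weight_induction hg with
      | h d w hw =>
        by_cases hd : d = c - (k - n - 1)
        · have h2 : ((n : ℤ) : ℝ) ≤ k - 2 - N := by exact_mod_cast hn
          have h3 : (c - (k - n - 1) : ℂ).re = c.re - (k - n - 1) := by simp
          rw [hd, hh.eq_bot_of_re_lt (by rw [h3]; linarith), Submodule.mem_bot] at hw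
          rw [hw, map_zero, map_zero]
        · exact hc.comp_mode hv n d hd w hw
      | h0 => simp
      | hadd x y hx hy => rw [map_add, map_add, hx, hy, add_zero]
    · exact ⟨min K K', fun n hn z => by
        rw [LinearMap.add_apply, hK n (hn.trans (min_le_left _ _)),
          hK' n (hn.trans (min_le_right _ _)), add_zero]⟩
  | h0 => exact ⟨0, by simp⟩
  | hadd u v hu hv =>
    obtain ⟨K, hK⟩ := hu
    obtain ⟨K', hK'⟩ := hv
    exact ⟨min K K', fun n hn z => by
      rw [map_add, LinearMap.add_apply, map_add, hK n (hn.trans (min_le_left _ _)),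
        hK' n (hn.trans (min_le_right _ _)), add_zero]⟩

/-- The homogeneous forms on a module satisfy the Jacobi identity, since the module does. -/
theorem IsLowestWeight.gradedDual_le {h : ℂ} (hh : M.IsLowestWeight h) (hg : M.IsGeneralized) :
    M.gradedDual ≤ M.rep.jacobiForms ℂ := fun β hβ =>
  ⟨hh.isLowerTrunc hg hβ, fun u v w l m n => by
    have h1 := map_borcherds β.toAddMonoidHom (M.rep_trunc.finFst u v w) (M.rep_trunc.finSnd u v w)
      (M.rep.finIter u v w) l m n
    exact h1.symm.trans ((congrArg β (M.jacobi_borcherds u v w l m n)).trans (map_zero β))⟩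

theorem dual_mem_gradedDual (v : V) (n : ℤ) (β : Module.Dual ℂ W) (hβ : β ∈ M.gradedDual) :
    M.rep.dual.y n v β ∈ M.gradedDual :=
  ModeRep.dual_mem_of_comp (fun a p _ hβ => comp_mode_mem_gradedDual a p hβ) v n hβ

/-- The contragredient module of an irreducible module is irreducible. -/
theorem IsIrreducible.gradedDual (irr : M.IsIrreducible) (hM : M.IsOrdinary)
    {N : Submodule ℂ (Module.Dual ℂ W)} (hN : N ≤ M.gradedDual)
    (hst : ∀ v n, ∀ β ∈ N, M.rep.dual.y n v β ∈ N) : N = ⊥ ∨ N = M.gradedDual := by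
  -- stability under the dual action is stability under composition with modes
  have hcomp : ∀ v n, ∀ β ∈ N, β ∘ₗ M.mode v n ∈ N := by
    let S : Submodule ℂ (Module.End ℂ W × Module.End ℂ W) :=
      { carrier := {A | ∀ β ∈ N, β ∘ₗ A.1 ∈ N}
        zero_mem' := fun β _ => by simp
        add_mem' := fun {A B} hA hB β hβ => by
          rw [Prod.fst_add, LinearMap.comp_add]
          exact N.add_mem (hA β hβ) (hB β hβ)
        smul_mem' := fun c A hA β hβ => by
          rw [Prod.smul_fst, LinearMap.comp_smul]
          exact N.smul_mem c (hA β hβ) }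
    exact fun v n => ModeRep.pair_mem_of_opp M.rep M.rep (S := S) (fun n v β hβ => hst v n β hβ) n v
  have hK : M.IsSubmodule N.dualCoannihilator := fun v n w hw => by
    rw [Submodule.mem_dualCoannihilator] at hw ⊢
    exact fun β hβ => hw _ (hcomp v n β hβ)
  -- the vectors on which `N` vanishes form a submodule of `W`; if it is zero, then `N` contains
  -- all forms of each weight, and if it is all of `W`, then `N = 0`
  rcases irr.2 _ hK with h | h
  · right
    refine le_antisymm hN (iSup_le fun c β hβ => ?_)
    rw [mem_dualAnnihilator_weight] at hβ
    have := hM.finite c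
    -- The restrictions of the forms in `N` to the homogeneous subspace separate its points.
    have hres : N.map (M.weightSpace c).subtype.dualMap = ⊤ := by
      rw [← Subspace.dualCoannihilator_dualAnnihilator_eq (W := N.map _),
        Submodule.dualAnnihilator_eq_top_iff, eq_bot_iff]
      intro w hw
      rw [Submodule.mem_dualCoannihilator] at hw
      have : (w : W) ∈ N.dualCoannihilator := (Submodule.mem_dualCoannihilator _).mpr fun β hβ =>
        hw _ ⟨β, hβ, rfl⟩
      rw [h, Submodule.mem_bot] at this
      exact Subtype.ext this
    obtain ⟨β', hβ', hr⟩ : (M.weightSpace c).subtype.dualMap β ∈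
        N.map (M.weightSpace c).subtype.dualMap := hres ▸ Submodule.mem_top
    obtain ⟨f, hf, hsum⟩ := (Submodule.mem_iSup_iff_exists_finsupp _ _).mp (hN hβ')
    have hf' : ∀ c, M.IsHomogeneousForm c (f c) := fun c => mem_dualAnnihilator_weight.mp (hf c)
    have hfc : f c = β := by
      rw [eq_comp_weightProj hM.generalized (hf' c), eq_comp_weightProj hM.generalized hβ]
      congr 1
      refine Eq.trans (LinearMap.ext fun w => ?_) hr
      rw [← hsum]
      change f c w = (f.sum fun _ x => x) w
      rw [Finsupp.sum, LinearMap.sum_apply]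
      refine (Finset.sum_eq_single c (fun d _ hd => hf' d c hd.symm w w.2) fun hc => ?_).symm
      rw [Finsupp.notMem_support_iff.mp hc, LinearMap.zero_apply]
    -- the weight `c` component of `β'` is `β`, and `N` contains the `L(0)`-components of its
    -- elements
    by_cases hc : c ∈ f.support
    · rw [← hfc]
      refine Module.End.mem_of_sum_eigenvectors_mem (D := (M.L 0).dualMap)
        (fun β hβ => hcomp 𝒱.ω 1 β hβ) f.support (f := f) (fun d _ => ?_) (by rw [← hsum] at hβ'; exact hβ') c hc
      rw [Module.End.mem_eigenspace_iff]
      refine LinearMap.ext fun w => ?_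
      change f d (M.L 0 w) = d * f d w
      induction w using weight_induction hM.generalized with
      | h c' w hw =>
        rw [M.mem_weightSpace.mp hw, map_smul, smul_eq_mul]
        by_cases hd : c' = d
        · rw [hd]
        · rw [hf' d c' hd w hw, mul_zero, mul_zero]
      | h0 => simp
      | hadd x y hx hy => rw [map_add, map_add, map_add, hx, hy, mul_add]
    · rw [← hfc, Finsupp.notMem_support_iff.mp hc]
      exact N.zero_mem
  · left
    refine eq_bot_iff.mpr fun β hβ => (Submodule.mem_bot ℂ).mpr (LinearMap.ext fun w => ?_)
    have : w ∈ N.dualCoannihilator := h ▸ Submodule.mem_top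
    exact (Submodule.mem_dualCoannihilator _).mp this β hβ

end WeakModule

end Contragredient

section Irreducible

variable {V : Type u} [AddCommGroup V] [Module ℂ V] {𝒱 : VertexOperatorAlgebra V}
  {W : Type u} [AddCommGroup W] [Module ℂ W] {M : WeakModule 𝒱 W}

/-- A nonzero homomorphism from `F(U)` is injective if `F(U)` is irreducible. -/
theorem FModule.injective_of_irreducible {U X : Type u} [AddCommGroup U] [Module ℂ U]
    [AddCommGroup X] [Module ℂ X] {ρ : V →ₗ[ℂ] Module.End ℂ U} (R : ModeRep 𝒱 X)
    (irr : IsModeIrreducible (FModule.mode ρ 𝒱)) {Φ : FModule ρ 𝒱 →ₗ[ℂ] X}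
    (hΦ : ∀ v n x, Φ (FModule.mode ρ 𝒱 v n x) = R.y n v (Φ x)) (h0 : Φ ≠ 0) :
    Function.Injective Φ := by
  rw [← LinearMap.ker_eq_bot]
  refine (irr.2 _ fun v n x hx => ?_).resolve_right fun h => h0 (LinearMap.ker_eq_top.mp h)
  rw [LinearMap.mem_ker] at hx ⊢
  rw [hΦ, hx, map_zero]

/-- `F(U)` is irreducible if it embeds with irreducible image. -/
theorem FModule.irreducible_of_injective {U X : Type u} [AddCommGroup U] [Module ℂ U]
    [AddCommGroup X] [Module ℂ X] {ρ : V →ₗ[ℂ] Module.End ℂ U} (R : ModeRep 𝒱 X)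
    {Φ : FModule ρ 𝒱 →ₗ[ℂ] X} (hΦ : ∀ v n x, Φ (FModule.mode ρ 𝒱 v n x) = R.y n v (Φ x))
    (hinj : Function.Injective Φ) (h0 : Φ ≠ 0)
    (h : ∀ N ≤ LinearMap.range Φ, (∀ v n, ∀ x ∈ N, R.y n v x ∈ N) →
      N = ⊥ ∨ N = LinearMap.range Φ) :
    IsModeIrreducible (FModule.mode ρ 𝒱) := by
  refine ⟨?_, fun N hN => ?_⟩
  · by_contra hc
    rw [not_nontrivial_iff_subsingleton] at hc
    exact h0 (LinearMap.ext fun x => by rw [Subsingleton.elim x 0, map_zero, map_zero])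
  · rcases h (N.map Φ) (LinearMap.map_le_range) (by
      rintro v n _ ⟨x, hx, rfl⟩
      exact ⟨_, hN v n x hx, hΦ v n x⟩) with h | h
    · left
      exact Submodule.map_injective_of_injective hinj (h.trans (Submodule.map_bot Φ).symm)
    · right
      rw [← Submodule.map_top] at h
      exact Submodule.map_injective_of_injective hinj h

namespace WeakModule

theorem jacobiAt_rep (w : W) : M.rep.JacobiAt w :=
  (M.rep_trunc.jacobiAt_iff w).mpr fun u v l m n => M.jacobi_borcherds u v w l m n

/-- The natural map from `F(W(0))` to `W`. -/
theorem IsLowestWeight.exists_fmodule_hom {h : ℂ} (hh : M.IsLowestWeight h) :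
    ∃ Φ : FModule M.oLowest 𝒱 →ₗ[ℂ] W,
      (∀ v n x, Φ (FModule.mode M.oLowest 𝒱 v n x) = M.mode v n (Φ x)) ∧
      ∀ a : M.lowest, Φ (FModule.e M.oLowest 𝒱 a) = a := by
  obtain ⟨Φ, h1, h2, -⟩ := FModule.exists_lift M.oLowest M.rep M.lowest.subtype ⊤
    (fun _ _ _ _ => trivial) (fun _ => trivial)
    (fun k v hv m hm a => hh.mode_lowest_eq_zero hv a.2 hm) (fun k v hv a => (coe_oLowest hv a).symm)
    (fun x _ => jacobiAt_rep x)
  exact ⟨Φ, h1, h2⟩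

theorem IsLowestWeight.exists_ne_zero {h : ℂ} (hh : M.IsLowestWeight h) :
    ∃ a : M.lowest, a ≠ 0 := by
  obtain ⟨x, hx, hx0⟩ := Submodule.exists_mem_ne_zero_of_ne_bot hh.1
  exact ⟨⟨x, hh.lowest_eq.ge hx⟩, fun e => hx0 (congrArg Subtype.val e)⟩

theorem irreducible_iff_eqF (hM : M.IsOrdinary) (irr : M.IsIrreducible) :
    IsModeIrreducible (FModule.mode M.oLowest 𝒱) ↔ M.EqF := by
  obtain ⟨h, hh⟩ := hM.exists_isLowestWeight irr
  obtain ⟨a, ha⟩ := hh.exists_ne_zero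
  refine ⟨fun hF => ?_, fun ⟨e, he, hee⟩ => ?_⟩
  · obtain ⟨Φ, hΦ, hΦe⟩ := hh.exists_fmodule_hom
    have h0 : Φ (FModule.e M.oLowest 𝒱 a) ≠ 0 := by
      rw [hΦe]
      exact fun e => ha (Subtype.ext e)
    have hinj := FModule.injective_of_irreducible M.rep hF hΦ fun e => h0 (by rw [e]; rfl)
    have hr : LinearMap.range Φ = ⊤ := by
      refine (irr.2 _ ?_).resolve_left fun e => h0 (LinearMap.congr_fun (LinearMap.range_eq_bot.mp e) _)
      rintro v n _ ⟨x, rfl⟩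
      exact ⟨_, hΦ v n x⟩
    exact ⟨LinearEquiv.ofBijective Φ ⟨hinj, LinearMap.range_eq_top.mp hr⟩, hΦ, hΦe⟩
  · refine FModule.irreducible_of_injective M.rep (Φ := e.toLinearMap) he e.injective ?_ ?_
    · intro h0
      have h1 := hee a
      rw [show e (FModule.e M.oLowest 𝒱 a) = 0 from LinearMap.congr_fun h0 _] at h1
      exact ha (Subtype.ext h1.symm)
    · rw [LinearEquiv.range]
      exact fun N _ hN => irr.2 N hN

/-- The natural map from `F(W(0)^*)` to the contragredient module. -/
theorem IsLowestWeight.exists_dual_fmodule_hom {h : ℂ} (hh : M.IsLowestWeight h)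
    (hg : M.IsGeneralized) :
    ∃ Φ : FModule M.oLowestDual 𝒱 →ₗ[ℂ] Module.Dual ℂ W,
      (∀ v n x, Φ (FModule.mode M.oLowestDual 𝒱 v n x) = M.rep.dual.y n v (Φ x)) ∧
      (∀ g, Φ (FModule.e M.oLowestDual 𝒱 g) = g ∘ₗ M.lowestProj hg hh) ∧
      ∀ x, Φ x ∈ M.gradedDual := by
  have hJ := ModeRep.jacobiAt_dual dual_mem_gradedDual (hh.gradedDual_le hg)
  have hφ : ∀ g : Module.Dual ℂ M.lowest, (M.lowestProj hg hh).dualMap g ∈ M.gradedDual := fun g =>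
    IsHomogeneousForm.mem (c := h) fun c' hc w hw => by
      rw [LinearMap.dualMap_apply, lowestProj_of_ne hg hh hw hc, map_zero]
  have ha : ∀ k, ∀ v ∈ 𝒱.homog k, ∀ m ≤ k - 2, ∀ w, M.lowestProj hg hh (M.rep.y m v w) = 0 := by
    intro k v hv m hm w
    rw [rep_y]
    induction w using weight_induction hg with
    | h c w hw =>
      by_cases hc : c + (k - m - 1) = h
      · have h2 : ((m : ℤ) : ℝ) ≤ k - 2 := by exact_mod_cast hm
        rw [hh.eq_bot_of_re_lt (by rw [← hc]; simp; linarith), Submodule.mem_bot] at hw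
        rw [hw, map_zero, map_zero]
      · exact lowestProj_of_ne hg hh (M.mode_mem hv hw m) hc
    | h0 => simp
    | hadd x y hx hy => rw [map_add, map_add, hx, hy, add_zero]
  have hb : ∀ k, ∀ v ∈ 𝒱.homog k, ∀ w,
      M.lowestProj hg hh (M.rep.y (k - 1) v w) = M.oLowest v (M.lowestProj hg hh w) := by
    intro k v hv w
    rw [rep_y]
    induction w using weight_induction hg with
    | h c w hw =>
      have h1 := M.mode_mem hv hw (k - 1)
      rw [show c + ((k : ℂ) - ((k - 1 : ℤ) : ℂ) - 1) = c by push_cast; ring] at h1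
      by_cases hc : c = h
      · subst hc
        refine Subtype.ext ?_
        rw [coe_lowestProj hg hh h1, coe_oLowest hv, coe_lowestProj hg hh hw]
      · rw [lowestProj_of_ne hg hh hw hc, lowestProj_of_ne hg hh h1 hc, map_zero]
    | h0 => simp
    | hadd x y hx hy => rw [map_add, map_add, map_add, map_add, hx, hy]
  let φ : Module.Dual ℂ M.lowest →ₗ[ℂ] M.gradedDual :=
    LinearMap.codRestrict _ (M.lowestProj hg hh).dualMap hφ
  have h0 : ∀ k, ∀ v ∈ 𝒱.homog k, ∀ m ≥ k, ∀ g,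
      (M.rep.dual.restrict _ dual_mem_gradedDual).y m v (φ g) = 0 := fun k v hv m hm g => by
    refine Subtype.ext (LinearMap.ext fun z => ?_)
    obtain ⟨N, hN⟩ := 𝒱.evZero_expL v
    change g (M.lowestProj hg hh (M.rep.opp m v z)) = 0
    rw [ModeRep.opp_eq_sum _ hv hN, map_zsmul, map_sum,
      Finset.sum_eq_zero fun j _ => ha _ _ (𝒱.expL_mem hv j) _ (by omega) z, smul_zero, map_zero]
  have h1 : ∀ k, ∀ v ∈ 𝒱.homog k, ∀ g, (M.rep.dual.restrict _ dual_mem_gradedDual).y (k - 1) v (φ g)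
      = φ (M.oLowestDual v g) := fun k v hv g => by
    refine Subtype.ext (LinearMap.ext fun z => ?_)
    change g (M.lowestProj hg hh (M.rep.opp (k - 1) v z))
      = g (M.oLowest (𝒱.θ v) (M.lowestProj hg hh z))
    rw [ModeRep.map_opp_eq_theta _ (M.lowestProj hg hh) M.oLowest (fun k v hv => hb k v hv z) hv]
  obtain ⟨Φ, hΦ, hΦe, -⟩ := FModule.exists_lift M.oLowestDual
    (M.rep.dual.restrict _ dual_mem_gradedDual) φ ⊤ (fun _ _ _ _ => trivial) (fun _ => trivial)
    h0 h1 fun x _ => hJ.2 x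
  refine ⟨M.gradedDual.subtype ∘ₗ Φ, fun v n x => ?_, fun g => ?_, fun x => (Φ x).2⟩
  · rw [LinearMap.comp_apply, hΦ]
    rfl
  · rw [LinearMap.comp_apply, hΦe]
    rfl

theorem dual_y_apply (v : V) (n : ℤ) (β : Module.Dual ℂ W) (w : W) :
    M.rep.dual.y n v β w = β (M.oppMode n v w) := by
  rw [ModeRep.dual_apply, opp_rep]

theorem IsLowestWeight.exists_dual_ne_zero {h : ℂ} (hh : M.IsLowestWeight h) :
    ∃ (g : Module.Dual ℂ M.lowest) (a : M.lowest), g a ≠ 0 := by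
  obtain ⟨a, ha⟩ := hh.exists_ne_zero
  by_contra! hc
  exact ha ((Module.forall_dual_apply_eq_zero_iff ℂ a).mp fun g => hc g a)

theorem irreducible_iff_dualEqF (hM : M.IsOrdinary) (irr : M.IsIrreducible) :
    IsModeIrreducible (FModule.mode M.oLowestDual 𝒱) ↔ M.DualEqF := by
  obtain ⟨h, hh⟩ := hM.exists_isLowestWeight irr
  obtain ⟨g, a, hga⟩ := hh.exists_dual_ne_zero
  refine ⟨fun hF => ?_, fun ⟨e, hinj, hr, he, hee⟩ => ?_⟩
  · obtain ⟨Φ, hΦ, hΦe, hmem⟩ := hh.exists_dual_fmodule_hom hM.generalized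
    have hlow : ∀ (f : Module.Dual ℂ M.lowest) (w : M.lowest),
        Φ (FModule.e M.oLowestDual 𝒱 f) w = f w := fun f w => by
      rw [hΦe, LinearMap.comp_apply]
      exact congrArg f (Subtype.ext (coe_lowestProj _ hh (hh.lowest_eq.le w.2)))
    have h0 : Φ ≠ 0 := fun e => hga (by rw [← hlow, e]; rfl)
    refine ⟨Φ, FModule.injective_of_irreducible M.rep.dual hF hΦ h0, ?_, fun v n x w => ?_, hlow⟩
    · refine (irr.gradedDual hM (N := LinearMap.range Φ) ?_ ?_).resolve_left
        fun e => h0 (LinearMap.range_eq_bot.mp e)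
      · rintro _ ⟨x, rfl⟩
        exact hmem x
      · rintro v n _ ⟨x, rfl⟩
        exact ⟨_, hΦ v n x⟩
    · rw [hΦ, dual_y_apply]
  · refine FModule.irreducible_of_injective M.rep.dual (Φ := e)
      (fun v n x => LinearMap.ext fun w => by rw [he, dual_y_apply]) hinj ?_ ?_
    · exact fun h0 => hga (by rw [← hee, h0]; rfl)
    · rw [hr]
      exact fun N hN hst => irr.gradedDual hM hN hst

end WeakModule

end Irreducible

/-! ### Complete reducibility -/

section CompleteReducibility

variable {V : Type u} [AddCommGroup V] [Module ℂ V] {𝒱 : VertexOperatorAlgebra V}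
  {X : Type u} [AddCommGroup X] [Module ℂ X]

/-- Let `X` be a completely reducible module that is generated by its homogeneous subspace of weight
`h`. A homomorphism from `X` with irreducible image that is injective on this subspace is injective:
its restriction to some irreducible summand is onto the image, and by the grading this summand
contains the generating subspace. -/
theorem WeakModule.IsCompletelyReducible.injective {N : WeakModule 𝒱 X} (hcr : N.IsCompletelyReducible)
    (hg : N.IsGeneralized) {h : ℂ}
    (hgen : ∀ K : Submodule ℂ X, N.IsSubmodule K → N.weightSpace h ≤ K → K = ⊤)
    {Z : Type u} [AddCommGroup Z] [Module ℂ Z] (R : ModeRep 𝒱 Z) {Φ : X →ₗ[ℂ] Z}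
    (hΦ : ∀ v n x, Φ (N.mode v n x) = R.y n v (Φ x)) (h0 : Φ ≠ 0)
    (hirr : ∀ T ≤ LinearMap.range Φ, (∀ v n, ∀ x ∈ T, R.y n v x ∈ T) →
      T = ⊥ ∨ T = LinearMap.range Φ)
    (hinj : ∀ x ∈ N.weightSpace h, Φ x = 0 → x = 0) : Function.Injective Φ := by
  obtain ⟨S, hS, -, htop⟩ := hcr
  have hker : N.IsSubmodule (LinearMap.ker Φ) := fun v n x hx => by
    rw [LinearMap.mem_ker] at hx ⊢
    rw [hΦ, hx, map_zero]
  obtain ⟨T, hT, hTk⟩ : ∃ T ∈ S, ¬ T ≤ LinearMap.ker Φ := by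
    by_contra! hc
    exact h0 (LinearMap.ker_eq_top.mp (top_le_iff.mp (htop.ge.trans (sSup_le hc))))
  obtain ⟨hTs, -, hTirr⟩ := hS T hT
  have hmap : T.map Φ = LinearMap.range Φ := by
    refine (hirr _ LinearMap.map_le_range ?_).resolve_left
      fun e => hTk (Submodule.map_le_iff_le_comap.mp e.le)
    rintro v n _ ⟨x, hx, rfl⟩
    exact ⟨_, hTs v n x hx, hΦ v n x⟩
  have hT1 : T = ⊤ := by
    refine hgen T hTs fun x hx => ?_
    obtain ⟨y, hy, hxy⟩ := hmap.ge ⟨x, rfl⟩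
    have hp := Module.End.eigenProj_mem_of_stable (D := N.L 0) hg (fun z hz => hTs _ _ z hz) hy h
    have hk := Module.End.eigenProj_mem_of_stable (D := N.L 0) hg (fun z hz => hker _ _ z hz)
      (show x - y ∈ LinearMap.ker Φ by rw [LinearMap.mem_ker, map_sub, hxy, sub_self]) h
    have hw := Module.End.eigenProj_mem (D := N.L 0) hg h (x - y)
    have h1 := hinj _ hw hk
    rw [map_sub, Module.End.eigenProj_self hg hx, sub_eq_zero] at h1
    rwa [h1]
  rw [← LinearMap.ker_eq_bot]
  refine (hTirr _ (hT1.ge.trans' le_top) hker).resolve_right fun e => hTk e.ge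

namespace FModule

variable {U : Type u} [AddCommGroup U] [Module ℂ U] {ρ : V →ₗ[ℂ] Module.End ℂ U}

/-- `F(U)` is spanned by the vectors `v_m (e a)`. -/
theorem eq_top_of_modes (hρ : ρ 𝒱.one = 1) {N : Submodule ℂ (FModule ρ 𝒱)}
    (h : ∀ k, ∀ v ∈ 𝒱.homog k, ∀ m a, mode ρ 𝒱 v m (e ρ 𝒱 a) ∈ N) : N = ⊤ := by
  let M := weak ρ hρ
  have hN : ∀ v m a, M.mode v m (e ρ 𝒱 a) ∈ N := by
    intro v m a
    induction v using 𝒱.homog_induction with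
    | h k v hv =>
      rw [weak_mode]
      exact h k v hv m a
    | h0 => simp
    | hadd u v hu hv => simpa using N.add_mem hu hv
  let S : U → Submodule ℂ (FModule ρ 𝒱) := fun a =>
    Submodule.span ℂ (Set.range fun an : V × ℤ => M.mode an.1 an.2 (e ρ 𝒱 a))
  have hS : ∀ a, M.IsSubmodule (S a) := fun a =>
    WeakModule.isSubmodule_span_modes 𝒱.adjoint M M (fun v (n : ℤ) x => M.mode v n x) (e ρ 𝒱 a)
      (by simp) (fun v n => by simpa using M.evZero_mode v (e ρ 𝒱 a) n)
      (fun u v l m n => by simpa using M.jacobi_borcherds u v (e ρ 𝒱 a) l m n)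
  rw [← top_le_iff, ← eq_top (N := ⨆ a, S a) ?_ fun a => ?_]
  · refine iSup_le fun a => Submodule.span_le.mpr ?_
    rintro _ ⟨⟨v, m⟩, rfl⟩
    exact hN v m a
  · intro v n x hx
    induction hx using Submodule.iSup_induction' with
    | mem a x hx =>
      rw [← weak_mode ρ hρ]
      exact Submodule.mem_iSup_of_mem a (hS a v n x hx)
    | zero => exact (congrArg (· ∈ _) (smul_zero _)).mpr (zero_mem _)
    | add x y _ _ hx hy => exact (congrArg (· ∈ _) (smul_add _ x y)).mpr (add_mem hx hy)
  · exact Submodule.mem_iSup_of_mem a (Submodule.subset_span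
      ⟨(𝒱.one, -1), WeakModule.mode_one (M := M) (e ρ 𝒱 a)⟩)

variable {h : ℂ}

theorem e_mem_weightSpace (hρ : ρ 𝒱.one = 1) (hω : ∀ a, ρ 𝒱.ω a = h • a) (a : U) :
    e ρ 𝒱 a ∈ (weak ρ hρ).weightSpace h := by
  rw [WeakModule.mem_weightSpace]
  refine (weak_mode ρ hρ _ _ _).trans ((mode_e ρ WeakModule.omega_mem a).trans ?_)
  rw [hω, ← eLin_apply, map_smul, eLin_apply]

theorem mode_e_mem (hρ : ρ 𝒱.one = 1) (hω : ∀ a, ρ 𝒱.ω a = h • a) {k : ℤ} {v : V}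
    (hv : v ∈ 𝒱.homog k) (m : ℤ) (a : U) :
    mode ρ 𝒱 v m (e ρ 𝒱 a) ∈ (weak ρ hρ).weightSpace (h + (k - m - 1)) := by
  rw [← weak_mode ρ hρ]
  exact (weak ρ hρ).mode_mem hv (e_mem_weightSpace hρ hω a) m

theorem iSup_weightSpace (hρ : ρ 𝒱.one = 1) (hω : ∀ a, ρ 𝒱.ω a = h • a) :
    ⨆ n : ℕ, (weak ρ hρ).weightSpace (h + n) = ⊤ := by
  refine eq_top_of_modes hρ fun k v hv m a => ?_
  rcases le_or_gt k m with hm | hm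
  · rw [mode_e_of_le ρ hv hm]
    exact zero_mem _
  · refine Submodule.mem_iSup_of_mem (k - m - 1).toNat ?_
    convert mode_e_mem hρ hω hv m a using 3
    have : ((k - m - 1).toNat : ℤ) = k - m - 1 := Int.toNat_of_nonneg (by omega)
    exact_mod_cast congrArg (Int.cast : ℤ → ℂ) this

theorem isGeneralized (hρ : ρ 𝒱.one = 1) (hω : ∀ a, ρ 𝒱.ω a = h • a) :
    (weak ρ hρ).IsGeneralized :=
  top_le_iff.mp ((iSup_weightSpace hρ hω).ge.trans
    (iSup_le fun n => le_iSup (weak ρ hρ).weightSpace (h + n)))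

/-- The lowest weight vectors of `F(U)` are those of `U`. -/
theorem exists_e_eq (hρ : ρ 𝒱.one = 1) (hω : ∀ a, ρ 𝒱.ω a = h • a) {x : FModule ρ 𝒱}
    (hx : x ∈ (weak ρ hρ).weightSpace h) : ∃ a, e ρ 𝒱 a = x := by
  have hg := isGeneralized hρ hω
  have : (LinearMap.range (eLin ρ 𝒱)).comap
      (Module.End.eigenProj (D := (weak ρ hρ).L 0) hg h) = ⊤ := by
    refine eq_top_of_modes hρ fun k v hv m a => ?_
    rw [Submodule.mem_comap]
    by_cases hm : m = k - 1
    · subst hm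
      rw [mode_e ρ hv, Module.End.eigenProj_self hg (e_mem_weightSpace hρ hω _)]
      exact ⟨_, rfl⟩
    · rw [Module.End.eigenProj_of_ne hg (mode_e_mem hρ hω hv m a)]
      · exact zero_mem _
      · intro h1
        have h2 : ((k - m - 1 : ℤ) : ℂ) = 0 := by
          push_cast
          linear_combination h1
        have := Int.cast_eq_zero.mp h2
        omega
  have h1 : x ∈ (LinearMap.range (eLin ρ 𝒱)).comap
      (Module.End.eigenProj (D := (weak ρ hρ).L 0) hg h) := this ▸ Submodule.mem_top
  rw [Submodule.mem_comap, Module.End.eigenProj_self hg hx] at h1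
  exact h1

/-- `F(U)` is generated by its homogeneous subspace of weight `h`. -/
theorem eq_top_of_weightSpace_le (hρ : ρ 𝒱.one = 1) (hω : ∀ a, ρ 𝒱.ω a = h • a)
    (N : Submodule ℂ (FModule ρ 𝒱)) (hN : (weak ρ hρ).IsSubmodule N)
    (hle : (weak ρ hρ).weightSpace h ≤ N) : N = ⊤ :=
  eq_top (fun v n x hx => by
    rw [← weak_mode ρ hρ]
    exact hN v n x hx) fun a => hle (e_mem_weightSpace hρ hω a)

/-- If lowest weight generalized modules are completely reducible, then `F(U)` is irreducible as soon
as it has a homomorphism with irreducible image that is injective on `U`. -/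
theorem irreducible_of_completelyReducible
    (hcr : ∀ (X : Type u) [AddCommGroup X] [Module ℂ X] (N : WeakModule 𝒱 X),
      N.IsGeneralized → N.IsLowestWeightModule → N.IsCompletelyReducible)
    (hρ : ρ 𝒱.one = 1) (hω : ∀ a, ρ 𝒱.ω a = h • a)
    {Z : Type u} [AddCommGroup Z] [Module ℂ Z] (R : ModeRep 𝒱 Z) {Φ : FModule ρ 𝒱 →ₗ[ℂ] Z}
    (hΦ : ∀ v n x, Φ (mode ρ 𝒱 v n x) = R.y n v (Φ x)) (h0 : Φ ≠ 0)
    (hirr : ∀ T ≤ LinearMap.range Φ, (∀ v n, ∀ x ∈ T, R.y n v x ∈ T) →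
      T = ⊥ ∨ T = LinearMap.range Φ)
    (hinj : ∀ a, Φ (e ρ 𝒱 a) = 0 → a = 0) : IsModeIrreducible (mode ρ 𝒱) := by
  have hg := isGeneralized hρ hω
  have hgen := eq_top_of_weightSpace_le hρ hω
  refine irreducible_of_injective R hΦ ?_ h0 hirr
  refine (hcr _ _ hg ⟨h, iSup_weightSpace hρ hω, hgen⟩).injective hg hgen R
    (fun v n x => by rw [weak_mode, hΦ]) h0 hirr fun x hx hx0 => ?_
  obtain ⟨a, rfl⟩ := exists_e_eq hρ hω hx
  rw [hinj a hx0, ← eLin_apply, map_zero]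

end FModule

namespace WeakModule

variable {M : WeakModule 𝒱 X}

theorem IsLowestWeight.oLowest_omega {h : ℂ} (hh : M.IsLowestWeight h) (x : M.lowest) :
    M.oLowest 𝒱.ω x = h • x := by
  refine Subtype.ext ?_
  rw [coe_oLowest omega_mem]
  exact M.mem_weightSpace.mp (hh.lowest_eq.le x.2)

theorem irreducible_oLowest_of_completelyReducible
    (hcr : ∀ (X : Type u) [AddCommGroup X] [Module ℂ X] (N : WeakModule 𝒱 X),
      N.IsGeneralized → N.IsLowestWeightModule → N.IsCompletelyReducible)
    (hM : M.IsOrdinary) (irr : M.IsIrreducible) :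
    IsModeIrreducible (FModule.mode M.oLowest 𝒱) := by
  obtain ⟨h, hh⟩ := hM.exists_isLowestWeight irr
  obtain ⟨a, ha⟩ := hh.exists_ne_zero
  obtain ⟨Φ, hΦ, hΦe⟩ := hh.exists_fmodule_hom
  have hinj : ∀ a, Φ (FModule.e M.oLowest 𝒱 a) = 0 → a = 0 := fun a ha => by
    rw [hΦe] at ha
    exact Subtype.ext ha
  have h0 : Φ ≠ 0 := fun e => ha (hinj a (by rw [e]; rfl))
  refine FModule.irreducible_of_completelyReducible hcr M.oLowest_one hh.oLowest_omega M.rep hΦ h0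
    (fun T hT hst => ?_) hinj
  refine (irr.2 T hst).imp_right fun e => le_antisymm hT ?_
  rw [e]
  exact le_top

theorem irreducible_oLowestDual_of_completelyReducible
    (hcr : ∀ (X : Type u) [AddCommGroup X] [Module ℂ X] (N : WeakModule 𝒱 X),
      N.IsGeneralized → N.IsLowestWeightModule → N.IsCompletelyReducible)
    (hM : M.IsOrdinary) (irr : M.IsIrreducible) :
    IsModeIrreducible (FModule.mode M.oLowestDual 𝒱) := by
  obtain ⟨h, hh⟩ := hM.exists_isLowestWeight irr
  obtain ⟨g, a, hga⟩ := hh.exists_dual_ne_zero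
  obtain ⟨Φ, hΦ, hΦe, hmem⟩ := hh.exists_dual_fmodule_hom hM.generalized
  have hinj : ∀ f, Φ (FModule.e M.oLowestDual 𝒱 f) = 0 → f = 0 := fun f hf => by
    refine LinearMap.ext fun w => ?_
    have h1 := LinearMap.congr_fun hf (w : X)
    rw [hΦe, LinearMap.comp_apply] at h1
    rwa [show M.lowestProj hM.generalized hh w = w from
      Subtype.ext (coe_lowestProj _ hh (hh.lowest_eq.le w.2))] at h1
  have h0 : Φ ≠ 0 := fun e => hga (by rw [hinj g (by rw [e]; rfl)]; rfl)
  have hr : LinearMap.range Φ ≤ M.gradedDual := by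
    rintro _ ⟨x, rfl⟩
    exact hmem x
  refine FModule.irreducible_of_completelyReducible (h := h) hcr M.oLowestDual_one (fun f => ?_)
    M.rep.dual hΦ h0 (fun T hT hst => ?_) hinj
  · refine LinearMap.ext fun x => ?_
    change f (M.oLowest (𝒱.θ 𝒱.ω) x) = h • f x
    rw [𝒱.theta_omega, hh.oLowest_omega, map_smul]
  · refine (irr.gradedDual hM (hT.trans hr) hst).imp_right fun e => le_antisymm hT ?_
    rw [e]
    exact hr

end WeakModule

end CompleteReducibility

end

theorem corollary4p17 {V W W₁ W₂ : Type u}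
    [AddCommGroup V] [Module ℂ V] [AddCommGroup W] [Module ℂ W]
    [AddCommGroup W₁] [Module ℂ W₁] [AddCommGroup W₂] [Module ℂ W₂]
    (𝒱 : VertexOperatorAlgebra V)
    (M : WeakModule 𝒱 W) (M₁ : WeakModule 𝒱 W₁) (M₂ : WeakModule 𝒱 W₂)
    (hM : M.IsOrdinary)
    (hM₁ : M₁.IsOrdinary) (irr₁ : M₁.IsIrreducible)
    (hM₂ : M₂.IsOrdinary) (irr₂ : M₂.IsIrreducible) :
    -- `F(W₁(0))` is irreducible iff `W₁ = F(W₁(0))`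
    (IsModeIrreducible (FModule.mode M₁.oLowest 𝒱) ↔ M₁.EqF) ∧
    -- `F(W₂(0)^*)` is irreducible iff `W₂' = F(W₂(0)^*)`
    (IsModeIrreducible (FModule.mode M₂.oLowestDual 𝒱) ↔ M₂.DualEqF) ∧
    -- the fusion rule formula
    (IsModeIrreducible (FModule.mode M₁.oLowest 𝒱) →
      IsModeIrreducible (FModule.mode M₂.oLowestDual 𝒱) →
      Module.rank ℂ (BalancedTensor 𝒱.A M.A M₁.lowest →ₗ[𝒱.A] M₂.lowest)
        = Module.rank ℂ (intertwiningOperators M M₁ M₂)) ∧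
    -- the case that every lowest weight generalized module is completely reducible
    ((∀ (X : Type u) [AddCommGroup X] [Module ℂ X] (N : WeakModule 𝒱 X),
        N.IsGeneralized → N.IsLowestWeightModule → N.IsCompletelyReducible) →
      Module.rank ℂ (BalancedTensor 𝒱.A M.A M₁.lowest →ₗ[𝒱.A] M₂.lowest)
        = Module.rank ℂ (intertwiningOperators M M₁ M₂)) := by
  have key : IsModeIrreducible (FModule.mode M₁.oLowest 𝒱) →
      IsModeIrreducible (FModule.mode M₂.oLowestDual 𝒱) →
      Module.rank ℂ (BalancedTensor 𝒱.A M.A M₁.lowest →ₗ[𝒱.A] M₂.lowest)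
        = Module.rank ℂ (intertwiningOperators M M₁ M₂) := fun h₁ h₂ =>
    WeakModule.rank_balancedTensor_hom_eq hM hM₁ irr₁ hM₂ irr₂
      ((WeakModule.irreducible_iff_eqF hM₁ irr₁).mp h₁)
      ((WeakModule.irreducible_iff_dualEqF hM₂ irr₂).mp h₂)
  exact ⟨WeakModule.irreducible_iff_eqF hM₁ irr₁, WeakModule.irreducible_iff_dualEqF hM₂ irr₂, key,
    fun hcr => key (WeakModule.irreducible_oLowest_of_completelyReducible hcr hM₁ irr₁)
      (WeakModule.irreducible_oLowestDual_of_completelyReducible hcr hM₂ irr₂)⟩
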